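/- **Setting.** Write points of $\mathbb R^2$ as $x=(r,z)$, let $H=\{r>0\}$, let $n\ge 1$ be an integer, and put $$\mathrm{grad}^n u=\big(\partial_r u,\,-\tfrac nr u,\,\partial_z u\big),\quad \mathrm{curl}^n v=\big(-(\tfrac nr v_z+\partial_z v_\theta),\ \partial_z v_r-\partial_r v_z,\ \tfrac{nv_r+v_\theta}{r}+\partial_r v_\theta\big),\quad \mathrm{div}^n w=\partial_r w_r+\tfrac{w_r-nw_\theta}{r}+\partial_z w_z$$ (distributional derivatives). $L^2_r(\Omega)$ is the $L^2$ space of the measure $r\,dr\,dz$ on $\Omega\subset H$. $H_r(\mathrm{grad}^n,\Omega)$, $H_r(\mathrm{curl}^n,\Omega)$, $H_r(\mathrm{div}^n,\Omega)$ are the $L^2_r$ functions (resp. three-component fields) whose $\mathrm{grad}^n$, $\mathrm{curl}^n$, $\mathrm{div}^n$ is in $L^2_r$. $\Gamma_1=\overline{\partial\Omega\cap H}$. **Reflection.** Let $U\supset\overline\Omega$ be open and let $\psi$ map $(U\cap H)\setminus\Omega$ bi-Lipschitzly into $\mathbb R^2$, with $\psi=\mathrm{id}$ on $\partial\Omega\cap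 H$, $\psi((U\cap H)\setminus\overline\Omega)\subset\Omega$, and $r\le c\,(r\circ\psi)$ for some constant $c$. For a point $x=(r,z)$, a point $X=(R,Z)$ and a $2\times2$ matrix $M$ define the transformations $$P^g u=\tfrac rn\,\tfrac{nu}{R}(X),\qquad P^o u=\det M\;u(X),$$ $$P^c v=\big(\tfrac rn q_r-\tfrac1n v_\theta(X),\ v_\theta(X),\ \tfrac rn q_z\big),\quad q=M^T\big(\tfrac{nv_r+v_\theta}{R},\tfrac{nv_z}{R}\big)(X),$$ $$P^d w=\big(p_r,\ \tfrac1n p_r+\tfrac rn\det M\,\tfrac{nw_\theta-w_r}{R}(X),\ p_z\big),\quad p=\det M\,M^{-1}(w_r,w_z)(X),$$ where $\det M\,M^{-1}$ denotes the adjugate of $M$. The extension operators $E^g,E^c,E^d,E^o$ leave a function unchanged on $\Omega$ and outside $\Omega$ are $P^g,P^c,P^d,P^o$ with $X=\psi(x)$, $M=d\psi/dx$. **Meshes and discrete spaces.** $\mathscr T_h$ is a finite conforming triangulation, in $\{r\ge0\}$, whose closed triangles have union with interior $\Omega$. $h_K$ is the diameter of $K$, $\rho_K$ that of its largest inscribed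 disk, $h=\max_K h_K$. $A_h\subset H_r(\mathrm{grad}^n,\Omega)$, $B_h\subset H_r(\mathrm{curl}^n,\Omega)$, $C_h\subset H_r(\mathrm{div}^n,\Omega)$, $D_h\subset L^2_r(\Omega)$ are the subspaces of elements having on each $K$ respectively the form $\alpha_1r+\alpha_2r^2+\alpha_3rz$; $(\beta_1+\beta_4r+\beta_3z-\beta_6rz,\,-n\beta_1+\beta_2r-n\beta_3z,\,\beta_5r+\beta_6r^2)$; $(n\gamma_1+\gamma_2r,\,\gamma_1+\gamma_3r,\,\gamma_4+\gamma_2z)$; constant. **Smoothers.** Fix $l\ge0$ and let $P_l$ be the polynomials in $(r,z)$ of degree at most $l$. For $\delta>0$ and a mesh vertex $a$, $D_a$ is the closed disk of radius $\delta h$ around $a$, or its half in $r\ge0$ if $a$ is on the axis $r=0$; $\eta_a\in P_l$ is determined by $\int_{D_a}r^3\eta_a p\,dr\,dz=p(a)$ for all $p\in P_l$; $\kappa_a=r^3\eta_a$. For a triangle $K=[a_1,a_2,a_3]$ with barycentric coordinates $\lambda_i$ put $\tilde x_y(x)=\sum_i\lambda_i(x)y_i$. On $K$, the smoothers $S^g,S^c,S^d,S^o$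 are the integrals $\int_{D_{a_1}}\int_{D_{a_2}}\int_{D_{a_3}}\kappa_{a_1}(y_1)\kappa_{a_2}(y_2)\kappa_{a_3}(y_3)\,(\cdot)\,dy_3dy_2dy_1$ of $P^g,P^c,P^d,P^o$ with $X=\tilde x_y(x)$, $M=d\tilde x_y/dx$. The number $\delta$ is called *admissible* for the mesh if, with $\Omega_a$ the union of the triangles with vertex $a$: $D_a\subset\Omega_a$ for vertices $a\notin\Gamma_1$; $D_a\cap\Omega\subset\Omega_a$ for vertices $a\in\Gamma_1$; the $D_a$ of different vertices are disjoint; and $r\ge\delta h$ on $D_a$ for every vertex $a$ off the axis. **Interpolation.** Let $(i,j,k)$ run through the circular permutations, $e_i=[a_j,a_k]$ with unit tangent $t_i$ from $a_j$ to $a_k$, $n_i$ the counter-clockwise rotation of $t_i$ by $\pi/2$, $\nu_i=\lambda_j\nabla\lambda_k-\lambda_k\nabla\lambda_j$, $\xi_i=(-\nu_i^z,\nu_i^r)$. On each $K$ (quotients by $r$ being extended continuously from the interior of $K$) $$I_gu=\sum_i\tfrac{nu}{r}(a_i)\,\tfrac rn\lambda_i,\qquad I_ou=\tfrac1{|K|}\int_Ku,$$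 $$I_cv=\sum_iv_\theta(a_i)\big(-\tfrac1n\lambda_i,\lambda_i,0\big)+\sum_i\Big(\int_{e_i}\big(\tfrac{nv_r+v_\theta}{r},\tfrac{nv_z}{r}\big)\cdot t_i\Big)\big(\tfrac rn\nu_i^r,0,\tfrac rn\nu_i^z\big),$$ $$I_dw=\Big(\tfrac1{|K|}\int_K\tfrac{nw_\theta-w_r}{r}\Big)\big(0,\tfrac rn,0\big)+\sum_i\Big(\int_{e_i}(w_r,w_z)\cdot n_i\Big)\big(\xi_i^r,\tfrac1n\xi_i^r,\xi_i^z\big).$$ Finally $R_h^g=I_gS^gE^g$, $R_h^c=I_cS^cE^c$, $R_h^d=I_dS^dE^d$, $R_h^o=I_oS^oE^o$. **Lemma.** Let $\Omega,U,\psi$ be as above, and let $l\ge0$ and constants $\sigma,\tau$ be given. There is $\delta_1>0$ such that for every $n\ge1$, every such triangulation $\mathscr T_h$ of $\Omega$ with $h_K/\rho_K<\sigma$ and $h\le\tau h_K$ for all $K$, and every $\delta\in(0,\delta_1)$ that is admissible for it, the following holds. 1. $R_h^g,R_h^c,R_h^d,R_h^o$ map $A_h,B_h,C_h,D_h$ linearly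 and bijectively onto themselves. 2. The inverses $J_h^g,J_h^c,J_h^d,J_h^o$ of these restrictions have $L^2_r(\Omega)$ operator norm at most $2$. 3. The inverses commute with the differential operators. For $u\in A_h$, $v\in B_h$, $w\in C_h$ we have $\mathrm{grad}^nu\in B_h$, $\mathrm{curl}^nv\in C_h$, $\mathrm{div}^nw\in D_h$ and $$\mathrm{grad}^nJ_h^gu=J_h^c\,\mathrm{grad}^nu,\qquad \mathrm{curl}^nJ_h^cv=J_h^d\,\mathrm{curl}^nv,\qquad \mathrm{div}^nJ_h^dw=J_h^o\,\mathrm{div}^nw.$$ -/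

import Mathlib

open MeasureTheory Set Filter Topology
open scoped ContDiff ENNReal NNReal Matrix

noncomputable section

namespace AxiFEM

/-- The `(r, z)`-plane with its Euclidean metric: `x 0 = r` and `x 1 = z`. -/
abbrev Pt : Type := EuclideanSpace ℝ (Fin 2)

/-- Values of vector fields: the components `0, 1, 2` are the `r`, `θ`, `z` components. -/
abbrev Vec : Type := EuclideanSpace ℝ (Fin 3)

/-- The open half plane `r > 0`. -/
def halfPlane : Set Pt := {x | 0 < x 0}

/-! ### Weighted spaces and the operators `grad`, `curl`, `div` of the `n`-th Fourier mode -/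

/-- The measure `r dr dz` on `Ω`. -/
def rMeasure (Ω : Set Pt) : Measure Pt :=
  (volume.restrict Ω).withDensity (fun x => ENNReal.ofReal (x 0))

/-- The space `L²_r(Ω)`. -/
abbrev L2r (Ω : Set Pt) : Type := Lp ℝ 2 (rMeasure Ω)

/-- The space `L²_r(Ω) × L²_r(Ω) × L²_r(Ω)` with its Hilbert norm. -/
abbrev L2rVec (Ω : Set Pt) : Type := Lp Vec 2 (rMeasure Ω)

/-- Test functions on `Ω`: smooth with compact support contained in `Ω` (and in `r > 0`, where all
domains below lie). -/
def IsTest (Ω : Set Pt) (φ : Pt → ℝ) : Prop :=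
  ContDiff ℝ ∞ φ ∧ HasCompactSupport φ ∧ tsupport φ ⊆ Ω ∩ halfPlane

/-- The partial derivative in the direction `i` (`0` for `r`, `1` for `z`). -/
def pd (i : Fin 2) (φ : Pt → ℝ) (x : Pt) : ℝ := fderiv ℝ φ x (EuclideanSpace.single i 1)

/-- `∫_Ω u φ dr dz` -/
def pair (Ω : Set Pt) (u φ : Pt → ℝ) : ℝ := ∫ x in Ω, u x * φ x

/-- `φ / r` -/
def overR (φ : Pt → ℝ) (x : Pt) : ℝ := φ x / x 0

/-- The component `i` of a vector field. -/
def comp (v : Pt → Vec) (i : Fin 3) (x : Pt) : ℝ := v x i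

/-- `v = grad^n u = (∂_r u, -(n/r) u, ∂_z u)` in `Ω`, in the sense of distributions. -/
def IsGrad (n : ℕ) (Ω : Set Pt) (u : Pt → ℝ) (v : Pt → Vec) : Prop :=
  ∀ φ, IsTest Ω φ →
    pair Ω (comp v 0) φ = -pair Ω u (pd 0 φ) ∧
    pair Ω (comp v 1) φ = -((n : ℝ) * pair Ω u (overR φ)) ∧
    pair Ω (comp v 2) φ = -pair Ω u (pd 1 φ)

/-- `w = curl^n v = (-((n/r) v_z + ∂_z v_θ), ∂_z v_r - ∂_r v_z, (n v_r + v_θ)/r + ∂_r v_θ)` in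
`Ω`, in the sense of distributions. -/
def IsCurl (n : ℕ) (Ω : Set Pt) (v w : Pt → Vec) : Prop :=
  ∀ φ, IsTest Ω φ →
    pair Ω (comp w 0) φ = -((n : ℝ) * pair Ω (comp v 2) (overR φ)) + pair Ω (comp v 1) (pd 1 φ) ∧
    pair Ω (comp w 1) φ = -pair Ω (comp v 0) (pd 1 φ) + pair Ω (comp v 2) (pd 0 φ) ∧
    pair Ω (comp w 2) φ = (n : ℝ) * pair Ω (comp v 0) (overR φ) +
      pair Ω (comp v 1) (overR φ) - pair Ω (comp v 1) (pd 0 φ)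

/-- `f = div^n w = ∂_r w_r + (w_r - n w_θ)/r + ∂_z w_z` in `Ω`, in the sense of distributions. -/
def IsDiv (n : ℕ) (Ω : Set Pt) (w : Pt → Vec) (f : Pt → ℝ) : Prop :=
  ∀ φ, IsTest Ω φ →
    pair Ω f φ = -pair Ω (comp w 0) (pd 0 φ) + pair Ω (comp w 0) (overR φ) -
      (n : ℝ) * pair Ω (comp w 1) (overR φ) - pair Ω (comp w 2) (pd 1 φ)

/-! The distributional operators are linear. -/

/-- Continuous functions with compact support in `r > 0`. -/
def IsCc (g : Pt → ℝ) : Prop := Continuous g ∧ HasCompactSupport g ∧ tsupport g ⊆ halfPlane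

lemma IsTest.isCc {Ω : Set Pt} {φ : Pt → ℝ} (h : IsTest Ω φ) : IsCc φ :=
  ⟨h.1.continuous, h.2.1, fun _ hx => (h.2.2 hx).2⟩

lemma IsTest.isCc_pd {Ω : Set Pt} {φ : Pt → ℝ} (h : IsTest Ω φ) (i : Fin 2) : IsCc (pd i φ) := by
  have hsub : tsupport (pd i φ) ⊆ tsupport φ := by
    refine (closure_mono ?_).trans (tsupport_fderiv_subset ℝ (f := φ))
    intro x hx hx'
    exact hx (by simp [pd, hx'])
  refine ⟨?_, ?_, fun x hx => (h.2.2 (hsub hx)).2⟩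
  · exact (h.1.continuous_fderiv (by simp)).clm_apply continuous_const
  · exact h.2.1.of_isClosed_subset (isClosed_tsupport _) hsub

lemma IsCc.overR {g : Pt → ℝ} (h : IsCc g) : IsCc (overR g) := by
  have hsub : tsupport (AxiFEM.overR g) ⊆ tsupport g := by
    refine closure_mono ?_
    intro x hx hx'
    exact hx (by simp [AxiFEM.overR, hx'])
  refine ⟨?_, ?_, fun x hx => h.2.2 (hsub hx)⟩
  · refine continuous_of_tsupport fun x hx => ?_
    have hx0 : x 0 ≠ 0 := (h.2.2 (hsub hx)).ne'
    exact h.1.continuousAt.div (by fun_prop) hx0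
  · exact h.2.1.of_isClosed_subset (isClosed_tsupport _) hsub

lemma integrable_mul {Ω : Set Pt} {u g : Pt → ℝ} (hu : MemLp u 2 (rMeasure Ω)) (hg : IsCc g) :
    Integrable (fun x => u x * g x) (volume.restrict Ω) := by
  have hfin : IsLocallyFiniteMeasure (rMeasure Ω) :=
    IsLocallyFiniteMeasure.withDensity_ofReal (by fun_prop)
  have h2 : MemLp (overR g) 2 (rMeasure Ω) :=
    hg.overR.1.memLp_of_hasCompactSupport hg.overR.2.1
  have h3 : Integrable (fun x => u x * overR g x) (rMeasure Ω) := hu.integrable_mul h2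
  rw [rMeasure, integrable_withDensity_iff_integrable_smul' (by fun_prop) (by simp)] at h3
  refine h3.congr (Eventually.of_forall fun x => ?_)
  by_cases hx : g x = 0
  · simp [overR, hx]
  · have hx0 : 0 < x 0 := hg.2.2 (subset_tsupport _ hx)
    simp only [ENNReal.toReal_ofReal hx0.le, overR, smul_eq_mul]
    field_simp

lemma pair_congr {Ω : Set Pt} {u v g : Pt → ℝ} (h : u =ᵐ[rMeasure Ω] v) (hg : IsCc g) :
    pair Ω u g = pair Ω v g := by
  refine integral_congr_ae ?_
  have h' := (ae_withDensity_iff (by fun_prop)).1 h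
  filter_upwards [h'] with x hx
  by_cases hgx : g x = 0
  · simp [hgx]
  · have hx0 : 0 < x 0 := hg.2.2 (subset_tsupport _ hgx)
    rw [hx (by simpa using hx0)]

lemma pair_add {Ω : Set Pt} {u v g : Pt → ℝ} (hu : MemLp u 2 (rMeasure Ω))
    (hv : MemLp v 2 (rMeasure Ω)) (hg : IsCc g) :
    pair Ω (u + v) g = pair Ω u g + pair Ω v g := by
  rw [pair, pair, pair, ← integral_add (integrable_mul hu hg) (integrable_mul hv hg)]
  exact integral_congr_ae (Eventually.of_forall fun x => by simp [add_mul])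

lemma pair_smul {Ω : Set Pt} (c : ℝ) (u g : Pt → ℝ) : pair Ω (c • u) g = c * pair Ω u g := by
  rw [pair, pair, ← integral_const_mul]
  exact integral_congr_ae (Eventually.of_forall fun x => by simp [mul_assoc])

lemma memLp_comp {Ω : Set Pt} (v : L2rVec Ω) (i : Fin 3) : MemLp (comp v i) 2 (rMeasure Ω) :=
  (Lp.memLp v).continuousLinearMap_comp (EuclideanSpace.proj (𝕜 := ℝ) i)

lemma pair_add_L2r {Ω : Set Pt} (u v : L2r Ω) {g : Pt → ℝ} (hg : IsCc g) :
    pair Ω ⇑(u + v) g = pair Ω u g + pair Ω v g := by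
  rw [pair_congr (Lp.coeFn_add u v) hg, pair_add (Lp.memLp u) (Lp.memLp v) hg]

lemma pair_smul_L2r {Ω : Set Pt} (c : ℝ) (u : L2r Ω) {g : Pt → ℝ} (hg : IsCc g) :
    pair Ω ⇑(c • u) g = c * pair Ω u g := by
  rw [pair_congr (Lp.coeFn_smul c u) hg, pair_smul]

lemma pair_zero_L2r {Ω : Set Pt} {g : Pt → ℝ} (hg : IsCc g) :
    pair Ω ⇑(0 : L2r Ω) g = 0 := by
  simpa using pair_smul_L2r (0 : ℝ) (0 : L2r Ω) hg

lemma pair_add_L2rVec {Ω : Set Pt} (u v : L2rVec Ω) (i : Fin 3) {g : Pt → ℝ} (hg : IsCc g) :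
    pair Ω (comp ⇑(u + v) i) g = pair Ω (comp u i) g + pair Ω (comp v i) g := by
  rw [← pair_add (memLp_comp u i) (memLp_comp v i) hg]
  refine pair_congr ?_ hg
  filter_upwards [Lp.coeFn_add u v] with x hx
  simp only [comp, hx, Pi.add_apply, PiLp.add_apply]

lemma pair_smul_L2rVec {Ω : Set Pt} (c : ℝ) (u : L2rVec Ω) (i : Fin 3) {g : Pt → ℝ}
    (hg : IsCc g) : pair Ω (comp ⇑(c • u) i) g = c * pair Ω (comp u i) g := by
  rw [← pair_smul]
  refine pair_congr ?_ hg
  filter_upwards [Lp.coeFn_smul c u] with x hx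
  simp [comp, hx]

lemma pair_zero_L2rVec {Ω : Set Pt} (i : Fin 3) {g : Pt → ℝ} (hg : IsCc g) :
    pair Ω (comp ⇑(0 : L2rVec Ω) i) g = 0 := by
  simpa using pair_smul_L2rVec (0 : ℝ) (0 : L2rVec Ω) i hg

/-! ### Triangles and triangulations -/

/-- The closed triangle with vertices `K 0`, `K 1`, `K 2`. -/
def tri (K : Fin 3 → Pt) : Set Pt := convexHull ℝ (range K)

/-- The planar cross product. -/
def cross (u v : Pt) : ℝ := u 0 * v 1 - u 1 * v 0

/-- The barycentric coordinate `λ_i` of the triangle `K`: the affine function equal to `1` at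
`a_i` and to `0` at the two other vertices. -/
def bary (K : Fin 3 → Pt) (i : Fin 3) (x : Pt) : ℝ :=
  cross (K (i + 2) - K (i + 1)) (x - K (i + 1)) /
    cross (K (i + 2) - K (i + 1)) (K i - K (i + 1))

/-- The (constant) gradient of `λ_i`. -/
def gradBary (K : Fin 3 → Pt) (i : Fin 3) : Fin 2 → ℝ :=
  ![-(K (i + 2) - K (i + 1)) 1 / cross (K (i + 2) - K (i + 1)) (K i - K (i + 1)),
    (K (i + 2) - K (i + 1)) 0 / cross (K (i + 2) - K (i + 1)) (K i - K (i + 1))]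

/-- The diameter `ρ_K` of the largest disk contained in `S`. -/
def inDiam (S : Set Pt) : ℝ :=
  sSup {d | ∃ (c : Pt) (t : ℝ), 0 ≤ t ∧ d = 2 * t ∧ Metric.closedBall c t ⊆ S}

/-- A conforming finite triangulation in the closed half plane `r ≥ 0`: any two of its closed
triangles meet exactly in the hull of their common vertices (the empty set, a vertex, an edge).
Each triangle is listed once, with some numbering of its vertices. -/
structure Triangulation where
  cells : Finset (Fin 3 → Pt)
  nondegenerate : ∀ K ∈ cells, AffineIndependent ℝ K
  nonneg : ∀ K ∈ cells, ∀ i, 0 ≤ K i 0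
  listed_once : ∀ K ∈ cells, ∀ K' ∈ cells, range K = range K' → K = K'
  conforming : ∀ K ∈ cells, ∀ K' ∈ cells,
    tri K ∩ tri K' = convexHull ℝ (range K ∩ range K')

namespace Triangulation

variable (T : Triangulation)

/-- `T` is a triangulation of the open set `Ω`. -/
def Meshes (Ω : Set Pt) : Prop := interior (⋃ K ∈ T.cells, tri K) = Ω

/-- The set of mesh vertices. -/
def vertices : Set Pt := ⋃ K ∈ T.cells, range K

/-- The vertex patch `Ω_a`. -/
def patch (a : Pt) : Set Pt := ⋃ K ∈ T.cells, ⋃ (_ : a ∈ range K), tri K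

/-- The mesh size `h`, the largest diameter of a triangle. -/
def meshSize : ℝ := sSup ((fun K => Metric.diam (tri K)) '' (T.cells : Set (Fin 3 → Pt)))

/-- Shape regularity `h_K / ρ_K < σ`. -/
def ShapeRegular (σ : ℝ) : Prop :=
  ∀ K ∈ T.cells, Metric.diam (tri K) < σ * inDiam (tri K)

/-- Quasi-uniformity: `h ≤ τ h_K` for all triangles. -/
def QuasiUniform (τ : ℝ) : Prop :=
  ∀ K ∈ T.cells, T.meshSize ≤ τ * Metric.diam (tri K)

end Triangulation

/-! ### The finite element spaces -/

/-- `u ∈ A_1` on the triangle `K`: `u = α₁ r + α₂ r² + α₃ r z`. -/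
def IsA1 (Ω : Set Pt) (K : Fin 3 → Pt) (u : Pt → ℝ) : Prop :=
  ∃ α₁ α₂ α₃ : ℝ, ∀ᵐ x ∂(rMeasure Ω), x ∈ tri K →
    u x = α₁ * x 0 + α₂ * x 0 ^ 2 + α₃ * x 0 * x 1

/-- `v ∈ B_1` on the triangle `K`. -/
def IsB1 (n : ℕ) (Ω : Set Pt) (K : Fin 3 → Pt) (v : Pt → Vec) : Prop :=
  ∃ β₁ β₂ β₃ β₄ β₅ β₆ : ℝ, ∀ᵐ x ∂(rMeasure Ω), x ∈ tri K →
    v x 0 = β₁ + β₄ * x 0 + β₃ * x 1 - β₆ * x 0 * x 1 ∧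
    v x 1 = -(n : ℝ) * β₁ + β₂ * x 0 - (n : ℝ) * β₃ * x 1 ∧
    v x 2 = β₅ * x 0 + β₆ * x 0 ^ 2

/-- `w ∈ C_1` on the triangle `K`. -/
def IsC1 (n : ℕ) (Ω : Set Pt) (K : Fin 3 → Pt) (w : Pt → Vec) : Prop :=
  ∃ γ₁ γ₂ γ₃ γ₄ : ℝ, ∀ᵐ x ∂(rMeasure Ω), x ∈ tri K →
    w x 0 = (n : ℝ) * γ₁ + γ₂ * x 0 ∧
    w x 1 = γ₁ + γ₃ * x 0 ∧
    w x 2 = γ₄ + γ₂ * x 1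

/-- `f` is constant on the triangle `K`. -/
def IsD1 (Ω : Set Pt) (K : Fin 3 → Pt) (f : Pt → ℝ) : Prop :=
  ∃ c : ℝ, ∀ᵐ x ∂(rMeasure Ω), x ∈ tri K → f x = c

/-- The space `A_h`: the functions in `H_r(grad^n, Ω)` that are piecewise in `A_1`. -/
def Ah (n : ℕ) (Ω : Set Pt) (T : Triangulation) : Submodule ℝ (L2r Ω) where
  carrier := {u | (∃ v : L2rVec Ω, IsGrad n Ω u v) ∧ ∀ K ∈ T.cells, IsA1 Ω K u}
  zero_mem' := by
    refine ⟨⟨0, fun φ hφ => ?_⟩, fun K _ => ⟨0, 0, 0, ?_⟩⟩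
    · simp only [pair_zero_L2r hφ.isCc.overR, pair_zero_L2r (hφ.isCc_pd _),
        pair_zero_L2rVec _ hφ.isCc, mul_zero, neg_zero, and_self]
    · filter_upwards [Lp.coeFn_zero ℝ 2 (rMeasure Ω)] with x hx _
      rw [hx]
      simp
  add_mem' := by
    rintro u u' ⟨⟨v, hv⟩, hu⟩ ⟨⟨v', hv'⟩, hu'⟩
    refine ⟨⟨v + v', fun φ hφ => ?_⟩, fun K hK => ?_⟩
    · obtain ⟨h0, h1, h2⟩ := hv φ hφ
      obtain ⟨h0', h1', h2'⟩ := hv' φ hφ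
      rw [pair_add_L2rVec _ _ _ hφ.isCc, pair_add_L2rVec _ _ _ hφ.isCc,
        pair_add_L2rVec _ _ _ hφ.isCc, pair_add_L2r _ _ hφ.isCc.overR,
        pair_add_L2r _ _ (hφ.isCc_pd _), pair_add_L2r _ _ (hφ.isCc_pd _)]
      exact ⟨by linarith, by linarith, by linarith⟩
    · obtain ⟨a, b, c, h⟩ := hu K hK
      obtain ⟨a', b', c', h'⟩ := hu' K hK
      refine ⟨a + a', b + b', c + c', ?_⟩
      filter_upwards [h, h', Lp.coeFn_add u u'] with x hx hx' hadd hxK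
      rw [hadd, Pi.add_apply, hx hxK, hx' hxK]
      ring
  smul_mem' := by
    rintro t u ⟨⟨v, hv⟩, hu⟩
    refine ⟨⟨t • v, fun φ hφ => ?_⟩, fun K hK => ?_⟩
    · obtain ⟨h0, h1, h2⟩ := hv φ hφ
      rw [pair_smul_L2rVec _ _ _ hφ.isCc, pair_smul_L2rVec _ _ _ hφ.isCc,
        pair_smul_L2rVec _ _ _ hφ.isCc, pair_smul_L2r _ _ hφ.isCc.overR,
        pair_smul_L2r _ _ (hφ.isCc_pd _), pair_smul_L2r _ _ (hφ.isCc_pd _), h0, h1, h2]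
      exact ⟨by ring, by ring, by ring⟩
    · obtain ⟨a, b, c, h⟩ := hu K hK
      refine ⟨t * a, t * b, t * c, ?_⟩
      filter_upwards [h, Lp.coeFn_smul t u] with x hx hsm hxK
      rw [hsm, Pi.smul_apply, hx hxK, smul_eq_mul]
      ring

/-- The space `B_h`: the fields in `H_r(curl^n, Ω)` that are piecewise in `B_1`. -/
def Bh (n : ℕ) (Ω : Set Pt) (T : Triangulation) : Submodule ℝ (L2rVec Ω) where
  carrier := {v | (∃ w : L2rVec Ω, IsCurl n Ω v w) ∧ ∀ K ∈ T.cells, IsB1 n Ω K v}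
  zero_mem' := by
    refine ⟨⟨0, fun φ hφ => ?_⟩, fun K _ => ⟨0, 0, 0, 0, 0, 0, ?_⟩⟩
    · simp only [pair_zero_L2rVec _ hφ.isCc.overR, pair_zero_L2rVec _ (hφ.isCc_pd _),
        pair_zero_L2rVec _ hφ.isCc, mul_zero, neg_zero, add_zero, sub_zero, and_self]
    · filter_upwards [Lp.coeFn_zero Vec 2 (rMeasure Ω)] with x hx _
      rw [hx]
      simp
  add_mem' := by
    rintro u u' ⟨⟨v, hv⟩, hu⟩ ⟨⟨v', hv'⟩, hu'⟩
    refine ⟨⟨v + v', fun φ hφ => ?_⟩, fun K hK => ?_⟩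
    · obtain ⟨h0, h1, h2⟩ := hv φ hφ
      obtain ⟨h0', h1', h2'⟩ := hv' φ hφ
      simp only [pair_add_L2rVec _ _ _ hφ.isCc, pair_add_L2rVec _ _ _ hφ.isCc.overR,
        pair_add_L2rVec _ _ _ (hφ.isCc_pd _)]
      exact ⟨by linarith, by linarith, by linarith⟩
    · obtain ⟨b₁, b₂, b₃, b₄, b₅, b₆, h⟩ := hu K hK
      obtain ⟨c₁, c₂, c₃, c₄, c₅, c₆, h'⟩ := hu' K hK
      refine ⟨b₁ + c₁, b₂ + c₂, b₃ + c₃, b₄ + c₄, b₅ + c₅, b₆ + c₆, ?_⟩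
      filter_upwards [h, h', Lp.coeFn_add u u'] with x hx hx' hadd hxK
      obtain ⟨e0, e1, e2⟩ := hx hxK
      obtain ⟨e0', e1', e2'⟩ := hx' hxK
      simp only [hadd, Pi.add_apply, PiLp.add_apply, e0, e1, e2, e0', e1', e2']
      exact ⟨by ring, by ring, by ring⟩
  smul_mem' := by
    rintro t u ⟨⟨v, hv⟩, hu⟩
    refine ⟨⟨t • v, fun φ hφ => ?_⟩, fun K hK => ?_⟩
    · obtain ⟨h0, h1, h2⟩ := hv φ hφ
      simp only [pair_smul_L2rVec _ _ _ hφ.isCc, pair_smul_L2rVec _ _ _ hφ.isCc.overR,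
        pair_smul_L2rVec _ _ _ (hφ.isCc_pd _), h0, h1, h2]
      exact ⟨by ring, by ring, by ring⟩
    · obtain ⟨b₁, b₂, b₃, b₄, b₅, b₆, h⟩ := hu K hK
      refine ⟨t * b₁, t * b₂, t * b₃, t * b₄, t * b₅, t * b₆, ?_⟩
      filter_upwards [h, Lp.coeFn_smul t u] with x hx hsm hxK
      obtain ⟨e0, e1, e2⟩ := hx hxK
      simp only [hsm, Pi.smul_apply, PiLp.smul_apply, smul_eq_mul, e0, e1, e2]
      exact ⟨by ring, by ring, by ring⟩

/-- The space `C_h`: the fields in `H_r(div^n, Ω)` that are piecewise in `C_1`. -/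
def Ch (n : ℕ) (Ω : Set Pt) (T : Triangulation) : Submodule ℝ (L2rVec Ω) where
  carrier := {w | (∃ f : L2r Ω, IsDiv n Ω w f) ∧ ∀ K ∈ T.cells, IsC1 n Ω K w}
  zero_mem' := by
    refine ⟨⟨0, fun φ hφ => ?_⟩, fun K _ => ⟨0, 0, 0, 0, ?_⟩⟩
    · simp only [pair_zero_L2rVec _ hφ.isCc.overR, pair_zero_L2rVec _ (hφ.isCc_pd _),
        pair_zero_L2r hφ.isCc, mul_zero, neg_zero, add_zero, sub_zero]
    · filter_upwards [Lp.coeFn_zero Vec 2 (rMeasure Ω)] with x hx _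
      rw [hx]
      simp
  add_mem' := by
    rintro u u' ⟨⟨v, hv⟩, hu⟩ ⟨⟨v', hv'⟩, hu'⟩
    refine ⟨⟨v + v', fun φ hφ => ?_⟩, fun K hK => ?_⟩
    · have h0 := hv φ hφ
      have h0' := hv' φ hφ
      simp only [pair_add_L2r _ _ hφ.isCc, pair_add_L2rVec _ _ _ hφ.isCc.overR,
        pair_add_L2rVec _ _ _ (hφ.isCc_pd _)]
      linarith
    · obtain ⟨b₁, b₂, b₃, b₄, h⟩ := hu K hK
      obtain ⟨c₁, c₂, c₃, c₄, h'⟩ := hu' K hK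
      refine ⟨b₁ + c₁, b₂ + c₂, b₃ + c₃, b₄ + c₄, ?_⟩
      filter_upwards [h, h', Lp.coeFn_add u u'] with x hx hx' hadd hxK
      obtain ⟨e0, e1, e2⟩ := hx hxK
      obtain ⟨e0', e1', e2'⟩ := hx' hxK
      simp only [hadd, Pi.add_apply, PiLp.add_apply, e0, e1, e2, e0', e1', e2']
      exact ⟨by ring, by ring, by ring⟩
  smul_mem' := by
    rintro t u ⟨⟨v, hv⟩, hu⟩
    refine ⟨⟨t • v, fun φ hφ => ?_⟩, fun K hK => ?_⟩
    · have h0 := hv φ hφ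
      simp only [pair_smul_L2r _ _ hφ.isCc, pair_smul_L2rVec _ _ _ hφ.isCc.overR,
        pair_smul_L2rVec _ _ _ (hφ.isCc_pd _), h0]
      ring
    · obtain ⟨b₁, b₂, b₃, b₄, h⟩ := hu K hK
      refine ⟨t * b₁, t * b₂, t * b₃, t * b₄, ?_⟩
      filter_upwards [h, Lp.coeFn_smul t u] with x hx hsm hxK
      obtain ⟨e0, e1, e2⟩ := hx hxK
      simp only [hsm, Pi.smul_apply, PiLp.smul_apply, smul_eq_mul, e0, e1, e2]
      exact ⟨by ring, by ring, by ring⟩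

/-- The space `D_h`: the functions in `L²_r(Ω)` that are piecewise constant. -/
def Dh (Ω : Set Pt) (T : Triangulation) : Submodule ℝ (L2r Ω) where
  carrier := {f | ∀ K ∈ T.cells, IsD1 Ω K f}
  zero_mem' := fun K _ => ⟨0, by
    filter_upwards [Lp.coeFn_zero ℝ 2 (rMeasure Ω)] with x hx _
    rw [hx]
    simp⟩
  add_mem' := by
    intro u u' hu hu' K hK
    obtain ⟨a, h⟩ := hu K hK
    obtain ⟨a', h'⟩ := hu' K hK
    refine ⟨a + a', ?_⟩
    filter_upwards [h, h', Lp.coeFn_add u u'] with x hx hx' hadd hxK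
    rw [hadd, Pi.add_apply, hx hxK, hx' hxK]
  smul_mem' := by
    intro t u hu K hK
    obtain ⟨a, h⟩ := hu K hK
    refine ⟨t * a, ?_⟩
    filter_upwards [h, Lp.coeFn_smul t u] with x hx hsm hxK
    rw [hsm, Pi.smul_apply, hx hxK, smul_eq_mul]

/-! ### The extension operators -/

/-- Data of a Lipschitz reflection across `Γ_1`: the set `U ∩ {r > 0}` is the extended domain,
and `ψ` maps its part outside `Ω` into `Ω ∪ Γ_1` in a bi-Lipschitz way, fixing `Γ_1` and with
`r ≤ c · (r ∘ ψ)`. -/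
structure IsReflection (Ω U : Set Pt) (ψ : Pt → Pt) : Prop where
  isOpen : IsOpen U
  closure_subset : closure Ω ⊆ U
  mapsTo : ∀ x ∈ (U ∩ halfPlane) \ closure Ω, ψ x ∈ Ω
  fixed : ∀ x ∈ frontier Ω ∩ halfPlane, ψ x = x
  lipschitz : ∃ L : ℝ, ∀ x ∈ (U ∩ halfPlane) \ Ω, ∀ y ∈ (U ∩ halfPlane) \ Ω,
    dist (ψ x) (ψ y) ≤ L * dist x y
  antilipschitz : ∃ L : ℝ, ∀ x ∈ (U ∩ halfPlane) \ Ω, ∀ y ∈ (U ∩ halfPlane) \ Ω,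
    dist x y ≤ L * dist (ψ x) (ψ y)
  radius : ∃ c : ℝ, ∀ x ∈ (U ∩ halfPlane) \ Ω, x 0 ≤ c * ψ x 0

/-- The Jacobian matrix of `ψ`. -/
def jacMap (ψ : Pt → Pt) (x : Pt) : Matrix (Fin 2) (Fin 2) ℝ :=
  Matrix.of fun p q => fderiv ℝ ψ x (EuclideanSpace.single q 1) p

/-- `n u / r`. -/
def quotG (n : ℕ) (u : Pt → ℝ) (x : Pt) : ℝ := (n : ℝ) * u x / x 0

/-- `((n v_r + v_θ)/r, n v_z / r)`. -/
def quotC (n : ℕ) (v : Pt → Vec) (x : Pt) : Fin 2 → ℝ :=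
  ![((n : ℝ) * v x 0 + v x 1) / x 0, (n : ℝ) * v x 2 / x 0]

/-- `(w_r, w_z)`. -/
def rzPart (w : Pt → Vec) (x : Pt) : Fin 2 → ℝ := ![w x 0, w x 2]

/-- `(n w_θ - w_r)/r`. -/
def quotD (n : ℕ) (w : Pt → Vec) (x : Pt) : ℝ := ((n : ℝ) * w x 1 - w x 0) / x 0

open Classical in
/-- The extension of scalar fields in `H_r(grad^n)`: outside `Ω`, the function `n u / r` is
composed with `ψ`. -/
def extG (n : ℕ) (Ω : Set Pt) (ψ : Pt → Pt) (u : Pt → ℝ) (x : Pt) : ℝ :=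
  if x ∈ Ω then u x else x 0 / (n : ℝ) * quotG n u (ψ x)

open Classical in
/-- The extension of vector fields in `H_r(curl^n)`: outside `Ω`, `v_θ` is composed with `ψ` and
`((n v_r + v_θ)/r, n v_z / r)` is pulled back covariantly. -/
def extC (n : ℕ) (Ω : Set Pt) (ψ : Pt → Pt) (v : Pt → Vec) (x : Pt) : Vec :=
  if x ∈ Ω then v x else
    !₂[x 0 / (n : ℝ) * ((jacMap ψ x)ᵀ *ᵥ quotC n v (ψ x)) 0 - 1 / (n : ℝ) * v (ψ x) 1,
      v (ψ x) 1,
      x 0 / (n : ℝ) * ((jacMap ψ x)ᵀ *ᵥ quotC n v (ψ x)) 1]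

open Classical in
/-- The extension of vector fields in `H_r(div^n)`: outside `Ω`, `(w_r, w_z)` is pulled back by
the Piola transformation (`adjugate M = det M · M⁻¹`) and `(n w_θ - w_r)/r` as a density. -/
def extD (n : ℕ) (Ω : Set Pt) (ψ : Pt → Pt) (w : Pt → Vec) (x : Pt) : Vec :=
  if x ∈ Ω then w x else
    !₂[((jacMap ψ x).adjugate *ᵥ rzPart w (ψ x)) 0,
      1 / (n : ℝ) * ((jacMap ψ x).adjugate *ᵥ rzPart w (ψ x)) 0 +
        x 0 / (n : ℝ) * ((jacMap ψ x).det * quotD n w (ψ x)),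
      ((jacMap ψ x).adjugate *ᵥ rzPart w (ψ x)) 1]

open Classical in
/-- The extension of scalar fields in `L²_r`: outside `Ω`, pulled back as a density. -/
def extO (Ω : Set Pt) (ψ : Pt → Pt) (f : Pt → ℝ) (x : Pt) : ℝ :=
  if x ∈ Ω then f x else (jacMap ψ x).det * f (ψ x)

/-! ### Smoothing domains and weights -/

open Classical in
/-- The smoothing domain `D_a`: the closed disk of radius `ρ` around `a`, or its half in `r ≥ 0`
if `a` lies on the axis. -/
def disk (ρ : ℝ) (a : Pt) : Set Pt :=
  if a 0 = 0 then Metric.closedBall a ρ ∩ {x | 0 ≤ x 0} else Metric.closedBall a ρ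

/-- The value of a polynomial in `(r, z)`. -/
def polyVal (p : MvPolynomial (Fin 2) ℝ) (x : Pt) : ℝ := MvPolynomial.eval (fun i => x i) p

/-- `η` lies in `P_l` and `∫_{D_a} (r η) (r p) r dr dz = p(a)` for all `p ∈ P_l`. -/
def IsEta (l : ℕ) (ρ : ℝ) (a : Pt) (η : MvPolynomial (Fin 2) ℝ) : Prop :=
  η.totalDegree ≤ l ∧ ∀ p : MvPolynomial (Fin 2) ℝ, p.totalDegree ≤ l →
    ∫ x in disk ρ a, (x 0 * polyVal η x) * (x 0 * polyVal p x) * x 0 = polyVal p a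

/-- The polynomial `η_a`, the unique solution of `IsEta`. -/
def eta (l : ℕ) (ρ : ℝ) (a : Pt) : MvPolynomial (Fin 2) ℝ := Classical.epsilon (IsEta l ρ a)

/-- The weight `κ = r³ η_a`. -/
def kappa (l : ℕ) (ρ : ℝ) (a y : Pt) : ℝ := y 0 ^ 3 * polyVal (eta l ρ a) y

/-- The part `Γ_1` of the boundary of `Ω` that is not on the axis. It is closed, and `Γ_0` is the
remaining part of the boundary. -/
def gammaOne (Ω : Set Pt) : Set Pt := closure (frontier Ω ∩ halfPlane)

/-- The requirements on the smoothing domains, which have radius `ρ = δ h`. -/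
structure Admissible (Ω : Set Pt) (T : Triangulation) (δ : ℝ) : Prop where
  disk_subset : ∀ a ∈ T.vertices, a ∉ gammaOne Ω → disk (δ * T.meshSize) a ⊆ T.patch a
  disk_inter_subset : ∀ a ∈ T.vertices, a ∈ gammaOne Ω →
    disk (δ * T.meshSize) a ∩ Ω ⊆ T.patch a
  disjoint : ∀ a ∈ T.vertices, ∀ b ∈ T.vertices, a ≠ b →
    Disjoint (disk (δ * T.meshSize) a) (disk (δ * T.meshSize) b)
  radius : ∀ a ∈ T.vertices, a 0 ≠ 0 → ∀ y ∈ disk (δ * T.meshSize) a, δ * T.meshSize ≤ y 0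

/-! ### The smoothers on a triangle `K` -/

/-- `∫_{D_{a₁}} ∫_{D_{a₂}} ∫_{D_{a₃}} κ₁₂₃ F(y₁, y₂, y₃) dy₃ dy₂ dy₁`. -/
def smooth (l : ℕ) (ρ : ℝ) (K : Fin 3 → Pt) (F : (Fin 3 → Pt) → ℝ) : ℝ :=
  ∫ y₁ in disk ρ (K 0), ∫ y₂ in disk ρ (K 1), ∫ y₃ in disk ρ (K 2),
    kappa l ρ (K 0) y₁ * kappa l ρ (K 1) y₂ * kappa l ρ (K 2) y₃ * F ![y₁, y₂, y₃]

/-- `x̃_y = ∑ λ_i(x) y_i`. -/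
def xTilde (K y : Fin 3 → Pt) (x : Pt) : Pt := ∑ i, bary K i x • y i

/-- The Jacobian matrix `d x̃_y / dx`. -/
def jacTilde (K y : Fin 3 → Pt) : Matrix (Fin 2) (Fin 2) ℝ :=
  Matrix.of fun p q => ∑ i, y i p * gradBary K i q

/-- The smoother `S^g` on `K`. -/
def smoothG (n l : ℕ) (ρ : ℝ) (K : Fin 3 → Pt) (u : Pt → ℝ) (x : Pt) : ℝ :=
  x 0 / (n : ℝ) * smooth l ρ K (fun y => quotG n u (xTilde K y x))

/-- The smoother `S^c` on `K`. -/
def smoothC (n l : ℕ) (ρ : ℝ) (K : Fin 3 → Pt) (v : Pt → Vec) (x : Pt) : Vec :=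
  !₂[x 0 / (n : ℝ) *
        smooth l ρ K (fun y => ((jacTilde K y)ᵀ *ᵥ quotC n v (xTilde K y x)) 0) -
      1 / (n : ℝ) * smooth l ρ K (fun y => v (xTilde K y x) 1),
    smooth l ρ K (fun y => v (xTilde K y x) 1),
    x 0 / (n : ℝ) *
      smooth l ρ K (fun y => ((jacTilde K y)ᵀ *ᵥ quotC n v (xTilde K y x)) 1)]

/-- The smoother `S^d` on `K`; here `adjugate M = det M · M⁻¹`. -/
def smoothD (n l : ℕ) (ρ : ℝ) (K : Fin 3 → Pt) (w : Pt → Vec) (x : Pt) : Vec :=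
  !₂[smooth l ρ K (fun y => ((jacTilde K y).adjugate *ᵥ rzPart w (xTilde K y x)) 0),
    1 / (n : ℝ) *
        smooth l ρ K (fun y => ((jacTilde K y).adjugate *ᵥ rzPart w (xTilde K y x)) 0) +
      x 0 / (n : ℝ) *
        smooth l ρ K (fun y => (jacTilde K y).det * quotD n w (xTilde K y x)),
    smooth l ρ K (fun y => ((jacTilde K y).adjugate *ᵥ rzPart w (xTilde K y x)) 1)]

/-- The smoother `S^o` on `K`. -/
def smoothO (l : ℕ) (ρ : ℝ) (K : Fin 3 → Pt) (f : Pt → ℝ) (x : Pt) : ℝ :=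
  smooth l ρ K (fun y => (jacTilde K y).det * f (xTilde K y x))

/-! ### The interpolation operators on a triangle `K` -/

/-- The continuous extension of `f` from the interior of `K`. It gives quotients by `r` their
values at points of `K` on the axis `r = 0`. -/
def onTri (K : Fin 3 → Pt) (f : Pt → ℝ) : Pt → ℝ := extendFrom (interior (tri K)) f

/-- `∫_{e_i} F · t_i`, where `e_i = [a_j, a_k]` and `t_i` is the unit tangent from `a_j` to `a_k`,
with `(i, j, k)` a circular permutation. -/
def edgeTangent (K : Fin 3 → Pt) (i : Fin 3) (F : Pt → Fin 2 → ℝ) : ℝ :=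
  ∫ s in (0 : ℝ)..1,
    (F (K (i + 1) + s • (K (i + 2) - K (i + 1))) 0 * (K (i + 2) - K (i + 1)) 0 +
      F (K (i + 1) + s • (K (i + 2) - K (i + 1))) 1 * (K (i + 2) - K (i + 1)) 1)

/-- `∫_{e_i} F · n_i`, where the unit normal `n_i` is `t_i` rotated counter-clockwise by `π/2`. -/
def edgeNormal (K : Fin 3 → Pt) (i : Fin 3) (F : Pt → Fin 2 → ℝ) : ℝ :=
  ∫ s in (0 : ℝ)..1,
    (F (K (i + 1) + s • (K (i + 2) - K (i + 1))) 1 * (K (i + 2) - K (i + 1)) 0 -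
      F (K (i + 1) + s • (K (i + 2) - K (i + 1))) 0 * (K (i + 2) - K (i + 1)) 1)

/-- `ν_i = λ_j ∇λ_k - λ_k ∇λ_j`. -/
def nu (K : Fin 3 → Pt) (i : Fin 3) (x : Pt) : Fin 2 → ℝ :=
  bary K (i + 1) x • gradBary K (i + 2) - bary K (i + 2) x • gradBary K (i + 1)

/-- `ξ_i`, the rotation of `ν_i` counter-clockwise by `π/2`. -/
def xi (K : Fin 3 → Pt) (i : Fin 3) (x : Pt) : Fin 2 → ℝ := ![-(nu K i x 1), nu K i x 0]

/-- The interpolation operator `I_g^n` on `K`. -/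
def interpG (n : ℕ) (K : Fin 3 → Pt) (u : Pt → ℝ) (x : Pt) : ℝ :=
  ∑ i, onTri K (quotG n u) (K i) * (x 0 / (n : ℝ) * bary K i x)

/-- The interpolation operator `I_c^n` on `K`. -/
def interpC (n : ℕ) (K : Fin 3 → Pt) (v : Pt → Vec) (x : Pt) : Vec :=
  ∑ i, v (K i) 1 • (!₂[-(1 / (n : ℝ)) * bary K i x, bary K i x, 0] : Vec) +
  ∑ i, edgeTangent K i (fun p m => onTri K (fun q => quotC n v q m) p) •
    (!₂[x 0 / (n : ℝ) * nu K i x 0, 0, x 0 / (n : ℝ) * nu K i x 1] : Vec)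

/-- The interpolation operator `I_d^n` on `K`. -/
def interpD (n : ℕ) (K : Fin 3 → Pt) (w : Pt → Vec) (x : Pt) : Vec :=
  (⨍ p in tri K, quotD n w p) • (!₂[0, x 0 / (n : ℝ), 0] : Vec) +
  ∑ i, edgeNormal K i (rzPart w) •
    (!₂[xi K i x 0, 1 / (n : ℝ) * xi K i x 0, xi K i x 1] : Vec)

/-- The interpolation operator `I_o` on `K`; the value is constant on `K`. -/
def interpO (K : Fin 3 → Pt) (f : Pt → ℝ) : ℝ := ⨍ p in tri K, f p

/-! ### The operators `R_h = I_h S E` -/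

/-- The function that is `F K` in the interior of each triangle `K` of the mesh. -/
def piecewise {V : Type*} [AddCommGroup V] (T : Triangulation)
    (F : (Fin 3 → Pt) → Pt → V) (x : Pt) : V :=
  ∑ K ∈ T.cells, (interior (tri K)).indicator (F K) x

/-- The operator `R_h^g`. -/
def RhG (n l : ℕ) (Ω : Set Pt) (ψ : Pt → Pt) (T : Triangulation) (δ : ℝ) (u : Pt → ℝ) :
    Pt → ℝ :=
  piecewise T fun K => interpG n K (smoothG n l (δ * T.meshSize) K (extG n Ω ψ u))

/-- The operator `R_h^c`. -/
def RhC (n l : ℕ) (Ω : Set Pt) (ψ : Pt → Pt) (T : Triangulation) (δ : ℝ) (v : Pt → Vec) :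
    Pt → Vec :=
  piecewise T fun K => interpC n K (smoothC n l (δ * T.meshSize) K (extC n Ω ψ v))

/-- The operator `R_h^d`. -/
def RhD (n l : ℕ) (Ω : Set Pt) (ψ : Pt → Pt) (T : Triangulation) (δ : ℝ) (w : Pt → Vec) :
    Pt → Vec :=
  piecewise T fun K => interpD n K (smoothD n l (δ * T.meshSize) K (extD n Ω ψ w))

/-- The operator `R_h^o`. -/
def RhO (l : ℕ) (Ω : Set Pt) (ψ : Pt → Pt) (T : Triangulation) (δ : ℝ) (f : Pt → ℝ) :
    Pt → ℝ :=
  piecewise T fun K _ => interpO K (smoothO l (δ * T.meshSize) K (extO Ω ψ f))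

end AxiFEM

end

/-!
Read a scalar `u` as the 0-form `nu/r`, a field `v` as the pair of a 0-form `v_θ` and the 1-form
`((n v_r + v_θ)/r, n v_z/r)`, and a field `w` as a 1-form and the 2-form `(n w_θ - w_r)/r`. Then
`A_h`, `B_h`, `C_h`, `D_h` are spaces of Whitney forms, so an element is the same thing as its
degrees of freedom: vertex values, edge integrals, triangle averages. The maps `P^g`, `P^c`, `P^d`,
`P^o` are pullbacks of forms. Hence each `R_h` is described on degrees of freedom by three
operators (`map0`, `map1`, `map2`), which integrate over the vertices, edges and triangles of a
randomly displaced triangle the form pulled back by the folding map `x ↦ x` on `Ω`, `x ↦ ψ x`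
outside, and average with the signed density `∏ κ_{a_i}`. None of this depends on `n`.

*Degrees of freedom.* An element of a discrete space is a priori only piecewise of the given form.
Having its `grad^n`, `curl^n` or `div^n` in `L^2_r` forces the (tangential) traces from the two sides
of an edge to agree (`WeakCurl.tangential_eq`), so it comes from a global cochain. Conversely the
cochain `c` gives the form `∑ c(a, b) F_a dF_b`, with Lipschitz hat functions `F_a` composed with the
fold, and such a form has a weak curl (`weakCurl_of_lipschitz`).

*Commutation.* The pulled back forms have discontinuous coefficients, but they are made of Lipschitz
functions, so Stokes' formula holds along almost every displaced edge and on almost every displaced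
triangle; averaging gives `map1_diff0` and `map2_curlOn`. So the `R_h` commute with the differential
operators, and so do their inverses (`commute_symm`).

*Closeness to the identity.* The density `κ_a` has integral one, and its total variation is bounded
by a constant that depends on `l` only: by the Cauchy-Schwarz inequality and scaling this reduces to
bounding `p(a) ^ 2` by the mean square of the polynomial `p` on one disk near `a`, and the weight
`r ^ 3` is under control there because `r` is at least `δ h` on disks off the axis
(`exists_integral_abs_kappa_le`). The degrees of freedom change by `O(δ)` when the vertices move by
`δ h`: for vertex values this is the Lipschitz bound (`abs_map0_sub_le`), for edge integrals one
integrates by parts along the edge (`abs_map1_sub_le`), and for triangle averages the points where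
the value jumps fill an `O(δ)` part of the triangle (`abs_map2_sub_le`). Since `σ`, `τ` bound the
number of neighbours of a triangle, and since on each triangle the weighted norm is comparable with
the degrees of freedom (`cellWeight_mul_sum_sq_le`), summing up gives `‖R_h u - u‖ ≤ ‖u‖ / 2` for
small `δ`, uniformly in the mesh and in `n` (`exists_contracts`).

*Conclusion.* A linear map of a finite-dimensional space that moves each vector by at most half of
its norm is bijective, and its inverse has norm at most `2` (`exists_linearEquiv_of_near_id`).
-/

noncomputable section

namespace AxiFEM

/-- Triples of points. -/
abbrev Tri : Type := Fin 3 → Pt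

open Finset (sum_congr sum_le_sum mul_sum sum_nonneg sum_add_distrib sum_mul sum_sub_distrib
  abs_sum_le_sum_abs sum_eq_single sum_const sum_comm card_univ sum_eq_zero smul_sum)
open intervalIntegral (integral_of_le integral_eq_sub_of_hasDerivAt)
open Metric hiding eventually_nhds_iff
open EuclideanSpace (single proj)
open Fin (sum_univ_two sum_univ_three)
open Real (norm_eq_abs)
open Triangulation
open PiLp (add_apply sub_apply smul_apply)

variable {Ω : Set Pt} {ψ : Pt → Pt} {T : Triangulation} {L A ε ρ δ M : ℝ} {F c c' : Pt → Pt → ℝ}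
  {K K' : Tri} {x y : Pt} {f g q θ φ u P Q G : Pt → ℝ} {p : Pt → Prop} {s s' : Tri → ℝ} {C : ℝ≥0}
  {w : Fin 3 → ℝ} {i j : Fin 3} {l m n : ℕ}

/-! ### Barycentric coordinates -/

/-- Twice the signed area of the triangle `K`. -/
def sarea (K : Tri) : ℝ := cross (K 1 - K 0) (K 2 - K 0)

lemma cross_eq_sarea (K : Tri) (i : Fin 3) :
    cross (K (i + 2) - K (i + 1)) (K i - K (i + 1)) = sarea K := by
  fin_cases i <;> simp [cross, sarea] <;> ring

lemma bary_eq (K : Tri) (i : Fin 3) (x : Pt) :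
    bary K i x = cross (K (i + 2) - K (i + 1)) (x - K (i + 1)) / sarea K := by
  rw [bary, cross_eq_sarea]

lemma gradBary_zero (K : Tri) (i : Fin 3) :
    gradBary K i 0 = -(K (i + 2) - K (i + 1)) 1 / sarea K := by
  rw [gradBary, cross_eq_sarea]; rfl

lemma gradBary_one (K : Tri) (i : Fin 3) :
    gradBary K i 1 = (K (i + 2) - K (i + 1)) 0 / sarea K := by
  rw [gradBary, cross_eq_sarea]; rfl

lemma pt_ext (h0 : x 0 = y 0) (h1 : x 1 = y 1) : x = y := by
  ext i; fin_cases i <;> assumption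

lemma bary_sub (K : Tri) (i : Fin 3) (x y : Pt) :
    bary K i x - bary K i y = gradBary K i 0 * (x 0 - y 0) + gradBary K i 1 * (x 1 - y 1) := by
  rw [bary_eq, bary_eq, gradBary_zero, gradBary_one]
  simp only [cross, sub_apply]
  ring

lemma sarea_ne_zero (hK : AffineIndependent ℝ K) : sarea K ≠ 0 := by
  intro h0
  have hinj := hK.injective
  rw [affineIndependent_iff] at hK
  have key : ∀ x, cross (K 2 - K 1) (x - K 1) = 0 := by
    intro x
    have := hK Finset.univ (fun i => cross (K (i + 2) - K (i + 1)) (x - K (i + 1))) ?_ ?_ 0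
      (Finset.mem_univ _)
    · simpa using this
    · simp only [sarea, cross] at h0
      simp [sum_univ_three, cross] at h0 ⊢
      linear_combination h0
    · simp only [sarea, cross] at h0
      apply pt_ext
      · simp [sum_univ_three, cross] at h0 ⊢
        linear_combination x 0 * h0
      · simp [sum_univ_three, cross] at h0 ⊢
        linear_combination x 1 * h0
  have e0 := key (K 1 + single 0 1)
  have e1 := key (K 1 + single 1 1)
  simp [cross] at e0 e1
  have : K 2 = K 1 := pt_ext (by linarith) (by linarith)
  grind

lemma bary_sum (h : sarea K ≠ 0) (x : Pt) : ∑ i, bary K i x = 1 := by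
  simp only [sum_univ_three, bary_eq]
  field_simp
  simp [cross, sarea]
  ring

lemma bary_combo (h : sarea K ≠ 0) (x : Pt) : ∑ i, bary K i x • K i = x := by
  apply pt_ext <;> simp only [sum_univ_three, bary_eq, add_apply, smul_apply,
    smul_eq_mul] <;> field_simp <;> simp [cross, sarea] <;> ring

lemma bary_combo_apply (h : sarea K ≠ 0) (x : Pt) (m : Fin 2) :
    ∑ i, bary K i x * K i m = x m := by
  conv_rhs => rw [← bary_combo h x]
  simp

lemma bary_vertex (h : sarea K ≠ 0) (i j : Fin 3) :
    bary K i (K j) = if i = j then 1 else 0 := by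
  rw [bary_eq]
  obtain rfl | rfl | rfl : i = j ∨ j = i + 1 ∨ j = i + 2 := by revert i j; decide
  · rw [cross_eq_sarea, div_self h, if_pos rfl]
  · rw [if_neg (by revert i; decide)]
    simp [cross]
  · rw [if_neg (by revert i; decide)]
    simp [cross, mul_comm]

lemma bary_of_combo (h : sarea K ≠ 0) (hw : ∑ i, w i = 1) (i : Fin 3) :
    bary K i (∑ j, w j • K j) = w i := by
  have e : ∀ j, bary K i (K j) - bary K i (K 0) =
      gradBary K i 0 * (K j 0 - K 0 0) + gradBary K i 1 * (K j 1 - K 0 1) :=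
    fun j => bary_sub K i _ _
  have e1 := bary_sub K i (∑ j, w j • K j) (K 0)
  have : bary K i (∑ j, w j • K j) = ∑ j, w j * bary K i (K j) := by
    rw [sum_univ_three] at hw ⊢
    simp only [sum_univ_three, add_apply, smul_apply, smul_eq_mul] at e1 ⊢
    have h1 := e 1
    have h2 := e 2
    have hw0 : w 0 = 1 - w 1 - w 2 := by linarith
    rw [hw0] at e1 ⊢
    linear_combination e1 - w 1 * h1 - w 2 * h2
  rw [this]
  simp [bary_vertex h]

lemma mem_tri_iff (h : sarea K ≠ 0) (x : Pt) : x ∈ tri K ↔ ∀ i, 0 ≤ bary K i x := by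
  constructor
  · intro hx i
    rw [tri, convexHull_range_eq_exists_affineCombination] at hx
    obtain ⟨s, w, h0, h1, rfl⟩ := hx
    rw [Finset.affineCombination_eq_linear_combination _ _ _ h1]
    have hw : ∑ j, (if j ∈ s then w j else 0) = 1 := by simp_all
    have : ∑ j ∈ s, w j • K j = ∑ j, (if j ∈ s then w j else 0) • K j := by
      simp
    rw [this, bary_of_combo h hw]
    grind
  · intro hx
    rw [← bary_combo h x]
    exact (convex_convexHull ℝ _).sum_mem (fun i _ => hx i) (bary_sum h x)
      (fun i _ => subset_convexHull ℝ _ (mem_range_self i))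

lemma continuous_bary (i : Fin 3) : Continuous (bary K i) := by
  unfold bary cross
  fun_prop

lemma bary_le_one (h : sarea K ≠ 0) (hx : x ∈ tri K) (i : Fin 3) : bary K i x ≤ 1 := by
  rw [← bary_sum h x]
  exact Finset.single_le_sum (fun j _ => (mem_tri_iff h x).1 hx j) (Finset.mem_univ i)

lemma gradBary_edge (h : sarea K ≠ 0) (i j k : Fin 3) :
    gradBary K i 0 * (K j 0 - K k 0) + gradBary K i 1 * (K j 1 - K k 1) =
      (if i = j then 1 else 0) - (if i = k then 1 else 0) := by
  rw [← bary_sub, bary_vertex h, bary_vertex h]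

lemma sum_gradBary (h : sarea K ≠ 0) (m : Fin 2) : ∑ i, gradBary K i m = 0 := by
  fin_cases m <;> simp [sum_univ_three, gradBary_zero, gradBary_one] <;> field_simp <;> ring

lemma gradBary_ne (h : sarea K ≠ 0) (i : Fin 3) :
    gradBary K i 0 ^ 2 + gradBary K i 1 ^ 2 ≠ 0 := by
  intro h0
  have h1 : gradBary K i 0 = 0 := by nlinarith
  have h2 : gradBary K i 1 = 0 := by grind
  have := gradBary_edge h i i (i + 1)
  grind

lemma interior_tri (h : sarea K ≠ 0) : interior (tri K) = {x | ∀ i, 0 < bary K i x} := by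
  apply subset_antisymm
  · intro x hx i
    by_contra hi
    have h0 := le_antisymm (not_lt.1 hi) ((mem_tri_iff h x).1 (interior_subset hx) i)
    -- moving against the gradient leaves the triangle
    have hc : Tendsto (fun t : ℝ => x - t • (!₂[gradBary K i 0, gradBary K i 1] : Pt))
        (𝓝[>] 0) (𝓝 x) := by
      have : Continuous fun t : ℝ => x - t • (!₂[gradBary K i 0, gradBary K i 1] : Pt) := by
        fun_prop
      have := this.tendsto 0
      simp only [zero_smul, sub_zero] at this
      exact this.mono_left nhdsWithin_le_nhds
    have hev := hc.eventually (mem_interior_iff_mem_nhds.1 hx)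
    obtain ⟨t, ht, ht0⟩ := (hev.and self_mem_nhdsWithin).exists
    have h1 := (mem_tri_iff h _).1 ht i
    have h2 := bary_sub K i (x - t • (!₂[gradBary K i 0, gradBary K i 1] : Pt)) x
    simp at h2
    have hp := lt_of_le_of_ne (by positivity) (gradBary_ne h i).symm
    nlinarith
  · apply interior_maximal
    · intro x hx
      exact (mem_tri_iff h x).2 fun i => (hx i).le
    · simp only [ofPred_forall]
      exact isOpen_iInter_of_finite fun i => isOpen_lt continuous_const (continuous_bary i)

lemma isCompact_tri (K : Tri) : IsCompact (tri K) :=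
  Set.Finite.isCompact_convexHull (𝕜 := ℝ) (finite_range K)

lemma convex_tri (K : Tri) : Convex ℝ (tri K) := convex_convexHull ℝ _

lemma vertex_mem_tri (K : Tri) (i : Fin 3) : K i ∈ tri K :=
  subset_convexHull ℝ _ (mem_range_self i)

/-- The centroid shows that a nondegenerate triangle has interior points. -/
lemma nonempty_interior_tri (h : sarea K ≠ 0) : (interior (tri K)).Nonempty := by
  refine ⟨∑ j, (fun _ => (1 / 3 : ℝ)) j • K j, ?_⟩
  rw [interior_tri h]
  intro i
  rw [bary_of_combo h (by simp)]
  norm_num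

lemma closure_interior_tri (h : sarea K ≠ 0) : closure (interior (tri K)) = tri K := by
  rw [(convex_tri K).closure_interior_eq_closure_of_nonempty_interior (nonempty_interior_tri h),
    (isCompact_tri K).isClosed.closure_eq]

lemma volume_frontier_tri (K : Tri) : volume (frontier (tri K)) = 0 :=
  (convex_tri K).addHaar_frontier _

lemma ae_mem_interior_of_mem_tri (K : Tri) :
    ∀ᵐ x : Pt, x ∈ tri K → x ∈ interior (tri K) := by
  have := measure_eq_zero_iff_ae_notMem.1 (volume_frontier_tri K)
  filter_upwards [this] with x hx hxK
  by_contra hi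
  exact hx ⟨subset_closure hxK, hi⟩

/-- On an edge, only the coordinates of its two end points are nonzero. -/
lemma bary_segment (h : sarea K ≠ 0) (i j k : Fin 3) (s : ℝ) :
    bary K i (K j + s • (K k - K j)) =
      (if i = j then 1 else 0) + s * ((if i = k then 1 else 0) - (if i = j then 1 else 0)) := by
  have := bary_sub K i (K j + s • (K k - K j)) (K j)
  have h2 := gradBary_edge h i k j
  rw [bary_vertex h] at this
  simp only [add_apply, smul_apply, sub_apply, smul_eq_mul, add_sub_cancel_left]
    at this
  linear_combination this + s * h2

/-! ### Green's formula on a triangle -/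

lemma fderiv_apply_eq_pd (f : Pt → ℝ) (x v : Pt) :
    fderiv ℝ f x v = v 0 * pd 0 f x + v 1 * pd 1 f x := by
  have : v = v 0 • single 0 1 + v 1 • single 1 1 := by
    apply pt_ext <;> simp
  conv_lhs => rw [this]
  simp [pd]

lemma integral_pt {E : Type*} [NormedAddCommGroup E] [NormedSpace ℝ E] (f : Pt → E) :
    ∫ x : Pt, f x = ∫ p : ℝ × ℝ, f !₂[p.1, p.2] := by
  have h1 := (volume_preserving_finTwoArrow ℝ).symm
  have h2 := (EuclideanSpace.volume_preserving_symm_measurableEquiv_toLp (Fin 2)).symm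
  rw [← h2.integral_comp', ← h1.integral_comp']
  rfl

/-- The reference triangle. -/
def refTri : Set Pt := {x | 0 ≤ x 0 ∧ 0 ≤ x 1 ∧ x 0 + x 1 ≤ 1}

lemma isClosed_refTri : IsClosed refTri := by
  unfold refTri
  refine IsClosed.and ?_ (IsClosed.and ?_ ?_)
  · exact isClosed_le (by fun_prop) (by fun_prop)
  · exact isClosed_le (by fun_prop) (by fun_prop)
  · exact isClosed_le (by fun_prop) (by fun_prop)

lemma isCompact_refTri : IsCompact refTri := by
  refine isCompact_of_isClosed_isBounded isClosed_refTri ?_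
  refine (isBounded_closedBall (x := (0 : Pt)) (r := 2)).subset fun x hx => ?_
  obtain ⟨h0, h1, h2⟩ := hx
  rw [mem_closedBall_zero_iff, EuclideanSpace.norm_eq, Real.sqrt_le_left (by norm_num)]
  simp only [sum_univ_two, norm_eq_abs, sq_abs]
  nlinarith

/-- The linear map with columns `u` and `w`. -/
def colMap (u w : Pt) : Pt →L[ℝ] Pt :=
  (proj (𝕜 := ℝ) (0 : Fin 2)).smulRight u +
    (proj (𝕜 := ℝ) (1 : Fin 2)).smulRight w

lemma colMap_apply (u w x : Pt) : colMap u w x = x 0 • u + x 1 • w := by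
  simp [colMap]

lemma det_colMap (u w : Pt) : (colMap u w).det = cross u w := by
  have := LinearMap.det_toMatrix (EuclideanSpace.basisFun (Fin 2) ℝ).toBasis
    ((colMap u w : Pt →L[ℝ] Pt) : Pt →ₗ[ℝ] Pt)
  rw [ContinuousLinearMap.det, ← this, Matrix.det_fin_two]
  simp [LinearMap.toMatrix_apply, colMap_apply, cross]
  ring

lemma tri_eq_image (h : sarea K ≠ 0) :
    tri K = (fun x => K 0 + colMap (K 1 - K 0) (K 2 - K 0) x) '' refTri := by
  have hb : ∀ x, K 0 + colMap (K 1 - K 0) (K 2 - K 0) x =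
      ∑ j, ![1 - x 0 - x 1, x 0, x 1] j • K j := by
    intro x
    rw [colMap_apply]
    apply pt_ext <;> simp [sum_univ_three] <;> ring
  have hs : ∀ x : Pt, ∑ j, ![1 - x 0 - x 1, x 0, x 1] j = 1 := by
    intro x; simp [sum_univ_three]; ring
  ext y
  constructor
  · intro hy
    have hy' := (mem_tri_iff h y).1 hy
    have hsum := bary_sum h y
    rw [sum_univ_three] at hsum
    refine ⟨!₂[bary K 1 y, bary K 2 y], ⟨by simpa using hy' 1, by simpa using hy' 2, ?_⟩, ?_⟩
    · have := hy' 0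
      simp
      linarith
    · simp only []
      rw [hb]
      conv_rhs => rw [← bary_combo h y]
      simp only [sum_univ_three]
      have : bary K 0 y = 1 - bary K 1 y - bary K 2 y := by linarith
      simp [this]
  · rintro ⟨x, ⟨h0, h1, h2⟩, rfl⟩
    simp only []
    rw [mem_tri_iff h, hb]
    intro i
    rw [bary_of_combo h (hs x)]
    fin_cases i <;> simp <;> linarith

lemma setIntegral_tri (h : sarea K ≠ 0) (g : Pt → ℝ) :
    ∫ x in tri K, g x = |sarea K| * ∫ x in refTri, g (K 0 + colMap (K 1 - K 0) (K 2 - K 0) x) := by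
  have hdet : (colMap (K 1 - K 0) (K 2 - K 0)).det = sarea K := det_colMap _ _
  rw [tri_eq_image h, integral_image_eq_integral_abs_det_fderiv_smul volume
    isClosed_refTri.measurableSet (f' := fun _ => colMap (K 1 - K 0) (K 2 - K 0))]
  · simp only [hdet, smul_eq_mul]
    rw [integral_const_mul]
  · fun_prop
  · have hinj : Function.Injective (colMap (K 1 - K 0) (K 2 - K 0)) := by
      have hd : LinearMap.det ((colMap (K 1 - K 0) (K 2 - K 0) : Pt →L[ℝ] Pt) : Pt →ₗ[ℝ] Pt) ≠ 0 := by
        simp_all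
      exact (LinearMap.equivOfDetNeZero _ hd).injective
    exact fun x _ y _ hxy => hinj (add_left_cancel hxy)

lemma mem_refTri (s t : ℝ) : (!₂[s, t] : Pt) ∈ refTri ↔ 0 ≤ s ∧ 0 ≤ t ∧ s + t ≤ 1 := by
  simp [refTri]

lemma integrable_refTri (hg : Continuous g) :
    Integrable (fun p : ℝ × ℝ => refTri.indicator g !₂[p.1, p.2]) := by
  have h0 : Integrable (refTri.indicator g) :=
    (integrable_indicator_iff isClosed_refTri.measurableSet).2
      (hg.continuousOn.integrableOn_compact isCompact_refTri)
  have h1 := (volume_preserving_finTwoArrow ℝ).symm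
  have h2 := (EuclideanSpace.volume_preserving_symm_measurableEquiv_toLp (Fin 2)).symm
  exact (h1.integrable_comp_emb (MeasurableEquiv.measurableEmbedding _)).2
    ((h2.integrable_comp_emb (MeasurableEquiv.measurableEmbedding _)).2 h0)

lemma setIntegral_refTri (hg : Continuous g) :
    ∫ x in refTri, g x = ∫ t in (0 : ℝ)..1, ∫ s in (0 : ℝ)..(1 - t), g !₂[s, t] := by
  rw [← integral_indicator isClosed_refTri.measurableSet, integral_pt,
    Measure.volume_eq_prod, integral_prod_symm _ (integrable_refTri hg),
    integral_of_le zero_le_one, ← integral_Icc_eq_integral_Ioc,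
    ← integral_indicator measurableSet_Icc]
  refine integral_congr_ae (.of_forall fun t => ?_)
  by_cases ht : t ∈ Icc 0 1
  · rw [indicator_of_mem ht, integral_of_le (by linarith [ht.2]),
      ← integral_Icc_eq_integral_Ioc, ← integral_indicator measurableSet_Icc]
    refine integral_congr_ae (.of_forall fun s => ?_)
    simp only []
    by_cases hs : s ∈ Icc 0 (1 - t)
    · rw [indicator_of_mem hs, indicator_of_mem]
      exact (mem_refTri _ _).2 ⟨hs.1, ht.1, by linarith [hs.2]⟩
    · rw [indicator_of_notMem hs, indicator_of_notMem]
      rw [mem_refTri]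
      grind
  · rw [indicator_of_notMem ht]
    refine integral_eq_zero_of_ae (.of_forall fun s => ?_)
    simp only []
    rw [indicator_of_notMem]
    · rfl
    · rw [mem_refTri]
      grind

lemma setIntegral_refTri' (hg : Continuous g) :
    ∫ x in refTri, g x = ∫ s in (0 : ℝ)..1, ∫ t in (0 : ℝ)..(1 - s), g !₂[s, t] := by
  rw [← integral_indicator isClosed_refTri.measurableSet, integral_pt,
    Measure.volume_eq_prod, integral_prod _ (integrable_refTri hg),
    integral_of_le zero_le_one, ← integral_Icc_eq_integral_Ioc,
    ← integral_indicator measurableSet_Icc]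
  refine integral_congr_ae (.of_forall fun t => ?_)
  by_cases ht : t ∈ Icc 0 1
  · rw [indicator_of_mem ht, integral_of_le (by linarith [ht.2]),
      ← integral_Icc_eq_integral_Ioc, ← integral_indicator measurableSet_Icc]
    refine integral_congr_ae (.of_forall fun s => ?_)
    simp only []
    by_cases hs : s ∈ Icc 0 (1 - t)
    · rw [indicator_of_mem hs, indicator_of_mem]
      exact (mem_refTri _ _).2 ⟨ht.1, hs.1, by linarith [hs.2]⟩
    · rw [indicator_of_notMem hs, indicator_of_notMem]
      rw [mem_refTri]
      grind
  · rw [indicator_of_notMem ht]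
    refine integral_eq_zero_of_ae (.of_forall fun s => ?_)
    simp only []
    rw [indicator_of_notMem]
    · rfl
    · rw [mem_refTri]
      grind

lemma integral_refTri_pd_zero (hq : ContDiff ℝ 1 q) :
    ∫ x in refTri, pd 0 q x = ∫ t in (0 : ℝ)..1, (q !₂[1 - t, t] - q !₂[0, t]) := by
  have hc : Continuous (pd 0 q) := (hq.continuous_fderiv (by simp)).clm_apply continuous_const
  rw [setIntegral_refTri hc]
  congr 1; ext t
  refine integral_eq_sub_of_hasDerivAt (f := fun s => q !₂[s, t]) (fun s _ => ?_)
    ((hc.comp (by fun_prop : Continuous fun s => (!₂[s, t] : Pt))).intervalIntegrable _ _)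
  have h1 : HasDerivAt (fun s => (!₂[s, t] : Pt)) (single 0 1) s := by
    have : (fun s => (!₂[s, t] : Pt)) =
        fun s => s • single 0 1 + !₂[0, t] := by
      ext s i; fin_cases i <;> simp
    rw [this]
    simpa using ((hasDerivAt_id s).smul_const (single 0 1)).add_const
      (!₂[0, t] : Pt)
  exact ((hq.differentiable (by simp) _).hasFDerivAt).comp_hasDerivAt s h1

lemma integral_refTri_pd_one (hq : ContDiff ℝ 1 q) :
    ∫ x in refTri, pd 1 q x = ∫ s in (0 : ℝ)..1, (q !₂[s, 1 - s] - q !₂[s, 0]) := by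
  have hc : Continuous (pd 1 q) := (hq.continuous_fderiv (by simp)).clm_apply continuous_const
  rw [setIntegral_refTri' hc]
  congr 1; ext s
  refine integral_eq_sub_of_hasDerivAt (f := fun t => q !₂[s, t]) (fun t _ => ?_)
    ((hc.comp (by fun_prop : Continuous fun t => (!₂[s, t] : Pt))).intervalIntegrable _ _)
  have h1 : HasDerivAt (fun t => (!₂[s, t] : Pt)) (single 1 1) t := by
    have : (fun t => (!₂[s, t] : Pt)) =
        fun t => t • single 1 1 + !₂[s, 0] := by
      ext s i; fin_cases i <;> simp
    rw [this]
    simpa using ((hasDerivAt_id t).smul_const (single 1 1)).add_const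
      (!₂[s, 0] : Pt)
  exact ((hq.differentiable (by simp) _).hasFDerivAt).comp_hasDerivAt t h1

lemma fderiv_comp_colMap (hP : ContDiff ℝ 1 P) (a u w x v : Pt) : fderiv ℝ
    (fun x => P (a + colMap u w x)) x v = fderiv ℝ P (a + colMap u w x) (colMap u w v) := by
  have h1 : HasFDerivAt (fun x => a + colMap u w x) (colMap u w) x :=
    (colMap u w).hasFDerivAt.const_add a
  have h2 := ((hP.differentiable (by simp) (a + colMap u w x)).hasFDerivAt).comp x h1
  have h3 : fderiv ℝ (fun x => P (a + colMap u w x)) x = _ := h2.fderiv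
  rw [h3]
  rfl

lemma pd_pullback (hP : ContDiff ℝ 1 P) (hQ : ContDiff ℝ 1 Q) (a u w x d : Pt) (i : Fin 2) : pd i
    (fun x => P (a + colMap u w x) * d 0 + Q (a + colMap u w x) * d 1) x = fderiv ℝ P
    (a + colMap u w x) (colMap u w (single i 1)) * d 0 + fderiv ℝ Q
    (a + colMap u w x) (colMap u w (single i 1)) * d 1 := by
  have hA : ContDiff ℝ 1 (fun x => a + colMap u w x) := contDiff_const.add (colMap u w).contDiff
  have h1 : DifferentiableAt ℝ (fun x => P (a + colMap u w x)) x :=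
    (hP.comp hA).differentiable (by simp) x
  have h2 : DifferentiableAt ℝ (fun x => Q (a + colMap u w x)) x :=
    (hQ.comp hA).differentiable (by simp) x
  rw [pd, fderiv_fun_add (h1.mul_const _) (h2.mul_const _), fderiv_mul_const h1,
    fderiv_mul_const h2]
  simp only [_root_.add_apply, _root_.smul_apply, smul_eq_mul]
  rw [fderiv_comp_colMap hP, fderiv_comp_colMap hQ]
  ring

/-- Green's formula for the `1`-form `P dr + Q dz` on a triangle. -/
theorem green_tri (h : sarea K ≠ 0) (hP : ContDiff ℝ 1 P) (hQ : ContDiff ℝ 1 Q) : ∫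
    x in tri K, (pd 0 Q x - pd 1 P x) = SignType.sign (sarea K) * ∑ i, edgeTangent K i
    (fun x => ![P x, Q x]) := by
  have hD : sarea K = (K 1 - K 0) 0 * (K 2 - K 0) 1 - (K 1 - K 0) 1 * (K 2 - K 0) 0 := rfl
  have hA : ContDiff ℝ 1 (fun x => K 0 + colMap (K 1 - K 0) (K 2 - K 0) x) :=
    contDiff_const.add (colMap _ _).contDiff
  -- the components of the form pulled back to the reference triangle
  obtain ⟨f, hf⟩ : ∃ f : Pt → Pt → ℝ, f = fun d x =>
    P (K 0 + colMap (K 1 - K 0) (K 2 - K 0) x) * d 0 +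
      Q (K 0 + colMap (K 1 - K 0) (K 2 - K 0) x) * d 1 := ⟨_, rfl⟩
  have hfc : ∀ d, ContDiff ℝ 1 (f d) := fun d => by
    rw [hf]
    fun_prop
  have hfcc : ∀ d, Continuous (f d) := fun d => (hfc d).continuous
  have hi : ∀ (d : Pt) {c : ℝ → Pt}, Continuous c →
      IntervalIntegrable (fun t => f d (c t)) volume 0 1 := fun d c hc =>
    ((hfcc d).comp hc).intervalIntegrable _ _
  have hint : ∀ (d : Pt) (i : Fin 2), IntegrableOn (pd i (f d)) refTri := fun d i =>
    (((hfc d).continuous_fderiv (by simp)).clm_apply continuous_const).continuousOn.integrableOn_compact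
      isCompact_refTri
  have hpull : sarea K * ∫ x in refTri, (pd 0 Q (K 0 + colMap (K 1 - K 0) (K 2 - K 0) x) -
      pd 1 P (K 0 + colMap (K 1 - K 0) (K 2 - K 0) x)) =
      (∫ x in refTri, pd 0 (f (K 2 - K 0)) x) - ∫ x in refTri, pd 1 (f (K 1 - K 0)) x := by
    rw [← integral_sub (hint _ _) (hint _ _), ← integral_const_mul]
    congr 1; ext x
    rw [hf]
    rw [pd_pullback hP hQ, pd_pullback hP hQ, fderiv_apply_eq_pd, fderiv_apply_eq_pd,
      fderiv_apply_eq_pd, fderiv_apply_eq_pd, hD]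
    simp only [colMap_apply]
    simp
    ring
  have E0 : edgeTangent K 0 (fun x => ![P x, Q x]) =
      (∫ t in 0..1, f (K 2 - K 0) !₂[1 - t, t]) -
        ∫ t in 0..1, f (K 1 - K 0) !₂[t, 1 - t] := by
    have : ∫ t in 0..1, f (K 1 - K 0) !₂[t, 1 - t] =
        ∫ t in 0..1, f (K 1 - K 0) !₂[1 - t, t] := by
      have := intervalIntegral.integral_comp_sub_left
        (fun t => f (K 1 - K 0) !₂[1 - t, t]) 1 (a := 0) (b := 1)
      simpa using this
    rw [this, ← intervalIntegral.integral_sub (hi _ (by fun_prop)) (hi _ (by fun_prop)), edgeTangent]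
    congr 1; ext t
    have : K (0 + 1) + t • (K (0 + 2) - K (0 + 1)) =
        K 0 + colMap (K 1 - K 0) (K 2 - K 0) !₂[1 - t, t] := by
      rw [colMap_apply]; apply pt_ext <;> simp <;> ring
    rw [this, hf]
    simp; ring
  have E1 : edgeTangent K 1 (fun x => ![P x, Q x]) =
      -∫ t in 0..1, f (K 2 - K 0) !₂[0, t] := by
    have : ∫ t in 0..1, f (K 2 - K 0) !₂[0, t] =
        ∫ t in 0..1, f (K 2 - K 0) !₂[0, 1 - t] := by
      have := intervalIntegral.integral_comp_sub_left
        (fun t => f (K 2 - K 0) !₂[0, t]) 1 (a := 0) (b := 1)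
      simpa using this.symm
    rw [this, ← intervalIntegral.integral_neg, edgeTangent]
    congr 1; ext t
    have : K (1 + 1) + t • (K (1 + 2) - K (1 + 1)) =
        K 0 + colMap (K 1 - K 0) (K 2 - K 0) !₂[0, 1 - t] := by
      rw [colMap_apply]; apply pt_ext <;> simp <;> ring
    rw [this, hf]
    simp; ring
  have E2 : edgeTangent K 2 (fun x => ![P x, Q x]) =
      ∫ t in 0..1, f (K 1 - K 0) !₂[t, 0] := by
    rw [edgeTangent]
    congr 1; ext t
    have : K (2 + 1) + t • (K (2 + 2) - K (2 + 1)) =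
        K 0 + colMap (K 1 - K 0) (K 2 - K 0) !₂[t, 0] := by
      rw [colMap_apply]; apply pt_ext <;> simp
    simp_all
  rw [setIntegral_tri h, ← sign_mul_self (sarea K), mul_assoc, hpull, sum_univ_three,
    E0, E1, E2, integral_refTri_pd_zero (hfc _), integral_refTri_pd_one (hfc _),
    intervalIntegral.integral_sub (hi _ (by fun_prop)) (hi _ (by fun_prop)),
    intervalIntegral.integral_sub (hi _ (by fun_prop)) (hi _ (by fun_prop))]
  ring

/-! ### Stokes' formula for Lipschitz functions -/

lemma acOfLip {f : ℝ → ℝ} (hf : LipschitzWith C f) (a b : ℝ) :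
    AbsolutelyContinuousOnInterval f a b :=
  hf.lipschitzOnWith.absolutelyContinuousOnInterval

/-- One-dimensional perturbation of `∫ f dg`. -/
lemma abs_integral_mul_deriv_sub_le {f g f₀ g₀ : ℝ → ℝ} (hf : LipschitzWith C f)
    (hg : LipschitzWith C g) (hf₀ : LipschitzWith C f₀) (hg₀ : LipschitzWith C g₀) {η m B : ℝ}
    (hη : 0 ≤ η) (hB : 0 ≤ B) (hff : ∀ s ∈ Icc (0 : ℝ) 1, |f s - f₀ s| ≤ η)
    (hgg : ∀ s ∈ Icc (0 : ℝ) 1, |g s - g₀ s| ≤ η) (hf1 : ∀ s ∈ Icc (0 : ℝ) 1, |f₀ s| ≤ m)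
    (hgB : ∀ s ∈ Icc (0 : ℝ) 1, ∀ t ∈ Icc (0 : ℝ) 1, |g s - g t| ≤ B * |s - t|)
    (hfB : ∀ s ∈ Icc (0 : ℝ) 1, ∀ t ∈ Icc (0 : ℝ) 1, |f₀ s - f₀ t| ≤ B * |s - t|) :
    |(∫ s in (0 : ℝ)..1, f s * deriv g s) - ∫ s in (0 : ℝ)..1, f₀ s * deriv g₀ s| ≤
      2 * (m * η) + 2 * (η * B) := by
  have hder : ∀ k : ℝ → ℝ, (∀ s ∈ Icc 0 1, ∀ t ∈ Icc 0 1, |k s - k t| ≤ B * |s - t|) →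
      ∀ᵐ s : ℝ, s ∈ uIoc 0 1 → |deriv k s| ≤ B := by
    intro k hk
    have h1 : ∀ᵐ s : ℝ, s ≠ 1 := by simp [ae_iff]
    filter_upwards [h1] with s hs1 hs
    rw [uIoc_of_le zero_le_one] at hs
    exact norm_deriv_le_of_lip' (f := k) hB (by
      filter_upwards [Icc_mem_nhds hs.1 (lt_of_le_of_ne hs.2 hs1)] with t ht
        using by
          simp only [Real.norm_eq_abs]; grind)
  have hIg := (acOfLip hg 0 1).intervalIntegrable_deriv
  have hIg₀ := (acOfLip hg₀ 0 1).intervalIntegrable_deriv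
  have h1 := hIg.continuousOn_mul hf.continuous.continuousOn
  have h2 := hIg.continuousOn_mul hf₀.continuous.continuousOn
  have h3 := hIg₀.continuousOn_mul hf₀.continuous.continuousOn
  have hIf₀ := (acOfLip hf₀ 0 1).intervalIntegrable_deriv
  have p1 := (acOfLip hf₀ 0 1).integral_mul_deriv_eq_deriv_mul (acOfLip hg 0 1)
  have p2 := (acOfLip hf₀ 0 1).integral_mul_deriv_eq_deriv_mul (acOfLip hg₀ 0 1)
  have e : (∫ s in 0..1, f s * deriv g s) - ∫ s in 0..1, f₀ s * deriv g₀ s =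
      (∫ s in 0..1, (f s - f₀ s) * deriv g s) +
      (f₀ 1 * (g 1 - g₀ 1) - f₀ 0 * (g 0 - g₀ 0) -
        ∫ s in 0..1, deriv f₀ s * (g s - g₀ s)) := by
    have q1 : (∫ s in 0..1, (f s - f₀ s) * deriv g s) =
        (∫ s in 0..1, f s * deriv g s) - ∫ s in 0..1, f₀ s * deriv g s := by
      rw [← intervalIntegral.integral_sub h1 h2]
      grind
    have q2 : (∫ s in 0..1, deriv f₀ s * (g s - g₀ s)) =
        (∫ s in 0..1, deriv f₀ s * g s) - ∫ s in 0..1, deriv f₀ s * g₀ s := by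
      rw [← intervalIntegral.integral_sub (hIf₀.mul_continuousOn hg.continuous.continuousOn)
        (hIf₀.mul_continuousOn hg₀.continuous.continuousOn)]
      exact intervalIntegral.integral_congr fun s _ => by ring
    linarith
  have b1 : |∫ s in 0..1, (f s - f₀ s) * deriv g s| ≤ η * B := by
    have := intervalIntegral.norm_integral_le_of_norm_le_const_ae (a := 0) (b := 1)
      (f := fun s => (f s - f₀ s) * deriv g s) (C := η * B) ?_
    · simpa using this
    · filter_upwards [hder g hgB] with s hs hsI
      rw [norm_mul]
      rw [uIoc_of_le zero_le_one] at *
      exact mul_le_mul (hff s ⟨hsI.1.le, hsI.2⟩) (hs hsI) (abs_nonneg _) hη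
  have b2 : |∫ s in 0..1, deriv f₀ s * (g s - g₀ s)| ≤ η * B := by
    have := intervalIntegral.norm_integral_le_of_norm_le_const_ae (a := 0) (b := 1)
      (f := fun s => deriv f₀ s * (g s - g₀ s)) (C := η * B) ?_
    · simpa using this
    · filter_upwards [hder f₀ hfB] with s hs hsI
      rw [norm_mul, mul_comm]
      rw [uIoc_of_le zero_le_one] at *
      exact mul_le_mul (hgg s ⟨hsI.1.le, hsI.2⟩) (hs hsI) (abs_nonneg _) hη
  have b3 : ∀ s ∈ Icc 0 1, |f₀ s * (g s - g₀ s)| ≤ m * η := fun s hs => by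
    rw [abs_mul]
    exact mul_le_mul (hf1 s hs) (hgg s hs) (abs_nonneg _) ((abs_nonneg _).trans (hf1 s hs))
  have b4 := b3 0 (by norm_num)
  have b5 := b3 1 (by norm_num)
  clear b3
  rw [e]
  rw [abs_le] at *
  grind

lemma abs_pd_le_of_lip {F : Pt → ℝ} (hF : LipschitzWith C F) (i : Fin 2) (x : Pt) :
    |pd i F x| ≤ C := by
  have h1 : ‖fderiv ℝ F x‖ ≤ C := norm_fderiv_le_of_lipschitz ℝ hF
  refine ((fderiv ℝ F x).le_opNorm _).trans ?_
  simpa using h1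

lemma measurable_pd (F : Pt → ℝ) (i : Fin 2) : Measurable (pd i F) :=
  measurable_fderiv_apply_const ℝ F _

/-- Mollification: a Lipschitz function is the uniform limit of smooth functions with the same
Lipschitz constant, whose derivatives converge almost everywhere. -/
theorem exists_smooth_approx {F : Pt → ℝ} (hF : LipschitzWith C F) : ∃ Fk : ℕ → Pt → ℝ,
    (∀ k, ContDiff ℝ ∞ (Fk k)) ∧ (∀ k, LipschitzWith C (Fk k)) ∧
    (∀ k x, |Fk k x - F x| ≤ C * (2 / (k + 1))) ∧ ∀ᵐ x : Pt, ∀ i, Tendsto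
    (fun k => pd i (Fk k) x) atTop (𝓝 (pd i F x)) := by
  let φ : ℕ → ContDiffBump (0 : Pt) := fun k =>
    { rIn := 1 / ((k : ℝ) + 1)
      rOut := 2 / ((k : ℝ) + 1)
      rIn_pos := by positivity
      rIn_lt_rOut := by gcongr; norm_num }
  have hφ : Tendsto (fun k => (φ k).rOut) atTop (𝓝 0) := by
    have := (tendsto_one_div_add_atTop_nhds_zero_nat (𝕜 := ℝ)).const_mul 2
    grind
  have hφ' : ∀ᶠ k in atTop, (φ k).rOut ≤ 2 * (φ k).rIn :=
    .of_forall fun k => le_of_eq (by grind)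
  let Fk : ℕ → Pt → ℝ := fun k => convolution ((φ k).normed volume) F (ContinuousLinearMap.lsmul ℝ ℝ) volume
  have hFk : ∀ k x, Fk k x = ∫ t, (φ k).normed volume t * F (x - t) := fun k x => rfl
  have hcont : ∀ k, Continuous ((φ k).normed (volume : Measure Pt)) := fun k =>
    (φ k).continuous_normed
  have hcs : ∀ k, HasCompactSupport ((φ k).normed (volume : Measure Pt)) := fun k =>
    (φ k).hasCompactSupport_normed
  have hint : ∀ k {g : Pt → ℝ}, Continuous g →
      Integrable (fun t => (φ k).normed volume t * g t) := fun k g hg =>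
    ((hcont k).mul hg).integrable_of_hasCompactSupport (hcs k).mul_right
  have hint0 : ∀ k, Integrable ((φ k).normed (volume : Measure Pt)) := fun k =>
    (hcont k).integrable_of_hasCompactSupport (hcs k)
  have hsm : ∀ k, ContDiff ℝ ∞ (Fk k) := fun k =>
    (hcs k).contDiff_convolution_left (ContinuousLinearMap.lsmul ℝ ℝ : ℝ →L[ℝ] ℝ →L[ℝ] ℝ)
      (φ k).contDiff_normed hF.continuous.locallyIntegrable
  have hlip : ∀ k, LipschitzWith C (Fk k) := by
    intro k
    refine LipschitzWith.of_dist_le_mul fun x y => ?_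
    rw [Real.dist_eq, hFk, hFk, ← integral_sub (hint k (by have := hF.continuous; fun_prop))
      (hint k (by have := hF.continuous; fun_prop))]
    rw [← norm_eq_abs]
    refine (norm_integral_le_of_norm_le (g := fun t => (φ k).normed volume t * (C * dist x y))
      ((hint0 k).mul_const _) (.of_forall fun t => ?_)).trans ?_
    · rw [← mul_sub, norm_mul, Real.norm_of_nonneg ((φ k).nonneg_normed t)]
      refine mul_le_mul_of_nonneg_left ?_ ((φ k).nonneg_normed t)
      have := hF.dist_le_mul (x - t) (y - t)
      aesop
    · rw [integral_mul_const, (φ k).integral_normed, one_mul]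
  have hpd : ∀ k x i, pd i (Fk k) x = convolution ((φ k).normed volume)
      (fun y => lineDeriv ℝ F y (single i 1)) (ContinuousLinearMap.lsmul ℝ ℝ) volume x := by
    intro k x i
    set v : Pt := single i 1
    have h1 := (((hsm k).differentiable (by simp) x).hasFDerivAt.hasLineDerivAt v).tendsto_slope_zero_right
    have h2 := hF.integral_inv_smul_sub_mul_tendsto_integral_lineDeriv_mul (μ := volume)
      (g := fun y => (φ k).normed volume (x - y)) ((hint0 k).comp_sub_left x) v
    refine (tendsto_nhds_unique h1 (h2.congr fun s => ?_)).trans ?_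
    · rw [← integral_sub_left_eq_self _ volume x, hFk, hFk, ← integral_sub
        (hint k (by have := hF.continuous; fun_prop)) (hint k (by have := hF.continuous; fun_prop)),
        ← integral_smul]
      congr 1; ext u
      rw [sub_sub_cancel, add_sub_right_comm, smul_eq_mul, smul_eq_mul]
      ring
    · rw [← integral_sub_left_eq_self _ volume x, convolution]
      congr 1; ext u
      rw [sub_sub_cancel, ContinuousLinearMap.lsmul_apply, smul_eq_mul, mul_comm]
  refine ⟨Fk, hsm, hlip, fun k x =>
    ContDiffBump.dist_normed_convolution_le hF.continuous.aestronglyMeasurable fun y hy =>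
      (hF.dist_le_mul y x).trans (mul_le_mul_of_nonneg_left (mem_ball.1 hy).le C.2), ?_⟩
  rw [ae_all_iff]
  intro i
  have hd := hF.ae_differentiableAt (μ := (volume : Measure Pt))
  have hl := ContDiffBump.ae_convolution_tendsto_right_of_locallyIntegrable (μ := volume) hφ hφ'
    (hF.locallyIntegrable_lineDeriv (μ := volume) (single i 1))
  filter_upwards [hd, hl] with x hx hx'
  simp only [hpd]
  rw [pd, ← hx.lineDeriv_eq_fderiv]
  exact hx'

lemma pd_comm (hG : ContDiff ℝ 2 G) (x : Pt) : pd 0 (pd 1 G) x = pd 1 (pd 0 G) x := by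
  have hd := (hG.fderiv_right (m := 1) (by norm_num)).differentiable (by simp) x
  have h1 : ∀ i j, pd i (pd j G) x =
      fderiv ℝ (fderiv ℝ G) x (single i 1) (single j 1) := by
    intro i j
    have : HasFDerivAt (pd j G) ((fderiv ℝ (fderiv ℝ G) x).flip (single j 1)) x :=
      (ContinuousLinearMap.apply ℝ ℝ (single j 1 : Pt)).hasFDerivAt.comp x
        hd.hasFDerivAt
    rw [pd, this.fderiv]
    rfl
  rw [h1, h1]
  exact (hG.contDiffAt.isSymmSndFDerivAt (by simp)) _ _

/-- The `i`-th edge of `K`, parametrized by `[0, 1]`. -/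
def edgeCurve (K : Tri) (i : Fin 3) (s : ℝ) : Pt := K (i + 1) + s • (K (i + 2) - K (i + 1))

lemma lipschitz_edgeCurve (K : Tri) (i : Fin 3) :
    LipschitzWith (nndist (K (i + 1)) (K (i + 2))) (edgeCurve K i) := by
  refine LipschitzWith.of_dist_le_mul fun s t => ?_
  rw [edgeCurve, edgeCurve, dist_add_left, dist_eq_norm, ← sub_smul, norm_smul, coe_nndist,
    dist_comm (K (i + 1)), dist_eq_norm, Real.dist_eq, norm_eq_abs, mul_comm]

lemma hasDerivAt_edgeCurve (K : Tri) (i : Fin 3) (s : ℝ) :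
    HasDerivAt (edgeCurve K i) (K (i + 2) - K (i + 1)) s := by
  unfold edgeCurve
  simpa using
    ((hasDerivAt_id s).smul_const (K (i + 2) - K (i + 1))).const_add (K (i + 1))

lemma pd_mul (hf : DifferentiableAt ℝ f x) (hg : DifferentiableAt ℝ g x) (i : Fin 2) :
    pd i (fun y => f y * g y) x = f x * pd i g x + pd i f x * g x := by
  rw [pd, fderiv_fun_mul hf hg]
  simp [pd]
  ring

/-- Stokes' formula for the `1`-form `F dG` on a triangle, for smooth functions. -/
lemma stokes_tri_smooth (h : sarea K ≠ 0) {F : Pt → ℝ} (hF : ContDiff ℝ ∞ F)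
    (hG : ContDiff ℝ ∞ G) : ∫ x in tri K, (pd 0 F x * pd 1 G x - pd 1 F x * pd 0 G x) =
    SignType.sign (sarea K) * ∑ i, ∫ s in (0 : ℝ)..1, F (edgeCurve K i s) * deriv
    (fun s => G (edgeCurve K i s)) s := by
  have hpd : ∀ i, ContDiff ℝ 1 (pd i G) := fun i =>
    ((contDiff_infty.1 hG 2).fderiv_right (by norm_num)).clm_apply contDiff_const
  have hF1 : ContDiff ℝ 1 F := hF.of_le (by simp)
  have hG2 := contDiff_infty.1 hG 2
  have := green_tri h (hF1.mul (hpd 0)) (hF1.mul (hpd 1))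
  convert! this using 3 with x
  · have hFx := hF1.differentiable (by simp) x
    have hx : ∀ i, DifferentiableAt ℝ (pd i G) x := fun i => (hpd i).differentiable (by simp) x
    rw [pd_mul hFx (hx 1), pd_mul hFx (hx 0), pd_comm hG2]
    ring
  · rename_i i _
    rw [edgeTangent]
    congr 1; ext s
    have hd := ((hG2.differentiable (by simp) (edgeCurve K i s)).hasFDerivAt).comp_hasDerivAt s
      (hasDerivAt_edgeCurve K i s)
    have e : deriv (fun s => G (edgeCurve K i s)) s = _ := hd.deriv
    rw [e, fderiv_apply_eq_pd]
    simp [edgeCurve]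
    ring

/-- Stokes' formula for the `1`-form `F dG` on a triangle, for Lipschitz functions. -/
theorem stokes_tri (h : sarea K ≠ 0) {F : Pt → ℝ} (hF : LipschitzWith C F)
    (hG : LipschitzWith C G) : ∫ x in tri K, (pd 0 F x * pd 1 G x - pd 1 F x * pd 0 G x) =
    SignType.sign (sarea K) * ∑ i, ∫ s in (0 : ℝ)..1, F (edgeCurve K i s) * deriv
    (fun s => G (edgeCurve K i s)) s := by
  obtain ⟨Fk, hFs, hFl, hFt, hFd⟩ := exists_smooth_approx hF
  obtain ⟨Gk, hGs, hGl, hGt, hGd⟩ := exists_smooth_approx hG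
  have hL : Tendsto (fun k => ∫ x in tri K, (pd 0 (Fk k) x * pd 1 (Gk k) x -
      pd 1 (Fk k) x * pd 0 (Gk k) x)) atTop
      (𝓝 (∫ x in tri K, (pd 0 F x * pd 1 G x - pd 1 F x * pd 0 G x))) := by
    refine tendsto_integral_of_dominated_convergence (fun _ => (C : ℝ) * C + C * C) (fun k => ?_)
      ?_ (fun k => ?_) ?_
    · exact (((measurable_pd _ 0).mul (measurable_pd _ 1)).sub
        ((measurable_pd _ 1).mul (measurable_pd _ 0))).aestronglyMeasurable
    · exact integrableOn_const (isCompact_tri K).measure_lt_top.ne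
    · refine .of_forall fun x => ?_
      rw [norm_eq_abs]
      refine (abs_sub _ _).trans ?_
      rw [abs_mul, abs_mul]
      gcongr <;> first | exact abs_pd_le_of_lip (hFl k) _ _ | exact abs_pd_le_of_lip (hGl k) _ _
    · refine ae_restrict_of_ae ?_
      filter_upwards [hFd, hGd] with x h1 h2
      exact ((h1 0).mul (h2 1)).sub ((h1 1).mul (h2 0))
  refine tendsto_nhds_unique hL ?_
  simp_rw [fun k => stokes_tri_smooth h (hFs k) (hGs k)]
  refine Tendsto.const_mul _ (tendsto_finsetSum _ fun i _ => ?_)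
  have hl := lipschitz_edgeCurve K i
  have lip : ∀ {u : Pt → ℝ}, LipschitzWith C u → ∀ s ∈ Icc 0 1, ∀ t ∈ Icc (0 : ℝ) 1,
      |u (edgeCurve K i s) - u (edgeCurve K i t)| ≤ _ * |s - t| := fun hu s _ t _ =>
    (hu.comp hl).dist_le_mul s t
  obtain ⟨m, hm⟩ := isCompact_Icc.exists_bound_of_continuousOn (hF.comp hl).continuous.continuousOn
  refine tendsto_iff_dist_tendsto_zero.2 (squeeze_zero (fun _ => dist_nonneg) (fun k =>
    abs_integral_mul_deriv_sub_le ((hFl k).comp hl) ((hGl k).comp hl) (hF.comp hl) (hG.comp hl)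
      (by positivity) NNReal.zero_le_coe (fun s _ => hFt k _) (fun s _ => hGt k _) hm (lip (hGl k))
      (lip hF)) ?_)
  have h0 : Tendsto (fun k : ℕ => C * (2 / ((k : ℝ) + 1))) atTop (𝓝 0) := by
    simpa [div_eq_mul_inv] using
      ((tendsto_one_div_add_atTop_nhds_zero_nat (𝕜 := ℝ)).const_mul 2).const_mul (C : ℝ)
  simpa using ((h0.const_mul m).const_mul 2).add ((h0.mul_const _).const_mul 2)

lemma bary_opposite_edge (h : sarea K ≠ 0) (i : Fin 3) (s : ℝ) :
    bary K i (K (i + 1) + s • (K (i + 2) - K (i + 1))) = 0 := by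
  have h1 : i ≠ i + 1 := by revert i; decide
  have h2 : i ≠ i + 2 := by revert i; decide
  rw [bary_segment h, if_neg h1, if_neg h2]
  simp

/-- The integral of `dF ∧ dG` over the plane vanishes if `F` has compact support. -/
theorem integral_wedge_eq_zero {F : Pt → ℝ} (hF : LipschitzWith C F) (hG : LipschitzWith C G)
    (hcs : HasCompactSupport F) : ∫ x, (pd 0 F x * pd 1 G x - pd 1 F x * pd 0 G x) = 0 := by
  obtain ⟨R, hR0, hR⟩ := hcs.isBounded.subset_ball_lt 0 0
  -- a triangle whose boundary is outside the disk of radius `R`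
  let K : Tri := ![!₂[-(4 * R), -R], !₂[4 * R, -R], !₂[0, 3 * R]]
  have hK : sarea K = 32 * R ^ 2 := by simp [sarea, cross, K]; ring
  have hK0 : sarea K ≠ 0 := by rw [hK]; positivity
  have hsub : tsupport F ⊆ interior (tri K) := by
    intro x hx
    have hx' := hR hx
    rw [mem_ball_zero_iff, EuclideanSpace.norm_eq, Real.sqrt_lt' hR0] at hx'
    simp only [sum_univ_two, norm_eq_abs, sq_abs] at hx'
    have a0 : |x 0| < R := abs_lt_of_sq_lt_sq (by nlinarith) hR0.le
    have a1 : |x 1| < R := abs_lt_of_sq_lt_sq (by nlinarith) hR0.le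
    rw [abs_lt] at a0 a1
    rw [interior_tri hK0]
    intro i
    rw [bary_eq, hK]
    refine div_pos ?_ (by positivity)
    fin_cases i <;> simp [cross, K] <;> nlinarith
  have hpd : ∀ i x, x ∉ tri K → pd i F x = 0 := by
    intro i x hx
    have : x ∉ tsupport F := fun h => hx (interior_subset (hsub h))
    have h0 : fderiv ℝ F x = 0 := by
      by_contra hne
      exact this (tsupport_fderiv_subset ℝ (subset_tsupport _ hne))
    rw [pd, h0]; rfl
  rw [← setIntegral_eq_integral_of_forall_compl_eq_zero, stokes_tri hK0 hF hG]
  · rw [sum_eq_zero, mul_zero]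
    intro i _
    have h0 : ∀ s, F (edgeCurve K i s) = 0 := fun s => by
      refine image_eq_zero_of_notMem_tsupport fun h => ?_
      have := hsub h
      rw [interior_tri hK0] at this
      exact (this i).ne' (bary_opposite_edge hK0 i s)
    simp [h0]
  · simp_all

/-! ### The weights of the smoothers -/

lemma continuous_polyVal (p : MvPolynomial (Fin 2) ℝ) : Continuous (polyVal p) := by
  unfold polyVal
  exact (MvPolynomial.continuous_eval p).comp (by fun_prop)

lemma polyVal_add (p q : MvPolynomial (Fin 2) ℝ) (x : Pt) :
    polyVal (p + q) x = polyVal p x + polyVal q x := by simp [polyVal]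

lemma polyVal_smul (c : ℝ) (p : MvPolynomial (Fin 2) ℝ) (x : Pt) :
    polyVal (c • p) x = c * polyVal p x := by simp [polyVal, MvPolynomial.smul_eval]

/-- A polynomial vanishing on a disk is zero. -/
lemma eq_zero_of_polyVal_eq_zero {p : MvPolynomial (Fin 2) ℝ} {c : Pt} (hε : 0 < ε)
    (h : ∀ x ∈ ball c ε, polyVal p x = 0) : p = 0 := by
  refine MvPolynomial.funext_set (fun i => Ioo (c i - ε / 2) (c i + ε / 2))
    (fun i => Ioo_infinite (by linarith)) fun x hx => ?_
  rw [map_zero]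
  refine h (WithLp.toLp 2 x) ?_
  rw [mem_ball, EuclideanSpace.dist_eq, Real.sqrt_lt' hε]
  simp only [sum_univ_two, Real.dist_eq, sq_abs]
  have h0 := hx 0 (mem_univ _)
  have h1 := hx 1 (mem_univ _)
  nlinarith [h0.1, h0.2, h1.1, h1.2]

/-- Evaluation at a point is represented by a polynomial in a weighted inner product. -/
lemma exists_representer (l : ℕ) {D : Set Pt} (hD : IsCompact D) {w : Pt → ℝ} (hw : Continuous w)
    (hw0 : ∀ x ∈ D, 0 ≤ w x) {c : Pt} (hε : 0 < ε) (hball : ball c ε ⊆ D)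
    (hpos : ∀ x ∈ ball c ε, 0 < w x) (a : Pt) : ∃ η : MvPolynomial (Fin 2) ℝ, η.totalDegree ≤
    l ∧ ∀ p : MvPolynomial (Fin 2) ℝ, p.totalDegree ≤ l → ∫ x in D, w x *
    (polyVal η x * polyVal p x) = polyVal p a := by
  let W := MvPolynomial.restrictTotalDegree (Fin 2) ℝ l
  have hint : ∀ p q : MvPolynomial (Fin 2) ℝ,
      IntegrableOn (fun x => w x * (polyVal p x * polyVal q x)) D := fun p q =>
    (hw.mul ((continuous_polyVal p).mul (continuous_polyVal q))).continuousOn.integrableOn_compact hD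
  let B : W →ₗ[ℝ] W →ₗ[ℝ] ℝ := LinearMap.mk₂ ℝ
    (fun p q => ∫ x in D, w x * (polyVal p.1 x * polyVal q.1 x))
    (fun p p' q => by
      rw [← integral_add (hint _ _) (hint _ _)]
      congr 1; ext x; simp only [Submodule.coe_add, polyVal_add]; ring)
    (fun t p q => by
      rw [smul_eq_mul, ← integral_const_mul]
      congr 1; ext x; simp only [Submodule.coe_smul, polyVal_smul]; ring)
    (fun p q q' => by
      rw [← integral_add (hint _ _) (hint _ _)]
      congr 1; ext x; simp only [Submodule.coe_add, polyVal_add]; ring)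
    (fun t p q => by
      rw [smul_eq_mul, ← integral_const_mul]
      congr 1; ext x; simp only [Submodule.coe_smul, polyVal_smul]; ring)
  have hinj : Function.Injective B := by
    rw [← LinearMap.ker_eq_bot, LinearMap.ker_eq_bot']
    intro p hp
    have h0 : ∫ x in D, w x * (polyVal p.1 x * polyVal p.1 x) = 0 := by
      have : B p p = 0 := by rw [hp]; rfl
      exact this
    refine Subtype.ext (eq_zero_of_polyVal_eq_zero hε (c := c) fun x hx => ?_)
    by_contra hne
    have hnn : ∀ x ∈ D, 0 ≤ w x * (polyVal p.1 x * polyVal p.1 x) := fun x hx =>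
      mul_nonneg (hw0 x hx) (mul_self_nonneg _)
    have hcont : Continuous fun x => w x * (polyVal p.1 x * polyVal p.1 x) :=
      hw.mul ((continuous_polyVal _).mul (continuous_polyVal _))
    have hp1 : 0 < ∫ x in D, w x * (polyVal p.1 x * polyVal p.1 x) := by
      rw [setIntegral_pos_iff_support_of_nonneg_ae]
      · refine lt_of_lt_of_le (IsOpen.measure_pos (U := Function.support
          (fun x => w x * (polyVal p.1 x * polyVal p.1 x)) ∩ ball c ε) volume
          (hcont.isOpen_support.inter isOpen_ball) ⟨x, ?_, hx⟩) ?_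
        · exact mul_ne_zero (hpos x hx).ne' (mul_self_ne_zero.2 hne)
        · exact measure_mono (inter_subset_inter_right _ hball)
      · exact (ae_restrict_iff' hD.measurableSet).2 (.of_forall hnn)
      · exact hint _ _
    exact hp1.ne' h0
  have hsurj : Function.Surjective B := by
    refine (LinearMap.injective_iff_surjective_of_finrank_eq_finrank ?_).1 hinj
    simp
  let ev : W →ₗ[ℝ] ℝ :=
    { toFun := fun p => polyVal p.1 a
      map_add' := fun p q => polyVal_add _ _ _
      map_smul' := fun t p => polyVal_smul _ _ _ }
  obtain ⟨η, hη⟩ := hsurj ev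
  refine ⟨η.1, (MvPolynomial.mem_restrictTotalDegree _ _ _).1 η.2, fun p hp => ?_⟩
  have := congrArg (fun f => f ⟨p, (MvPolynomial.mem_restrictTotalDegree _ _ _).2 hp⟩) hη
  exact this

/-- The Cauchy-Schwarz inequality for continuous functions. -/
lemma sq_integral_mul_le {D : Set Pt} (hD : IsCompact D) {w : Pt → ℝ} (hw : Continuous w)
    (hw0 : ∀ x ∈ D, 0 ≤ w x) (hf : Continuous f) (hg : Continuous g) : (∫ x in D, w x * (f x * g x))
    ^ 2 ≤ (∫ x in D, w x * (f x) ^ 2) * ∫ x in D, w x * (g x) ^ 2 := by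
  have hi : ∀ {u : Pt → ℝ}, Continuous u → IntegrableOn u D := fun hu =>
    hu.continuousOn.integrableOn_compact hD
  have key : ∀ t, 0 ≤ (∫ x in D, w x * (g x) ^ 2) * (t * t) +
      (2 * ∫ x in D, w x * (f x * g x)) * t + ∫ x in D, w x * (f x) ^ 2 := by
    intro t
    have : (∫ x in D, w x * (g x) ^ 2) * (t * t) + (2 * ∫ x in D, w x * (f x * g x)) * t +
        ∫ x in D, w x * (f x) ^ 2 = ∫ x in D, w x * (f x + t * g x) ^ 2 := by
      rw [← integral_const_mul, ← integral_mul_const, ← integral_mul_const,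
        ← integral_add (hi (by fun_prop)) (hi (by fun_prop)),
        ← integral_add (hi (by fun_prop)) (hi (by fun_prop))]
      congr 1; ext x; ring
    rw [this]
    exact setIntegral_nonneg hD.measurableSet fun x hx => mul_nonneg (hw0 x hx) (sq_nonneg _)
  have := discrim_le_zero key
  rw [discrim] at this
  nlinarith

lemma totalDegree_bind_le {p : MvPolynomial (Fin 2) ℝ} {f : Fin 2 → MvPolynomial (Fin 2) ℝ}
    (hf : ∀ i, (f i).totalDegree ≤ 1) : (MvPolynomial.bind₁ f p).totalDegree ≤ p.totalDegree := by
  rw [MvPolynomial.bind₁, MvPolynomial.aeval_def, MvPolynomial.eval₂_eq']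
  refine MvPolynomial.totalDegree_finsetSum_le fun m hm => ?_
  refine (MvPolynomial.totalDegree_mul _ _).trans ?_
  have h1 : ((algebraMap ℝ (MvPolynomial (Fin 2) ℝ)) (p.coeff m)).totalDegree = 0 :=
    MvPolynomial.totalDegree_C _
  rw [h1, zero_add]
  refine (MvPolynomial.totalDegree_finsetProd _ _).trans ?_
  refine (sum_le_sum fun i _ => (MvPolynomial.totalDegree_pow _ _).trans
    (Nat.mul_le_mul_left _ (hf i))).trans ?_
  have := MvPolynomial.le_totalDegree hm
  rw [Finsupp.sum_fintype _ _ (fun _ => rfl)] at this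
  simpa using this

/-- A disk of radius `ρ / 4` inside the smoothing domain and away from the axis. -/
def offCenter (ρ : ℝ) (a : Pt) : Pt := a + (ρ / 2) • single 0 (1 : ℝ)

/-- The value of a polynomial at `a` is bounded by its mean square over a disk near `a`, with a
constant that depends on the degree only. -/
lemma exists_polyVal_sq_le (l : ℕ) : ∃ C : ℝ, 0 < C ∧ ∀ (a : Pt) (ρ : ℝ), 0 < ρ →
    ∀ p : MvPolynomial (Fin 2) ℝ, p.totalDegree ≤ l →
      polyVal p a ^ 2 ≤ C / ρ ^ 2 * ∫ x in closedBall (offCenter ρ a) (ρ / 4), polyVal p x ^ 2 := by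
  obtain ⟨η, hη, hrep⟩ := exists_representer l
    (isCompact_closedBall (offCenter 1 0) (1 / 4)) continuous_const
    (fun _ _ => zero_le_one) (ε := 1 / 4) (by norm_num) ball_subset_closedBall
    (fun _ _ => zero_lt_one) 0
  refine ⟨(∫ x in closedBall (offCenter 1 0) (1 / 4), 1 * polyVal η x ^ 2) + 1, ?_,
    fun a ρ hρ p hp => ?_⟩
  · positivity
  let f : Fin 2 → MvPolynomial (Fin 2) ℝ := fun i =>
    MvPolynomial.C (a i) + MvPolynomial.C ρ * MvPolynomial.X i
  have hf : ∀ i, (f i).totalDegree ≤ 1 := fun i => by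
    refine (MvPolynomial.totalDegree_add _ _).trans (max_le (by simp) ?_)
    refine (MvPolynomial.totalDegree_mul _ _).trans ?_
    simp
  have hval : ∀ x, polyVal (MvPolynomial.bind₁ f p) x = polyVal p (a + ρ • x) := by
    intro x
    simp only [polyVal, MvPolynomial.eval, MvPolynomial.eval₂Hom_bind₁]
    aesop
  have h1 := hrep (MvPolynomial.bind₁ f p) ((totalDegree_bind_le hf).trans hp)
  rw [hval] at h1
  simp only [smul_zero, add_zero] at h1
  have h2 := sq_integral_mul_le (isCompact_closedBall (offCenter 1 0) (1 / 4 : ℝ))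
    continuous_const (fun _ _ => zero_le_one) (continuous_polyVal η)
    (continuous_polyVal (MvPolynomial.bind₁ f p))
  rw [h1] at h2
  refine h2.trans ?_
  -- the change of variables `x ↦ a + ρ x`
  have h3 : ∫ x in closedBall (offCenter 1 0) (1 / 4),
      1 * polyVal (MvPolynomial.bind₁ f p) x ^ 2 =
      1 / ρ ^ 2 * ∫ x in closedBall (offCenter ρ a) (ρ / 4), polyVal p x ^ 2 := by
    have e := Measure.setIntegral_comp_smul_of_pos volume (fun y => polyVal p (a + y) ^ 2)
      (closedBall (offCenter 1 0) (1 / 4)) hρ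
    rw [_root_.smul_closedBall _ _ (by norm_num)] at e
    have e' := (measurePreserving_add_left volume a).setIntegral_preimage_emb
      (MeasurableEquiv.addLeft a).measurableEmbedding (fun y => polyVal p y ^ 2)
      (closedBall (offCenter ρ a) (ρ / 4))
    have hpre : (fun x => a + x) ⁻¹' closedBall (offCenter ρ a) (ρ / 4) =
        closedBall (ρ • offCenter 1 0) (‖ρ‖ * (1 / 4)) := by
      ext x
      have : offCenter ρ a = a + ρ • offCenter 1 0 := by simp [offCenter, smul_smul, div_eq_mul_inv]
      rw [mem_preimage, mem_closedBall, mem_closedBall, this, dist_add_left,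
        Real.norm_of_nonneg hρ.le, mul_one_div]
    rw [hpre] at e'
    simp_all
  rw [h3]
  have h4 : 0 ≤ 1 / ρ ^ 2 * ∫ x in closedBall (offCenter ρ a) (ρ / 4), polyVal p x ^ 2 :=
    mul_nonneg (by positivity) (setIntegral_nonneg measurableSet_closedBall fun x _ => sq_nonneg _)
  calc _ ≤ ((∫ x in closedBall (offCenter 1 0) (1 / 4), 1 * polyVal η x ^ 2) + 1) *
        (1 / ρ ^ 2 * ∫ x in closedBall (offCenter ρ a) (ρ / 4), polyVal p x ^ 2) :=
        mul_le_mul_of_nonneg_right (by linarith) h4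
    _ = _ := by ring

/-- The requirements on a smoothing domain of radius `ρ` around `a`: the disk does not come closer
to the axis than `ρ` unless its center lies on the axis. -/
structure GoodDisk (ρ : ℝ) (a : Pt) : Prop where
  pos : 0 < ρ
  nonneg : 0 ≤ a 0
  radius : a 0 ≠ 0 → ∀ y ∈ disk ρ a, ρ ≤ y 0

lemma disk_subset_closedBall (ρ : ℝ) (a : Pt) : disk ρ a ⊆ closedBall a ρ := by
  unfold disk
  grind

lemma isClosed_disk (ρ : ℝ) (a : Pt) : IsClosed (disk ρ a) := by
  unfold disk
  split_ifs
  · exact isClosed_closedBall.inter (isClosed_le continuous_const (by fun_prop))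
  · exact isClosed_closedBall

lemma isCompact_disk (ρ : ℝ) (a : Pt) : IsCompact (disk ρ a) :=
  (isCompact_closedBall a ρ).of_isClosed_subset (isClosed_disk ρ a) (disk_subset_closedBall ρ a)

lemma convex_disk (ρ : ℝ) (a : Pt) : Convex ℝ (disk ρ a) := by
  unfold disk
  split_ifs
  · refine (convex_closedBall a ρ).inter ?_
    exact convex_halfSpace_ge ⟨fun _ _ => rfl, fun _ _ => rfl⟩ 0
  · exact convex_closedBall a ρ

lemma abs_coord_sub_le_dist (x y : Pt) (i : Fin 2) : |x i - y i| ≤ dist x y := by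
  rw [dist_eq_norm]
  exact PiLp.norm_apply_le (x - y) i

namespace GoodDisk

variable {a : Pt}

lemma nonneg_of_mem (h : GoodDisk ρ a) (hy : y ∈ disk ρ a) : 0 ≤ y 0 := by
  by_cases h0 : a 0 = 0
  · rw [disk, if_pos h0] at hy
    exact hy.2
  · exact h.pos.le.trans (h.radius h0 y hy)

lemma offCenter_le (_ : GoodDisk ρ a) (hy : y ∈ closedBall (offCenter ρ a) (ρ / 4)) :
    a 0 + ρ / 4 ≤ y 0 := by
  have h1 := (abs_coord_sub_le_dist y (offCenter ρ a) 0).trans hy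
  have h2 : offCenter ρ a 0 = a 0 + ρ / 2 := by simp [offCenter]
  rw [h2] at h1
  linarith [(abs_le.1 h1).1]

lemma offCenter_subset (h : GoodDisk ρ a) :
    closedBall (offCenter ρ a) (ρ / 4) ⊆ disk ρ a := by
  intro y hy
  have h1 : y ∈ closedBall a ρ := by
    have h2 : dist (offCenter ρ a) a = ρ / 2 := by
      rw [offCenter, dist_self_add_left, norm_smul, Real.norm_of_nonneg (by linarith [h.pos])]
      simp
    have := dist_triangle y (offCenter ρ a) a
    rw [mem_closedBall] at hy ⊢
    linarith [h.pos]
  unfold disk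
  split_ifs
  · exact ⟨h1, by have := h.offCenter_le hy; have := h.nonneg; have := h.pos; simp only [mem_ofPred_eq]; linarith⟩
  · exact h1

lemma isEta (h : GoodDisk ρ a) (l : ℕ) : IsEta l ρ a (eta l ρ a) := by
  refine Classical.epsilon_spec ?_
  obtain ⟨η, h1, h2⟩ := exists_representer l (isCompact_disk ρ a)
    (by fun_prop) (fun x hx => pow_nonneg (h.nonneg_of_mem hx) 3) (ε := ρ / 4)
    (by linarith [h.pos]) (ball_subset_closedBall.trans h.offCenter_subset)
    (fun x hx => pow_pos (by
      have := h.offCenter_le (ball_subset_closedBall hx)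
      linarith [h.nonneg, h.pos]) 3) a
  refine ⟨η, h1, fun p hp => ?_⟩
  rw [← h2 p hp]
  congr 1; ext x; ring

lemma integral_kappa (h : GoodDisk ρ a) (l : ℕ) : ∫ y in disk ρ a, kappa l ρ a y = 1 := by
  have := (h.isEta l).2 1 (by simp)
  have e : ∀ x, polyVal 1 x = 1 := fun x => by simp [polyVal]
  simp only [e, mul_one] at this
  rw [← this]
  congr 1; ext x; rw [kappa]; ring

end GoodDisk

lemma continuous_kappa (l : ℕ) (ρ : ℝ) (a : Pt) : Continuous (kappa l ρ a) := by
  unfold kappa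
  have := continuous_polyVal (eta l ρ a)
  fun_prop

/-- The weights `κ_a` are bounded in `L¹`, uniformly in the position and size of the smoothing
domain. -/
theorem exists_integral_abs_kappa_le (l : ℕ) :
    ∃ C : ℝ, 1 ≤ C ∧ ∀ (ρ : ℝ) (a : Pt), GoodDisk ρ a → ∫ y in disk ρ a, |kappa l ρ a y| ≤ C := by
  obtain ⟨C, hC, hb⟩ := exists_polyVal_sq_le l
  refine ⟨1 + Real.sqrt (Real.pi * 64 * C), by simp,
    fun ρ a h => ?_⟩
  have hρ := h.pos
  have ha := h.nonneg
  set η := eta l ρ a with hη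
  obtain ⟨hdeg, hrep⟩ := h.isEta l
  rw [← hη] at hdeg hrep
  have hcη := continuous_polyVal η
  have hI : ∫ x in disk ρ a, x 0 ^ 3 * polyVal η x ^ 2 = polyVal η a := by
    rw [← hrep η hdeg]
    congr 1; ext x; ring
  set I := ∫ x in disk ρ a, x 0 ^ 3 * polyVal η x ^ 2 with hIdef
  have hI0 : 0 ≤ I := setIntegral_nonneg (isClosed_disk ρ a).measurableSet fun x hx =>
    mul_nonneg (pow_nonneg (h.nonneg_of_mem hx) 3) (sq_nonneg _)
  set R := a 0 + ρ with hR
  have hR0 : 0 < R := by linarith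
  -- the inverse estimate for `η` itself bounds `∫ r³ η²`
  have h1 : I ^ 2 ≤ C / ρ ^ 2 * (64 / R ^ 3 * I) := by
    rw [hI]
    refine (hb a ρ hρ η hdeg).trans (mul_le_mul_of_nonneg_left ?_ (by positivity))
    rw [← hI, ← integral_const_mul]
    have hi : ∀ {u : Pt → ℝ}, Continuous u → IntegrableOn u (disk ρ a) := fun hu =>
      hu.continuousOn.integrableOn_compact (isCompact_disk ρ a)
    refine (setIntegral_mono_on ((hi (by fun_prop)).mono_set h.offCenter_subset)
      ((hi (by fun_prop)).mono_set h.offCenter_subset) measurableSet_closedBall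
      fun x hx => ?_).trans (setIntegral_mono_set (hi (by fun_prop)) ?_
        (.of_forall h.offCenter_subset))
    · have := pow_le_pow_left₀ (by positivity) (by linarith [h.offCenter_le hx] : R / 4 ≤ x 0) 3
      rw [← mul_assoc]
      refine le_mul_of_one_le_left (sq_nonneg _) ?_
      rw [div_mul_eq_mul_div, le_div_iff₀ (by positivity)]
      nlinarith
    · refine (ae_restrict_iff' (isClosed_disk ρ a).measurableSet).2 (.of_forall fun x hx => ?_)
      have := h.nonneg_of_mem hx
      positivity
  have h2 : I ≤ 64 * C / (ρ ^ 2 * R ^ 3) := by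
    rcases hI0.eq_or_lt with h0 | h0
    · rw [← h0]; positivity
    · have : I * I ≤ (64 * C / (ρ ^ 2 * R ^ 3)) * I := by
        calc I * I = I ^ 2 := by ring
          _ ≤ _ := h1
          _ = _ := by field_simp
      simp_all
  have hcs := sq_integral_mul_le (isCompact_disk ρ a) (by fun_prop)
    (fun x hx => pow_nonneg (h.nonneg_of_mem hx) 3) (f := fun _ => 1) continuous_const
    hcη.abs
  simp only [one_mul, one_pow, mul_one, sq_abs] at hcs
  have h3 : ∫ x in disk ρ a, x 0 ^ 3 ≤ R ^ 3 * (Real.pi * ρ ^ 2) := by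
    have hv : (volume (disk ρ a)).toReal ≤ Real.pi * ρ ^ 2 := by
      have h1 := measure_mono (μ := volume) (disk_subset_closedBall ρ a)
      have h2 := ENNReal.toReal_mono (isCompact_closedBall a ρ).measure_lt_top.ne h1
      refine h2.trans (le_of_eq ?_)
      rw [EuclideanSpace.volume_closedBall_fin_two]
      simp [ENNReal.toReal_ofReal hρ.le, mul_comm, Real.pi_pos.le]
    refine (Real.le_norm_self _).trans ((norm_setIntegral_le_of_norm_le_const (C := R ^ 3)
      (isCompact_disk ρ a).measure_lt_top (fun x hx => ?_)).trans ?_)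
    · have h0 := h.nonneg_of_mem hx
      have h1 := (abs_coord_sub_le_dist x a 0).trans (disk_subset_closedBall ρ a hx)
      rw [Real.norm_of_nonneg (by positivity)]
      exact pow_le_pow_left₀ h0 (by rw [hR]; linarith [(abs_le.1 h1).2]) 3
    · aesop
  have h4 : ∫ y in disk ρ a, |kappa l ρ a y| = ∫ x in disk ρ a, x 0 ^ 3 * |polyVal η x| := by
    refine setIntegral_congr_fun (isClosed_disk ρ a).measurableSet fun x hx => ?_
    simp only [kappa, abs_mul, ← hη]
    rw [abs_of_nonneg (pow_nonneg (h.nonneg_of_mem hx) 3)]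
  rw [h4]
  have h5 : (∫ x in disk ρ a, x 0 ^ 3 * |polyVal η x|) ^ 2 ≤ Real.pi * 64 * C := by
    refine hcs.trans ?_
    calc _ ≤ (R ^ 3 * (Real.pi * ρ ^ 2)) * (64 * C / (ρ ^ 2 * R ^ 3)) :=
          mul_le_mul h3 h2 hI0 (by positivity)
      _ = _ := by field_simp
  have h6 := Real.le_sqrt_of_sq_le h5
  linarith

/-! ### Averages over the positions of the vertices -/

/-- The affine combination of three points, as a linear function of the points. -/
def combo (w : Fin 3 → ℝ) : Tri →L[ℝ] Pt := ∑ i, w i • ContinuousLinearMap.proj i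

lemma combo_apply (w : Fin 3 → ℝ) (y : Tri) : combo w y = ∑ i, w i • y i := by
  simp [combo]

lemma continuous_combo : Continuous (combo : (Fin 3 → ℝ) → Tri →L[ℝ] Pt) := by
  unfold combo
  fun_prop

/-- The linear map that replaces the `j`-th point by the combination with weights `w`. -/
def shear (j : Fin 3) (w : Fin 3 → ℝ) : Tri →L[ℝ] Tri :=
  ContinuousLinearMap.id ℝ Tri + (ContinuousLinearMap.single ℝ (fun _ => Pt) j).comp
    (combo w - ContinuousLinearMap.proj j)

lemma shear_apply (j : Fin 3) (w : Fin 3 → ℝ) (y : Tri) :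
    shear j w y = y + Pi.single j (combo w y - y j) := by
  aesop

lemma shear_same (j : Fin 3) (w : Fin 3 → ℝ) (y : Tri) : shear j w y j = combo w y := by
  rw [shear_apply]; simp

lemma shear_other (h : i ≠ j) (w : Fin 3 → ℝ) (y : Tri) : shear j w y i = y i := by
  rw [shear_apply]; simp [h]

lemma continuous_shear (j : Fin 3) : Continuous (shear j) := by
  unfold shear
  exact continuous_const.add (continuous_const.clm_comp (continuous_combo.sub continuous_const))

/-- The weights of the inverse of `shear`. -/
def unweights (j : Fin 3) (w : Fin 3 → ℝ) : Fin 3 → ℝ :=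
  fun i => if i = j then (w j)⁻¹ else -(w j)⁻¹ * w i

lemma shear_unweights (h : w j ≠ 0) (y : Tri) : shear j (unweights j w) (shear j w y) = y := by
  funext i
  by_cases hi : i = j
  · subst hi
    rw [shear_same, combo_apply, ← Finset.add_sum_erase _ _ (Finset.mem_univ i)]
    have e : ∀ k ∈ Finset.univ.erase i, unweights i w k • shear i w y k = -(w i)⁻¹ • (w k • y k) := by
      intro k hk
      rw [shear_other (Finset.ne_of_mem_erase hk), unweights, if_neg (Finset.ne_of_mem_erase hk),
        smul_smul]
    rw [sum_congr rfl e, ← smul_sum, shear_same, combo_apply,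
      ← Finset.add_sum_erase _ _ (Finset.mem_univ i), unweights, if_pos rfl, smul_add, smul_smul,
      inv_mul_cancel₀ h]
    simp
  · rw [shear_other hi, shear_other hi]

lemma shear_shear_unweights (h : w j ≠ 0) (y : Tri) :
    shear j w (shear j (unweights j w) y) = y := by
  have hj : unweights j w j ≠ 0 := by simp [unweights, h]
  have : unweights j (unweights j w) = w := by
    funext i
    by_cases hi : i = j
    · simp [unweights, hi]
    · simp [unweights, hi, h]
  have h1 := shear_unweights hj y
  rwa [this] at h1

lemma det_shear_ne_zero (h : w j ≠ 0) : (shear j w).det ≠ 0 := by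
  intro h0
  have hc : ((shear j (unweights j w) : Tri →L[ℝ] Tri) : Tri →ₗ[ℝ] Tri) ∘ₗ
      ((shear j w : Tri →L[ℝ] Tri) : Tri →ₗ[ℝ] Tri) = LinearMap.id :=
    LinearMap.ext fun y => shear_unweights h y
  have := congrArg LinearMap.det hc
  rw [LinearMap.det_comp, LinearMap.det_id] at this
  grind

/-- The homeomorphism of the space of triples given by `shear`. -/
def shearHomeo (h : w j ≠ 0) : Tri ≃ₜ Tri where
  toFun := shear j w
  invFun := shear j (unweights j w)
  left_inv := shear_unweights h
  right_inv := shear_shear_unweights h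
  continuous_toFun := (shear j w).continuous
  continuous_invFun := (shear j (unweights j w)).continuous

lemma map_shear (h : w j ≠ 0) : Measure.map (shear j w) volume = ENNReal.ofReal |(shear j w).det⁻¹|
    • (volume : Measure Tri) := by
  exact Measure.map_linearMap_addHaar_eq_smul_addHaar volume (det_shear_ne_zero h)

lemma integral_comp_shear (h : w j ≠ 0) (f : Tri → ℝ) :
    ∫ y, f (shear j w y) = |(shear j w).det⁻¹| * ∫ z, f z := by
  have h1 := (shearHomeo h).measurableEmbedding.integral_map (μ := volume) f
  have h2 : Measure.map (shearHomeo h) volume =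
    ENNReal.ofReal |(shear j w).det⁻¹| • (volume : Measure Tri) := map_shear h
  aesop

/-- An affine combination of the points `y i` avoids a null set for almost all `y`. -/
lemma ae_combo_notMem (hw : w ≠ 0) (hp : ∀ᵐ x, p x) : ∀ᵐ y : Tri, p (combo w y) := by
  obtain ⟨j, hj⟩ := Function.ne_iff.1 hw
  have hq1 : Measure.QuasiMeasurePreserving (shear j w) (volume : Measure Tri) volume := by
    refine ⟨(shear j w).continuous.measurable, ?_⟩
    rw [map_shear hj]
    exact Measure.smul_absolutelyContinuous
  have hq2 : Measure.QuasiMeasurePreserving (fun y : Tri => y j) volume volume :=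
    Measure.quasiMeasurePreserving_eval (fun _ => volume) j
  have := hq1.ae (hq2.ae hp)
  simpa only [shear_same] using this

/-- Averages `∫_D W(y) g(∑ w_i y_i) dy` depend continuously on the weights `w ≠ 0`, even for
discontinuous `g`. -/
theorem continuousAt_average {D : Set Tri} (hD : IsCompact D) (hDc : Convex ℝ D) {W : Tri → ℝ}
    (hW : Continuous W) (hg : Measurable g) (hM : ∀ x, |g x| ≤ M) {w₀ : Fin 3 → ℝ} (hw : w₀ ≠ 0) :
    ContinuousAt (fun w => ∫ y in D, W y * g (combo w y)) w₀ := by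
  obtain ⟨j, hj⟩ := Function.ne_iff.1 hw
  have hj' : w₀ j ≠ 0 := hj
  have hev := (continuous_apply j).continuousAt.eventually_ne hj'
  have hM0 := (abs_nonneg _).trans (hM 0)
  -- substitute `z = shear j w y`
  have hsub : ∀ w : Fin 3 → ℝ, w j ≠ 0 → ∫ y in D, W y * g (combo w y) =
      |(shear j w).det⁻¹| * ∫ z, D.indicator W (shear j (unweights j w) z) * g (z j) := by
    intro w h
    rw [← integral_comp_shear h, ← integral_indicator hD.measurableSet]
    congr 1; ext y
    rw [shear_unweights h, shear_same]
    by_cases hy : y ∈ D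
    · simp_all
    · simp_all
  have hun : ContinuousAt (unweights j) w₀ := by
    rw [continuousAt_pi]
    intro i
    unfold unweights
    have h1 : ContinuousAt (fun w : Fin 3 → ℝ => w j) w₀ := (continuous_apply j).continuousAt
    have h2 : ContinuousAt (fun w : Fin 3 → ℝ => w i) w₀ := (continuous_apply i).continuousAt
    by_cases hi : i = j
    · simp only [hi, if_true]
      exact h1.inv₀ hj'
    · simp only [hi, if_false]
      exact (h1.inv₀ hj').neg.mul h2
  obtain ⟨B, hB⟩ := hD.isBounded.exists_norm_le
  obtain ⟨A, hA⟩ := hD.exists_bound_of_continuousOn hW.continuousOn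
  have hnorm := ((continuous_shear j).norm.continuousAt.eventually_lt continuousAt_const (by linarith :
      ‖shear j w₀‖ < ‖shear j w₀‖ + 1)).mono fun _ h => le_of_lt h
  set R := (‖shear j w₀‖ + 1) * |B| with hR
  have hlim : Tendsto (fun w => ∫ z, D.indicator W (shear j (unweights j w) z) * g (z j)) (𝓝 w₀)
      (𝓝 (∫ z, D.indicator W (shear j (unweights j w₀) z) * g (z j))) := by
    refine tendsto_integral_filter_of_dominated_convergence
      ((closedBall (0 : Tri) R).indicator fun _ => |A| * M) ?_ ?_ ?_ ?_
    · refine .of_forall fun w => ?_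
      have h1 := hW.measurable.indicator hD.measurableSet
      fun_prop
    · filter_upwards [hev, hnorm] with w h hn
      refine .of_forall fun z => ?_
      by_cases hz : shear j (unweights j w) z ∈ D
      · have h1 : z ∈ closedBall (0 : Tri) R := by
          rw [mem_closedBall_zero_iff, ← shear_shear_unweights h z]
          refine ((shear j w).le_opNorm _).trans ?_
          exact mul_le_mul hn ((hB _ hz).trans (le_abs_self B)) (norm_nonneg _) (by positivity)
        rw [indicator_of_mem h1, indicator_of_mem hz, norm_mul]
        exact mul_le_mul ((hA _ hz).trans (le_abs_self A)) (hM _) (norm_nonneg _) (abs_nonneg _)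
      · rw [indicator_of_notMem hz, zero_mul, norm_zero]
        exact indicator_nonneg (fun _ _ => by positivity) _
    · exact (integrable_indicator_iff measurableSet_closedBall).2
        (integrableOn_const (isCompact_closedBall _ _).measure_lt_top.ne)
    · have hfr := measure_eq_zero_iff_ae_notMem.1 (hDc.addHaar_frontier volume)
      have hu0 : unweights j w₀ j ≠ 0 := by simp [unweights, hj']
      have hq : Measure.QuasiMeasurePreserving (shear j (unweights j w₀)) (volume : Measure Tri)
          volume := by
        refine ⟨(shear j _).continuous.measurable, ?_⟩
        rw [map_shear hu0]
        exact Measure.smul_absolutelyContinuous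
      filter_upwards [hq.ae hfr] with z hz
      refine Tendsto.mul_const _ ?_
      have hc := hW.continuousOn.continuousAt_indicator hz
      have h2 : ContinuousAt (fun w => shear j (unweights j w) z) w₀ :=
        (((continuous_shear j).clm_apply continuous_const).continuousAt).comp hun
      exact hc.tendsto.comp h2
  have hdet : Tendsto (fun w => |(shear j w).det⁻¹|) (𝓝 w₀) (𝓝 |(shear j w₀).det⁻¹|) := by
    have h1 := ContinuousLinearMap.continuous_det.comp (continuous_shear j)
    exact (h1.continuousAt.inv₀ (det_shear_ne_zero hj')).abs
  rw [ContinuousAt, hsub w₀ hj']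
  exact (hdet.mul hlim).congr' (hev.mono fun w h => (hsub w h).symm)

/-- The integration domain of the smoothers. -/
def diskProd (ρ : ℝ) (K : Tri) : Set Tri := Set.pi univ fun i => disk ρ (K i)

lemma isCompact_diskProd (ρ : ℝ) (K : Tri) : IsCompact (diskProd ρ K) :=
  isCompact_univ_pi fun i => isCompact_disk ρ (K i)

lemma convex_diskProd (ρ : ℝ) (K : Tri) : Convex ℝ (diskProd ρ K) :=
  convex_pi fun i _ => convex_disk ρ (K i)

/-- The weight of the smoothers. -/
def kappaProd (l : ℕ) (ρ : ℝ) (K : Tri) (y : Tri) : ℝ :=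
  kappa l ρ (K 0) (y 0) * kappa l ρ (K 1) (y 1) * kappa l ρ (K 2) (y 2)

lemma continuous_kappaProd (l : ℕ) (ρ : ℝ) (K : Tri) : Continuous (kappaProd l ρ K) := by
  unfold kappaProd
  have h0 := continuous_kappa l ρ (K 0)
  have h1 := continuous_kappa l ρ (K 1)
  have h2 := continuous_kappa l ρ (K 2)
  fun_prop

lemma piFinSuccAbove_symm_zero (a : Pt) (z : Fin n → Pt) :
    (MeasurableEquiv.piFinSuccAbove (fun _ : Fin (n + 1) => Pt) 0).symm (a, z) = Fin.cons a z := by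
  aesop

lemma integral_fin_succ {f : (Fin (n + 1) → Pt) → ℝ} (hf : Integrable f) :
    ∫ y, f y = ∫ a : Pt, ∫ z : Fin n → Pt, f (Fin.cons a z) := by
  have h := (volume_preserving_piFinSuccAbove (fun _ : Fin (n + 1) => Pt) 0).symm
  rw [← h.integral_comp' f, Measure.volume_eq_prod, integral_prod]
  · aesop
  · exact (h.integrable_comp_emb (MeasurableEquiv.measurableEmbedding _)).2 hf

lemma ae_integrable_fin_succ {f : (Fin (n + 1) → Pt) → ℝ} (hf : Integrable f) :
    ∀ᵐ a : Pt, Integrable fun z : Fin n → Pt => f (Fin.cons a z) := by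
  have h := (volume_preserving_piFinSuccAbove (fun _ : Fin (n + 1) => Pt) 0).symm
  have h1 := (h.integrable_comp_emb (MeasurableEquiv.measurableEmbedding _)).2 hf
  rw [Measure.volume_eq_prod] at h1
  simpa only [Function.comp_def, piFinSuccAbove_symm_zero] using h1.prod_right_ae

/-- Integrals over triples are iterated integrals. -/
lemma integral_triple {f : Tri → ℝ} (hf : Integrable f) :
    ∫ y, f y = ∫ y₁, ∫ y₂, ∫ y₃, f ![y₁, y₂, y₃] := by
  rw [integral_fin_succ hf]
  refine integral_congr_ae ?_
  filter_upwards [ae_integrable_fin_succ hf] with a ha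
  rw [integral_fin_succ ha]
  refine integral_congr_ae ?_
  filter_upwards [ae_integrable_fin_succ ha] with b hb
  rw [integral_fin_succ hb]
  congr 1; ext c
  have : (volume : Measure (Fin 0 → Pt)) = Measure.dirac (fun i => i.elim0) := by
    rw [volume_pi, Measure.pi_of_empty _ _]
  aesop

lemma smooth_eq_integral {F : Tri → ℝ}
    (hF : IntegrableOn (fun y => kappaProd l ρ K y * F y) (diskProd ρ K)) :
    smooth l ρ K F = ∫ y in diskProd ρ K, kappaProd l ρ K y * F y := by
  have hm := (isCompact_diskProd ρ K).measurableSet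
  rw [← integral_indicator hm, integral_triple ((integrable_indicator_iff hm).2 hF), smooth,
    ← integral_indicator (isClosed_disk _ _).measurableSet]
  congr 1; ext y₁
  by_cases h1 : y₁ ∈ disk ρ (K 0)
  swap
  · rw [indicator_of_notMem h1]
    symm
    refine integral_eq_zero_of_ae (.of_forall fun y₂ => ?_)
    refine integral_eq_zero_of_ae (.of_forall fun y₃ => ?_)
    simp only []
    rw [indicator_of_notMem]
    · rfl
    · exact fun h => h1 (h 0 (mem_univ _))
  rw [indicator_of_mem h1, ← integral_indicator (isClosed_disk _ _).measurableSet]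
  congr 1; ext y₂
  by_cases h2 : y₂ ∈ disk ρ (K 1)
  swap
  · rw [indicator_of_notMem h2]
    symm
    refine integral_eq_zero_of_ae (.of_forall fun y₃ => ?_)
    simp only []
    rw [indicator_of_notMem]
    · rfl
    · exact fun h => h2 (h 1 (mem_univ _))
  rw [indicator_of_mem h2, ← integral_indicator (isClosed_disk _ _).measurableSet]
  congr 1; ext y₃
  by_cases h3 : y₃ ∈ disk ρ (K 2)
  · rw [indicator_of_mem h3, indicator_of_mem]
    · rfl
    · intro i _
      fin_cases i <;> assumption
  · rw [indicator_of_notMem h3, indicator_of_notMem]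
    exact fun h => h3 (h 2 (mem_univ _))

lemma integral_triple_prod (F : Tri → ℝ) :
    ∫ y, F y = ∫ p : Pt × (Pt × Pt), F ![p.1, p.2.1, p.2.2] := by
  have h1 := (volume_preserving_piFinSuccAbove (fun _ : Fin 3 => Pt) 0).symm
  have h2 := (volume_preserving_finTwoArrow Pt).symm
  have h3 : MeasurePreserving (Prod.map id (MeasurableEquiv.finTwoArrow (α := Pt)).symm)
      (volume : Measure (Pt × (Pt × Pt))) volume :=
    (MeasurePreserving.id (volume : Measure Pt)).prod h2
  have h4 : MeasurableEmbedding (Prod.map id (MeasurableEquiv.finTwoArrow (α := Pt)).symm :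
      Pt × (Pt × Pt) → Pt × (Fin 2 → Pt)) :=
    MeasurableEmbedding.id.prodMap (MeasurableEquiv.measurableEmbedding _)
  rw [← h1.integral_comp' F]
  rw [← h3.integral_comp h4]
  aesop

lemma integral_rotate (i : Fin 3) (F : Tri → ℝ) : ∫ y, F y = ∫ y : Tri, F (fun k => y (k - i)) := by
  have h := volume_measurePreserving_piCongrLeft (fun _ => Pt) (Equiv.addRight i)
  rw [← h.integral_comp' F]
  congr 1; ext y
  congr 1; ext1 k
  have := Equiv.piCongrLeft_apply_apply (fun _ => Pt) (Equiv.addRight i) y (k - i)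
  aesop

lemma kappaProd_eq_prod (l : ℕ) (ρ : ℝ) (K y : Tri) :
    kappaProd l ρ K y = ∏ i, kappa l ρ (K i) (y i) := by
  rw [Fin.prod_univ_three, kappaProd]

lemma indicator_diskProd (ρ : ℝ) (K : Tri) (f : Fin 3 → Pt → ℝ) (y : Tri) :
    (diskProd ρ K).indicator (fun y => ∏ i, f i (y i)) y =
      ∏ i, (disk ρ (K i)).indicator (f i) (y i) := by
  by_cases hy : y ∈ diskProd ρ K
  · rw [indicator_of_mem hy]
    exact Finset.prod_congr rfl fun i _ => (indicator_of_mem (hy i (mem_univ _)) _).symm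
  · rw [indicator_of_notMem hy]
    simp only [diskProd, Set.mem_pi, mem_univ, true_imp_iff, not_forall] at hy
    obtain ⟨i, hi⟩ := hy
    exact (Finset.prod_eq_zero (Finset.mem_univ i) (indicator_of_notMem hi _)).symm

/-- The average of a function of the `j`-th vertex. -/
def dofVertex (l : ℕ) (ρ : ℝ) (a : Pt) (f : Pt → ℝ) : ℝ := ∫ y in disk ρ a, kappa l ρ a y * f y

/-- The average of a function of two vertices. -/
def dofEdge (l : ℕ) (ρ : ℝ) (a b : Pt) (f : Pt → Pt → ℝ) : ℝ :=
  ∫ p in disk ρ a ×ˢ disk ρ b, kappa l ρ a p.1 * kappa l ρ b p.2 * f p.1 p.2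

lemma average_vertex (hK : ∀ i, GoodDisk ρ (K i)) (j : Fin 3) (f : Pt → ℝ) :
    ∫ y in diskProd ρ K, kappaProd l ρ K y * f (y j) = dofVertex l ρ (K j) f := by
  rw [← integral_indicator (isCompact_diskProd ρ K).measurableSet]
  have e : ∀ y, kappaProd l ρ K y * f (y j) =
      ∏ i, (fun x => kappa l ρ (K i) x * if i = j then f x else 1) (y i) := by
    intro y
    simp only [Finset.prod_mul_distrib, ← kappaProd_eq_prod]
    simp
  simp only [e]
  simp_rw [indicator_diskProd ρ K (fun i x => kappa l ρ (K i) x * if i = j then f x else 1)]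
  rw [volume_pi, integral_fintype_prod_eq_prod (fun i => (disk ρ (K i)).indicator
    (fun x => kappa l ρ (K i) x * if i = j then f x else 1)), Finset.prod_eq_single j]
  · rw [integral_indicator (isClosed_disk _ _).measurableSet]
    simp [dofVertex]
  · intro i _ hij
    rw [integral_indicator (isClosed_disk _ _).measurableSet]
    simp only [hij, if_false, mul_one]
    exact (hK i).integral_kappa l
  · simp

lemma average_edge (hK : ∀ i, GoodDisk ρ (K i)) (i : Fin 3) (f : Pt → Pt → ℝ) : ∫ y in diskProd ρ K,
    kappaProd l ρ K y * f (y (i + 1)) (y (i + 2)) = dofEdge l ρ (K (i + 1)) (K (i + 2)) f := by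
  have hm : ∀ a, MeasurableSet (disk ρ a) := fun a => (isClosed_disk _ _).measurableSet
  rw [← integral_indicator (isCompact_diskProd ρ K).measurableSet, integral_rotate i,
    integral_triple_prod]
  have e : ∀ p : Pt × (Pt × Pt), (diskProd ρ K).indicator
      (fun y => kappaProd l ρ K y * f (y (i + 1)) (y (i + 2)))
      (fun k => (![p.1, p.2.1, p.2.2] : Tri) (k - i)) =
      (disk ρ (K i)).indicator (kappa l ρ (K i)) p.1 *
      ((disk ρ (K (i + 1))) ×ˢ (disk ρ (K (i + 2)))).indicator
        (fun q => kappa l ρ (K (i + 1)) q.1 * kappa l ρ (K (i + 2)) q.2 * f q.1 q.2) p.2 := by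
    intro p
    have h1 : i + 1 - i = 1 := by revert i; decide
    have h2 : i + 2 - i = 2 := by revert i; decide
    have hmem : (fun k => (![p.1, p.2.1, p.2.2] : Tri) (k - i)) ∈ diskProd ρ K ↔
        p.1 ∈ disk ρ (K i) ∧ p.2 ∈ (disk ρ (K (i + 1))) ×ˢ (disk ρ (K (i + 2))) := by
      simp only [diskProd, Set.mem_pi, mem_univ, true_imp_iff, mem_prod]
      constructor
      · intro h
        refine ⟨by simpa using h i, by simpa [h1] using h (i + 1), by simpa [h2] using h (i + 2)⟩
      · rintro ⟨a, b, c⟩ k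
        obtain rfl | rfl | rfl : k = i ∨ k = i + 1 ∨ k = i + 2 := by
          grind
        · simpa using a
        · simpa [h1] using b
        · simpa [h2] using c
    by_cases hp : p.1 ∈ disk ρ (K i) ∧ p.2 ∈ (disk ρ (K (i + 1))) ×ˢ (disk ρ (K (i + 2)))
    · rw [indicator_of_mem (hmem.2 hp), indicator_of_mem hp.1, indicator_of_mem hp.2,
        kappaProd_eq_prod]
      have : ∀ g : Fin 3 → ℝ, ∏ k, g k = g i * (g (i + 1) * g (i + 2)) := by
        intro g
        fin_cases i <;> simp [Fin.prod_univ_three] <;> ring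
      rw [this]
      simp only [sub_self, h1, h2]
      simp
      ring
    · rw [indicator_of_notMem (fun h => hp (hmem.1 h))]
      rw [not_and_or] at hp
      aesop
  simp_rw [e]
  rw [Measure.volume_eq_prod, integral_prod_mul ((disk ρ (K i)).indicator (kappa l ρ (K i)))
    (((disk ρ (K (i + 1))) ×ˢ (disk ρ (K (i + 2)))).indicator
        (fun q => kappa l ρ (K (i + 1)) q.1 * kappa l ρ (K (i + 2)) q.2 * f q.1 q.2)),
    integral_indicator (hm _), (hK i).integral_kappa l, one_mul,
    integral_indicator ((hm _).prod (hm _))]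
  rfl

lemma dofEdge_swap (l : ℕ) (ρ : ℝ) (a b : Pt) (f : Pt → Pt → ℝ) :
    dofEdge l ρ b a (fun y z => f z y) = dofEdge l ρ a b f := by
  have hm : ∀ a, MeasurableSet (disk ρ a) := fun a => (isClosed_disk _ _).measurableSet
  rw [dofEdge, dofEdge, ← integral_indicator ((hm _).prod (hm _)),
    ← integral_indicator ((hm _).prod (hm _)), Measure.volume_eq_prod, ← integral_prod_swap]
  congr 1; ext p
  by_cases hp : p ∈ disk ρ a ×ˢ disk ρ b
  · have : p.swap ∈ disk ρ b ×ˢ disk ρ a := ⟨hp.2, hp.1⟩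
    rw [indicator_of_mem hp, indicator_of_mem this]
    grind
  · aesop

/-! ### Geometry of the mesh -/

/-- The hat function of the vertex `a`, as an affine function attached to the triangle `K`; it is
zero if `a` is not a vertex of `K`. -/
def hatOn (K : Tri) (a x : Pt) : ℝ := ∑ i, if K i = a then bary K i x else 0

/-- The gradient of `hatOn K a`. -/
def gradHatOn (K : Tri) (a : Pt) (m : Fin 2) : ℝ := ∑ i, if K i = a then gradBary K i m else 0

lemma hatOn_sub (K : Tri) (a x y : Pt) :
    hatOn K a x - hatOn K a y = gradHatOn K a 0 * (x 0 - y 0) + gradHatOn K a 1 * (x 1 - y 1) := by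
  simp only [hatOn, gradHatOn, sum_univ_three]
  have h0 := bary_sub K 0 x y
  have h1 := bary_sub K 1 x y
  have h2 := bary_sub K 2 x y
  split_ifs <;> linarith

namespace Triangulation

variable (T : Triangulation)

open Classical in
/-- The finite set of mesh vertices. -/
def verts : Finset Pt := T.cells.biUnion fun K => Finset.univ.image K

variable {T}

lemma mem_verts {a : Pt} : a ∈ T.verts ↔ ∃ K ∈ T.cells, ∃ i, K i = a := by
  simp [verts]

lemma vertex_mem_verts (hK : K ∈ T.cells) (i : Fin 3) : K i ∈ T.verts :=
  mem_verts.2 ⟨K, hK, i, rfl⟩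

lemma mem_vertices (hK : K ∈ T.cells) (i : Fin 3) : K i ∈ T.vertices := by
  simp only [vertices, mem_iUnion]
  exact ⟨K, hK, i, rfl⟩

lemma sarea_ne (T : Triangulation) (hK : K ∈ T.cells) : sarea K ≠ 0 :=
  sarea_ne_zero (T.nondegenerate K hK)

lemma inj (T : Triangulation) (hK : K ∈ T.cells) : Function.Injective K :=
  (T.nondegenerate K hK).injective

end Triangulation

lemma hatOn_vertex (h : sarea K ≠ 0) (a : Pt) (j : Fin 3) :
    hatOn K a (K j) = if K j = a then 1 else 0 := by
  simp only [hatOn, bary_vertex h]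
  rw [sum_eq_single j]
  · simp
  · intro i _ hij
    simp [hij]
  · simp

lemma hatOn_self (hinj : Function.Injective K) (i : Fin 3) (x : Pt) :
    hatOn K (K i) x = bary K i x := by
  rw [hatOn, sum_eq_single i]
  · simp
  · intro j _ hij
    simp [hinj.ne hij]
  · simp

lemma gradHatOn_self (hinj : Function.Injective K) (i : Fin 3) (m : Fin 2) :
    gradHatOn K (K i) m = gradBary K i m := by
  rw [gradHatOn, sum_eq_single i]
  · simp
  · intro j _ hij
    simp [hinj.ne hij]
  · simp

lemma hatOn_of_notMem {a : Pt} (h : a ∉ range K) (x : Pt) : hatOn K a x = 0 :=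
  sum_eq_zero fun i _ => if_neg fun hi => h ⟨i, hi⟩

namespace Triangulation

lemma sum_verts (hK : K ∈ T.cells) (f : Pt → ℝ) (g : Fin 3 → ℝ) :
    ∑ a ∈ T.verts, f a * (∑ i, if K i = a then g i else 0) = ∑ i, f (K i) * g i := by
  simp_rw [mul_sum]
  rw [sum_comm]
  refine sum_congr rfl fun i _ => ?_
  rw [sum_eq_single (K i)]
  · simp
  · intro b _ hb
    simp [hb.symm]
  · intro h
    exact absurd (vertex_mem_verts hK i) h

lemma sum_hatOn (hK : K ∈ T.cells) (f : Pt → ℝ) (x : Pt) :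
    ∑ a ∈ T.verts, f a * hatOn K a x = ∑ i, f (K i) * bary K i x := sum_verts hK f _

lemma sum_gradHatOn (hK : K ∈ T.cells) (f : Pt → ℝ) (m : Fin 2) :
    ∑ a ∈ T.verts, f a * gradHatOn K a m = ∑ i, f (K i) * gradBary K i m := sum_verts hK f _

/-- The affine hat functions of two triangles agree on their intersection. -/
lemma hatOn_eq_hatOn (hK : K ∈ T.cells) (hK' : K' ∈ T.cells) (hx : x ∈ tri K) (hx' : x ∈ tri K')
    (a : Pt) : hatOn K a x = hatOn K' a x := by
  have hmem : x ∈ convexHull ℝ (range K ∩ range K') := by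
    rw [← T.conforming K hK K' hK']; exact ⟨hx, hx'⟩
  have hsub : convexHull ℝ (range K ∩ range K') ⊆ {x | hatOn K a x = hatOn K' a x} := by
    refine convexHull_min ?_ ?_
    · rintro y ⟨⟨i, rfl⟩, ⟨j, hj⟩⟩
      simp only [mem_ofPred_eq]
      rw [hatOn_vertex (T.sarea_ne hK), ← hj, hatOn_vertex (T.sarea_ne hK')]
    · intro y hy z hz s t hs ht hst
      simp only [mem_ofPred_eq] at hy hz ⊢
      have e1 := hatOn_sub K a (s • y + t • z) y
      have e2 := hatOn_sub K' a (s • y + t • z) y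
      have e3 := hatOn_sub K a z y
      have e4 := hatOn_sub K' a z y
      simp only [add_apply, smul_apply, smul_eq_mul] at e1 e2
      have hs' : s = 1 - t := by linarith
      subst hs'
      linear_combination e1 - e2 - t * e3 + t * e4 + (1 - t) * hy + t * hz
  exact hsub hmem

lemma eq_of_mem_interior (hK : K ∈ T.cells) (hK' : K' ∈ T.cells) (hx : x ∈ interior (tri K))
    (hx' : x ∈ tri K') : K = K' := by
  have hpos := hx
  rw [interior_tri (T.sarea_ne hK)] at hpos
  have hsub : range K ⊆ range K' := by
    rintro _ ⟨i, rfl⟩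
    by_contra hn
    have h1 := hatOn_eq_hatOn hK hK' (interior_subset hx) hx' (K i)
    rw [hatOn_self (T.inj hK), hatOn_of_notMem hn] at h1
    exact (hpos i).ne' h1
  refine T.listed_once K hK K' hK' (Set.eq_of_subset_of_ncard_le hsub ?_ (finite_range K'))
  rw [← Set.image_univ, ← Set.image_univ, Set.ncard_image_of_injective _ (T.inj hK),
    Set.ncard_image_of_injective _ (T.inj hK')]

lemma piecewise_eq {V : Type*} [AddCommGroup V] (F : Tri → Pt → V) (hK : K ∈ T.cells)
    (hx : x ∈ interior (tri K)) : piecewise T F x = F K x := by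
  rw [piecewise, sum_eq_single K]
  · exact indicator_of_mem hx _
  · intro K' hK' hne
    exact indicator_of_notMem (fun h => hne (eq_of_mem_interior hK' hK h (interior_subset hx))) _
  · exact fun h => absurd hK h

variable (T) in
/-- The closed polygon covered by the mesh. -/
def support : Set Pt := ⋃ K ∈ T.cells, tri K

lemma mem_support : x ∈ T.support ↔ ∃ K ∈ T.cells, x ∈ tri K := by
  simp [support]

lemma tri_subset_support (hK : K ∈ T.cells) : tri K ⊆ T.support :=
  fun _ hx => mem_support.2 ⟨K, hK, hx⟩

variable (T) in
lemma isCompact_support : IsCompact T.support :=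
  T.cells.finite_toSet.isCompact_biUnion fun K _ => isCompact_tri K

lemma nonneg_of_mem (hK : K ∈ T.cells) (hx : x ∈ tri K) : 0 ≤ x 0 := by
  rw [← bary_combo_apply (T.sarea_ne hK) x 0]
  exact sum_nonneg fun i _ => mul_nonneg ((mem_tri_iff (T.sarea_ne hK) x).1 hx i)
    (T.nonneg K hK i)

lemma pos_of_mem_interior (hK : K ∈ T.cells) (hx : x ∈ interior (tri K)) : 0 < x 0 := by
  by_contra h
  have h0 := le_antisymm (not_lt.1 h) (nonneg_of_mem hK (interior_subset hx))
  have hc : Tendsto (fun t : ℝ => x - t • single 0 1) (𝓝[>] 0)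
      (𝓝 x) := by
    have : Continuous fun t : ℝ => x - t • single 0 1 := by fun_prop
    have := this.tendsto 0
    simp only [zero_smul, sub_zero] at this
    exact this.mono_left nhdsWithin_le_nhds
  obtain ⟨t, ht, ht0⟩ :=
    ((hc.eventually (mem_interior_iff_mem_nhds.1 hx)).and self_mem_nhdsWithin).exists
  have h1 := nonneg_of_mem hK ht
  have ht0' := ht0
  simp [h0] at h1
  linarith

section Meshes

lemma Meshes.eq_interior (hΩ : T.Meshes Ω) : Ω = interior T.support := hΩ.symm

lemma Meshes.isOpen (hΩ : T.Meshes Ω) : IsOpen Ω := by rw [hΩ.eq_interior]; exact isOpen_interior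

lemma Meshes.subset_support (hΩ : T.Meshes Ω) : Ω ⊆ T.support := by rw [hΩ.eq_interior]; exact interior_subset

lemma Meshes.interior_tri_subset (hΩ : T.Meshes Ω) (hK : K ∈ T.cells) : interior (tri K) ⊆ Ω := by
  rw [hΩ.eq_interior]; exact interior_mono (tri_subset_support hK)

lemma Meshes.closure_eq (hΩ : T.Meshes Ω) : closure Ω = T.support := by
  refine subset_antisymm (closure_minimal hΩ.subset_support T.isCompact_support.isClosed) ?_
  intro x hx
  obtain ⟨K, hK, hxK⟩ := mem_support.1 hx
  rw [← closure_interior_tri (T.sarea_ne hK)] at hxK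
  exact closure_mono (hΩ.interior_tri_subset hK) hxK

variable (T) in
lemma ae_mem_interior_of_mem_support :
    ∀ᵐ x : Pt, x ∈ T.support → ∃ K ∈ T.cells, x ∈ interior (tri K) := by
  have : ∀ᵐ x : Pt, ∀ K ∈ T.cells, x ∈ tri K → x ∈ interior (tri K) :=
    (Finset.eventually_all _).2 fun K _ => ae_mem_interior_of_mem_tri K
  filter_upwards [this] with x hx hs
  obtain ⟨K, hK, hxK⟩ := mem_support.1 hs
  exact ⟨K, hK, hx K hK hxK⟩

lemma Meshes.ae_notMem_frontier (hΩ : T.Meshes Ω) : ∀ᵐ x : Pt, x ∉ frontier Ω := by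
  filter_upwards [T.ae_mem_interior_of_mem_support] with x hx hf
  obtain ⟨K, hK, hxK⟩ := hx (hΩ.closure_eq ▸ hf.1)
  exact hf.2 (hΩ.isOpen.interior_eq.symm ▸ hΩ.interior_tri_subset hK hxK)

lemma Meshes.pos_of_mem (hΩ : T.Meshes Ω) (hx : x ∈ Ω) : 0 < x 0 := by
  have h0 : 0 ≤ x 0 := by
    obtain ⟨K, hK, hxK⟩ := mem_support.1 (hΩ.subset_support hx)
    exact nonneg_of_mem hK hxK
  by_contra h
  have h0 := le_antisymm (not_lt.1 h) h0
  have hc : Tendsto (fun t : ℝ => x - t • single 0 1) (𝓝[>] 0)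
      (𝓝 x) := by
    have : Continuous fun t : ℝ => x - t • single 0 1 := by fun_prop
    have := this.tendsto 0
    simp only [zero_smul, sub_zero] at this
    exact this.mono_left nhdsWithin_le_nhds
  obtain ⟨t, ht, ht0⟩ :=
    ((hc.eventually (hΩ.isOpen.mem_nhds hx)).and self_mem_nhdsWithin).exists
  obtain ⟨K, hK, hxK⟩ := mem_support.1 (hΩ.subset_support ht)
  have h1 := nonneg_of_mem hK hxK
  have ht0' := ht0
  simp [h0] at h1
  linarith

end Meshes

open Classical in
variable (T) in
/-- The continuous piecewise affine hat function of the vertex `a`, on the closed polygon. -/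
def hat (a x : Pt) : ℝ := if h : ∃ K ∈ T.cells, x ∈ tri K then hatOn h.choose a x else 0

lemma hat_eq (hK : K ∈ T.cells) (hx : x ∈ tri K) (a : Pt) : T.hat a x = hatOn K a x := by
  have h : ∃ K ∈ T.cells, x ∈ tri K := ⟨K, hK, hx⟩
  rw [hat, dif_pos h]
  exact hatOn_eq_hatOn h.choose_spec.1 hK h.choose_spec.2 hx a

end Triangulation

/-! ### Shape regular and quasi-uniform meshes -/

namespace Triangulation

/-- Quantitative regularity of a mesh, with one constant `A`: barycentric coordinates are
`A / h`-Lipschitz, and each triangle has a vertex whose distance from the axis is at least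
`h / A`. -/
structure Regular (T : Triangulation) (A : ℝ) : Prop where
  one_le : 1 ≤ A
  pos : 0 < T.meshSize
  dist_le : ∀ K ∈ T.cells, ∀ x ∈ tri K, ∀ y ∈ tri K, dist x y ≤ T.meshSize
  bary_lip : ∀ K ∈ T.cells, ∀ i x y, |bary K i x - bary K i y| ≤ A / T.meshSize * dist x y
  radius : ∀ K ∈ T.cells, ∃ i, T.meshSize ≤ A * K i 0

lemma diam_le_meshSize (hK : K ∈ T.cells) : diam (tri K) ≤ T.meshSize :=
  le_csSup ((T.cells.finite_toSet.image _).bddAbove) ⟨K, hK, rfl⟩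

/-- Shape regular, quasi-uniform meshes are regular with a constant that depends only on the two
mesh parameters. -/
theorem regular_of_shapeRegular {σ τ : ℝ} (hσ : T.ShapeRegular σ) (hτ : T.QuasiUniform τ)
    (hne : T.cells.Nonempty) : T.Regular (max 1 (2 * σ * τ)) := by
  have hdist : ∀ K ∈ T.cells, ∀ x ∈ tri K, ∀ y ∈ tri K, dist x y ≤ T.meshSize :=
    fun K hK x hx y hy => (dist_le_diam_of_mem (isCompact_tri K).isBounded hx hy).trans
      (diam_le_meshSize hK)
  have hpos : 0 < T.meshSize := by
    obtain ⟨K, hK⟩ := hne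
    have h01 : K 0 ≠ K 1 := (T.inj hK).ne (by decide)
    exact (dist_pos.2 h01).trans_le
      (hdist K hK _ (vertex_mem_tri K 0) _ (vertex_mem_tri K 1))
  have hball : ∀ K ∈ T.cells, ∃ (c : Pt) (t : ℝ), 0 < t ∧
      T.meshSize ≤ max 1 (2 * σ * τ) * t ∧ closedBall c t ⊆ tri K := by
    intro K hK
    have h1 := hσ K hK
    have h2 := hτ K hK
    have hdpos : 0 < diam (tri K) := by
      have h01 : K 0 ≠ K 1 := (T.inj hK).ne (by decide)
      exact (dist_pos.2 h01).trans_le (dist_le_diam_of_mem (isCompact_tri K).isBounded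
        (vertex_mem_tri K 0) (vertex_mem_tri K 1))
    have hτ0 : 0 < τ := by
      nlinarith
    have hin : 0 ≤ inDiam (tri K) := by
      refine Real.sSup_nonneg ?_
      grind
    have hσ0 : 0 < σ := by
      nlinarith
    have h3 : diam (tri K) / σ < inDiam (tri K) := by
      rw [div_lt_iff₀ hσ0]; linarith
    obtain ⟨d, ⟨c, t, ht, rfl, hsub⟩, hd⟩ := exists_lt_of_lt_csSup (s := {d | ∃ (c : Pt) (t : ℝ),
      0 ≤ t ∧ d = 2 * t ∧ closedBall c t ⊆ tri K})
      ⟨0, K 0, 0, le_rfl, by simp, by simpa using vertex_mem_tri K 0⟩ h3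
    rw [div_lt_iff₀ hσ0] at hd
    have ht0 : 0 < t := by
      nlinarith
    refine ⟨c, t, ht0, ?_, hsub⟩
    calc T.meshSize ≤ τ * diam (tri K) := h2
      _ ≤ τ * (2 * t * σ) := by gcongr
      _ = (2 * σ * τ) * t := by ring
      _ ≤ _ := by simp_all
  refine ⟨le_max_left _ _, hpos, hdist, fun K hK i x y => ?_, fun K hK => ?_⟩
  · obtain ⟨c, t, ht, hA, hsub⟩ := hball K hK
    rcases eq_or_ne x y with rfl | hxy
    · simp
    have hd := dist_pos.2 hxy
    have hmem : c + (t / dist x y) • (x - y) ∈ tri K := by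
      refine hsub ?_
      rw [mem_closedBall, dist_eq_norm, add_sub_cancel_left, norm_smul, norm_eq_abs,
        abs_of_pos (by positivity), ← dist_eq_norm, div_mul_cancel₀ _ hd.ne']
    have hc := hsub (mem_closedBall_self ht.le)
    have hs := T.sarea_ne hK
    have e1 := bary_sub K i (c + (t / dist x y) • (x - y)) c
    have e2 := bary_sub K i x y
    simp only [add_apply, smul_apply, sub_apply, smul_eq_mul,
      add_sub_cancel_left] at e1
    have e3 : bary K i (c + (t / dist x y) • (x - y)) - bary K i c =
        (t / dist x y) * (bary K i x - bary K i y) := by rw [e1, e2]; ring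
    have hle : |bary K i (c + (t / dist x y) • (x - y)) - bary K i c| ≤ 1 := by
      rw [abs_le]
      constructor <;>
        linarith [(mem_tri_iff hs _).1 hmem i, (mem_tri_iff hs _).1 hc i, bary_le_one hs hmem i,
          bary_le_one hs hc i]
    rw [e3, abs_mul, abs_of_pos (by positivity), div_mul_eq_mul_div, div_le_one hd] at hle
    rw [div_mul_eq_mul_div, le_div_iff₀ hpos]
    nlinarith
  · obtain ⟨c, t, ht, hA, hsub⟩ := hball K hK
    have hs := T.sarea_ne hK
    have hmem : c - t • single 0 1 ∈ tri K := by
      refine hsub ?_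
      simp [norm_smul, abs_of_pos ht]
    have h0 := nonneg_of_mem hK hmem
    simp at h0
    by_contra! hlt
    have hc := hsub (mem_closedBall_self ht.le)
    have hA0 : 0 < max 1 (2 * σ * τ) := lt_max_of_lt_left one_pos
    have h2 : max 1 (2 * σ * τ) * c 0 < T.meshSize := by
      rw [← bary_combo_apply hs c 0, mul_sum]
      have h1 := bary_sum hs c
      calc _ ≤ ∑ i, bary K i c * (max 1 (2 * σ * τ) * K i 0) := by
            grind
        _ < ∑ i, bary K i c * T.meshSize := by
            refine Finset.sum_lt_sum (fun i _ => mul_le_mul_of_nonneg_left (hlt i).le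
              ((mem_tri_iff hs c).1 hc i)) ?_
            by_contra! hcon
            have : ∑ i, bary K i c ≤ 0 := Finset.sum_nonpos fun i hi => by
              have := hcon i hi
              by_contra! hb
              nlinarith [hlt i]
            linarith
        _ = T.meshSize := by rw [← sum_mul, h1, one_mul]
    nlinarith

namespace Regular

lemma grad_le (hT : T.Regular A) (hK : K ∈ T.cells) (i : Fin 3) (m : Fin 2) :
    |gradBary K i m| ≤ A / T.meshSize := by
  have h := hT.bary_lip K hK i (single m 1) 0
  rw [bary_sub] at h
  fin_cases m <;> simpa using h

lemma edge_ge (hT : T.Regular A) (hK : K ∈ T.cells) (hij : i ≠ j) :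
    T.meshSize ≤ A * dist (K i) (K j) := by
  have h := hT.bary_lip K hK i (K i) (K j)
  rw [bary_vertex (T.sarea_ne hK), bary_vertex (T.sarea_ne hK)] at h
  simp only [if_true, if_neg hij, sub_zero, abs_one] at h
  rwa [div_mul_eq_mul_div, one_le_div hT.pos] at h

lemma dist_le_add (x y : Pt) : dist x y ≤ |x 0 - y 0| + |x 1 - y 1| := by
  rw [EuclideanSpace.dist_eq, sum_univ_two, Real.dist_eq, Real.dist_eq]
  refine Real.sqrt_le_iff.2 ⟨by positivity, ?_⟩
  nlinarith [mul_nonneg (abs_nonneg (x 0 - y 0)) (abs_nonneg (x 1 - y 1))]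

lemma sarea_ge (hT : T.Regular A) (hK : K ∈ T.cells) : T.meshSize ^ 2 ≤ 2 * A ^ 2 * |sarea K| := by
  have hs := T.sarea_ne hK
  have hA := hT.one_le
  have h := hT.pos
  have e1 : |K 2 0 - K 1 0| ≤ A / T.meshSize * |sarea K| := by
    have := hT.grad_le hK 0 1
    rw [gradBary_one, abs_div, div_le_iff₀ (abs_pos.2 hs)] at this
    simpa using this
  have e2 : |K 2 1 - K 1 1| ≤ A / T.meshSize * |sarea K| := by
    have := hT.grad_le hK 0 0
    rw [gradBary_zero, abs_div, div_le_iff₀ (abs_pos.2 hs)] at this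
    simpa [abs_sub_comm] using this
  have e3 := dist_le_add (K 2) (K 1)
  have e4 := hT.edge_ge hK (i := 2) (j := 1) (by decide)
  have e5 : T.meshSize ≤ A * (2 * (A / T.meshSize * |sarea K|)) :=
    e4.trans (by gcongr; linarith)
  calc T.meshSize ^ 2 = T.meshSize * T.meshSize := by ring
    _ ≤ T.meshSize * (A * (2 * (A / T.meshSize * |sarea K|))) := by gcongr
    _ = _ := by field_simp

lemma sarea_le (hT : T.Regular A) (hK : K ∈ T.cells) :
    |sarea K| ≤ 2 * T.meshSize ^ 2 := by
  have hc : ∀ i m, |(K i - K 0) m| ≤ T.meshSize := fun i m => by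
    rw [sub_apply]
    exact (abs_coord_sub_le_dist _ _ m).trans
      (hT.dist_le K hK _ (vertex_mem_tri K i) _ (vertex_mem_tri K 0))
  have h := hT.pos
  rw [sarea, cross]
  calc _ ≤ |(K 1 - K 0) 0 * (K 2 - K 0) 1| + |(K 1 - K 0) 1 * (K 2 - K 0) 0| := abs_sub _ _
    _ ≤ T.meshSize * T.meshSize + T.meshSize * T.meshSize := by
        rw [abs_mul, abs_mul]
        gcongr <;> apply hc
    _ = _ := by ring

end Regular

end Triangulation

lemma integral_refTri_const (c : ℝ) : ∫ _ in refTri, c = c / 2 := by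
  rw [setIntegral_refTri continuous_const]
  simp only [intervalIntegral.integral_const, smul_eq_mul, sub_zero]
  rw [intervalIntegral.integral_mul_const, intervalIntegral.integral_sub (by simp) (by simp)]
  simp
  ring

lemma volume_real_tri (h : sarea K ≠ 0) : volume.real (tri K) = |sarea K| / 2 := by
  have := setIntegral_tri h (fun _ => 1)
  rw [integral_refTri_const, setIntegral_const, smul_eq_mul, mul_one] at this
  linarith

namespace Triangulation

open Classical in
/-- The triangles at a distance of at most about `4 h` from `K`. -/
def near (T : Triangulation) (K : Tri) : Finset Tri :=
  T.cells.filter fun K' => dist (K' 0) (K 0) ≤ 4 * T.meshSize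

lemma mem_near : K' ∈ T.near K ↔ K' ∈ T.cells ∧ dist (K' 0) (K 0) ≤ 4 * T.meshSize := by simp [near]

lemma aedisjoint_tri (hK : K ∈ T.cells) (hK' : K' ∈ T.cells) (hne : K ≠ K') :
    AEDisjoint volume (tri K) (tri K') := by
  refine measure_mono_null (t := frontier (tri K)) ?_ (volume_frontier_tri K)
  rintro x ⟨hx, hx'⟩
  exact ⟨subset_closure hx, fun h => hne (eq_of_mem_interior hK hK' h hx')⟩

lemma Regular.card_near_le (hT : T.Regular A) (K : Tri) : ((T.near K).card : ℝ) ≤ 400 * A ^ 2 := by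
  have h := hT.pos
  have hA := hT.one_le
  have h1 : ∑ K' ∈ T.near K, volume.real (tri K') ≤
      volume.real (closedBall (K 0) (5 * T.meshSize)) := by
    rw [← measureReal_biUnion_finset₀ (fun K₁ h₁ K₂ h₂ hne =>
      aedisjoint_tri (mem_near.1 h₁).1 (mem_near.1 h₂).1 hne)
      (fun K' _ => (isCompact_tri K').measurableSet.nullMeasurableSet)
      (fun K' _ => (isCompact_tri K').measure_lt_top.ne)]
    refine measureReal_mono ?_ (measure_closedBall_lt_top).ne
    refine iUnion₂_subset fun K' hK' x hx => ?_
    obtain ⟨h1, h2⟩ := mem_near.1 hK'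
    have h3 := hT.dist_le K' h1 x hx _ (vertex_mem_tri K' 0)
    rw [mem_closedBall]
    linarith [dist_triangle x (K' 0) (K 0)]
  have h2 : volume.real (closedBall (K 0) (5 * T.meshSize)) ≤ 100 * T.meshSize ^ 2 := by
    rw [measureReal_def, EuclideanSpace.volume_closedBall_fin_two]
    simp only [ENNReal.toReal_mul, ENNReal.toReal_pow, 
      ENNReal.toReal_ofReal (by positivity : 0 ≤ 5 * T.meshSize), ENNReal.toReal_ofReal Real.pi_pos.le]
    nlinarith [Real.pi_le_four, sq_nonneg T.meshSize]
  have h3 : ∑ K' ∈ T.near K, T.meshSize ^ 2 / (4 * A ^ 2) ≤ ∑ K' ∈ T.near K, volume.real (tri K') := by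
    refine sum_le_sum fun K' hK' => ?_
    have hK := (mem_near.1 hK').1
    rw [volume_real_tri (T.sarea_ne hK), div_le_iff₀ (by positivity)]
    nlinarith [hT.sarea_ge hK]
  rw [sum_const, nsmul_eq_mul] at h3
  have h4 := h3.trans (h1.trans h2)
  rw [mul_div_assoc', div_le_iff₀ (by positivity)] at h4
  have h5 : 0 < T.meshSize ^ 2 := by positivity
  nlinarith

end Triangulation

/-! ### Folding by a reflection -/

/-- A function on a convex set that is Lipschitz at each point with the same constant is Lipschitz
with that constant. -/
lemma abs_sub_le_of_eventually {C : Set Pt} (hC : Convex ℝ C)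
    (h : ∀ z ∈ C, ∀ᶠ z' in 𝓝[C] z, |f z' - f z| ≤ M * dist z' z) (hx : x ∈ C) (hy : y ∈ C) :
    |f y - f x| ≤ M * dist y x := by
  set c : ℝ → Pt := fun s => x + s • (y - x) with hc
  have hcc : Continuous c := by fun_prop
  have hmem : ∀ s ∈ Icc 0 1, c s ∈ C := fun s hs => hC.add_smul_sub_mem hx hy hs
  have hdist : ∀ s t, dist (c s) (c t) = |s - t| * dist y x := fun s t => by
    rw [dist_eq_norm, dist_eq_norm, hc]
    simp only [add_sub_add_left_eq_sub, ← sub_smul, norm_smul, norm_eq_abs]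
  have hloc : ∀ s ∈ Icc 0 1, ∀ᶠ t in 𝓝[Icc 0 1] s,
      |f (c t) - f (c s)| ≤ M * (|t - s| * dist y x) := by
    intro s hs
    have ht : Tendsto c (𝓝[Icc 0 1] s) (𝓝[C] (c s)) :=
      tendsto_nhdsWithin_iff.2 ⟨hcc.continuousAt.mono_left nhdsWithin_le_nhds,
        eventually_nhdsWithin_of_forall hmem⟩
    filter_upwards [ht.eventually (h _ (hmem s hs))] with t ht
    rwa [hdist] at ht
  have hcont : ContinuousOn (fun s => f (c s)) (Icc 0 1) := by
    intro s hs
    rw [ContinuousWithinAt, tendsto_iff_dist_tendsto_zero]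
    refine squeeze_zero' (.of_forall fun _ => dist_nonneg) (hloc s hs) ?_
    have : Continuous fun t => M * (|t - s| * dist y x) := by fun_prop
    have := this.tendsto s
    simp only [sub_self, abs_zero, zero_mul, mul_zero] at this
    exact this.mono_left nhdsWithin_le_nhds
  have hsub : Icc 0 1 ⊆ {s | |f (c s) - f (c 0)| ≤ M * (s * dist y x)} := by
    refine IsClosed.Icc_subset_of_forall_exists_gt ?_ (by simp) ?_
    · have h1 : ContinuousOn (fun s => |f (c s) - f (c 0)| - M * (s * dist y x)) (Icc 0 1) :=
        ((hcont.sub continuousOn_const).abs).sub (by fun_prop)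
      have := h1.preimage_isClosed_of_isClosed isClosed_Icc (isClosed_Iic (a := 0))
      convert this using 1
      grind
    · rintro s ⟨hs, hs1⟩ t hst
      have hst' := hst
      have h1 := hloc s ⟨hs1.1, hs1.2.le⟩
      have h2 := Ioc_mem_nhdsGT (lt_min hst' hs1.2)
      have h3 : 𝓝[Ioc s (min t 1)] s ≤ 𝓝[Icc 0 1] s := nhdsWithin_mono _ fun r hr =>
        ⟨hs1.1.trans hr.1.le, hr.2.trans (min_le_right _ _)⟩
      have h4 : 𝓝[>] s ≤ 𝓝[Icc 0 1] s := by
        simp_all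
      obtain ⟨r, hr, hr'⟩ := ((h1.filter_mono h4).and h2).exists
      refine ⟨r, ?_, hr'.1, hr'.2.trans (min_le_left _ _)⟩
      simp only [mem_ofPred_eq] at hs ⊢
      rw [abs_of_pos (show 0 < r - s by linarith [hr'.1])] at hr
      grind
  have := hsub (right_mem_Icc.2 zero_le_one)
  simpa [hc] using this

lemma exists_frontier_mem_segment {S : Set Pt} (hx : x ∈ S) (hy : y ∉ S) :
    ∃ w ∈ segment ℝ x y, w ∈ frontier S := by
  by_contra! h
  have hsub : segment ℝ x y ⊆ interior S := by
    refine (convex_segment x y).isPreconnected.subset_left_of_subset_union isOpen_interior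
      isClosed_closure.isOpen_compl (v := (closure S)ᶜ) ?_ ?_ ?_
    · exact disjoint_compl_right_iff_subset.2 (interior_subset.trans subset_closure)
    · intro w hw
      by_contra hn
      rw [mem_union, not_or, mem_compl_iff, not_not] at hn
      exact h w hw ⟨hn.2, hn.1⟩
    · refine ⟨x, left_mem_segment ℝ x y, ?_⟩
      by_contra hn
      exact h x (left_mem_segment ℝ x y) ⟨subset_closure hx, hn⟩
  exact hy (interior_subset (hsub (right_mem_segment ℝ x y)))

/-- The part of the open half plane at a distance less than `ε` from `S`. -/
def collar (ε : ℝ) (S : Set Pt) : Set Pt := thickening ε S ∩ halfPlane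

lemma isOpen_halfPlane : IsOpen halfPlane := isOpen_lt continuous_const (by fun_prop)

lemma convex_halfPlane : Convex ℝ halfPlane := by
  intro x hx y hy s t hs ht hst
  simp only [halfPlane, mem_ofPred_eq, add_apply, smul_apply, smul_eq_mul] at *
  rcases hs.eq_or_lt with rfl | hs
  · simp_all
  · positivity

lemma isOpen_collar (ε : ℝ) (S : Set Pt) : IsOpen (collar ε S) :=
  isOpen_thickening.inter isOpen_halfPlane

lemma convex_collar (ε : ℝ) {S : Set Pt} (hS : Convex ℝ S) : Convex ℝ (collar ε S) :=
  (hS.thickening ε).inter convex_halfPlane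

lemma collar_mono {ε' : ℝ} {S S' : Set Pt} (h : ε ≤ ε') (hS : S ⊆ S') : collar ε S ⊆ collar ε' S' :=
  inter_subset_inter_left _ ((thickening_mono h S).trans
    (thickening_subset_of_subset ε' hS))

open Classical in
/-- The folding map: the identity on `Ω` and the reflection `ψ` elsewhere. -/
def fold (Ω : Set Pt) (ψ : Pt → Pt) (x : Pt) : Pt := if x ∈ Ω then x else ψ x

/-- `ψ` is a reflection across `∂Ω`, bi-Lipschitz with constant `L`, on the collar of width `ε`. -/
structure Folds (Ω : Set Pt) (ψ : Pt → Pt) (L ε : ℝ) : Prop where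
  one_le : 1 ≤ L
  eps_pos : 0 < ε
  isOpen : IsOpen Ω
  pos : Ω ⊆ halfPlane
  ae_notMem_frontier : ∀ᵐ x : Pt, x ∉ frontier Ω
  mapsTo : ∀ x ∈ collar ε (closure Ω), x ∉ closure Ω → ψ x ∈ Ω
  fixed : ∀ x ∈ frontier Ω ∩ halfPlane, ψ x = x
  lip : ∀ x ∈ collar ε (closure Ω) \ Ω, ∀ y ∈ collar ε (closure Ω) \ Ω,
    dist (ψ x) (ψ y) ≤ L * dist x y
  antilip : ∀ x ∈ collar ε (closure Ω) \ Ω, ∀ y ∈ collar ε (closure Ω) \ Ω,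
    dist x y ≤ L * dist (ψ x) (ψ y)

lemma IsReflection.exists_folds {U : Set Pt} (h : IsReflection Ω U ψ) (hc : IsCompact (closure Ω)) :
    ∃ L ε : ℝ, ∀ T : Triangulation, T.Meshes Ω → Folds Ω ψ L ε := by
  obtain ⟨ε, hε, hsub⟩ := hc.exists_thickening_subset_open h.isOpen h.closure_subset
  obtain ⟨L₁, h₁⟩ := h.lipschitz
  obtain ⟨L₂, h₂⟩ := h.antilipschitz
  have hN : collar ε (closure Ω) ⊆ U ∩ halfPlane := inter_subset_inter_left _ hsub
  refine ⟨max 1 (max L₁ L₂), ε, fun T hT => ⟨le_max_left _ _, hε, hT.isOpen,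
    fun x hx => hT.pos_of_mem hx, hT.ae_notMem_frontier,
    fun x hx hn => h.mapsTo x ⟨hN hx, hn⟩, h.fixed, fun x hx y hy => ?_, fun x hx y hy => ?_⟩⟩
  · refine (h₁ x ⟨hN hx.1, hx.2⟩ y ⟨hN hy.1, hy.2⟩).trans ?_
    gcongr
    simp
  · refine (h₂ x ⟨hN hx.1, hx.2⟩ y ⟨hN hy.1, hy.2⟩).trans ?_
    gcongr
    simp

namespace Folds

lemma mono (h : Folds Ω ψ L ε) {ε' : ℝ} (hε' : 0 < ε') (hle : ε' ≤ ε) : Folds Ω ψ L ε' := by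
  have hs : collar ε' (closure Ω) ⊆ collar ε (closure Ω) := collar_mono hle subset_rfl
  exact ⟨h.one_le, hε', h.isOpen, h.pos, h.ae_notMem_frontier, fun x hx => h.mapsTo x (hs hx),
    h.fixed, fun x hx y hy => h.lip x ⟨hs hx.1, hx.2⟩ y ⟨hs hy.1, hy.2⟩,
    fun x hx y hy => h.antilip x ⟨hs hx.1, hx.2⟩ y ⟨hs hy.1, hy.2⟩⟩

lemma fold_mem (h : Folds Ω ψ L ε) (hx : x ∈ collar ε (closure Ω)) :
    fold Ω ψ x ∈ closure Ω ∩ halfPlane := by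
  by_cases hΩ : x ∈ Ω
  · rw [fold, if_pos hΩ]
    exact ⟨subset_closure hΩ, h.pos hΩ⟩
  rw [fold, if_neg hΩ]
  by_cases hc : x ∈ closure Ω
  · have hf : x ∈ frontier Ω := ⟨hc, fun hi => hΩ (interior_subset hi)⟩
    rw [h.fixed x ⟨hf, hx.2⟩]
    exact ⟨hc, hx.2⟩
  · exact ⟨subset_closure (h.mapsTo x hx hc), h.pos (h.mapsTo x hx hc)⟩

lemma mem_collar (h : Folds Ω ψ L ε) (hx : x ∈ Ω) : x ∈ collar ε (closure Ω) :=
  ⟨self_subset_thickening h.eps_pos _ (subset_closure hx), h.pos hx⟩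

lemma dist_fold_le (h : Folds Ω ψ L ε) {C : Set Pt} (hC : Convex ℝ C)
    (hCN : C ⊆ collar ε (closure Ω)) (hx : x ∈ C) (hy : y ∈ C) :
    dist (fold Ω ψ x) (fold Ω ψ y) ≤ L * dist x y := by
  have hL := h.one_le
  have key : ∀ x ∈ C, ∀ y ∈ C, x ∈ Ω → y ∉ Ω → dist x (ψ y) ≤ L * dist x y := by
    intro x hx y hy hxΩ hyΩ
    obtain ⟨w, hw, hwf⟩ := exists_frontier_mem_segment hxΩ hyΩ
    have hwC := hC.segment_subset hx hy hw
    have hwn : w ∉ Ω := fun hn => hwf.2 (h.isOpen.interior_eq.symm ▸ hn)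
    have h1 := h.lip w ⟨hCN hwC, hwn⟩ y ⟨hCN hy, hyΩ⟩
    rw [h.fixed w ⟨hwf, (hCN hwC).2⟩] at h1
    have h2 := dist_add_dist_of_mem_segment hw
    have h3 := dist_triangle x w (ψ y)
    nlinarith [dist_nonneg (x := x) (y := w)]
  by_cases hxΩ : x ∈ Ω <;> by_cases hyΩ : y ∈ Ω
  · rw [fold, fold, if_pos hxΩ, if_pos hyΩ]
    nlinarith [dist_nonneg (x := x) (y := y)]
  · rw [fold, fold, if_pos hxΩ, if_neg hyΩ]
    grind
  · rw [fold, fold, if_neg hxΩ, if_pos hyΩ, dist_comm (ψ x) y, dist_comm x y]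
    grind
  · rw [fold, fold, if_neg hxΩ, if_neg hyΩ]
    exact h.lip x ⟨hCN hx, hxΩ⟩ y ⟨hCN hy, hyΩ⟩

/-- The folding map is nonsingular: preimages of null sets are null. -/
lemma ae_fold (h : Folds Ω ψ L ε) (hp : ∀ᵐ x, p x) :
    ∀ᵐ x, x ∈ collar ε (closure Ω) → p (fold Ω ψ x) := by
  set S := collar ε (closure Ω) \ Ω
  have hanti : AntilipschitzWith (Real.toNNReal L) (fun x : S => ψ x) := by
    refine AntilipschitzWith.of_le_mul_dist fun x y => ?_
    rw [Real.coe_toNNReal _ (zero_le_one.trans h.one_le)]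
    exact h.antilip x x.2 y y.2
  have h0 : Measure.hausdorffMeasure 2 {x : Pt | ¬ p x} = 0 := by
    have hac : (Measure.hausdorffMeasure 2 : Measure Pt) ≪ volume := by
      have : ((Module.finrank ℝ Pt : ℕ) : ℝ) = 2 := by simp
      rw [← this]
      exact Measure.absolutelyContinuous_isAddHaarMeasure _ _
    exact hac hp
  have h1 := hanti.hausdorffMeasure_preimage_le (d := 2) (by norm_num) {x : Pt | ¬ p x}
  rw [h0, mul_zero, nonpos_iff_eq_zero] at h1
  have h2 : Measure.hausdorffMeasure 2 (((↑) : S → Pt) '' ((fun x : S => ψ x) ⁻¹' {x | ¬ p x})) = 0 := by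
    rw [isometry_subtype_coe.hausdorffMeasure_image (Or.inl (by norm_num)), h1]
  have h3 : volume (((↑) : S → Pt) '' ((fun x : S => ψ x) ⁻¹' {x | ¬ p x})) = 0 := by
    have hac : (volume : Measure Pt) ≪ Measure.hausdorffMeasure 2 := by
      have : ((Module.finrank ℝ Pt : ℕ) : ℝ) = 2 := by simp
      rw [← this]
      exact Measure.absolutelyContinuous_isAddHaarMeasure _ _
    exact hac h2
  filter_upwards [hp, measure_eq_zero_iff_ae_notMem.1 h3] with x hx hx' hxc
  by_cases hΩ : x ∈ Ω
  · rwa [fold, if_pos hΩ]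
  · rw [fold, if_neg hΩ]
    aesop

end Folds

/-! ### Hat functions composed with the folding map -/

/-- The affine function `hatOn K a` as a sum of its value at the origin and a linear form. -/
def gradHatForm (K : Tri) (a : Pt) : Pt →L[ℝ] ℝ :=
  gradHatOn K a 0 • proj 0 + gradHatOn K a 1 • proj 1

lemma hasFDerivAt_hatOn (K : Tri) (a x : Pt) : HasFDerivAt (hatOn K a) (gradHatForm K a) x := by
  have h : hatOn K a = fun y => hatOn K a 0 + gradHatForm K a y := by
    funext y
    have := hatOn_sub K a y 0
    simp only [PiLp.zero_apply, sub_zero] at this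
    simp [gradHatForm]
    linarith
  rw [h]
  fun_prop

lemma continuous_hatOn (K : Tri) (a : Pt) : Continuous (hatOn K a) :=
  continuous_iff_continuousAt.2 fun x => (hasFDerivAt_hatOn K a x).continuousAt

open Classical in
/-- The Jacobian matrix of the folding map. -/
def foldJac (Ω : Set Pt) (ψ : Pt → Pt) (x : Pt) : Matrix (Fin 2) (Fin 2) ℝ :=
  if x ∈ Ω then 1 else jacMap ψ x

namespace Triangulation

lemma hat_mem_Icc (a x : Pt) : T.hat a x ∈ Icc (0 : ℝ) 1 := by
  by_cases h : ∃ K ∈ T.cells, x ∈ tri K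
  · obtain ⟨K, hK, hx⟩ := h
    rw [hat_eq hK hx]
    by_cases ha : a ∈ range K
    · obtain ⟨i, rfl⟩ := ha
      rw [hatOn_self (T.inj hK)]
      exact ⟨(mem_tri_iff (T.sarea_ne hK) x).1 hx i, bary_le_one (T.sarea_ne hK) hx i⟩
    · rw [hatOn_of_notMem ha]
      simp
  · rw [hat, dif_neg h]
    simp

lemma Regular.hatOn_lip (hT : T.Regular A) (hK : K ∈ T.cells) (a x y : Pt) :
    |hatOn K a x - hatOn K a y| ≤ A / T.meshSize * dist x y := by
  by_cases ha : a ∈ range K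
  · obtain ⟨i, rfl⟩ := ha
    rw [hatOn_self (T.inj hK), hatOn_self (T.inj hK)]
    exact hT.bary_lip K hK i x y
  · rw [hatOn_of_notMem ha, hatOn_of_notMem ha, sub_self, abs_zero]
    have := hT.pos
    have := hT.one_le
    positivity

/-- Near a point of the mesh one only meets triangles that contain this point. -/
lemma eventually_mem_tri_imp (p : Pt) : ∀ᶠ p' in 𝓝 p, ∀ K ∈ T.cells, p' ∈ tri K → p ∈ tri K := by
  refine (Finset.eventually_all _).2 fun K _ => ?_
  by_cases hp : p ∈ tri K
  · simp_all
  · filter_upwards [(isCompact_tri K).isClosed.isOpen_compl.mem_nhds hp] with p' hp' h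
    exact absurd h hp'

end Triangulation

lemma Folds.hat_fold_lip (h : Folds Ω ψ L ε) (hM : T.Meshes Ω) (hT : T.Regular A) (hK : K ∈ T.cells)
    (a : Pt) (hx : x ∈ collar ε (tri K)) (hy : y ∈ collar ε (tri K)) :
    |T.hat a (fold Ω ψ y) - T.hat a (fold Ω ψ x)| ≤ A * L / T.meshSize * dist y x := by
  have hC := convex_collar ε (convex_tri K)
  have hsub : collar ε (tri K) ⊆ collar ε (closure Ω) := by
    refine collar_mono le_rfl ?_
    rw [hM.closure_eq]
    exact tri_subset_support hK
  have hpos := hT.pos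
  have hA := hT.one_le
  refine abs_sub_le_of_eventually (f := fun z => T.hat a (fold Ω ψ z)) hC (fun z hz => ?_) hx hy
  have hcont : Tendsto (fold Ω ψ) (𝓝[collar ε (tri K)] z) (𝓝 (fold Ω ψ z)) := by
    rw [tendsto_iff_dist_tendsto_zero]
    refine squeeze_zero' (.of_forall fun _ => dist_nonneg)
      (eventually_nhdsWithin_of_forall fun z' hz' => h.dist_fold_le hC hsub hz' hz) ?_
    have : Continuous fun t => L * dist t z := by fun_prop
    have := this.tendsto z
    simp only [dist_self, mul_zero] at this
    exact this.mono_left nhdsWithin_le_nhds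
  filter_upwards [hcont.eventually (T.eventually_mem_tri_imp (fold Ω ψ z)), self_mem_nhdsWithin]
    with z' hz' hzC
  have hs := (h.fold_mem (hsub hzC)).1
  rw [hM.closure_eq] at hs
  obtain ⟨K', hK', hzK⟩ := mem_support.1 hs
  rw [hat_eq hK' hzK, hat_eq hK' (hz' K' hK' hzK)]
  refine (hT.hatOn_lip hK' a _ _).trans ?_
  have := h.dist_fold_le hC hsub hzC hz
  calc A / T.meshSize * dist (fold Ω ψ z') (fold Ω ψ z) ≤ A / T.meshSize * (L * dist z' z) := by
        gcongr
    _ = _ := by ring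

/-- A regular mesh of `Ω` together with globally Lipschitz functions `F a` that agree on the
collar with the hat functions `hat a ∘ fold`. -/
structure FoldedMesh (Ω : Set Pt) (ψ : Pt → Pt) (T : Triangulation) (L A ε : ℝ)
    (F : Pt → Pt → ℝ) : Prop extends Folds Ω ψ L ε where
  meshes : T.Meshes Ω
  reg : T.Regular A
  exists_lip : ∃ C : ℝ≥0, ∀ a, LipschitzWith C (F a)
  mem_Icc : ∀ a x, F a x ∈ Icc (0 : ℝ) 1
  eq_hat : ∀ a, ∀ x ∈ collar ε (closure Ω), F a x = T.hat a (fold Ω ψ x)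

theorem Folds.exists_foldedMesh (h : Folds Ω ψ L ε) (hM : T.Meshes Ω) (hT : T.Regular A) :
    ∃ F, FoldedMesh Ω ψ T L A (ε / 2) F := by
  have hε := h.eps_pos
  have hpos := hT.pos
  have hA := hT.one_le
  have hL := h.one_le
  set C : ℝ≥0 := Real.toNNReal (max (A * L / T.meshSize) (2 / ε)) with hC
  have hCr : (C : ℝ) = max (A * L / T.meshSize) (2 / ε) :=
    Real.coe_toNNReal _ (le_max_of_le_right (by positivity))
  have hlip : ∀ a, LipschitzOnWith C (fun x => T.hat a (fold Ω ψ x))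
      (collar (ε / 2) (closure Ω)) := by
    intro a
    refine LipschitzOnWith.of_dist_le_mul fun x hx y hy => ?_
    rw [hCr, Real.dist_eq]
    by_cases hd : dist x y < ε / 2
    · have hx' := hx.1
      rw [hM.closure_eq, mem_thickening_iff] at hx'
      obtain ⟨p, hp, hxp⟩ := hx'
      obtain ⟨K, hK, hpK⟩ := mem_support.1 hp
      refine (h.hat_fold_lip hM hT hK a ⟨?_, hy.2⟩ ⟨?_, hx.2⟩).trans ?_
      · refine mem_thickening_iff.2 ⟨p, hpK, ?_⟩
        linarith [dist_triangle_left y p x]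
      · exact mem_thickening_iff.2 ⟨p, hpK, by linarith⟩
      · gcongr
        exact le_max_left _ _
    · have h1 := T.hat_mem_Icc a (fold Ω ψ x)
      have h2 := T.hat_mem_Icc a (fold Ω ψ y)
      have h3 : |T.hat a (fold Ω ψ x) - T.hat a (fold Ω ψ y)| ≤ 1 := by
        grind
      refine h3.trans ?_
      calc 1 = 2 / ε * (ε / 2) := by field_simp
        _ ≤ max (A * L / T.meshSize) (2 / ε) * dist x y :=
          mul_le_mul (le_max_right _ _) (not_lt.1 hd) (by positivity)
            (le_max_of_le_right (by positivity))
  choose G hG hGeq using fun a => (hlip a).extend_real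
  refine ⟨fun a x => max 0 (min 1 (G a x)), { h.mono (half_pos hε) (by linarith) with
    meshes := hM, reg := hT, exists_lip := ⟨C, fun a => ?_⟩,
    mem_Icc := fun a x => ⟨le_max_left _ _, max_le zero_le_one (min_le_left _ _)⟩,
    eq_hat := fun a x hx => ?_ }⟩
  · exact ((hG a).const_min 1).const_max 0
  · have h1 := T.hat_mem_Icc a (fold Ω ψ x)
    rw [← hGeq a hx, min_eq_right h1.2, max_eq_right h1.1]

/-- The points of the closed half plane at a distance less than `ε` from `S`. -/
def closedCollar (ε : ℝ) (S : Set Pt) : Set Pt := thickening ε S ∩ {x | 0 ≤ x 0}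

lemma closedCollar_subset_closure (ε : ℝ) (S : Set Pt) :
    closedCollar ε S ⊆ closure (collar ε S) := by
  intro x hx
  have hc : Continuous fun t : ℝ => x + t • single 0 1 := by fun_prop
  have ht : Tendsto (fun t : ℝ => x + t • single 0 1) (𝓝[>] 0)
      (𝓝 x) := by
    have := hc.tendsto 0
    simp only [zero_smul, add_zero] at this
    exact this.mono_left nhdsWithin_le_nhds
  refine mem_closure_of_tendsto ht ?_
  filter_upwards [ht.eventually (isOpen_thickening.mem_nhds hx.1), self_mem_nhdsWithin]
    with t h1 h2
  refine ⟨h1, ?_⟩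
  have h2' : 0 < t := h2
  have h0 : 0 ≤ x 0 := hx.2
  simp [halfPlane]
  linarith

namespace FoldedMesh
variable (h : FoldedMesh Ω ψ T L A ε F)
include h

lemma continuous (a : Pt) : Continuous (F a) := by
  obtain ⟨C, hC⟩ := h.exists_lip
  exact (hC a).continuous

lemma abs_le_one (a x : Pt) : |F a x| ≤ 1 := by
  rw [abs_of_nonneg (h.mem_Icc a x).1]; exact (h.mem_Icc a x).2

lemma collar_subset (hK : K ∈ T.cells) : collar ε (tri K) ⊆ collar ε (closure Ω) := by
  refine collar_mono le_rfl ?_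
  rw [h.meshes.closure_eq]
  exact tri_subset_support hK

lemma eq_hatOn (hK : K ∈ T.cells) (a : Pt) (hx : x ∈ tri K) : F a x = hatOn K a x := by
  rw [← closure_interior_tri (T.sarea_ne hK)] at hx
  have hcl := isClosed_eq (h.continuous a) (continuous_hatOn K a)
  refine closure_minimal (fun y hy => ?_) hcl hx
  have hyΩ := h.meshes.interior_tri_subset hK hy
  simp only [mem_ofPred_eq]
  rw [h.eq_hat a y (h.mem_collar hyΩ), fold, if_pos hyΩ,
    hat_eq hK (interior_subset hy)]

lemma lip_closedCollar (hK : K ∈ T.cells) (a : Pt) (hx : x ∈ closedCollar ε (tri K))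
    (hy : y ∈ closedCollar ε (tri K)) :
    |F a x - F a y| ≤ A * L / T.meshSize * dist x y := by
  have h1 : ∀ p ∈ collar ε (tri K) ×ˢ collar ε (tri K),
      |F a p.1 - F a p.2| ≤ A * L / T.meshSize * dist p.1 p.2 := by
    intro p hp
    rw [h.eq_hat a _ (h.collar_subset hK hp.1), h.eq_hat a _ (h.collar_subset hK hp.2)]
    exact h.hat_fold_lip h.meshes h.reg hK a hp.2 hp.1
  have hc := h.continuous a
  have hcl : IsClosed {p : Pt × Pt | |F a p.1 - F a p.2| ≤ A * L / T.meshSize * dist p.1 p.2} :=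
    isClosed_le (by fun_prop) (by fun_prop)
  have hmem : (x, y) ∈ closure (collar ε (tri K) ×ˢ collar ε (tri K)) := by
    rw [closure_prod_eq]
    exact ⟨closedCollar_subset_closure _ _ hx, closedCollar_subset_closure _ _ hy⟩
  exact closure_minimal h1 hcl hmem

/-- Folding does not move points of the collar far away from the points of a triangle. -/
lemma dist_fold_le_of_mem (hK : K ∈ T.cells) {z p : Pt} (hz : z ∈ collar ε (tri K)) (hp : p ∈ tri K)
    : dist (fold Ω ψ z) p ≤ L * dist z p := by
  rw [← closure_interior_tri (T.sarea_ne hK)] at hp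
  have hcl : IsClosed {p | dist (fold Ω ψ z) p ≤ L * dist z p} :=
    isClosed_le (by fun_prop) (by fun_prop)
  refine closure_minimal (fun q hq => ?_) hcl hp
  have hqΩ := h.meshes.interior_tri_subset hK hq
  have hqC : q ∈ collar ε (tri K) :=
    ⟨self_subset_thickening h.eps_pos _ (interior_subset hq), h.pos hqΩ⟩
  have := h.dist_fold_le (convex_collar ε (convex_tri K)) (h.collar_subset hK) hz hqC
  rwa [fold, fold, if_pos hqΩ, ← fold] at this

/-- The function `F b` vanishes in the collar of `K` unless `b` is close to `K`. -/
lemma dist_le_of_ne_zero (hK : K ∈ T.cells) {b z p : Pt} (hz : z ∈ closedCollar ε (tri K))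
    (hb : F b z ≠ 0) (hp : p ∈ tri K) : dist b p ≤ T.meshSize + L * dist z p := by
  have h1 : ∀ z ∈ collar ε (tri K), F b z ≠ 0 → dist b p ≤ T.meshSize + L * dist z p := by
    intro z hz hb
    have hs := (h.fold_mem (h.collar_subset hK hz)).1
    rw [h.meshes.closure_eq] at hs
    obtain ⟨K', hK', hzK⟩ := mem_support.1 hs
    rw [h.eq_hat b _ (h.collar_subset hK hz), hat_eq hK' hzK] at hb
    have hb' : b ∈ range K' := by
      by_contra hn
      exact hb (hatOn_of_notMem hn _)
    obtain ⟨i, rfl⟩ := hb'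
    have h2 := h.reg.dist_le K' hK' _ (vertex_mem_tri K' i) _ hzK
    linarith [dist_triangle (K' i) (fold Ω ψ z) p, h.dist_fold_le_of_mem hK hz hp]
  have hcl : IsClosed {z : Pt | dist b p ≤ T.meshSize + L * dist z p} :=
    isClosed_le (by fun_prop) (by fun_prop)
  have hopen : IsOpen {z : Pt | F b z ≠ 0} := isOpen_ne_fun (h.continuous b) continuous_const
  have hmem : z ∈ closure (collar ε (tri K) ∩ {z | F b z ≠ 0}) := by
    have := hopen.inter_closure ⟨hb, closedCollar_subset_closure _ _ hz⟩
    rwa [inter_comm] at this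
  exact closure_minimal (fun z hz => h1 z hz.1 hz.2) hcl hmem

/-- Almost everywhere in the collar, the derivatives of the functions `F a` are given by the chain
rule. -/
theorem ae_chain : ∀ᵐ x, x ∈ collar ε (closure Ω) → (∀ p m, |foldJac Ω ψ x p m| ≤ L) ∧ ∃ K ∈
    T.cells, fold Ω ψ x ∈ interior (tri K) ∧ ∀ a, F a x = hatOn K a (fold Ω ψ x) ∧ DifferentiableAt
    ℝ (F a) x ∧ ∀ m, pd m (F a) x = ∑ p, gradHatOn K a p * foldJac Ω ψ x p m := by
  set V := collar ε (closure Ω) \ closure Ω with hV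
  have hVo : IsOpen V := (isOpen_collar _ _).sdiff isClosed_closure
  have hlip : LipschitzOnWith (Real.toNNReal L) ψ V := by
    refine LipschitzOnWith.of_dist_le_mul fun x hx y hy => ?_
    rw [Real.coe_toNNReal _ (zero_le_one.trans h.one_le)]
    exact h.lip x ⟨hx.1, fun hn => hx.2 (subset_closure hn)⟩ y
      ⟨hy.1, fun hn => hy.2 (subset_closure hn)⟩
  filter_upwards [h.ae_notMem_frontier, h.ae_fold T.ae_mem_interior_of_mem_support,
    hlip.ae_differentiableWithinAt_of_mem (μ := volume)] with x hxf hxs hxd hxc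
  have hs := (h.fold_mem hxc).1
  rw [h.meshes.closure_eq] at hs
  obtain ⟨K, hK, hxK⟩ := hxs hxc hs
  have hval : ∀ a, F a x = hatOn K a (fold Ω ψ x) := fun a => by
    rw [h.eq_hat a x hxc, hat_eq hK (interior_subset hxK)]
  by_cases hΩ : x ∈ Ω
  · have hJ : foldJac Ω ψ x = 1 := by rw [foldJac, if_pos hΩ]
    have hfx : fold Ω ψ x = x := by rw [fold, if_pos hΩ]
    refine ⟨fun p m => ?_, K, hK, hxK, fun a => ⟨hval a, ?_⟩⟩
    · have := h.one_le
      rw [hJ, Matrix.one_apply]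
      grind
    · have hF : HasFDerivAt (F a) (gradHatForm K a) x := by
        refine (hasFDerivAt_hatOn K a x).congr_of_eventuallyEq ?_
        rw [hfx] at hxK
        filter_upwards [isOpen_interior.mem_nhds hxK] with y hy
        exact h.eq_hatOn hK a (interior_subset hy)
      refine ⟨hF.differentiableAt, fun m => ?_⟩
      rw [pd, hF.fderiv, hJ]
      fin_cases m <;> simp [gradHatForm, Matrix.one_apply]
  · have hxV : x ∈ V := ⟨hxc, fun hn => hxf ⟨hn, fun hi => hΩ (interior_subset hi)⟩⟩
    have hd := (hxd hxV).differentiableAt (hVo.mem_nhds hxV)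
    have hJ : foldJac Ω ψ x = jacMap ψ x := by rw [foldJac, if_neg hΩ]
    have hfx : fold Ω ψ x = ψ x := by rw [fold, if_neg hΩ]
    refine ⟨fun p m => ?_, K, hK, hxK, fun a => ⟨hval a, ?_⟩⟩
    · have h1 := hd.hasFDerivAt.le_of_lipschitzOn (hVo.mem_nhds hxV) hlip
      rw [Real.coe_toNNReal _ (zero_le_one.trans h.one_le)] at h1
      rw [hJ, jacMap, Matrix.of_apply, ← norm_eq_abs]
      refine (PiLp.norm_apply_le _ p).trans ((ContinuousLinearMap.le_opNorm _ _).trans ?_)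
      simpa using h1
    · have hF : HasFDerivAt (F a) ((gradHatForm K a).comp (fderiv ℝ ψ x)) x := by
        refine ((hasFDerivAt_hatOn K a (ψ x)).comp x hd.hasFDerivAt).congr_of_eventuallyEq ?_
        rw [hfx] at hxK
        filter_upwards [hd.continuousAt.preimage_mem_nhds (isOpen_interior.mem_nhds hxK),
          hVo.mem_nhds hxV] with y hy hyV
        have hyΩ : y ∉ Ω := fun hn => hyV.2 (subset_closure hn)
        rw [h.eq_hat a y hyV.1, fold, if_neg hyΩ, hat_eq hK (interior_subset hy)]
        rfl
      refine ⟨hF.differentiableAt, fun m => ?_⟩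
      rw [pd, hF.fderiv, hJ]
      aesop

end FoldedMesh

/-! ### Weak curls -/

/-- `f` is integrable on `Ω` against continuous functions with compact support in `r > 0`. -/
def TestIntegrable (Ω : Set Pt) (f : Pt → ℝ) : Prop :=
  ∀ g, IsCc g → Integrable (fun x => f x * g x) (volume.restrict Ω)

lemma IsCc.radius_mul (h : IsCc g) : IsCc (fun x => x 0 * g x) :=
  ⟨by have := h.1; fun_prop, h.2.1.mul_left, (tsupport_mul_subset_right).trans h.2.2⟩

namespace TestIntegrable

lemma of_memLp (h : MemLp f 2 (rMeasure Ω)) : TestIntegrable Ω f := fun _ hg => integrable_mul h hg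

lemma add (hf : TestIntegrable Ω f) (hg : TestIntegrable Ω g) :
    TestIntegrable Ω (fun x => f x + g x) := fun φ hφ => by
  simp only [add_mul]
  exact (hf φ hφ).add (hg φ hφ)

lemma const_mul (c : ℝ) (hf : TestIntegrable Ω f) : TestIntegrable Ω (fun x => c * f x) :=
  fun φ hφ => by simpa only [mul_assoc] using (hf φ hφ).const_mul c

lemma neg (hf : TestIntegrable Ω f) : TestIntegrable Ω (fun x => -f x) :=
  fun φ hφ => by
    aesop

lemma sub (hf : TestIntegrable Ω f) (hg : TestIntegrable Ω g) :
    TestIntegrable Ω (fun x => f x - g x) := fun φ hφ => by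
  simp only [sub_mul]
  exact (hf φ hφ).sub (hg φ hφ)

lemma zero : TestIntegrable Ω (fun _ => 0) := fun _ _ => by simp

lemma radius_mul (hf : TestIntegrable Ω f) : TestIntegrable Ω (fun x => x 0 * f x) :=
  fun φ hφ => by
    refine (hf _ hφ.radius_mul).congr (.of_forall fun x => ?_)
    ring

lemma div_radius (hf : TestIntegrable Ω f) : TestIntegrable Ω (fun x => f x / x 0) :=
  fun φ hφ => by
    refine (hf _ hφ.overR).congr (.of_forall fun x => ?_)
    simp only [overR]
    ring

lemma congr (hf : TestIntegrable Ω f) (h : ∀ᵐ x ∂(volume.restrict Ω), f x = g x) :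
    TestIntegrable Ω g := fun φ hφ => by
  refine (hf φ hφ).congr ?_
  filter_upwards [h] with x hx
  rw [hx]

lemma of_bounded {C : ℝ} (hf : Measurable f) (hC : ∀ x, |f x| ≤ C) : TestIntegrable Ω f :=
  fun _ hφ => ((hφ.1.integrable_of_hasCompactSupport hφ.2.1).bdd_mul hf.aestronglyMeasurable
    (.of_forall hC)).integrableOn

/-- The fundamental lemma of the calculus of variations. -/
lemma ae_eq_zero (hf : TestIntegrable Ω f) (hΩ : IsOpen Ω) (hpos : Ω ⊆ halfPlane)
    (h : ∀ φ, IsTest Ω φ → pair Ω f φ = 0) : ∀ᵐ x, x ∈ Ω → f x = 0 := by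
  refine hΩ.ae_eq_zero_of_integral_contDiff_smul_eq_zero ?_ ?_
  · intro x hx
    obtain ⟨ε, hε, hsub⟩ := isOpen_iff.1 hΩ x hx
    let b : ContDiffBump x := ⟨ε / 4, ε / 2, by positivity, by linarith⟩
    have hcc : IsCc b := by
      refine ⟨b.continuous, b.hasCompactSupport, ?_⟩
      rw [b.tsupport_eq]
      exact (closedBall_subset_ball (by simp [b]; linarith)).trans (hsub.trans hpos)
    refine ⟨closedBall x (ε / 4), mem_nhdsWithin_of_mem_nhds
      (closedBall_mem_nhds _ (by positivity)), ?_⟩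
    have hs : closedBall x (ε / 4) ⊆ Ω :=
      (closedBall_subset_ball (by linarith)).trans hsub
    have h1 := IntegrableOn.mono_set (hf b hcc) hs
    refine h1.congr_fun (fun y hy => ?_) measurableSet_closedBall
    have := b.one_of_mem_closedBall hy
    simp [this]
  · intro g hg hgc hgs
    have := h g ⟨hg, hgc, subset_inter hgs (hgs.trans hpos)⟩
    rw [pair] at this
    rw [← this, ← setIntegral_eq_integral_of_forall_compl_eq_zero (s := Ω)]
    · simp [mul_comm]
    · intro x hx
      rw [image_eq_zero_of_notMem_tsupport (fun hn => hx (hgs hn)), zero_smul]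

end TestIntegrable

section pair

lemma pair_fun_add (hf : TestIntegrable Ω f) (hg : TestIntegrable Ω g) (hφ : IsCc φ) :
    pair Ω (fun x => f x + g x) φ = pair Ω f φ + pair Ω g φ := by
  simp only [pair, add_mul]
  exact integral_add (hf φ hφ) (hg φ hφ)

lemma pair_fun_sub (hf : TestIntegrable Ω f) (hg : TestIntegrable Ω g) (hφ : IsCc φ) :
    pair Ω (fun x => f x - g x) φ = pair Ω f φ - pair Ω g φ := by
  simp only [pair, sub_mul]
  exact integral_sub (hf φ hφ) (hg φ hφ)

lemma pair_fun_const_mul (c : ℝ) (f φ : Pt → ℝ) :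
    pair Ω (fun x => c * f x) φ = c * pair Ω f φ := by
  simp only [pair, mul_assoc]
  exact integral_const_mul _ _

lemma pair_fun_neg (f φ : Pt → ℝ) : pair Ω (fun x => -f x) φ = -pair Ω f φ := by
  simp only [pair, neg_mul]
  exact integral_neg _

lemma pair_zero_left (φ : Pt → ℝ) : pair Ω (fun _ => 0) φ = 0 := by simp [pair]

lemma pair_div_radius (f φ : Pt → ℝ) : pair Ω (fun x => f x / x 0) φ = pair Ω f (overR φ) := by
  refine integral_congr_ae (.of_forall fun x => ?_)
  simp only [overR]
  ring

lemma pair_fun_congr (h : ∀ᵐ x ∂(volume.restrict Ω), f x = g x) (φ : Pt → ℝ) :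
    pair Ω f φ = pair Ω g φ := by
  refine integral_congr_ae ?_
  filter_upwards [h] with x hx
  rw [hx]

end pair

/-- `∂_r Q - ∂_z P = f` in `Ω`, in the sense of distributions. -/
structure WeakCurl (Ω : Set Pt) (P Q f : Pt → ℝ) : Prop where
  left : TestIntegrable Ω P
  right : TestIntegrable Ω Q
  curl : TestIntegrable Ω f
  eq : ∀ φ, IsTest Ω φ → pair Ω f φ = pair Ω P (pd 1 φ) - pair Ω Q (pd 0 φ)

namespace WeakCurl

variable {P' Q' f' : Pt → ℝ}

lemma add (h : WeakCurl Ω P Q f) (h' : WeakCurl Ω P' Q' f') :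
    WeakCurl Ω (fun x => P x + P' x) (fun x => Q x + Q' x) (fun x => f x + f' x) := by
  refine ⟨h.left.add h'.left, h.right.add h'.right, h.curl.add h'.curl, fun φ hφ => ?_⟩
  rw [pair_fun_add h.curl h'.curl hφ.isCc, pair_fun_add h.left h'.left (hφ.isCc_pd _),
    pair_fun_add h.right h'.right (hφ.isCc_pd _), h.eq φ hφ, h'.eq φ hφ]
  ring

lemma const_mul (c : ℝ) (h : WeakCurl Ω P Q f) :
    WeakCurl Ω (fun x => c * P x) (fun x => c * Q x) (fun x => c * f x) := by
  refine ⟨h.left.const_mul c, h.right.const_mul c, h.curl.const_mul c, fun φ hφ => ?_⟩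
  rw [pair_fun_const_mul, pair_fun_const_mul, pair_fun_const_mul, h.eq φ hφ]
  ring

lemma zero : WeakCurl Ω (fun _ => 0) (fun _ => 0) (fun _ => 0) :=
  ⟨.zero, .zero, .zero, fun φ _ => by simp [pair_zero_left]⟩

lemma sum {ι : Type*} {P Q f : ι → Pt → ℝ} (s : Finset ι)
    (h : ∀ i ∈ s, WeakCurl Ω (P i) (Q i) (f i)) :
    WeakCurl Ω (fun x => ∑ i ∈ s, P i x) (fun x => ∑ i ∈ s, Q i x) (fun x => ∑ i ∈ s, f i x) := by
  classical
  induction s using Finset.induction_on with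
  | empty => simpa using zero
  | insert i s hi ih =>
    simp only [Finset.sum_insert hi]
    exact (h i (Finset.mem_insert_self _ _)).add (ih fun j hj => h j (Finset.mem_insert_of_mem hj))

lemma congr (h : WeakCurl Ω P Q f) (hP : ∀ᵐ x ∂(volume.restrict Ω), P x = P' x)
    (hQ : ∀ᵐ x ∂(volume.restrict Ω), Q x = Q' x) (hf : ∀ᵐ x ∂(volume.restrict Ω), f x = f' x) :
    WeakCurl Ω P' Q' f' := by
  refine ⟨h.left.congr hP, h.right.congr hQ, h.curl.congr hf, fun φ hφ => ?_⟩
  rw [← pair_fun_congr hP, ← pair_fun_congr hQ, ← pair_fun_congr hf, h.eq φ hφ]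

lemma radius_mul (h : WeakCurl Ω P Q f) :
    WeakCurl Ω (fun x => x 0 * P x) (fun x => x 0 * Q x) (fun x => x 0 * f x + Q x) := by
  refine ⟨h.left.radius_mul, h.right.radius_mul, h.curl.radius_mul.add h.right, fun φ hφ => ?_⟩
  have hr : IsTest Ω (fun x => x 0 * φ x) := by
    have hs := hφ.1
    exact ⟨by fun_prop, hφ.2.1.mul_left, (tsupport_mul_subset_right).trans hφ.2.2⟩
  have hd := hφ.1.differentiable (by simp)
  have e0 : pd 0 (fun x => x 0 * φ x) = fun x => x 0 * pd 0 φ x + φ x := by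
    funext x
    rw [pd_mul (f := fun x => x 0) (by fun_prop) (hd x)]
    have : pd 0 (fun x => x 0) x = 1 := by
      have := (proj 0 : Pt →L[ℝ] ℝ).hasFDerivAt (x := x)
      have e : fderiv ℝ (fun x => x 0) x = _ := this.fderiv
      rw [pd, e]; simp
    rw [this, one_mul]
  have e1 : pd 1 (fun x => x 0 * φ x) = fun x => x 0 * pd 1 φ x := by
    funext x
    rw [pd_mul (f := fun x => x 0) (by fun_prop) (hd x)]
    have : pd 1 (fun x => x 0) x = 0 := by
      have := (proj 0 : Pt →L[ℝ] ℝ).hasFDerivAt (x := x)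
      have e : fderiv ℝ (fun x => x 0) x = _ := this.fderiv
      rw [pd, e]; simp
    grind
  have hmv : ∀ (g χ : Pt → ℝ), pair Ω (fun x => x 0 * g x) χ = pair Ω g (fun x => x 0 * χ x) :=
    fun g χ => integral_congr_ae (.of_forall fun x => by simp only []; ring)
  have := h.eq _ hr
  rw [e0, e1] at this
  rw [pair_fun_add h.curl.radius_mul h.right hφ.isCc, hmv, hmv, hmv, this]
  have e2 : pair Ω Q (fun x => x 0 * pd 0 φ x + φ x) =
      pair Ω Q (fun x => x 0 * pd 0 φ x) + pair Ω Q φ := by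
    simp only [pair, mul_add]
    exact integral_add (h.right _ (hφ.isCc_pd 0).radius_mul) (h.right _ hφ.isCc)
  rw [e2]
  ring

end WeakCurl

lemma IsTest.exists_lipschitz (h : IsTest Ω φ) : ∃ C : ℝ≥0, LipschitzWith C φ :=
  h.1.lipschitzWith_of_hasCompactSupport h.2.1 (by simp)

/-- The weak curl of the `1`-form `F dG` is `dF ∧ dG`, for Lipschitz functions. -/
theorem weakCurl_of_lipschitz {F : Pt → ℝ} (hF : LipschitzWith C F) (hG : LipschitzWith C G)
    (hM : ∀ x, |F x| ≤ M) : WeakCurl Ω (fun x => F x * pd 0 G x) (fun x => F x * pd 1 G x)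
    (fun x => pd 0 F x * pd 1 G x - pd 1 F x * pd 0 G x) := by
  have hM0 := (abs_nonneg _).trans (hM 0)
  have hFm := hF.continuous.measurable
  have hmul : ∀ i, TestIntegrable Ω (fun x => F x * pd i G x) := fun i =>
    .of_bounded (hFm.mul (measurable_pd G i)) fun x => by
      rw [abs_mul]
      exact mul_le_mul (hM x) (abs_pd_le_of_lip hG i x) (abs_nonneg _) hM0
  have hw : ∀ i j, TestIntegrable Ω (fun x => pd i F x * pd j G x) := fun i j =>
    .of_bounded ((measurable_pd F i).mul (measurable_pd G j)) fun x => by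
      rw [abs_mul]
      exact mul_le_mul (abs_pd_le_of_lip hF i x) (abs_pd_le_of_lip hG j x) (abs_nonneg _) C.2
  refine ⟨hmul 0, hmul 1, (hw 0 1).sub (hw 1 0), fun φ hφ => ?_⟩
  obtain ⟨Cφ, hCφ⟩ := hφ.exists_lipschitz
  obtain ⟨Mφ, hMφ⟩ := hφ.2.1.exists_bound_of_continuous hφ.1.continuous
  have hMφ0 := (norm_nonneg _).trans (hMφ 0)
  have hprod : LipschitzWith (max C (Real.toNNReal (Mφ * C + M * Cφ))) (fun x => φ x * F x) := by
    refine (LipschitzWith.of_dist_le_mul (K := Real.toNNReal (Mφ * C + M * Cφ))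
      fun x y => ?_).weaken (le_max_right _ _)
    rw [Real.coe_toNNReal _ (by positivity), Real.dist_eq]
    have e : φ x * F x - φ y * F y = φ x * (F x - F y) + F y * (φ x - φ y) := by ring
    have h1 := hF.dist_le_mul x y
    have h2 := hCφ.dist_le_mul x y
    rw [e, add_mul]
    refine (abs_add_le _ _).trans ?_
    rw [abs_mul, abs_mul, mul_assoc, mul_assoc]
    exact add_le_add (mul_le_mul (hMφ x) h1 (abs_nonneg _) hMφ0)
      (mul_le_mul (hM y) h2 (abs_nonneg _) hM0)
  have h0 := integral_wedge_eq_zero hprod (hG.weaken (le_max_left _ _))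
    (hφ.2.1.mul_right (f' := F))
  have hout : ∀ x, x ∉ Ω → φ x = 0 ∧ ∀ i, pd i φ x = 0 := by
    intro x hx
    have hn : x ∉ tsupport φ := fun h => hx (hφ.2.2 h).1
    refine ⟨image_eq_zero_of_notMem_tsupport hn, fun i => ?_⟩
    have h0 : fderiv ℝ φ x = 0 := by
      by_contra hne
      exact hn (tsupport_fderiv_subset ℝ (subset_tsupport _ hne))
    rw [pd, h0]; rfl
  have hwhole : ∀ g : Pt → ℝ, (∀ x, x ∉ Ω → g x = 0) → ∫ x in Ω, g x = ∫ x, g x := fun g hg =>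
    setIntegral_eq_integral_of_forall_compl_eq_zero hg
  have hint : ∀ {g : Pt → ℝ}, TestIntegrable univ g → ∀ {χ : Pt → ℝ}, IsCc χ →
      Integrable (fun x => g x * χ x) := fun hg χ hχ => by simpa using hg χ hχ
  have hmul' : ∀ i, TestIntegrable univ (fun x => F x * pd i G x) := fun i =>
    .of_bounded (hFm.mul (measurable_pd G i)) fun x => by
      rw [abs_mul]
      exact mul_le_mul (hM x) (abs_pd_le_of_lip hG i x) (abs_nonneg _) hM0
  have hw' : ∀ i j, TestIntegrable univ (fun x => pd i F x * pd j G x) := fun i j =>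
    .of_bounded ((measurable_pd F i).mul (measurable_pd G j)) fun x => by
      rw [abs_mul]
      exact mul_le_mul (abs_pd_le_of_lip hF i x) (abs_pd_le_of_lip hG j x) (abs_nonneg _) C.2
  rw [pair, pair, pair, hwhole _ fun x hx => by grind,
    hwhole _ fun x hx => by grind,
    hwhole _ fun x hx => by grind,
    ← integral_sub (hint (hmul' 0) (hφ.isCc_pd 1)) (hint (hmul' 1) (hφ.isCc_pd 0)), ← sub_eq_zero,
    ← h0]
  have i1 := (hint (hmul' 0) (hφ.isCc_pd 1)).sub (hint (hmul' 1) (hφ.isCc_pd 0))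
  refine (integral_sub (hint ((hw' 0 1).sub (hw' 1 0)) hφ.isCc) i1).symm.trans ?_
  refine integral_congr_ae ?_
  filter_upwards [hF.ae_differentiableAt (μ := volume)] with x hx
  have hd := hφ.1.differentiable (by simp) x
  rw [pd_mul hd hx, pd_mul hd hx]
  simp only [Pi.sub_apply]
  ring

/-! ### The distributional operators in terms of weak curls -/

lemma ae_rMeasure_iff (hΩ : IsOpen Ω) (hpos : Ω ⊆ halfPlane) :
    (∀ᵐ x ∂(rMeasure Ω), p x) ↔ ∀ᵐ x, x ∈ Ω → p x := by
  rw [rMeasure, ae_withDensity_iff (by fun_prop), ae_restrict_iff' hΩ.measurableSet]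
  refine eventually_congr (.of_forall fun x => ?_)
  aesop

section Operators

lemma isGrad_iff (hΩ : IsOpen Ω) (hpos : Ω ⊆ halfPlane) {v : Pt → Vec} (hu : MemLp u 2 (rMeasure Ω))
    (hv : ∀ i, MemLp (comp v i) 2 (rMeasure Ω)) : IsGrad n Ω u v ↔ WeakCurl Ω (fun _ => 0) u
    (comp v 0) ∧ WeakCurl Ω (fun x => -u x) (fun _ => 0) (comp v 2) ∧ ∀ᵐ x, x ∈ Ω → v x 1 =
    -((n : ℝ) * u x / x 0) := by
  have iu := TestIntegrable.of_memLp hu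
  have iv := fun i => TestIntegrable.of_memLp (hv i)
  have i1 := (iv 1).add (iu.div_radius.const_mul n)
  constructor
  · intro h
    refine ⟨⟨.zero, iu, iv 0, fun φ hφ => ?_⟩, ⟨iu.neg, .zero, iv 2, fun φ hφ => ?_⟩, ?_⟩
    · rw [(h φ hφ).1, pair_zero_left, zero_sub]
    · rw [(h φ hφ).2.2, pair_zero_left, sub_zero, pair_fun_neg]
    · filter_upwards [i1.ae_eq_zero hΩ hpos fun φ hφ => by
        rw [pair_fun_add (iv 1) (iu.div_radius.const_mul n) hφ.isCc, pair_fun_const_mul,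
          pair_div_radius, (h φ hφ).2.1]
        ring] with x hx hxΩ
      have := hx hxΩ
      simp only [comp] at this
      grind
  · rintro ⟨h0, h2, h1⟩ φ hφ
    refine ⟨?_, ?_, ?_⟩
    · rw [h0.eq φ hφ, pair_zero_left, zero_sub]
    · rw [pair_fun_congr (g := fun x => (-n : ℝ) * (u x / x 0))
        ((ae_restrict_iff' hΩ.measurableSet).2 ?_), pair_fun_const_mul, pair_div_radius]
      · ring
      · filter_upwards [h1] with x hx hxΩ
        rw [comp, hx hxΩ]
        ring
    · rw [h2.eq φ hφ, pair_zero_left, sub_zero, pair_fun_neg]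

lemma isCurl_iff {v w : Pt → Vec} (hv : ∀ i, MemLp (comp v i) 2 (rMeasure Ω))
    (hw : ∀ i, MemLp (comp w i) 2 (rMeasure Ω)) :
    IsCurl n Ω v w ↔
      WeakCurl Ω (comp v 1) (fun _ => 0) (fun x => comp w 0 x + n * (comp v 2 x / x 0)) ∧
      WeakCurl Ω (fun x => -comp v 0 x) (fun x => -comp v 2 x) (comp w 1) ∧
      WeakCurl Ω (fun _ => 0) (comp v 1)
        (fun x => comp w 2 x - (n * (comp v 0 x / x 0) + comp v 1 x / x 0)) := by
  have iv := fun i => TestIntegrable.of_memLp (hv i)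
  have iw := fun i => TestIntegrable.of_memLp (hw i)
  have i2 := (iv 2).div_radius.const_mul n
  have i01 := ((iv 0).div_radius.const_mul n).add (iv 1).div_radius
  have e0 : ∀ φ, IsTest Ω φ → pair Ω (fun x => comp w 0 x + n * (comp v 2 x / x 0)) φ =
      pair Ω (comp w 0) φ + n * pair Ω (comp v 2) (overR φ) := fun φ hφ => by
    rw [pair_fun_add (iw 0) i2 hφ.isCc, pair_fun_const_mul, pair_div_radius]
  have e2 : ∀ φ, IsTest Ω φ →
      pair Ω (fun x => comp w 2 x - (n * (comp v 0 x / x 0) + comp v 1 x / x 0)) φ =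
      pair Ω (comp w 2) φ - (n * pair Ω (comp v 0) (overR φ) + pair Ω (comp v 1) (overR φ)) :=
    fun φ hφ => by
    rw [pair_fun_sub (iw 2) i01 hφ.isCc,
      pair_fun_add ((iv 0).div_radius.const_mul n) (iv 1).div_radius hφ.isCc, pair_fun_const_mul,
      pair_div_radius, pair_div_radius]
  constructor
  · intro h
    refine ⟨⟨iv 1, .zero, (iw 0).add i2, fun φ hφ => ?_⟩,
      ⟨(iv 0).neg, (iv 2).neg, iw 1, fun φ hφ => ?_⟩,
      ⟨.zero, iv 1, (iw 2).sub i01, fun φ hφ => ?_⟩⟩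
    · rw [e0 φ hφ, (h φ hφ).1, pair_zero_left]; ring
    · rw [(h φ hφ).2.1, pair_fun_neg, pair_fun_neg]; ring
    · rw [e2 φ hφ, (h φ hφ).2.2, pair_zero_left]; ring
  · rintro ⟨h0, h1, h2⟩ φ hφ
    have a0 := h0.eq φ hφ
    have a1 := h1.eq φ hφ
    have a2 := h2.eq φ hφ
    rw [e0 φ hφ, pair_zero_left] at a0
    rw [pair_fun_neg, pair_fun_neg] at a1
    rw [e2 φ hφ, pair_zero_left] at a2
    grind

lemma isDiv_iff {w : Pt → Vec} (hw : ∀ i, MemLp (comp w i) 2 (rMeasure Ω))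
    (hf : MemLp f 2 (rMeasure Ω)) : IsDiv n Ω w f ↔ WeakCurl Ω (fun x => -comp w 2 x) (comp w 0)
    (fun x => f x - (comp w 0 x / x 0 - n * (comp w 1 x / x 0))) := by
  have iw := fun i => TestIntegrable.of_memLp (hw i)
  have i1 := (iw 1).div_radius.const_mul n
  have i01 := (iw 0).div_radius.sub i1
  have e : ∀ φ, IsTest Ω φ →
      pair Ω (fun x => f x - (comp w 0 x / x 0 - n * (comp w 1 x / x 0))) φ =
      pair Ω f φ - (pair Ω (comp w 0) (overR φ) - n * pair Ω (comp w 1) (overR φ)) :=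
    fun φ hφ => by
    rw [pair_fun_sub (.of_memLp hf) i01 hφ.isCc, pair_fun_sub (iw 0).div_radius i1 hφ.isCc,
      pair_fun_const_mul, pair_div_radius, pair_div_radius]
  constructor
  · intro h
    refine ⟨(iw 2).neg, iw 0, (TestIntegrable.of_memLp hf).sub i01, fun φ hφ => ?_⟩
    rw [e φ hφ, h φ hφ, pair_fun_neg]; ring
  · intro h φ hφ
    have := h.eq φ hφ
    rw [e φ hφ, pair_fun_neg] at this
    linarith

end Operators

/-! ### Piecewise linear functions, Whitney forms and densities -/

namespace Triangulation

variable (T : Triangulation) (F : Pt → Pt → ℝ)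

/-- The function with vertex values `q`, for the system `F` of generalized hat functions. -/
def form0 (q : Pt → ℝ) (x : Pt) : ℝ := ∑ a ∈ T.verts, q a * F a x

/-- The partial derivatives of `form0`. -/
def gradForm0 (q : Pt → ℝ) (m : Fin 2) (x : Pt) : ℝ := ∑ a ∈ T.verts, q a * pd m (F a) x

/-- The components of the Whitney `1`-form `∑ c(a,b) F_a dF_b` with edge values `c`. -/
def form1 (c : Pt → Pt → ℝ) (m : Fin 2) (x : Pt) : ℝ :=
  ∑ a ∈ T.verts, ∑ b ∈ T.verts, c a b * (F a x * pd m (F b) x)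

/-- The density of `∑ c(a,b) dF_a ∧ dF_b`. -/
def curlForm1 (c : Pt → Pt → ℝ) (x : Pt) : ℝ :=
  ∑ a ∈ T.verts, ∑ b ∈ T.verts, c a b * (pd 0 (F a) x * pd 1 (F b) x - pd 1 (F a) x * pd 0 (F b) x)

/-- The piecewise constant density with values `s`. -/
def form2 (s : Tri → ℝ) : Pt → ℝ := piecewise T fun K _ => s K

end Triangulation

/-- The affine function on `K` with vertex values `q`. -/
def affineOn (K : Tri) (q : Pt → ℝ) (x : Pt) : ℝ := ∑ i, q (K i) * bary K i x

/-- The Whitney form on `K` with edge values `c`. -/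
def whitneyOn (K : Tri) (c : Pt → Pt → ℝ) (m : Fin 2) (x : Pt) : ℝ :=
  ∑ i, ∑ j, c (K i) (K j) * (bary K i x * gradBary K j m)

/-- The curl of the Whitney form on `K` with edge values `c`: the circulation along the boundary
divided by the area. -/
def curlOn (c : Pt → Pt → ℝ) (K : Tri) : ℝ := 2 / sarea K * ∑ i : Fin 3, c (K (i + 1)) (K (i + 2))

/-- The differences of vertex values along edges. -/
def diff0 (q : Pt → ℝ) (a b : Pt) : ℝ := q b - q a

/-- Edge values are alternating. -/
def Alternating (c : Pt → Pt → ℝ) : Prop := ∀ a b, c b a = -c a b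

lemma Alternating.self (hc : Alternating c) (a : Pt) : c a a = 0 := by
  have := hc a a; linarith

lemma alternating_diff0 (q : Pt → ℝ) : Alternating (diff0 q) := fun a b => by simp [diff0]

lemma Alternating.add (h : Alternating c) (h' : Alternating c') : Alternating (c + c') := fun a b
    => by simp [h a b, h' a b]; ring

lemma bary_eq_affine (K : Tri) (i : Fin 3) (x : Pt) :
    bary K i x = bary K i 0 + gradBary K i 0 * x 0 + gradBary K i 1 * x 1 := by
  have := bary_sub K i x 0
  simp only [PiLp.zero_apply, sub_zero] at this
  linarith

lemma sum_alternating (c : Fin 3 → Fin 3 → ℝ) (hc : ∀ i j, c j i = -c i j) (g : Fin 3 → Fin 3 → ℝ) :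
    ∑ i, ∑ j, c i j * g i j =
      c 1 2 * (g 1 2 - g 2 1) + c 2 0 * (g 2 0 - g 0 2) + c 0 1 * (g 0 1 - g 1 0) := by
  have h0 : ∀ i, c i i = 0 := fun i => by grind
  simp only [sum_univ_three, h0, hc 1 2, hc 2 0, hc 0 1]
  ring

lemma cross_gradBary (h : sarea K ≠ 0) (i : Fin 3) : gradBary K (i + 1) 0 * gradBary K (i + 2) 1 -
    gradBary K (i + 1) 1 * gradBary K (i + 2) 0 = 1 / sarea K := by
  rw [gradBary_zero, gradBary_one, gradBary_zero, gradBary_one]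
  field_simp
  rw [sarea, cross]
  fin_cases i <;> simp <;> ring

lemma sum_cross_gradBary (h : sarea K ≠ 0) (hc : Alternating c) : ∑ i, ∑ j, c (K i) (K j) *
    (gradBary K i 0 * gradBary K j 1 - gradBary K i 1 * gradBary K j 0) = curlOn c K := by
  rw [sum_alternating (fun i j => c (K i) (K j)) (fun i j => hc _ _), curlOn, sum_univ_three]
  have h0 := cross_gradBary h 0
  have h1 := cross_gradBary h 1
  have h2 := cross_gradBary h 2
  grind

lemma affineOn_eq (K : Tri) (q : Pt → ℝ) : ∃ t₀ t₁ t₂ : ℝ, ∀ x, affineOn K q x = t₀ + t₁ * x 0 + t₂ * x 1 := by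
  refine ⟨∑ i, q (K i) * bary K i 0, ∑ i, q (K i) * gradBary K i 0, ∑ i, q (K i) * gradBary K i 1,
    fun x => ?_⟩
  simp only [affineOn, bary_eq_affine K _ x, sum_mul, ← sum_add_distrib]
  grind

/-- A Whitney form is a constant form plus a multiple of the rotation form. -/
lemma whitneyOn_eq (K : Tri) (hc : Alternating c) :
    ∃ α β γ : ℝ, ∀ x, whitneyOn K c 0 x = α - γ * x 1 ∧ whitneyOn K c 1 x = β + γ * x 0 := by
  refine ⟨whitneyOn K c 0 0, whitneyOn K c 1 0,
    ∑ i, ∑ j, c (K i) (K j) * (gradBary K i 0 * gradBary K j 1), fun x => ?_⟩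
  have key := fun g => sum_alternating (fun i j => c (K i) (K j)) (fun i j => hc _ _) g
  simp only [whitneyOn, bary_eq_affine K _ x]
  rw [key, key, key, key, key]
  constructor <;> ring

/-- Values of the generalized hat functions and their derivatives at one point, as given by a
triangle `K`, a point `p` and a Jacobian matrix `J`. -/
def ChainAt (F : Pt → Pt → ℝ) (K : Tri) (p : Pt) (J : Matrix (Fin 2) (Fin 2) ℝ) (x : Pt) : Prop :=
  ∀ a, F a x = hatOn K a p ∧ ∀ m, pd m (F a) x = ∑ k, gradHatOn K a k * J k m

namespace ChainAt

variable {p : Pt} {J : Matrix (Fin 2) (Fin 2) ℝ}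

lemma form0_eq (h : ChainAt F K p J x) (hK : K ∈ T.cells) (q : Pt → ℝ) :
    T.form0 F q x = affineOn K q p := by
  simp only [form0, fun a => (h a).1]
  exact sum_hatOn hK q p

lemma gradForm0_eq (h : ChainAt F K p J x) (hK : K ∈ T.cells) (q : Pt → ℝ) (m : Fin 2) :
    T.gradForm0 F q m x = ∑ k, (∑ i, q (K i) * gradBary K i k) * J k m := by
  simp only [gradForm0, fun a => (h a).2, mul_sum]
  rw [sum_comm]
  refine sum_congr rfl fun k _ => ?_
  rw [← sum_gradHatOn hK q k, sum_mul]
  grind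

lemma sum_sum_verts (hK : K ∈ T.cells) (c : Pt → Pt → ℝ) (f g : Fin 3 → ℝ) :
    ∑ a ∈ T.verts, ∑ b ∈ T.verts, c a b * ((∑ i, if K i = a then f i else 0) *
      (∑ i, if K i = b then g i else 0)) = ∑ i, ∑ j, c (K i) (K j) * (f i * g j) := by
  have h1 : ∀ a, ∑ b ∈ T.verts, c a b * ((∑ i, if K i = a then f i else 0) *
      (∑ i, if K i = b then g i else 0)) =
      (∑ j, c a (K j) * g j) * (∑ i, if K i = a then f i else 0) := fun a => by
    rw [← sum_verts hK (fun b => c a b) g, sum_mul]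
    grind
  simp only [h1]
  rw [sum_verts hK (fun a => ∑ j, c a (K j) * g j) f]
  simp only [sum_mul]
  grind

lemma form1_eq (h : ChainAt F K p J x) (hK : K ∈ T.cells) (c : Pt → Pt → ℝ) (m : Fin 2) :
    T.form1 F c m x = ∑ k, whitneyOn K c k p * J k m := by
  have h1 : ∀ k, whitneyOn K c k p = ∑ a ∈ T.verts, ∑ b ∈ T.verts, c a b *
      (hatOn K a p * gradHatOn K b k) := fun k =>
    (sum_sum_verts hK c (fun i => bary K i p) (fun j => gradBary K j k)).symm
  simp only [form1, fun a => (h a).1, fun a => (h a).2, h1, sum_univ_two,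
    sum_mul, ← sum_add_distrib]
  grind

lemma curlForm1_eq (h : ChainAt F K p J x) (hK : K ∈ T.cells) (hs : sarea K ≠ 0)
    (hc : Alternating c) : T.curlForm1 F c x = J.det * curlOn c K := by
  have h2 := sum_cross_gradBary hs hc
  have h1 : ∀ k l, ∑ a ∈ T.verts, ∑ b ∈ T.verts, c a b * (gradHatOn K a k * gradHatOn K b l) =
      ∑ i, ∑ j, c (K i) (K j) * (gradBary K i k * gradBary K j l) := fun k l =>
    sum_sum_verts hK c (fun i => gradBary K i k) (fun j => gradBary K j l)
  simp only [mul_sub, sum_sub_distrib, ← h1] at h2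
  rw [← h2, Matrix.det_fin_two, curlForm1]
  simp only [fun a => (h a).2, sum_univ_two, ← sum_sub_distrib, mul_sum]
  exact sum_congr rfl fun a _ => sum_congr rfl fun b _ => by ring

end ChainAt

lemma measurable_piecewise_const (T : Triangulation) (s : Tri → ℝ) : Measurable (T.form2 s) := by
  have : T.form2 s = fun x => ∑ K ∈ T.cells, (interior (tri K)).indicator (fun _ => s K) x := rfl
  rw [this]
  exact Finset.measurable_fun_sum _ fun K _ =>
    measurable_const.indicator isOpen_interior.measurableSet

lemma abs_form2_le (T : Triangulation) (s : Tri → ℝ) (x : Pt) :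
    |T.form2 s x| ≤ ∑ K ∈ T.cells, |s K| := by
  refine (abs_sum_le_sum_abs _ _).trans (sum_le_sum fun K _ => ?_)
  by_cases hx : x ∈ interior (tri K)
  · simp_all
  · simp_all

lemma pd_coord (i j : Fin 2) (x : Pt) : pd i (fun y => y j) x = if j = i then 1 else 0 := by
  have := (proj j : Pt →L[ℝ] ℝ).hasFDerivAt (x := x)
  have e : fderiv ℝ (fun x => x j) x = _ := this.fderiv
  rw [pd, e]
  simp

lemma lipschitz_coord (j : Fin 2) : LipschitzWith 1 (fun y : Pt => y j) :=
  LipschitzWith.of_dist_le_mul fun x y => by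
    rw [Real.dist_eq, NNReal.coe_one, one_mul]
    exact abs_coord_sub_le_dist x y j

namespace FoldedMesh
variable (h : FoldedMesh Ω ψ T L A ε F)
include h

lemma chainAt_of_mem_interior (hK : K ∈ T.cells) (hx : x ∈ interior (tri K)) :
    ChainAt F K x 1 x := by
  intro a
  refine ⟨h.eq_hatOn hK a (interior_subset hx), fun m => ?_⟩
  have hF : HasFDerivAt (F a) (gradHatForm K a) x := by
    refine (hasFDerivAt_hatOn K a x).congr_of_eventuallyEq ?_
    filter_upwards [isOpen_interior.mem_nhds hx] with y hy
    exact h.eq_hatOn hK a (interior_subset hy)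
  rw [pd, hF.fderiv]
  fin_cases m <;> simp [gradHatForm, Matrix.one_apply]

section interior

lemma form0_eq (hK : K ∈ T.cells) (hx : x ∈ interior (tri K)) (q : Pt → ℝ) :
    T.form0 F q x = affineOn K q x :=
  (h.chainAt_of_mem_interior hK hx).form0_eq hK q

lemma form1_eq (hK : K ∈ T.cells) (hx : x ∈ interior (tri K)) (c : Pt → Pt → ℝ) (m : Fin 2) :
    T.form1 F c m x = whitneyOn K c m x := by
  rw [(h.chainAt_of_mem_interior hK hx).form1_eq hK c]
  simp [Matrix.one_apply]

lemma curlForm1_eq (hK : K ∈ T.cells) (hx : x ∈ interior (tri K)) (hc : Alternating c) :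
    T.curlForm1 F c x = curlOn c K := by
  rw [(h.chainAt_of_mem_interior hK hx).curlForm1_eq hK (T.sarea_ne hK) hc, Matrix.det_one, one_mul]

lemma form1_diff0 (hK : K ∈ T.cells) (hx : x ∈ interior (tri K)) (q : Pt → ℝ) (m : Fin 2) :
    T.form1 F (diff0 q) m x = T.gradForm0 F q m x := by
  rw [h.form1_eq hK hx, (h.chainAt_of_mem_interior hK hx).gradForm0_eq hK q]
  have h1 := bary_sum (T.sarea_ne hK) x
  have h2 := sum_gradBary (T.sarea_ne hK) m
  have e : ∑ k, (∑ i, q (K i) * gradBary K i k) * (1 : Matrix (Fin 2) (Fin 2) ℝ) k m =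
      ∑ i, q (K i) * gradBary K i m := by
    simp [Matrix.one_apply]
  rw [e]
  simp only [whitneyOn, diff0, sum_univ_three] at h1 h2 ⊢
  grind

end interior

/-- A property that holds inside all triangles holds almost everywhere in `Ω`. -/
lemma ae_of_cells (hp : ∀ K ∈ T.cells, ∀ x ∈ interior (tri K), p x) :
    ∀ᵐ x ∂(volume.restrict Ω), p x := by
  rw [ae_restrict_iff' h.isOpen.measurableSet]
  filter_upwards [T.ae_mem_interior_of_mem_support] with x hx hxΩ
  obtain ⟨K, hK, hxK⟩ := hx (h.meshes.subset_support hxΩ)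
  exact hp K hK x hxK

lemma weakCurl_form1 (c : Pt → Pt → ℝ) :
    WeakCurl Ω (T.form1 F c 0) (T.form1 F c 1) (T.curlForm1 F c) := by
  obtain ⟨C, hC⟩ := h.exists_lip
  exact WeakCurl.sum _ fun a _ => WeakCurl.sum _ fun b _ =>
    (weakCurl_of_lipschitz (hC a) (hC b) (h.abs_le_one a)).const_mul (c a b)

lemma weakCurl_form0_right (q : Pt → ℝ) :
    WeakCurl Ω (fun _ => 0) (T.form0 F q) (T.gradForm0 F q 0) := by
  obtain ⟨C, hC⟩ := h.exists_lip
  have := WeakCurl.sum T.verts fun a _ => (weakCurl_of_lipschitz (Ω := Ω)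
    ((hC a).weaken (le_max_left C 1)) ((lipschitz_coord 1).weaken (le_max_right C 1))
    (h.abs_le_one a)).const_mul (q a)
  simp [pd_coord] at this
  exact this

lemma weakCurl_form0_left (q : Pt → ℝ) :
    WeakCurl Ω (T.form0 F q) (fun _ => 0) (fun x => -T.gradForm0 F q 1 x) := by
  obtain ⟨C, hC⟩ := h.exists_lip
  have := WeakCurl.sum T.verts fun a _ => (weakCurl_of_lipschitz (Ω := Ω)
    ((hC a).weaken (le_max_left C 1)) ((lipschitz_coord 0).weaken (le_max_right C 1))
    (h.abs_le_one a)).const_mul (q a)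
  simp [pd_coord] at this
  exact this

end FoldedMesh

/-! ### The discrete fields with given degrees of freedom -/

namespace Triangulation

variable (T : Triangulation) (F : Pt → Pt → ℝ) (n : ℕ)

/-- The scalar field `u` for which `n u / r` has the vertex values `q`. -/
def fieldG (q : Pt → ℝ) (x : Pt) : ℝ := x 0 / n * T.form0 F q x

/-- The vector field `v` for which `v_θ` has the vertex values `θ` and
`((n v_r + v_θ) / r, n v_z / r)` is the Whitney form with edge values `c`. -/
def fieldC (θ : Pt → ℝ) (c : Pt → Pt → ℝ) (x : Pt) : Vec :=
  !₂[(x 0 * T.form1 F c 0 x - T.form0 F θ x) / n, T.form0 F θ x, x 0 * T.form1 F c 1 x / n]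

/-- The vector field `w` for which `(w_z, -w_r)` is the Whitney form with edge values `c` and
`(n w_θ - w_r) / r` is the density `s`. -/
def fieldD (c : Pt → Pt → ℝ) (s : Tri → ℝ) (x : Pt) : Vec :=
  !₂[-T.form1 F c 1 x, (x 0 * T.form2 s x - T.form1 F c 1 x) / n, T.form1 F c 0 x]

end Triangulation

section MemLp

lemma isFiniteMeasure_rMeasure (hb : Bornology.IsBounded Ω) : IsFiniteMeasure (rMeasure Ω) := by
  obtain ⟨R, hR⟩ := hb.subset_closedBall 0
  refine isFiniteMeasure_withDensity ?_
  refine (lt_of_le_of_lt (lintegral_mono_set hR) ?_).ne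
  refine lt_of_le_of_lt (setLIntegral_mono (g := fun _ => ENNReal.ofReal R) measurable_const
    fun x hx => ENNReal.ofReal_le_ofReal ?_) ?_
  · have h1 := abs_coord_sub_le_dist x 0 0
    have h2 : dist x 0 ≤ R := hx
    simp only [PiLp.zero_apply, sub_zero] at h1
    grind
  · rw [setLIntegral_const]
    exact ENNReal.mul_lt_top ENNReal.ofReal_lt_top measure_closedBall_lt_top

lemma memLp_of_bounded (hΩ : IsOpen Ω) (hpos : Ω ⊆ halfPlane) (hb : Bornology.IsBounded Ω)
    (hf : Measurable f) {C : ℝ} (hC : ∀ x ∈ Ω, |f x| ≤ C) : MemLp f 2 (rMeasure Ω) := by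
  have := isFiniteMeasure_rMeasure hb
  exact MemLp.of_bound hf.aestronglyMeasurable C
    ((ae_rMeasure_iff hΩ hpos).2 (.of_forall hC))

end MemLp

section congr

lemma comp_congr {v v' : Pt → Vec} (h : v =ᵐ[rMeasure Ω] v') (i : Fin 3) :
    comp v i =ᵐ[rMeasure Ω] comp v' i := by
  filter_upwards [h] with x hx
  rw [comp, comp, hx]

lemma IsGrad.congr {u' : Pt → ℝ} {v v' : Pt → Vec} (h : IsGrad n Ω u v) (hu : u =ᵐ[rMeasure Ω] u')
    (hv : v =ᵐ[rMeasure Ω] v') : IsGrad n Ω u' v' := fun φ hφ => by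
  have := h φ hφ
  have hc := fun i => comp_congr hv i
  rwa [pair_congr (hc 0) hφ.isCc, pair_congr (hc 1) hφ.isCc, pair_congr (hc 2) hφ.isCc,
    pair_congr hu (hφ.isCc_pd 0), pair_congr hu (hφ.isCc_pd 1), pair_congr hu hφ.isCc.overR] at this

lemma IsCurl.congr {v v' w w' : Pt → Vec} (h : IsCurl n Ω v w)
    (hv : v =ᵐ[rMeasure Ω] v') (hw : w =ᵐ[rMeasure Ω] w') : IsCurl n Ω v' w' := fun φ hφ => by
  have := h φ hφ
  have hc := fun i => comp_congr hv i
  have hd := fun i => comp_congr hw i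
  rwa [pair_congr (hd 0) hφ.isCc, pair_congr (hd 1) hφ.isCc, pair_congr (hd 2) hφ.isCc,
    pair_congr (hc 2) hφ.isCc.overR, pair_congr (hc 1) (hφ.isCc_pd 1),
    pair_congr (hc 0) (hφ.isCc_pd 1), pair_congr (hc 2) (hφ.isCc_pd 0),
    pair_congr (hc 0) hφ.isCc.overR, pair_congr (hc 1) hφ.isCc.overR,
    pair_congr (hc 1) (hφ.isCc_pd 0)] at this

lemma IsDiv.congr {w w' : Pt → Vec} {f' : Pt → ℝ} (h : IsDiv n Ω w f) (hw : w =ᵐ[rMeasure Ω] w')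
    (hf : f =ᵐ[rMeasure Ω] f') : IsDiv n Ω w' f' := fun φ hφ => by
  have := h φ hφ
  have hd := fun i => comp_congr hw i
  rwa [pair_congr hf hφ.isCc, pair_congr (hd 0) (hφ.isCc_pd 0), pair_congr (hd 0) hφ.isCc.overR,
    pair_congr (hd 1) hφ.isCc.overR, pair_congr (hd 2) (hφ.isCc_pd 1)] at this

lemma ae_eq_of_pair_eq (hΩ : IsOpen Ω) (hpos : Ω ⊆ halfPlane) (hf : MemLp f 2 (rMeasure Ω))
    (hg : MemLp g 2 (rMeasure Ω)) (h : ∀ φ, IsTest Ω φ → pair Ω f φ = pair Ω g φ) :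
    f =ᵐ[rMeasure Ω] g := by
  rw [EventuallyEq, ae_rMeasure_iff hΩ hpos]
  filter_upwards [((TestIntegrable.of_memLp hf).sub (.of_memLp hg)).ae_eq_zero hΩ hpos
    fun φ hφ => by rw [pair_fun_sub (.of_memLp hf) (.of_memLp hg) hφ.isCc, h φ hφ, sub_self]]
    with x hx hxΩ
  grind

lemma ae_eq_of_comp {v v' : Pt → Vec} (h : ∀ i, comp v i =ᵐ[rMeasure Ω] comp v' i) :
    v =ᵐ[rMeasure Ω] v' := by
  filter_upwards [h 0, h 1, h 2] with x h0 h1 h2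
  ext i
  fin_cases i
  exacts [h0, h1, h2]

/-- The distributional gradient is unique. -/
lemma IsGrad.unique (hΩ : IsOpen Ω) (hpos : Ω ⊆ halfPlane) {v v' : L2rVec Ω} (h : IsGrad n Ω u v)
    (h' : IsGrad n Ω u v') : v = v' := by
  refine Lp.ext (ae_eq_of_comp fun i => ae_eq_of_pair_eq hΩ hpos (memLp_comp v i) (memLp_comp v' i)
    fun φ hφ => ?_)
  have a := h φ hφ
  have b := h' φ hφ
  fin_cases i
  exacts [a.1.trans b.1.symm, a.2.1.trans b.2.1.symm, a.2.2.trans b.2.2.symm]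

/-- The distributional curl is unique. -/
lemma IsCurl.unique (hΩ : IsOpen Ω) (hpos : Ω ⊆ halfPlane) {u : Pt → Vec} {v v' : L2rVec Ω}
    (h : IsCurl n Ω u v) (h' : IsCurl n Ω u v') : v = v' := by
  refine Lp.ext (ae_eq_of_comp fun i => ae_eq_of_pair_eq hΩ hpos (memLp_comp v i) (memLp_comp v' i)
    fun φ hφ => ?_)
  have a := h φ hφ
  have b := h' φ hφ
  fin_cases i
  exacts [a.1.trans b.1.symm, a.2.1.trans b.2.1.symm, a.2.2.trans b.2.2.symm]

/-- The distributional divergence is unique. -/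
lemma IsDiv.unique (hΩ : IsOpen Ω) (hpos : Ω ⊆ halfPlane) {w : Pt → Vec} {f f' : L2r Ω}
    (h : IsDiv n Ω w f) (h' : IsDiv n Ω w f') : f = f' :=
  Lp.ext (ae_eq_of_pair_eq hΩ hpos (Lp.memLp f) (Lp.memLp f')
    fun φ hφ => (h φ hφ).trans (h' φ hφ).symm)

end congr

namespace FoldedMesh
variable (h : FoldedMesh Ω ψ T L A ε F)
include h

lemma isBounded : Bornology.IsBounded Ω :=
  T.isCompact_support.isBounded.subset h.meshes.subset_support

lemma measurable_form0 (q : Pt → ℝ) : Measurable (T.form0 F q) :=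
  Finset.measurable_fun_sum _ fun a _ => ((h.continuous a).measurable).const_mul _

lemma measurable_form1 (c : Pt → Pt → ℝ) (m : Fin 2) : Measurable (T.form1 F c m) :=
  Finset.measurable_fun_sum _ fun a _ => Finset.measurable_fun_sum _ fun b _ =>
    (((h.continuous a).measurable).mul (measurable_pd (F b) m)).const_mul _

lemma exists_form0_le (q : Pt → ℝ) : ∃ C, ∀ x, |T.form0 F q x| ≤ C := by
  refine ⟨∑ a ∈ T.verts, |q a|, fun x => (abs_sum_le_sum_abs _ _).trans
    (sum_le_sum fun a _ => ?_)⟩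
  rw [abs_mul]
  exact mul_le_of_le_one_right (abs_nonneg _) (h.abs_le_one a x)

lemma exists_form1_le (c : Pt → Pt → ℝ) : ∃ C, ∀ m x, |T.form1 F c m x| ≤ C := by
  obtain ⟨C, hC⟩ := h.exists_lip
  refine ⟨∑ a ∈ T.verts, ∑ b ∈ T.verts, |c a b| * C, fun m x =>
    (abs_sum_le_sum_abs _ _).trans (sum_le_sum fun a _ =>
    (abs_sum_le_sum_abs _ _).trans (sum_le_sum fun b _ => ?_))⟩
  rw [abs_mul, abs_mul]
  gcongr
  rw [← one_mul (C : ℝ)]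
  exact mul_le_mul (h.abs_le_one a x) (abs_pd_le_of_lip (hC b) m x) (abs_nonneg _) zero_le_one

lemma memLp_mul_radius (hf : Measurable f) {C : ℝ} (hC : ∀ x, |f x| ≤ C) :
    MemLp (fun x => x 0 * f x) 2 (rMeasure Ω) := by
  obtain ⟨R, hR⟩ := h.isBounded.subset_closedBall 0
  refine memLp_of_bounded h.isOpen h.pos h.isBounded (C := R * C) (by fun_prop) fun x hx => ?_
  have h1 := abs_coord_sub_le_dist x 0 0
  have h2 := hR hx
  simp only [PiLp.zero_apply, sub_zero] at h1
  rw [abs_mul]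
  exact mul_le_mul (h1.trans h2) (hC x) (abs_nonneg _) (dist_nonneg.trans h2)

lemma memLp_form0 (q : Pt → ℝ) : MemLp (T.form0 F q) 2 (rMeasure Ω) := by
  obtain ⟨C, hC⟩ := h.exists_form0_le q
  exact memLp_of_bounded h.isOpen h.pos h.isBounded (h.measurable_form0 q) fun x _ => hC x

lemma memLp_form1 (c : Pt → Pt → ℝ) (m : Fin 2) : MemLp (T.form1 F c m) 2 (rMeasure Ω) := by
  obtain ⟨C, hC⟩ := h.exists_form1_le c
  exact memLp_of_bounded h.isOpen h.pos h.isBounded (h.measurable_form1 c m) fun x _ => hC m x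

lemma memLp_form2 (s : Tri → ℝ) : MemLp (T.form2 s) 2 (rMeasure Ω) :=
  memLp_of_bounded h.isOpen h.pos h.isBounded (measurable_piecewise_const T s)
    fun x _ => abs_form2_le T s x

lemma memLp_fieldG (n : ℕ) (q : Pt → ℝ) : MemLp (T.fieldG F n q) 2 (rMeasure Ω) := by
  obtain ⟨C, hC⟩ := h.exists_form0_le q
  have := (h.memLp_mul_radius (h.measurable_form0 q) hC).const_mul (1 / (n : ℝ))
  refine this.congr_norm this.1 (.of_forall fun x => ?_) |>.ae_eq ?_
  · rfl
  · exact .of_forall fun x => by simp only [fieldG]; ring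

lemma memLp_fieldC_comp (n : ℕ) (θ : Pt → ℝ) (c : Pt → Pt → ℝ) (i : Fin 3) :
    MemLp (comp (T.fieldC F n θ c) i) 2 (rMeasure Ω) := by
  obtain ⟨C, hC⟩ := h.exists_form1_le c
  have hr := fun m => h.memLp_mul_radius (h.measurable_form1 c m) (hC m)
  fin_cases i
  · exact (((hr 0).sub (h.memLp_form0 θ)).const_mul (1 / (n : ℝ))).ae_eq
      (.of_forall fun x => by simp [comp, fieldC]; ring)
  · exact h.memLp_form0 θ
  · exact ((hr 1).const_mul (1 / (n : ℝ))).ae_eq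
      (.of_forall fun x => by simp [comp, fieldC]; ring)

lemma memLp_fieldD_comp (n : ℕ) (c : Pt → Pt → ℝ) (s : Tri → ℝ) (i : Fin 3) :
    MemLp (comp (T.fieldD F n c s) i) 2 (rMeasure Ω) := by
  fin_cases i
  · exact (h.memLp_form1 c 1).neg
  · exact (((h.memLp_mul_radius (measurable_piecewise_const T s) (abs_form2_le T s)).sub
      (h.memLp_form1 c 1)).const_mul (1 / (n : ℝ))).ae_eq
      (.of_forall fun x => by simp [comp, fieldD]; ring)
  · exact h.memLp_form1 c 0

omit h in
lemma memLp_of_comp {v : Pt → Vec} (hv : ∀ i, MemLp (comp v i) 2 (rMeasure Ω)) :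
    MemLp v 2 (rMeasure Ω) := memLp_piLp_iff.2 hv

lemma form2_ae (hc : Alternating c) :
    ∀ᵐ x ∂(volume.restrict Ω), T.curlForm1 F c x = T.form2 (curlOn c) x :=
  h.ae_of_cells fun K hK x hx => by
    rw [h.curlForm1_eq hK hx hc, form2, piecewise_eq _ hK hx]

lemma ae_restrict_pos : ∀ᵐ x ∂(volume.restrict Ω), 0 < x 0 :=
  (ae_restrict_iff' h.isOpen.measurableSet).2 (.of_forall fun _ hx => h.pos hx)

/-- The gradient of a discrete field, in terms of degrees of freedom. -/
theorem isGrad_fieldG (hn : 0 < n) (q : Pt → ℝ) :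
    IsGrad n Ω (T.fieldG F n q) (T.fieldC F n (-q) (diff0 q)) := by
  have hn' : (n : ℝ) ≠ 0 := by positivity
  rw [isGrad_iff h.isOpen h.pos (h.memLp_fieldG n q) (h.memLp_fieldC_comp n _ _)]
  have e0 : ∀ x, T.form0 F (-q) x = -T.form0 F q x := fun x => by
    simp [form0]
  have e1 := h.ae_of_cells fun K hK x hx m => h.form1_diff0 hK hx q m
  refine ⟨?_, ?_, ?_⟩
  · refine ((h.weakCurl_form0_right q).radius_mul.const_mul (1 / (n : ℝ))).congr ?_ ?_ ?_
    · simp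
    · exact .of_forall fun x => by simp only [fieldG]; ring
    · filter_upwards [e1] with x hx
      simp [comp, fieldC, hx, e0]
      ring
  · refine ((h.weakCurl_form0_left q).radius_mul.const_mul (-(1 / (n : ℝ)))).congr ?_ ?_ ?_
    · exact .of_forall fun x => by simp only [fieldG]; ring
    · simp
    · filter_upwards [e1] with x hx
      simp [comp, fieldC, hx]
      ring
  · refine .of_forall fun x hx => ?_
    have h0 : x 0 ≠ 0 := (h.pos hx).ne'
    simp [fieldC, fieldG, e0]
    field_simp

/-- The curl of a discrete field, in terms of degrees of freedom. -/
theorem isCurl_fieldC (hn : 0 < n) (θ : Pt → ℝ) (hc : Alternating c) :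
    IsCurl n Ω (T.fieldC F n θ c) (T.fieldD F n (c + diff0 θ) (-curlOn c)) := by
  have hn' : (n : ℝ) ≠ 0 := by positivity
  rw [isCurl_iff (h.memLp_fieldC_comp n _ _) (h.memLp_fieldD_comp n _ _)]
  have e1 : ∀ᵐ x ∂(volume.restrict Ω), ∀ m,
      T.form1 F (c + diff0 θ) m x = T.form1 F c m x + T.gradForm0 F θ m x :=
    h.ae_of_cells fun K hK x hx m => by
      rw [← h.form1_diff0 hK hx θ m]
      simp [form1, add_mul, sum_add_distrib]
  have e2 : ∀ x, T.form2 (-curlOn c) x = -T.form2 (curlOn c) x := fun x => by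
    simp only [form2, piecewise, ← Finset.sum_neg_distrib]
    refine sum_congr rfl fun K _ => ?_
    by_cases hx : x ∈ interior (tri K) <;> simp [hx]
  refine ⟨?_, ?_, ?_⟩
  · refine (h.weakCurl_form0_left θ).congr ?_ ?_ ?_
    · exact .of_forall fun x => rfl
    · simp
    · filter_upwards [e1, h.ae_restrict_pos] with x hx h0
      simp [comp, fieldC, fieldD, hx]
      field_simp
      ring
  · refine (((h.weakCurl_form1 c).radius_mul.const_mul (-(1 / (n : ℝ)))).add
      ((h.weakCurl_form0_left θ).const_mul (1 / (n : ℝ)))).congr ?_ ?_ ?_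
    · exact .of_forall fun x => by simp [comp, fieldC]; ring
    · exact .of_forall fun x => by simp [comp, fieldC]; ring
    · filter_upwards [e1, h.form2_ae hc] with x hx hx2
      simp [comp, fieldD, hx, e2, hx2]
      ring
  · refine (h.weakCurl_form0_right θ).congr ?_ ?_ ?_
    · simp
    · exact .of_forall fun x => rfl
    · filter_upwards [e1, h.ae_restrict_pos] with x hx h0
      simp [comp, fieldC, fieldD, hx]
      field_simp
      ring

/-- The divergence of a discrete field, in terms of degrees of freedom. -/
theorem isDiv_fieldD (hn : 0 < n) (hc : Alternating c) (s : Tri → ℝ) :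
    IsDiv n Ω (T.fieldD F n c s) (T.form2 (-curlOn c - s)) := by
  have hn' : (n : ℝ) ≠ 0 := by positivity
  rw [isDiv_iff (h.memLp_fieldD_comp n _ _) (h.memLp_form2 _)]
  have e2 : ∀ x, T.form2 (-curlOn c - s) x = -T.form2 (curlOn c) x - T.form2 s x := fun x => by
    simp only [form2, piecewise, ← Finset.sum_neg_distrib, ← sum_sub_distrib]
    refine sum_congr rfl fun K _ => ?_
    by_cases hx : x ∈ interior (tri K) <;> simp [hx]
  refine ((h.weakCurl_form1 c).const_mul (-1)).congr ?_ ?_ ?_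
  · exact .of_forall fun x => by simp [comp, fieldD]
  · exact .of_forall fun x => by simp [comp, fieldD]
  · filter_upwards [h.form2_ae hc, h.ae_restrict_pos] with x hx2 h0
    simp [comp, fieldD, e2, hx2]
    field_simp
    ring

/-! ### Membership in the finite element spaces -/

lemma ae_cell {V : Type*} {f g : Pt → V} (hfg : f =ᵐ[rMeasure Ω] g) {p : Pt → V}
    (hg : ∀ x ∈ interior (tri K), g x = p x) : ∀ᵐ x ∂(rMeasure Ω), x ∈ tri K → f x = p x := by
  have h1 := (ae_rMeasure_iff h.isOpen h.pos).1 hfg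
  rw [ae_rMeasure_iff h.isOpen h.pos]
  filter_upwards [h1, ae_mem_interior_of_mem_tri K] with x hx hxK hxΩ hxt
  grind

lemma mem_Ah (hn : 0 < n) {u : L2r Ω} (hu : ⇑u =ᵐ[rMeasure Ω] T.fieldG F n q) : u ∈ Ah n Ω T := by
  refine ⟨⟨(memLp_of_comp (h.memLp_fieldC_comp n (-q) (diff0 q))).toLp _,
    (h.isGrad_fieldG hn q).congr hu.symm (MemLp.coeFn_toLp _).symm⟩, fun K hK => ?_⟩
  obtain ⟨t₀, t₁, t₂, ht⟩ := affineOn_eq K q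
  refine ⟨t₀ / n, t₁ / n, t₂ / n, h.ae_cell hu fun x hx => ?_⟩
  rw [fieldG, h.form0_eq hK hx, ht]
  ring

lemma mem_Bh (hn : 0 < n) (hc : Alternating c) {v : L2rVec Ω}
    (hv : ⇑v =ᵐ[rMeasure Ω] T.fieldC F n θ c) : v ∈ Bh n Ω T := by
  have hn' : (n : ℝ) ≠ 0 := by positivity
  refine ⟨⟨(memLp_of_comp (h.memLp_fieldD_comp n (c + diff0 θ) (-curlOn c))).toLp _,
    (h.isCurl_fieldC hn θ hc).congr hv.symm (MemLp.coeFn_toLp _).symm⟩, fun K hK => ?_⟩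
  obtain ⟨t₀, t₁, t₂, ht⟩ := affineOn_eq K θ
  obtain ⟨α, β, γ, hαβγ⟩ := whitneyOn_eq K hc
  refine ⟨-t₀ / n, t₁, -t₂ / n, (α - t₁) / n, β / n, γ / n, ?_⟩
  filter_upwards [h.ae_cell hv (p := fun x =>
    !₂[(x 0 * whitneyOn K c 0 x - affineOn K θ x) / n, affineOn K θ x, x 0 * whitneyOn K c 1 x / n])
    fun x hx => by
      rw [fieldC, h.form0_eq hK hx, h.form1_eq hK hx, h.form1_eq hK hx]] with x hx hxK
  rw [hx hxK, ht, (hαβγ x).1, (hαβγ x).2]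
  simp
  grind

lemma mem_Ch (hn : 0 < n) (hc : Alternating c) {w : L2rVec Ω}
    (hw : ⇑w =ᵐ[rMeasure Ω] T.fieldD F n c s) : w ∈ Ch n Ω T := by
  have hn' : (n : ℝ) ≠ 0 := by positivity
  refine ⟨⟨(h.memLp_form2 (-curlOn c - s)).toLp _,
    (h.isDiv_fieldD hn hc s).congr hw.symm (MemLp.coeFn_toLp _).symm⟩, fun K hK => ?_⟩
  obtain ⟨α, β, γ, hαβγ⟩ := whitneyOn_eq K hc
  refine ⟨-β / n, -γ, (s K - γ) / n, α, ?_⟩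
  filter_upwards [h.ae_cell hw (p := fun x =>
    !₂[-whitneyOn K c 1 x, (x 0 * s K - whitneyOn K c 1 x) / n, whitneyOn K c 0 x])
    fun x hx => by
      rw [fieldD, h.form1_eq hK hx, h.form1_eq hK hx, form2,
        piecewise_eq _ hK hx]] with x hx hxK
  rw [hx hxK, (hαβγ x).1, (hαβγ x).2]
  simp
  grind

lemma mem_Dh {f : L2r Ω} (hf : ⇑f =ᵐ[rMeasure Ω] T.form2 s) : f ∈ Dh Ω T := fun K hK =>
  ⟨s K, h.ae_cell hf fun x hx => by rw [form2, piecewise_eq _ hK hx]⟩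

end FoldedMesh

/-! ### Weak curls and tangential jumps -/

lemma IsTest.mono {Ω' : Set Pt} (h : Ω' ⊆ Ω) (hφ : IsTest Ω' φ) : IsTest Ω φ :=
  ⟨hφ.1, hφ.2.1, hφ.2.2.trans (inter_subset_inter_left _ h)⟩

lemma IsTest.eq_zero (hφ : IsTest Ω φ) (hx : x ∉ Ω) : φ x = 0 ∧ ∀ i, pd i φ x = 0 := by
  have hn : x ∉ tsupport φ := fun h => hx (hφ.2.2 h).1
  refine ⟨image_eq_zero_of_notMem_tsupport hn, fun i => ?_⟩
  have h0 : fderiv ℝ φ x = 0 := by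
    by_contra hne
    exact hn (tsupport_fderiv_subset ℝ (subset_tsupport _ hne))
  rw [pd, h0]; rfl

lemma pair_eq_integral (hg : ∀ x, x ∉ Ω → g x = 0) (f : Pt → ℝ) : pair Ω f g = ∫ x, f x * g x :=
  setIntegral_eq_integral_of_forall_compl_eq_zero fun x hx => by grind

lemma WeakCurl.mono {Ω' : Set Pt} (h : WeakCurl Ω P Q f) (hs : Ω' ⊆ Ω) : WeakCurl Ω' P Q f := by
  have hm : ∀ {g : Pt → ℝ}, TestIntegrable Ω g → TestIntegrable Ω' g := fun hg φ hφ =>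
    IntegrableOn.mono_set (hg φ hφ) hs
  refine ⟨hm h.left, hm h.right, hm h.curl, fun φ hφ => ?_⟩
  have e := h.eq φ (hφ.mono hs)
  have h1 : ∀ x, x ∉ Ω → x ∉ Ω' := fun x hx h => hx (hs h)
  rwa [pair_eq_integral (fun x hx => (hφ.eq_zero (h1 x hx)).1),
    pair_eq_integral (fun x hx => (hφ.eq_zero (h1 x hx)).2 1),
    pair_eq_integral (fun x hx => (hφ.eq_zero (h1 x hx)).2 0),
    ← pair_eq_integral (Ω := Ω') (fun x hx => (hφ.eq_zero hx).1),
    ← pair_eq_integral (Ω := Ω') (fun x hx => (hφ.eq_zero hx).2 1),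
    ← pair_eq_integral (Ω := Ω') (fun x hx => (hφ.eq_zero hx).2 0)] at e

lemma continuous_pd (h : ContDiff ℝ 1 φ) (i : Fin 2) : Continuous (pd i φ) :=
  (h.continuous_fderiv (by simp)).clm_apply continuous_const

/-- Integration by parts on a triangle. -/
lemma green_test (h : sarea K ≠ 0) (hφ : ContDiff ℝ 1 φ) (hP : ContDiff ℝ 1 P) (hQ : ContDiff ℝ 1 Q)
    : (∫ x in tri K, (pd 0 Q x - pd 1 P x) * φ x) -
    ((∫ x in tri K, P x * pd 1 φ x) - ∫ x in tri K, Q x * pd 0 φ x) = SignType.sign (sarea K) * ∑ i,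
    edgeTangent K i (fun x => ![φ x * P x, φ x * Q x]) := by
  rw [← green_tri h (hφ.mul hP) (hφ.mul hQ)]
  have hint : ∀ {g : Pt → ℝ}, Continuous g → IntegrableOn g (tri K) := fun hg =>
    hg.continuousOn.integrableOn_compact (isCompact_tri K)
  have c0 := continuous_pd hφ 0
  have c1 := continuous_pd hφ 1
  have cQ := continuous_pd hQ 0
  have cP := continuous_pd hP 1
  have := hφ.continuous
  have := hP.continuous
  have := hQ.continuous
  rw [← integral_sub (hint (by fun_prop)) (hint (by fun_prop)),
    ← integral_sub (hint (by fun_prop)) (hint (by fun_prop))]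
  refine integral_congr_ae (.of_forall fun x => ?_)
  have d : ∀ {g : Pt → ℝ}, ContDiff ℝ 1 g → DifferentiableAt ℝ g x := fun hg =>
    hg.differentiable (by simp) x
  simp only []
  rw [pd_mul (d hφ) (d hQ), pd_mul (d hφ) (d hP)]
  ring

lemma edgeTangent_eq_zero (h : ∀ s : ℝ, φ (K (i + 1) + s • (K (i + 2) - K (i + 1))) = 0) :
    edgeTangent K i (fun x => ![φ x * P x, φ x * Q x]) = 0 := by
  simp [edgeTangent, h]

/-- Integration by parts on a triangle against a function that vanishes on two of the edges. -/
lemma green_test_ae (h : sarea K ≠ 0) (hφ : ContDiff ℝ 1 φ)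
    (h0 : ∀ x, bary K 1 x = 0 ∨ bary K 2 x = 0 → φ x = 0) {P₁ Q₁ : Pt → ℝ} (hP : ContDiff ℝ 1 P₁)
    (hQ : ContDiff ℝ 1 Q₁) (hPQ : ∀ᵐ x, x ∈ tri K → P x = P₁ x ∧ Q x = Q₁ x)
    (hf : ∀ᵐ x, x ∈ tri K → f x = pd 0 Q₁ x - pd 1 P₁ x) :
    (∫ x in tri K, f x * φ x) - ((∫ x in tri K, P x * pd 1 φ x) - ∫ x in tri K, Q x * pd 0 φ x) =
      SignType.sign (sarea K) * edgeTangent K 0 (fun x => ![φ x * P₁ x, φ x * Q₁ x]) := by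
  have e : ∀ {k k' : Pt → ℝ} (χ : Pt → ℝ), (∀ᵐ x, x ∈ tri K → k x = k' x) →
      ∫ x in tri K, k x * χ x = ∫ x in tri K, k' x * χ x := fun χ hk => by
    refine setIntegral_congr_ae (isCompact_tri K).measurableSet ?_
    filter_upwards [hk] with x hx hxK
    rw [hx hxK]
  rw [e φ hf, e _ (hPQ.mono fun x hx hxK => (hx hxK).1), e _ (hPQ.mono fun x hx hxK => (hx hxK).2),
    green_test h hφ hP hQ, sum_eq_single 0 (fun i _ hi => ?_) (by simp)]
  refine edgeTangent_eq_zero fun s => h0 _ ?_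
  have := bary_opposite_edge h i s
  fin_cases i
  exacts [absurd rfl hi, .inl this, .inr this]

/-- Inside a triangle, the weak curl of a smooth field is its curl. -/
lemma WeakCurl.ae_eq_curl (hw : WeakCurl Ω P Q f) (hpos : Ω ⊆ halfPlane) (h : sarea K ≠ 0)
    (hK : interior (tri K) ⊆ Ω) {P₁ Q₁ : Pt → ℝ} (hP₁ : ContDiff ℝ 1 P₁) (hQ₁ : ContDiff ℝ 1 Q₁)
    (hPQ : ∀ᵐ x, x ∈ tri K → P x = P₁ x ∧ Q x = Q₁ x) :
    ∀ᵐ x, x ∈ tri K → f x = pd 0 Q₁ x - pd 1 P₁ x := by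
  have hw' := hw.mono hK
  have hcont := (continuous_pd hQ₁ 0).sub (continuous_pd hP₁ 1)
  have hcurl : TestIntegrable (interior (tri K)) fun x => pd 0 Q₁ x - pd 1 P₁ x := fun φ hφ =>
    ((hcont.mul hφ.1).integrable_of_hasCompactSupport hφ.2.1.mul_left).integrableOn
  have key : ∀ φ, IsTest (interior (tri K)) φ →
      pair (interior (tri K)) (fun x => f x - (pd 0 Q₁ x - pd 1 P₁ x)) φ = 0 := by
    intro φ hφ
    rw [pair_fun_sub hw'.curl hcurl hφ.isCc, hw'.eq φ hφ]
    have hpair : ∀ (g χ : Pt → ℝ), (∀ x, x ∉ interior (tri K) → χ x = 0) →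
        pair (interior (tri K)) g χ = ∫ x in tri K, g x * χ x := fun g χ hχ => by
      rw [pair_eq_integral hχ, setIntegral_eq_integral_of_forall_compl_eq_zero]
      intro x hx
      rw [hχ x (fun hn => hx (interior_subset hn)), mul_zero]
    have z : ∀ x i, bary K i x = 0 → φ x = 0 := fun x i hi =>
      (hφ.eq_zero fun hn => by rw [interior_tri h] at hn; exact (hn i).ne' hi).1
    have hg := green_test_ae h (hφ.1.of_le (by simp)) (fun x hx => hx.elim (z x 1) (z x 2)) hP₁ hQ₁
      hPQ (.of_forall fun _ _ => rfl)
    rw [edgeTangent_eq_zero fun s => z _ 0 (bary_opposite_edge h 0 s), mul_zero] at hg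
    rw [hpair _ _ fun x hx => (hφ.eq_zero hx).1, hpair _ _ fun x hx => (hφ.eq_zero hx).2 1,
      hpair _ _ fun x hx => (hφ.eq_zero hx).2 0]
    linarith
  filter_upwards [(hw'.curl.sub hcurl).ae_eq_zero isOpen_interior (hK.trans hpos) key,
    ae_mem_interior_of_mem_tri K] with x hx hxi hxK
  grind

/-- The points at which the barycentric coordinates of the vertices `1` and `2` of both triangles are
positive: a neighbourhood of the open edge, if the triangles share the edge from `1` to `2`. -/
def edgeNbhd (C D : Tri) : Set Pt :=
  {x | (0 < bary C 1 x ∧ 0 < bary C 2 x) ∧ (0 < bary D 1 x ∧ 0 < bary D 2 x)}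

lemma isOpen_edgeNbhd (C D : Tri) : IsOpen (edgeNbhd C D) :=
  ((isOpen_lt continuous_const (continuous_bary 1)).inter
    (isOpen_lt continuous_const (continuous_bary 2))).inter
  ((isOpen_lt continuous_const (continuous_bary 1)).inter
    (isOpen_lt continuous_const (continuous_bary 2)))

lemma bary_zero_mul {a b c : Pt} (hc : sarea ![c, a, b] ≠ 0) (x : Pt) :
    bary ![c, a, b] 0 x * sarea ![c, a, b] = cross (b - a) (x - a) := by
  rw [bary_eq, div_mul_cancel₀ _ hc]; simp

lemma edgeNbhd_subset {a b c d : Pt} (hc : sarea ![c, a, b] ≠ 0) (hd : sarea ![d, a, b] ≠ 0)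
    (hopp : sarea ![c, a, b] * sarea ![d, a, b] < 0) :
    edgeNbhd ![c, a, b] ![d, a, b] ⊆ tri ![c, a, b] ∪ tri ![d, a, b] := by
  rintro x ⟨⟨h1, h2⟩, h3, h4⟩
  have e1 := bary_zero_mul hc x
  have e2 := bary_zero_mul hd x
  set C : Tri := ![c, a, b]
  set D : Tri := ![d, a, b]
  by_cases h0 : 0 ≤ bary C 0 x
  · left
    rw [mem_tri_iff hc]
    intro i; fin_cases i
    exacts [h0, h1.le, h2.le]
  · right
    rw [mem_tri_iff hd]
    intro i; fin_cases i
    · by_contra h5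
      have h5' : bary D 0 x < 0 := not_le.1 h5
      have h0' := not_le.1 h0
      have : (bary C 0 x * sarea C) * (bary D 0 x * sarea D) = (cross (b - a) (x - a)) ^ 2 := by
        rw [e1, e2]; ring
      nlinarith [mul_pos_of_neg_of_neg h0' h5', sq_nonneg (cross (b - a) (x - a))]
    exacts [h3.le, h4.le]

lemma mem_edgeNbhd {a b c d : Pt} (hc : sarea ![c, a, b] ≠ 0) (hd : sarea ![d, a, b] ≠ 0) {s : ℝ}
    (hs : s ∈ Ioo (0 : ℝ) 1) : a + s • (b - a) ∈ edgeNbhd ![c, a, b] ![d, a, b] := by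
  have e1 : ∀ i, bary ![c, a, b] i (a + s • (b - a)) = _ := fun i => bary_segment hc i 1 2 s
  have e2 : ∀ i, bary ![d, a, b] i (a + s • (b - a)) = _ := fun i => bary_segment hd i 1 2 s
  obtain ⟨s0, s1⟩ := hs
  refine ⟨⟨?_, ?_⟩, ?_, ?_⟩ <;> simp [e1, e2] <;> linarith

/-- A field with a weak curl that is smooth on two triangles on opposite sides of the edge `[a, b]`
has no tangential jump across this edge. -/
theorem WeakCurl.tangential_eq (hw : WeakCurl Ω P Q f) (hpos : Ω ⊆ halfPlane) {a b c d : Pt}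
    (hc : sarea ![c, a, b] ≠ 0) (hd : sarea ![d, a, b] ≠ 0)
    (hopp : sarea ![c, a, b] * sarea ![d, a, b] < 0)
    (hΩ : interior (tri ![c, a, b] ∪ tri ![d, a, b]) ⊆ Ω) {P₁ Q₁ P₂ Q₂ : Pt → ℝ}
    (hP₁ : ContDiff ℝ 1 P₁) (hQ₁ : ContDiff ℝ 1 Q₁) (hP₂ : ContDiff ℝ 1 P₂) (hQ₂ : ContDiff ℝ 1 Q₂)
    (h₁ : ∀ᵐ x, x ∈ tri ![c, a, b] → P x = P₁ x ∧ Q x = Q₁ x)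
    (h₂ : ∀ᵐ x, x ∈ tri ![d, a, b] → P x = P₂ x ∧ Q x = Q₂ x) {s : ℝ} (hs : s ∈ Ioo (0 : ℝ) 1) :
    P₁ (a + s • (b - a)) * (b - a) 0 + Q₁ (a + s • (b - a)) * (b - a) 1 =
      P₂ (a + s • (b - a)) * (b - a) 0 + Q₂ (a + s • (b - a)) * (b - a) 1 := by
  set C : Tri := ![c, a, b] with hCdef
  set D : Tri := ![d, a, b] with hDdef
  set V := edgeNbhd C D
  have hVo := isOpen_edgeNbhd C D
  have hVsub := edgeNbhd_subset hc hd hopp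
  have hVΩ := (interior_maximal hVsub hVo).trans hΩ
  set γ : ℝ → Pt := fun s => a + s • (b - a) with hγ
  -- the tangential jump, which makes sense everywhere
  set g : Pt → ℝ := fun x => (P₁ x - P₂ x) * (b - a) 0 + (Q₁ x - Q₂ x) * (b - a) 1 with hg
  have := hP₁.continuous
  have := hQ₁.continuous
  have := hP₂.continuous
  have := hQ₂.continuous
  have hgc : Continuous g := by fun_prop
  have hf₁ := hw.ae_eq_curl hpos hc ((interior_mono subset_union_left).trans hΩ) hP₁ hQ₁ h₁
  have hf₂ := hw.ae_eq_curl hpos hd ((interior_mono subset_union_right).trans hΩ) hP₂ hQ₂ h₂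
  have hdisj : AEDisjoint volume (tri C) (tri D) := by
    refine measure_mono_null (t := frontier (tri C)) ?_ (volume_frontier_tri C)
    rintro x ⟨hx, hx'⟩
    refine ⟨subset_closure hx, fun hi => ?_⟩
    rw [interior_tri hc] at hi
    have e := (bary_zero_mul hc x).trans (bary_zero_mul hd x).symm
    have h6 : 0 < (bary C 0 x * sarea C) * (bary D 0 x * sarea D) := by
      rw [← e]; exact mul_self_pos.2 (mul_ne_zero (hi 0).ne' hc)
    nlinarith [mul_nonneg (hi 0).le ((mem_tri_iff hd x).1 hx' 0)]
  have hmain : ∀ φ, IsTest V φ → ∫ t in 0..1, φ (γ t) * g (γ t) = 0 := by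
    intro φ hφ
    have hφ1 : ContDiff ℝ 1 φ := hφ.1.of_le (by simp)
    have hsplit : ∀ (k χ : Pt → ℝ), TestIntegrable Ω k → IsCc χ → (∀ x, x ∉ V → χ x = 0) →
        pair Ω k χ = (∫ x in tri C, k x * χ x) + ∫ x in tri D, k x * χ x := by
      intro k χ hk hχ h0
      have hi : Integrable (fun x => k x * χ x) := by
        rw [← integrableOn_iff_integrable_of_support_subset (s := V)]
        · exact IntegrableOn.mono_set (hk χ hχ) hVΩ
        · intro x hx
          by_contra hn
          simp_all
      rw [pair_eq_integral (fun x hx => h0 x fun hn => hx (hVΩ hn)),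
        ← setIntegral_union₀ hdisj (isCompact_tri D).measurableSet.nullMeasurableSet
          hi.integrableOn hi.integrableOn, setIntegral_eq_integral_of_forall_compl_eq_zero]
      intro x hx
      grind
    have e := hw.eq φ (hφ.mono hVΩ)
    rw [hsplit f φ hw.curl hφ.isCc fun x hx => (hφ.eq_zero hx).1,
      hsplit P _ hw.left (hφ.isCc_pd 1) fun x hx => (hφ.eq_zero hx).2 1,
      hsplit Q _ hw.right (hφ.isCc_pd 0) fun x hx => (hφ.eq_zero hx).2 0] at e
    have g₁ := green_test_ae hc hφ1 (fun x hx => (hφ.eq_zero fun hn =>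
      hx.elim hn.1.1.ne' hn.1.2.ne').1) hP₁ hQ₁ h₁ hf₁
    have g₂ := green_test_ae hd hφ1 (fun x hx => (hφ.eq_zero fun hn =>
      hx.elim hn.2.1.ne' hn.2.2.ne').1) hP₂ hQ₂ h₂ hf₂
    have hsub : edgeTangent C 0 (fun x => ![φ x * P₁ x, φ x * Q₁ x]) -
        edgeTangent D 0 (fun x => ![φ x * P₂ x, φ x * Q₂ x]) = 0 := by
      rcases lt_or_gt_of_ne hc with hneg | hp
      · rw [sign_neg hneg] at g₁
        rw [sign_pos (by nlinarith)] at g₂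
        simp at g₁ g₂
        linarith
      · rw [sign_pos hp] at g₁
        rw [sign_neg (by nlinarith)] at g₂
        simp at g₁ g₂
        linarith
    refine Eq.trans ?_ hsub
    have := hφ1.continuous
    rw [edgeTangent, edgeTangent, ← intervalIntegral.integral_sub]
    · refine intervalIntegral.integral_congr fun t _ => ?_
      simp [hCdef, hDdef, hg, hγ]
      ring
    all_goals
      refine Continuous.intervalIntegrable ?_ _ _
      fun_prop
  by_contra hne
  have hgs : 0 < g (γ s) * g (γ s) := mul_self_pos.2 fun h => hne (by linarith)
  -- otherwise a bump function near the point gives a contradiction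
  obtain ⟨β, hβs, hβc, hβ, hβr, hβ1⟩ := exists_contDiff_tsupport_subset
    ((hVo.inter (isOpen_lt continuous_const (hgc.mul_const (g (γ s))))).mem_nhds
      ⟨mem_edgeNbhd hc hd hs, hgs⟩)
  have h0 := hmain β ⟨hβ, hβc, subset_inter (hβs.trans inter_subset_left)
    (hβs.trans (inter_subset_left.trans (hVΩ.trans hpos)))⟩
  have hnn : ∀ t, 0 ≤ β (γ t) * g (γ t) * g (γ s) := fun t => by
    by_cases ht : γ t ∈ tsupport β
    · rw [mul_assoc]
      exact mul_nonneg (hβr ⟨_, rfl⟩).1 (hβs ht).2.le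
    · rw [image_eq_zero_of_notMem_tsupport ht, zero_mul, zero_mul]
  have hpos' : 0 < ∫ t in 0..1, β (γ t) * g (γ t) * g (γ s) := by
    have := hβ.continuous
    refine intervalIntegral.integral_pos zero_lt_one (by fun_prop) (fun t _ => hnn t)
      ⟨s, ⟨hs.1.le, hs.2.le⟩, ?_⟩
    rwa [hβ1, one_mul]
  simp_all

/-! ### Triangles with a common edge -/

namespace Triangulation

/-- A triangle with the edge `[a, b]` can be listed as `c, a, b`. -/
lemma exists_third (hs : sarea K ≠ 0) {a b : Pt} (ha : a ∈ range K) (hb : b ∈ range K)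
    (hab : a ≠ b) : ∃ c, range ![c, a, b] = range K ∧ sarea ![c, a, b] ≠ 0 := by
  obtain ⟨i, rfl⟩ := ha
  obtain ⟨j, rfl⟩ := hb
  have hij : i ≠ j := fun h => hab (by rw [h])
  obtain ⟨k, hk, he⟩ : ∃ k : Fin 3, Function.Surjective ![k, i, j] ∧
      sarea ![K k, K i, K j] ^ 2 = sarea K ^ 2 := by
    fin_cases i <;> fin_cases j <;> first
      | exact absurd rfl hij
      | exact ⟨0, by decide, by simp [sarea, cross] <;> ring⟩
      | exact ⟨1, by decide, by simp [sarea, cross] <;> ring⟩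
      | exact ⟨2, by decide, by simp [sarea, cross] <;> ring⟩
  refine ⟨K k, ?_, fun h0 => hs (by grind)⟩
  rw [← hk.range_comp K]
  congr 1
  ext m
  fin_cases m <;> rfl

lemma tri_congr (h : range K = range K') : tri K = tri K' := by rw [tri, tri, h]

/-- Two triangles of a mesh with a common edge lie on opposite sides of it. -/
lemma opposite (hK : K ∈ T.cells) (hK' : K' ∈ T.cells) (hne : K ≠ K') {a b c d : Pt}
    (hc : range ![c, a, b] = range K) (hd : range ![d, a, b] = range K')
    (hc0 : sarea ![c, a, b] ≠ 0) (hd0 : sarea ![d, a, b] ≠ 0) :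
    sarea ![c, a, b] * sarea ![d, a, b] < 0 := by
  by_contra! hnn
  have hp := lt_of_le_of_ne hnn (mul_ne_zero hc0 hd0).symm
  -- a point of the interior of the first triangle close to the midpoint of the edge
  have hm : a + (1 / 2 : ℝ) • (b - a) ∈ closure (interior (tri ![c, a, b])) := by
    rw [closure_interior_tri hc0]
    exact (convex_tri _).add_smul_sub_mem (vertex_mem_tri ![c, a, b] 1)
      (vertex_mem_tri ![c, a, b] 2) (by norm_num)
  obtain ⟨z, hz, hzi⟩ := mem_closure_iff_nhds.1 hm _
    ((isOpen_edgeNbhd _ _).mem_nhds (mem_edgeNbhd hc0 hd0 (by norm_num)))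
  have hzi' := hzi
  rw [interior_tri hc0] at hzi'
  have e := (bary_zero_mul hc0 z).trans (bary_zero_mul hd0 z).symm
  refine hne (eq_of_mem_interior hK hK' (by rwa [← tri_congr hc]) ?_)
  rw [← tri_congr hd, mem_tri_iff hd0]
  have h0 : 0 ≤ bary ![d, a, b] 0 z := by
    by_contra! hn
    have h1 := mul_pos (hzi' 0) hp
    rw [← mul_assoc, e] at h1
    nlinarith [sq_nonneg (sarea ![d, a, b])]
  intro i
  fin_cases i
  exacts [h0, hz.2.1.le, hz.2.2.le]

/-- A field with a weak curl that is smooth on two triangles with a common edge has no tangential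
jump across this edge, and the open edge is contained in `Ω`. -/
theorem Meshes.tangential_eq (hM : T.Meshes Ω) (hK : K ∈ T.cells) (hK' : K' ∈ T.cells)
    (hne : K ≠ K') {a b : Pt} (hab : a ≠ b) (haK : a ∈ range K) (hbK : b ∈ range K)
    (haK' : a ∈ range K') (hbK' : b ∈ range K') {s : ℝ} (hs : s ∈ Ioo (0 : ℝ) 1) : a + s • (b - a) ∈
    Ω ∧ ∀ (P Q f : Pt → ℝ), WeakCurl Ω P Q f → ∀ (P₁ Q₁ P₂ Q₂ : Pt → ℝ), ContDiff ℝ 1 P₁ → ContDiff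
    ℝ 1 Q₁ → ContDiff ℝ 1 P₂ → ContDiff ℝ 1 Q₂ → (∀ᵐ x, x ∈ tri K → P x = P₁ x ∧ Q x = Q₁ x) →
    (∀ᵐ x, x ∈ tri K' → P x = P₂ x ∧ Q x = Q₂ x) → P₁ (a + s • (b - a)) * (b - a) 0 + Q₁
    (a + s • (b - a)) * (b - a) 1 = P₂ (a + s • (b - a)) * (b - a) 0 + Q₂ (a + s • (b - a)) *
    (b - a) 1 := by
  obtain ⟨c, hc, hc0⟩ := exists_third (T.sarea_ne hK) haK hbK hab
  obtain ⟨d, hd, hd0⟩ := exists_third (T.sarea_ne hK') haK' hbK' hab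
  have hopp := opposite hK hK' hne hc hd hc0 hd0
  have hsub : tri ![c, a, b] ∪ tri ![d, a, b] ⊆ T.support := by
    rw [tri_congr hc, tri_congr hd]
    exact union_subset (tri_subset_support hK) (tri_subset_support hK')
  have hΩ : interior (tri ![c, a, b] ∪ tri ![d, a, b]) ⊆ Ω := by
    rw [hM.eq_interior]; exact interior_mono hsub
  refine ⟨hΩ (interior_maximal (edgeNbhd_subset hc0 hd0 hopp) (isOpen_edgeNbhd _ _)
    (mem_edgeNbhd hc0 hd0 hs)), fun P Q f hw P₁ Q₁ P₂ Q₂ hP₁ hQ₁ hP₂ hQ₂ h₁ h₂ => ?_⟩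
  exact hw.tangential_eq (fun x hx => hM.pos_of_mem hx) hc0 hd0 hopp hΩ hP₁ hQ₁ hP₂ hQ₂
    (by rwa [tri_congr hc]) (by rwa [tri_congr hd]) hs

/-! ### Connectedness of vertex stars -/

lemma mem_range_of_mem_tri {K₀ : Tri} (hK : K ∈ T.cells) (hK₀ : K₀ ∈ T.cells) (h : K₀ i ∈ tri K) :
    K₀ i ∈ range K := by
  by_contra hn
  have h1 := hatOn_eq_hatOn hK₀ hK (vertex_mem_tri K₀ i) h (K₀ i)
  rw [hatOn_of_notMem hn, hatOn_self (T.inj hK₀), bary_vertex (T.sarea_ne hK₀), if_pos rfl] at h1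
  exact one_ne_zero h1

/-- Two triangles with the common vertex `a` that meet in another point have a common edge. -/
lemma exists_common_vertex (hK : K ∈ T.cells) (hK' : K' ∈ T.cells) {a : Pt} (hx : x ∈ tri K)
    (hx' : x ∈ tri K') (hxa : x ≠ a) : ∃ b, b ≠ a ∧ b ∈ range K ∧ b ∈ range K' := by
  by_contra! h
  have hmem : x ∈ convexHull ℝ (range K ∩ range K') := by
    rw [← T.conforming K hK K' hK']; exact ⟨hx, hx'⟩
  have hsub : range K ∩ range K' ⊆ {a} := fun b hb => by
    by_contra hba
    exact h b hba hb.1 hb.2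
  have := convexHull_mono hsub hmem
  simp_all

end Triangulation

lemma isPreconnected_ball_diff (a : Pt) (ρ : ℝ) : IsPreconnected (ball a ρ \ {a}) := by
  have h1 : IsPreconnected (Ioo 0 ρ ×ˢ sphere (0 : Pt) 1) := by
    refine isPreconnected_Ioo.prod (isPreconnected_sphere ?_ _ _)
    rw [← Module.finrank_eq_rank]
    simp
  have h2 : ball a ρ \ {a} =
      (fun p : ℝ × Pt => a + p.1 • p.2) '' (Ioo 0 ρ ×ˢ sphere (0 : Pt) 1) := by
    ext x
    constructor
    · rintro ⟨hx, hxa⟩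
      have h0 := norm_pos_iff.2 (sub_ne_zero.2 hxa)
      refine ⟨(‖x - a‖, ‖x - a‖⁻¹ • (x - a)), ⟨⟨h0, ?_⟩, ?_⟩, ?_⟩
      · aesop
      · simp [norm_smul, h0.ne']
      · simp_all
    · rintro ⟨⟨t, v⟩, ⟨⟨ht0, htρ⟩, hv⟩, rfl⟩
      have hv' : ‖v‖ = 1 := by simpa using hv
      simp only at ht0 htρ
      constructor
      · simp [norm_smul, hv', abs_of_pos ht0, htρ]
      · aesop
  rw [h2]
  exact h1.image _ (by fun_prop)

namespace FoldedMesh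

/-- Near a vertex, the folding map retracts a connected punctured (half) disk onto the vertex star.
Hence the triangles around a vertex are connected through common edges: data of these triangles that
agree across edges are all equal. -/
theorem eq_of_common_vertex (h : FoldedMesh Ω ψ T L A ε F) (N : Tri → ℝ) {a : Pt}
    (hN : ∀ K ∈ T.cells, ∀ K' ∈ T.cells, a ∈ range K → a ∈ range K' →
      (∃ b, b ≠ a ∧ b ∈ range K ∧ b ∈ range K') → N K = N K')
    {K₁ K₂ : Tri} (hK₁ : K₁ ∈ T.cells) (hK₂ : K₂ ∈ T.cells) (ha₁ : a ∈ range K₁)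
    (ha₂ : a ∈ range K₂) : N K₁ = N K₂ := by
  classical
  have hε := h.eps_pos
  have hL := zero_lt_one.trans_le h.one_le
  have hat : a ∈ tri K₁ := by obtain ⟨i, rfl⟩ := ha₁; exact vertex_mem_tri K₁ i
  have hev : ∀ᶠ x in 𝓝 a, (∀ K ∈ T.cells, x ∈ tri K → a ∈ tri K) ∧ (a ∈ Ω → x ∈ Ω) ∧
      (a ∈ halfPlane → x ∈ halfPlane) :=
    (T.eventually_mem_tri_imp a).and ((eventually_imp_distrib_left.2 h.isOpen.mem_nhds).and
      (eventually_imp_distrib_left.2 isOpen_halfPlane.mem_nhds))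
  obtain ⟨ρ₁, hρ₁, hcell⟩ := Metric.eventually_nhds_iff.1 hev
  obtain ⟨ρ, hρ, hρ1, hρε⟩ : ∃ ρ > 0, L * ρ ≤ ρ₁ ∧ ρ ≤ ε :=
    ⟨min (ρ₁ / L) ε, by positivity, by rw [← le_div_iff₀' hL]; exact min_le_left _ _,
      min_le_right _ _⟩
  have hball : ∀ z ∈ ball a ρ, dist z a < ρ₁ := fun z hz =>
    (mem_ball.1 hz).trans_le ((le_mul_of_one_le_left hρ.le h.one_le).trans hρ1)
  set W : Set Pt := (ball a ρ ∩ halfPlane) \ {a} with hW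
  have hWpre : IsPreconnected W := by
    by_cases haH : a ∈ halfPlane
    · rw [hW, inter_eq_left.2 fun z hz => (hcell (hball z hz)).2.2 haH]
      exact isPreconnected_ball_diff a ρ
    · rw [hW, Set.sdiff_singleton_eq_self fun hn => haH hn.2]
      exact ((convex_ball a ρ).inter convex_halfPlane).isPreconnected
  have hWc : W ⊆ collar ε (tri K₁) := fun z hz =>
    ⟨mem_thickening_iff.2 ⟨a, hat, (mem_ball.1 hz.1.1).trans_le hρε⟩, hz.1.2⟩
  have hcont : ContinuousOn (fold Ω ψ) W := by
    have := LipschitzOnWith.of_dist_le_mul fun x hx y hy => by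
        rw [Real.coe_toNNReal _ hL.le]
        exact h.dist_fold_le (convex_collar ε (convex_tri K₁)) (h.collar_subset hK₁) hx hy
    exact this.continuousOn.mono hWc
  have hfold : ∀ z ∈ W, fold Ω ψ z ≠ a ∧ ∀ K ∈ T.cells, fold Ω ψ z ∈ tri K → a ∈ range K := by
    intro z hz
    refine ⟨fun hza => ?_, fun K hK hxK => ?_⟩
    · by_cases hzΩ : z ∈ Ω
      · rw [fold, if_pos hzΩ] at hza
        exact hz.2 hza
      · have haH := hza ▸ (h.fold_mem (h.collar_subset hK₁ (hWc hz))).2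
        have hac := hza ▸ (h.fold_mem (h.collar_subset hK₁ (hWc hz))).1
        have haΩ : a ∉ Ω := fun hn => hzΩ ((hcell (hball z hz.1.1)).2.1 hn)
        have haf : a ∈ frontier Ω := ⟨hac, fun hi => haΩ (interior_subset hi)⟩
        rw [fold, if_neg hzΩ] at hza
        have := h.antilip z ⟨h.collar_subset hK₁ (hWc hz), hzΩ⟩ a
          ⟨⟨self_subset_thickening hε _ hac, haH⟩, haΩ⟩
        rw [hza, h.fixed a ⟨haf, haH⟩, dist_self, mul_zero] at this
        simp_all
    · have := (hcell ((h.dist_fold_le_of_mem hK₁ (hWc hz) hat).trans_lt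
        ((mul_lt_mul_of_pos_left (mem_ball.1 hz.1.1) hL).trans_le hρ1))).1 K hK hxK
      obtain ⟨i, rfl⟩ := ha₁
      exact mem_range_of_mem_tri hK hK₁ this
  have hmeet : ∀ K ∈ T.cells, a ∈ range K → ∃ z ∈ W, fold Ω ψ z ∈ tri K := by
    intro K hK haK
    obtain ⟨i, rfl⟩ := haK
    have hcl := vertex_mem_tri K i
    rw [← closure_interior_tri (T.sarea_ne hK)] at hcl
    obtain ⟨z, hz, hd⟩ := mem_closure_iff.1 hcl ρ hρ
    have hzΩ := h.meshes.interior_tri_subset hK hz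
    refine ⟨z, ⟨⟨by rwa [mem_ball, dist_comm], h.pos hzΩ⟩, ?_⟩, ?_⟩
    · rintro rfl
      rw [interior_tri (T.sarea_ne hK)] at hz
      have h1 := hz (i + 1)
      rw [bary_vertex (T.sarea_ne hK), if_neg (by simp)] at h1
      exact lt_irrefl _ h1
    · rw [fold, if_pos hzΩ]; exact interior_subset hz
  by_contra hne
  have hZ : ∀ p : ℝ → Prop, ∃ Z : Set Pt, IsClosed Z ∧
      ∀ x, x ∈ Z ↔ ∃ K ∈ T.cells, a ∈ range K ∧ p (N K) ∧ x ∈ tri K := fun p =>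
    ⟨⋃ K ∈ T.cells.filter (fun K => a ∈ range K ∧ p (N K)), tri K,
      (Finset.finite_toSet _).isClosed_biUnion fun K _ => (isCompact_tri K).isClosed, fun x => by
      simp [and_assoc]⟩
  obtain ⟨Z₁, hc₁, hm₁⟩ := hZ (fun t => t = N K₁)
  obtain ⟨Z₂, hc₂, hm₂⟩ := hZ (fun t => t ≠ N K₁)
  have hcover : fold Ω ψ '' W ⊆ Z₁ ∪ Z₂ := by
    rintro _ ⟨z, hz, rfl⟩
    have hs := (h.fold_mem (h.collar_subset hK₁ (hWc hz))).1
    rw [h.meshes.closure_eq] at hs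
    obtain ⟨K, hK, hxK⟩ := mem_support.1 hs
    have haK := (hfold z hz).2 K hK hxK
    by_cases hNK : N K = N K₁
    · exact Or.inl ((hm₁ _).2 ⟨K, hK, haK, hNK, hxK⟩)
    · exact Or.inr ((hm₂ _).2 ⟨K, hK, haK, hNK, hxK⟩)
  have hn₁ : (fold Ω ψ '' W ∩ Z₁).Nonempty := by
    obtain ⟨z, hz, hzK⟩ := hmeet K₁ hK₁ ha₁
    exact ⟨_, ⟨z, hz, rfl⟩, (hm₁ _).2 ⟨K₁, hK₁, ha₁, rfl, hzK⟩⟩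
  have hn₂ : (fold Ω ψ '' W ∩ Z₂).Nonempty := by
    obtain ⟨z, hz, hzK⟩ := hmeet K₂ hK₂ ha₂
    exact ⟨_, ⟨z, hz, rfl⟩, (hm₂ _).2 ⟨K₂, hK₂, ha₂, fun hn => hne hn.symm, hzK⟩⟩
  obtain ⟨x, ⟨z, hz, rfl⟩, hx1, hx2⟩ :=
    isPreconnected_closed_iff.1 (hWpre.image _ hcont) Z₁ Z₂ hc₁ hc₂ hcover hn₁ hn₂
  obtain ⟨K, hK, haK, hNK, hxK⟩ := (hm₁ _).1 hx1
  obtain ⟨K', hK', haK', hNK', hxK'⟩ := (hm₂ _).1 hx2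
  refine hNK' ?_
  rw [← hNK]
  exact (hN K hK K' hK' haK haK'
    (exists_common_vertex hK hK' hxK hxK' (hfold z hz).1)).symm

/-- Functions on the triangles that agree at the common vertices of adjacent triangles are given by
vertex values. -/
theorem exists_vertex_values (h : FoldedMesh Ω ψ T L A ε F) (g : Tri → Pt → ℝ)
    (hg : ∀ K ∈ T.cells, ∀ K' ∈ T.cells, K ≠ K' → ∀ a b, a ≠ b → a ∈ range K → b ∈ range K →
      a ∈ range K' → b ∈ range K' → g K a = g K' a) :
    ∃ q : Pt → ℝ, ∀ K ∈ T.cells, ∀ i, q (K i) = g K (K i) := by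
  refine ⟨fun a => if ha : ∃ K ∈ T.cells, a ∈ range K then g ha.choose a else 0, fun K hK i => ?_⟩
  have ha : ∃ K' ∈ T.cells, K i ∈ range K' := ⟨K, hK, i, rfl⟩
  simp only [dif_pos ha]
  refine h.eq_of_common_vertex (fun K' => g K' (K i)) ?_ ha.choose_spec.1 hK ha.choose_spec.2 ⟨i, rfl⟩
  rintro K₁ h₁ K₂ h₂ ha₁ ha₂ ⟨b, hb, hb₁, hb₂⟩
  grind

end FoldedMesh

/-! ### The elements of the discrete spaces are fields of discrete forms -/

/-- An edge function that vanishes on pairs of points which do not belong to a common triangle. -/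
def Triangulation.EdgeSupported (T : Triangulation) (c : Pt → Pt → ℝ) : Prop :=
  ∀ a b, c a b ≠ 0 → ∃ K ∈ T.cells, a ∈ range K ∧ b ∈ range K

lemma affineOn_of_affine (hs : sarea K ≠ 0) {t₀ t₁ t₂ : ℝ}
    (hq : ∀ i, q (K i) = t₀ + t₁ * K i 0 + t₂ * K i 1) (x : Pt) :
    affineOn K q x = t₀ + t₁ * x 0 + t₂ * x 1 := by
  have h1 := bary_sum hs x
  have h2 := bary_combo_apply hs x 0
  have h3 := bary_combo_apply hs x 1
  simp only [affineOn, hq]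
  simp only [sum_univ_three] at *
  grind

/-- The Whitney interpolant reproduces the fields `(A - C z, B + C r)`. -/
lemma whitneyOn_of_rotation (hs : sarea K ≠ 0) {B C : ℝ} (hc : ∀ i j, c (K i) (K j) = (A - C * K i
    1) * (K j - K i) 0 + (B + C * K i 0) * (K j - K i) 1) (x : Pt) :
    whitneyOn K c 0 x = A - C * x 1 ∧ whitneyOn K c 1 x = B + C * x 0 := by
  have h1 := bary_sum hs x
  have h2 := bary_combo_apply hs x 0
  have h3 := bary_combo_apply hs x 1
  have g : ∀ m p, ∑ j, gradBary K j m * K j p = if p = m then 1 else 0 := by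
    have key : ∀ y : Pt, ∀ p, ∑ j, (gradBary K j 0 * (y 0) + gradBary K j 1 * (y 1)) * K j p =
        y p := fun y p => by
      have e1 := bary_combo_apply hs y p
      have e2 := bary_combo_apply hs 0 p
      have e3 : ∀ j, gradBary K j 0 * (y 0) + gradBary K j 1 * (y 1) =
          bary K j y - bary K j 0 := fun j => by rw [bary_sub]; simp
      simp only [e3, sub_mul, sum_sub_distrib, e1, e2]
      simp
    intro m p
    have := key (single m 1) p
    fin_cases m <;> fin_cases p <;> simpa using this
  have g0 := sum_gradBary hs
  have e : ∀ m, whitneyOn K c m x =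
      A * (∑ i, bary K i x) * (∑ j, gradBary K j m * K j 0)
      - C * (∑ i, bary K i x * K i 1) * (∑ j, gradBary K j m * K j 0)
      + B * (∑ i, bary K i x) * (∑ j, gradBary K j m * K j 1)
      + C * (∑ i, bary K i x * K i 0) * (∑ j, gradBary K j m * K j 1)
      - (∑ i, (A * K i 0 + B * K i 1) * bary K i x) * ∑ j, gradBary K j m := fun m => by
    simp only [whitneyOn, hc, sum_univ_three, sub_apply]
    ring
  simp_all

namespace FoldedMesh
variable (h : FoldedMesh Ω ψ T L A ε F)
include h

lemma ae_tri (hK : K ∈ T.cells) (hp : ∀ᵐ x ∂(rMeasure Ω), x ∈ tri K → p x) :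
    ∀ᵐ x, x ∈ tri K → p x := by
  have hp' := (ae_rMeasure_iff h.isOpen h.pos).1 hp
  filter_upwards [hp', ae_mem_interior_of_mem_tri K] with x hx hi hxK
  exact hx (h.meshes.interior_tri_subset hK (hi hxK)) hxK

lemma ae_of_ae_cells {p : Tri → Pt → Prop} {r : Pt → Prop}
    (hp : ∀ K ∈ T.cells, ∀ᵐ x ∂(rMeasure Ω), x ∈ tri K → p K x)
    (hr : ∀ K ∈ T.cells, ∀ x ∈ interior (tri K), p K x → r x) : ∀ᵐ x ∂(rMeasure Ω), r x := by
  rw [ae_rMeasure_iff h.isOpen h.pos]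
  have h1 := (Filter.eventually_all_finset _).2 fun K hK => h.ae_tri hK (hp K hK)
  filter_upwards [h1, T.ae_mem_interior_of_mem_support] with x hx hi hxΩ
  obtain ⟨K, hK, hxK⟩ := hi (h.meshes.subset_support hxΩ)
  exact hr K hK x hxK (hx K hK (interior_subset hxK))

/-- A function with weak derivatives that is smooth on the triangles has no jumps. -/
lemma no_jump (hf : WeakCurl Ω (fun _ => 0) u f) (hg : WeakCurl Ω u (fun _ => 0) g)
    {w : Tri → Pt → ℝ} (hw : ∀ K, ContDiff ℝ 1 (w K))
    (hu : ∀ K ∈ T.cells, ∀ᵐ x ∂(rMeasure Ω), x ∈ tri K → u x = w K x) (hK : K ∈ T.cells)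
    (hK' : K' ∈ T.cells) (hne : K ≠ K') {a b : Pt} (hab : a ≠ b) (haK : a ∈ range K)
    (hbK : b ∈ range K) (haK' : a ∈ range K') (hbK' : b ∈ range K') {s : ℝ} (hs : s ∈ Ioo (0 : ℝ) 1)
    : 0 < (a + s • (b - a)) 0 ∧ w K (a + s • (b - a)) = w K' (a + s • (b - a)) := by
  obtain ⟨hΩ, ht⟩ := Triangulation.Meshes.tangential_eq h.meshes hK hK' hne hab haK hbK haK' hbK' hs
  refine ⟨h.pos hΩ, ?_⟩
  have c0 : ContDiff ℝ 1 (fun _ : Pt => (0 : ℝ)) := contDiff_const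
  have e1 := ht _ _ _ hf _ _ _ _ c0 (hw K) c0 (hw K')
    (by filter_upwards [h.ae_tri hK (hu K hK)] with x hx hxK using ⟨rfl, hx hxK⟩)
    (by filter_upwards [h.ae_tri hK' (hu K' hK')] with x hx hxK using ⟨rfl, hx hxK⟩)
  have e2 := ht _ _ _ hg _ _ _ _ (hw K) c0 (hw K') c0
    (by filter_upwards [h.ae_tri hK (hu K hK)] with x hx hxK using ⟨hx hxK, rfl⟩)
    (by filter_upwards [h.ae_tri hK' (hu K' hK')] with x hx hxK using ⟨hx hxK, rfl⟩)
  have hd : (b - a) 0 ≠ 0 ∨ (b - a) 1 ≠ 0 := by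
    by_contra! hn
    exact hab (sub_eq_zero.1 (pt_ext hn.1 hn.2)).symm
  rcases hd with hd | hd
  · exact mul_right_cancel₀ hd (by linarith)
  · exact mul_right_cancel₀ hd (by linarith)

/-- Affine functions on the triangles that agree across edges come from vertex values. -/
lemma exists_affine_values (t₀ t₁ t₂ : Tri → ℝ) (ht : ∀ K ∈ T.cells, ∀ K' ∈ T.cells, K ≠ K' → ∀ a b,
    a ≠ b → a ∈ range K → b ∈ range K → a ∈ range K' → b ∈ range K' → ∀ s ∈ Ioo (0 : ℝ) 1, t₀ K + t₁
    K * (a + s • (b - a)) 0 + t₂ K * (a + s • (b - a)) 1 = t₀ K' + t₁ K' * (a + s • (b - a)) 0 + t₂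
    K' * (a + s • (b - a)) 1) :
    ∃ q : Pt → ℝ, ∀ K ∈ T.cells, ∀ x, affineOn K q x = t₀ K + t₁ K * x 0 + t₂ K * x 1 := by
  have hv : ∀ K ∈ T.cells, ∀ K' ∈ T.cells, K ≠ K' → ∀ a b, a ≠ b → a ∈ range K → b ∈ range K →
      a ∈ range K' → b ∈ range K' →
      t₀ K + t₁ K * a 0 + t₂ K * a 1 = t₀ K' + t₁ K' * a 0 + t₂ K' * a 1 := by
    intro K hK K' hK' hne a b hab h1 h2 h3 h4
    have e1 := ht K hK K' hK' hne a b hab h1 h2 h3 h4 (1 / 3) (by norm_num)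
    have e2 := ht K hK K' hK' hne a b hab h1 h2 h3 h4 (2 / 3) (by norm_num)
    simp only [add_apply, smul_apply, sub_apply, smul_eq_mul] at e1 e2 ⊢
    linarith
  obtain ⟨q, hq⟩ := h.exists_vertex_values (fun K x => t₀ K + t₁ K * x 0 + t₂ K * x 1) hv
  exact ⟨q, fun K hK => affineOn_of_affine (T.sarea_ne hK) (hq K hK)⟩

omit h in
/-- Fields `(A - C z, B + C r)` on the triangles whose tangential components agree across edges come
from edge values. -/
lemma exists_edge_values (A B C : Tri → ℝ)
    (ht : ∀ K ∈ T.cells, ∀ K' ∈ T.cells, K ≠ K' → ∀ a b, a ≠ b → a ∈ range K → b ∈ range K →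
      a ∈ range K' → b ∈ range K' →
      (A K - C K * a 1) * (b - a) 0 + (B K + C K * a 0) * (b - a) 1 =
      (A K' - C K' * a 1) * (b - a) 0 + (B K' + C K' * a 0) * (b - a) 1) :
    ∃ c : Pt → Pt → ℝ, Alternating c ∧ T.EdgeSupported c ∧ ∀ K ∈ T.cells, ∀ x,
      whitneyOn K c 0 x = A K - C K * x 1 ∧ whitneyOn K c 1 x = B K + C K * x 0 := by
  set c : Pt → Pt → ℝ := fun a b => if hE : ∃ K ∈ T.cells, a ∈ range K ∧ b ∈ range K then
    (A hE.choose - C hE.choose * a 1) * (b - a) 0 + (B hE.choose + C hE.choose * a 0) * (b - a) 1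
    else 0 with hc
  have key : ∀ K ∈ T.cells, ∀ a b, a ∈ range K → b ∈ range K →
      c a b = (A K - C K * a 1) * (b - a) 0 + (B K + C K * a 0) * (b - a) 1 := by
    intro K hK a b ha hb
    have hE : ∃ K ∈ T.cells, a ∈ range K ∧ b ∈ range K := ⟨K, hK, ha, hb⟩
    simp only [hc, dif_pos hE]
    by_cases hab : a = b
    · simp [hab]
    by_cases hKK : hE.choose = K
    · rw [hKK]
    · exact ht _ hE.choose_spec.1 K hK hKK a b hab hE.choose_spec.2.1 hE.choose_spec.2.2 ha hb
  have hsupp : T.EdgeSupported c := fun a b hne => by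
    by_contra hn
    grind
  refine ⟨c, fun a b => ?_, hsupp, fun K hK x => whitneyOn_of_rotation (T.sarea_ne hK)
    (fun i j => key K hK _ _ ⟨i, rfl⟩ ⟨j, rfl⟩) x⟩
  by_cases hE : ∃ K ∈ T.cells, a ∈ range K ∧ b ∈ range K
  · obtain ⟨K, hK, ha, hb⟩ := hE
    rw [key K hK _ _ ha hb, key K hK _ _ hb ha]
    simp only [sub_apply]
    ring
  · grind

/-- Since `grad^n u` is square integrable, `u` does not jump across edges, so the affine functions
`nu/r` on the triangles have common values at the vertices. -/
theorem exists_fieldG (hn : 0 < n) {u : L2r Ω} (hu : u ∈ Ah n Ω T) :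
    ∃ q, ⇑u =ᵐ[rMeasure Ω] T.fieldG F n q := by
  obtain ⟨⟨v, hv⟩, hA⟩ := hu
  rw [isGrad_iff h.isOpen h.pos (Lp.memLp u) (memLp_comp v)] at hv
  obtain ⟨h0, h2, -⟩ := hv
  simp only [IsA1] at hA
  choose! α₁ α₂ α₃ hα using hA
  have hn' : (n : ℝ) ≠ 0 := by positivity
  obtain ⟨q, hq⟩ := h.exists_affine_values (fun K => n * α₁ K) (fun K => n * α₂ K)
    (fun K => n * α₃ K) (fun K hK K' hK' hne a b hab h1 h2' h3 h4 s hs => by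
      obtain ⟨hp, e⟩ := h.no_jump
        h0 (by simpa using h2.const_mul (-1)) (fun K => by fun_prop) hα hK hK' hne hab h1 h2' h3 h4 hs
      nlinarith)
  refine ⟨q, h.ae_of_ae_cells hα fun K hK x hx hux => ?_⟩
  rw [hux, fieldG, h.form0_eq hK hx, hq K hK]
  field_simp

/-- The components of the weak curl force `v_θ` to be continuous across edges, and then the
tangential component of `(n v_r + v_θ, n v_z)/r` as well. -/
theorem exists_fieldC (hn : 0 < n) {v : L2rVec Ω} (hv : v ∈ Bh n Ω T) :
    ∃ θ c, Alternating c ∧ T.EdgeSupported c ∧ ⇑v =ᵐ[rMeasure Ω] T.fieldC F n θ c := by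
  obtain ⟨⟨w, hw⟩, hB⟩ := hv
  rw [isCurl_iff (memLp_comp v) (memLp_comp w)] at hw
  obtain ⟨h0, h1, h2⟩ := hw
  simp only [IsB1] at hB
  choose! β₁ β₂ β₃ β₄ β₅ β₆ hβ using hB
  have hn' : (n : ℝ) ≠ 0 := by positivity
  have hθ : ∀ K ∈ T.cells, ∀ K' ∈ T.cells, K ≠ K' → ∀ a b, a ≠ b → a ∈ range K → b ∈ range K →
      a ∈ range K' → b ∈ range K' → ∀ s ∈ Ioo (0 : ℝ) 1,
      -n * β₁ K + β₂ K * (a + s • (b - a)) 0 + -n * β₃ K * (a + s • (b - a)) 1 =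
      -n * β₁ K' + β₂ K' * (a + s • (b - a)) 0 + -n * β₃ K' * (a + s • (b - a)) 1 :=
    fun K hK K' hK' hne a b hab k1 k2 k3 k4 s hs => by
      obtain ⟨hp, e⟩ := h.no_jump
        (w := fun K x => -n * β₁ K + β₂ K * x 0 - n * β₃ K * x 1) h2 h0 (fun K => by fun_prop)
        (fun K hK => by filter_upwards [hβ K hK] with x hx hxK using (hx hxK).2.1)
        hK hK' hne hab k1 k2 k3 k4 hs
      linear_combination e
  obtain ⟨θ, hθ'⟩ := h.exists_affine_values (fun K => -n * β₁ K) (fun K => β₂ K)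
    (fun K => -n * β₃ K) hθ
  obtain ⟨c, hc, hcs, hc'⟩ := exists_edge_values (fun K => n * β₄ K + β₂ K)
    (fun K => n * β₅ K) (fun K => n * β₆ K) (fun K hK K' hK' hne a b hab k1 k2 k3 k4 => by
      have hs : (1 / 2 : ℝ) ∈ Ioo 0 1 := by norm_num
      obtain ⟨hΩ, ht⟩ :=
        Triangulation.Meshes.tangential_eq h.meshes hK hK' hne hab k1 k2 k3 k4 hs
      have e0 := hθ K hK K' hK' hne a b hab k1 k2 k3 k4 _ hs
      have e1 := ht _ _ _ h1
        (fun x => -(β₁ K + β₄ K * x 0 + β₃ K * x 1 - β₆ K * x 0 * x 1))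
        (fun x => -(β₅ K * x 0 + β₆ K * x 0 ^ 2))
        (fun x => -(β₁ K' + β₄ K' * x 0 + β₃ K' * x 1 - β₆ K' * x 0 * x 1))
        (fun x => -(β₅ K' * x 0 + β₆ K' * x 0 ^ 2)) (by fun_prop) (by fun_prop) (by fun_prop)
        (by fun_prop)
        (by filter_upwards [h.ae_tri hK (hβ K hK)] with x hx hxK
            simp only [comp, (hx hxK).1, (hx hxK).2.2, and_self])
        (by filter_upwards [h.ae_tri hK' (hβ K' hK')] with x hx hxK
            simp only [comp, (hx hxK).1, (hx hxK).2.2, and_self])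
      refine mul_left_cancel₀ (h.pos hΩ).ne' ?_
      simp only [add_apply, smul_apply, sub_apply, smul_eq_mul] at e0 e1 ⊢
      linear_combination -n * e1 + (b 0 - a 0) * e0)
  refine ⟨θ, c, hc, hcs, h.ae_of_ae_cells hβ fun K hK x hx hvx => ?_⟩
  obtain ⟨e0, e1, e2⟩ := hvx
  have f0 := h.form0_eq hK hx θ
  rw [hθ' K hK] at f0
  have f1 := h.form1_eq hK hx c 0
  have f2 := h.form1_eq hK hx c 1
  rw [(hc' K hK x).1] at f1
  rw [(hc' K hK x).2] at f2
  ext i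
  fin_cases i
  · simp only [fieldC, Fin.zero_eta, e0, f0, f1]
    simp
    field_simp
    ring
  · simp only [fieldC, Fin.mk_one, e1, f0]
    simp
    ring
  · have : (⟨2, by norm_num⟩ : Fin 3) = 2 := rfl
    simp only [fieldC, this, e2, f2]
    simp
    field_simp

/-- A square integrable `div^n w` forces the normal component of `(w_r, w_z)` to be continuous
across edges, which makes the edge integrals of the triangles compatible. -/
theorem exists_fieldD (hn : 0 < n) {w : L2rVec Ω} (hw : w ∈ Ch n Ω T) :
    ∃ c s, Alternating c ∧ T.EdgeSupported c ∧ ⇑w =ᵐ[rMeasure Ω] T.fieldD F n c s := by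
  obtain ⟨⟨f, hf⟩, hC⟩ := hw
  rw [isDiv_iff (memLp_comp w) (Lp.memLp f)] at hf
  simp only [IsC1] at hC
  choose! γ₁ γ₂ γ₃ γ₄ hγ using hC
  have hn' : (n : ℝ) ≠ 0 := by positivity
  obtain ⟨c, hc, hcs, hc'⟩ := exists_edge_values (fun K => γ₄ K) (fun K => -n * γ₁ K)
    (fun K => -γ₂ K) (fun K hK K' hK' hne a b hab k1 k2 k3 k4 => by
      have hs : (1 / 2 : ℝ) ∈ Ioo 0 1 := by norm_num
      obtain ⟨hΩ, ht⟩ :=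
        Triangulation.Meshes.tangential_eq h.meshes hK hK' hne hab k1 k2 k3 k4 hs
      have e1 := ht _ _ _ hf
        (fun x => -(γ₄ K + γ₂ K * x 1)) (fun x => n * γ₁ K + γ₂ K * x 0)
        (fun x => -(γ₄ K' + γ₂ K' * x 1)) (fun x => n * γ₁ K' + γ₂ K' * x 0) (by fun_prop)
        (by fun_prop) (by fun_prop) (by fun_prop)
        (by filter_upwards [h.ae_tri hK (hγ K hK)] with x hx hxK
            simp only [comp, (hx hxK).1, (hx hxK).2.2, and_self])
        (by filter_upwards [h.ae_tri hK' (hγ K' hK')] with x hx hxK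
            simp only [comp, (hx hxK).1, (hx hxK).2.2, and_self])
      simp only [add_apply, smul_apply, sub_apply, smul_eq_mul] at e1 ⊢
      linarith)
  refine ⟨c, fun K => n * γ₃ K - γ₂ K, hc, hcs, h.ae_of_ae_cells hγ fun K hK x hx hwx => ?_⟩
  obtain ⟨e0, e1, e2⟩ := hwx
  have f0 : T.form2 (fun K => n * γ₃ K - γ₂ K) x = n * γ₃ K - γ₂ K :=
    piecewise_eq _ hK hx
  have f1 := h.form1_eq hK hx c 0
  have f2 := h.form1_eq hK hx c 1
  rw [(hc' K hK x).1] at f1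
  rw [(hc' K hK x).2] at f2
  ext i
  fin_cases i
  · simp only [fieldD, Fin.zero_eta, e0, f2]
    simp
    ring
  · simp only [fieldD, Fin.mk_one, e1, f0, f2]
    simp
    field_simp
    ring
  · have : (⟨2, by norm_num⟩ : Fin 3) = 2 := rfl
    simp only [fieldD, this, e2, f1]
    simp

theorem exists_form2 {f : L2r Ω} (hf : f ∈ Dh Ω T) : ∃ s, ⇑f =ᵐ[rMeasure Ω] T.form2 s := by
  have hD : ∀ K ∈ T.cells, IsD1 Ω K f := hf
  simp only [IsD1] at hD
  choose! s hs using hD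
  refine ⟨s, h.ae_of_ae_cells hs fun K hK x hx hfx => ?_⟩
  rw [hfx]
  exact (piecewise_eq (fun K _ => s K) hK hx).symm

end FoldedMesh

/-! ### Averages over the smoothing disks -/

/-- A folded mesh together with a radius `ρ < ε` of the smoothing disks. -/
structure SmoothedMesh (Ω : Set Pt) (ψ : Pt → Pt) (T : Triangulation) (L A ε : ℝ)
    (F : Pt → Pt → ℝ) (ρ : ℝ) : Prop extends FoldedMesh Ω ψ T L A ε F where
  radius_lt : ρ < ε
  goodDisk : ∀ K ∈ T.cells, ∀ i, GoodDisk ρ (K i)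

lemma ae_ne_axis : ∀ᵐ x : Pt, x 0 ≠ 0 := by
  have h : volume ((LinearMap.ker (proj 0 : Pt →L[ℝ] ℝ).toLinearMap : Submodule ℝ Pt) : Set Pt) = 0 := by
    refine Measure.addHaar_submodule _ _ fun ht => ?_
    have : (single 0 1 : Pt) ∈
        (LinearMap.ker (proj 0 : Pt →L[ℝ] ℝ).toLinearMap : Submodule ℝ Pt) := by
      rw [ht]; trivial
    simp at this
  rw [ae_iff]
  aesop

lemma dist_combo_le (hw : ∀ i, 0 ≤ w i) (hw1 : ∑ i, w i = 1) {y z : Tri}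
    (hy : ∀ i, dist (y i) (z i) ≤ ρ) : dist (combo w y) (combo w z) ≤ ρ := by
  rw [dist_eq_norm, ← map_sub, combo_apply]
  calc ‖∑ i, w i • (y - z) i‖ ≤ ∑ i, w i * ρ := by
        refine (norm_sum_le _ _).trans (sum_le_sum fun i _ => ?_)
        rw [norm_smul, Real.norm_of_nonneg (hw i), Pi.sub_apply, ← dist_eq_norm]
        exact mul_le_mul_of_nonneg_left (hy i) (hw i)
    _ = ρ := by rw [← sum_mul, hw1, one_mul]

lemma mem_diskProd {y : Tri} : y ∈ diskProd ρ K ↔ ∀ i, y i ∈ disk ρ (K i) := by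
  simp [diskProd]

lemma dist_of_mem_diskProd {y : Tri} (hy : y ∈ diskProd ρ K) (i : Fin 3) : dist (y i) (K i) ≤ ρ :=
    disk_subset_closedBall _ _ (mem_diskProd.1 hy i)

/-- The weights of the point `x` in `K`. -/
def baryVec (K : Tri) (x : Pt) (i : Fin 3) : ℝ := bary K i x

lemma continuous_baryVec (K : Tri) : Continuous (baryVec K) :=
  continuous_pi fun i => continuous_bary i

lemma combo_baryVec (hs : sarea K ≠ 0) (x : Pt) : combo (baryVec K x) K = x := by
  rw [combo_apply]; exact bary_combo hs x

lemma xTilde_eq (K y : Tri) (x : Pt) : xTilde K y x = combo (baryVec K x) y :=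
  (combo_apply _ _).symm

lemma baryVec_ne_zero (hs : sarea K ≠ 0) (x : Pt) : baryVec K x ≠ 0 := fun h => by
  have := bary_sum hs x
  have h' : ∀ i, bary K i x = 0 := fun i => congrFun h i
  simp [h'] at this

lemma dist_combo_baryVec (hs : sarea K ≠ 0) (hx : x ∈ tri K) {y : Tri} (hy : y ∈ diskProd ρ K) :
    dist (combo (baryVec K x) y) x ≤ ρ := by
  have := dist_combo_le (w := baryVec K x) ((mem_tri_iff hs x).1 hx) (bary_sum hs x)
    (fun i => dist_of_mem_diskProd hy i)
  rwa [combo_baryVec hs] at this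

lemma continuous_jacTilde (K : Tri) (p q : Fin 2) : Continuous fun y : Tri => jacTilde K y p q := by
  simp only [jacTilde, Matrix.of_apply]
  fun_prop

lemma continuous_det_jacTilde (K : Tri) : Continuous fun y : Tri => (jacTilde K y).det := by
  simp only [Matrix.det_fin_two]
  have := continuous_jacTilde K
  fun_prop

lemma integrableOn_average {W : Tri → ℝ} (hW : Continuous W) (hg : Measurable g)
    (hM : ∀ x, |g x| ≤ M) (w : Fin 3 → ℝ) :
    IntegrableOn (fun y => W y * g (combo w y)) (diskProd ρ K) := by
  refine Integrable.mul_bdd (c := M) (hW.continuousOn.integrableOn_compact (isCompact_diskProd ρ K))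
    (hg.comp (combo w).continuous.measurable).aestronglyMeasurable ?_
  simp_all

namespace SmoothedMesh
variable (h : SmoothedMesh Ω ψ T L A ε F ρ)
include h

lemma combo_mem_closedCollar (hK : K ∈ T.cells) (hx : x ∈ tri K) {y : Tri} (hy : y ∈ diskProd ρ K) :
    combo (baryVec K x) y ∈ closedCollar ε (tri K) := by
  refine ⟨mem_thickening_iff.2
    ⟨x, hx, (dist_combo_baryVec (T.sarea_ne hK) hx hy).trans_lt h.radius_lt⟩, ?_⟩
  rw [mem_ofPred_eq, combo_apply, sum_univ_three]
  have hn := fun i => (h.goodDisk K hK i).nonneg_of_mem (mem_diskProd.1 hy i)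
  have hb : ∀ i, 0 ≤ baryVec K x i := (mem_tri_iff (T.sarea_ne hK) x).1 hx
  simp only [add_apply, smul_apply, smul_eq_mul]
  have := fun i => mul_nonneg (hb i) (hn i)
  grind

lemma ae_combo_mem_collar (hK : K ∈ T.cells) (hx : x ∈ tri K)
    (hp : ∀ᵐ z, z ∈ collar ε (closure Ω) → p z) :
    ∀ᵐ y : Tri, y ∈ diskProd ρ K → p (combo (baryVec K x) y) := by
  filter_upwards [ae_combo_notMem (baryVec_ne_zero (T.sarea_ne hK) x) hp,
    ae_combo_notMem (baryVec_ne_zero (T.sarea_ne hK) x) ae_ne_axis] with y h1 h2 hy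
  have h3 := h.combo_mem_closedCollar hK hx hy
  exact h1 (h.toFoldedMesh.collar_subset hK ⟨h3.1, lt_of_le_of_ne h3.2 h2.symm⟩)

/-- The smoothers are averages of bounded measurable functions, which depend continuously on the
point. -/
lemma smooth_eq_average (hK : K ∈ T.cells) (hx : x ∈ tri K) (l : ℕ) {ι : Type*} [Fintype ι]
    {W : ι → Tri → ℝ} (hW : ∀ k, Continuous (W k)) {G g : ι → Pt → ℝ} (hg : ∀ k, Measurable (g k))
    (hM : ∀ k x, |g k x| ≤ M) (hG : ∀ᵐ z, z ∈ collar ε (closure Ω) → ∀ k, G k z = g k z)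
    {f : Tri → ℝ} (hf : ∀ y, f y = ∑ k, W k y * G k (xTilde K y x)) : smooth l ρ K f = ∑ k, ∫ y in
    diskProd ρ K, (kappaProd l ρ K y * W k y) * g k (combo (baryVec K x) y) := by
  have hi : ∀ k, IntegrableOn
      (fun y => (kappaProd l ρ K y * W k y) * g k (combo (baryVec K x) y)) (diskProd ρ K) :=
    fun k => integrableOn_average ((continuous_kappaProd l ρ K).mul (hW k)) (hg k) (hM k) _
  have hae : ∀ᵐ y ∂(volume.restrict (diskProd ρ K)),
      ∑ k, (kappaProd l ρ K y * W k y) * g k (combo (baryVec K x) y) =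
      kappaProd l ρ K y * f y := by
    rw [ae_restrict_iff' (isCompact_diskProd ρ K).isClosed.measurableSet]
    filter_upwards [h.ae_combo_mem_collar hK hx hG] with y hy hyD
    rw [hf, mul_sum]
    refine sum_congr rfl fun k _ => ?_
    rw [xTilde_eq, hy hyD k]
    ring
  rw [smooth_eq_integral ((integrable_finsetSum _ fun k _ => hi k).congr hae), ← integral_congr_ae hae,
    integral_finsetSum _ fun k _ => hi k]

end SmoothedMesh

lemma continuous_average (hs : sarea K ≠ 0) (ρ : ℝ) {W : Tri → ℝ} (hW : Continuous W)
    (hg : Measurable g) (hM : ∀ x, |g x| ≤ M) :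
    Continuous fun x => ∫ y in diskProd ρ K, W y * g (combo (baryVec K x) y) := by
  refine continuous_iff_continuousAt.2 fun x => ?_
  exact ContinuousAt.comp
    (g := fun w => ∫ y in diskProd ρ K, W y * g (combo w y))
    (continuousAt_average (isCompact_diskProd ρ K) (convex_diskProd ρ K) hW hg hM
      (baryVec_ne_zero hs x)) (continuous_baryVec K).continuousAt

lemma onTri_eq (hs : sarea K ≠ 0) (hg : Continuous g) (hfg : ∀ x ∈ interior (tri K), f x = g x)
    (hx : x ∈ tri K) : onTri K f x = g x := by
  refine extendFrom_eq (by rwa [closure_interior_tri hs]) ?_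
  refine (hg.continuousAt.tendsto.mono_left nhdsWithin_le_nhds).congr' ?_
  filter_upwards [self_mem_nhdsWithin] with y hy using (hfg y hy).symm

/-! ### Degrees of freedom of the smoothed forms -/

/-- The integral of the `1`-form `g` along the segment from `y` to `z`. -/
def lineInt (g : Fin 2 → Pt → ℝ) (y z : Pt) : ℝ :=
  ∫ s in (0 : ℝ)..1, ∑ k, (z - y) k * g k (y + s • (z - y))

lemma lineInt_swap (g : Fin 2 → Pt → ℝ) (y z : Pt) : lineInt g z y = -lineInt g y z := by
  have h := intervalIntegral.integral_comp_sub_left (a := 0) (b := 1)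
    (fun s => ∑ k, (z - y) k * g k (y + s • (z - y))) 1
  simp only [sub_self, sub_zero] at h
  rw [lineInt, lineInt, ← h, ← intervalIntegral.integral_neg]
  refine intervalIntegral.integral_congr fun s _ => ?_
  simp only [← Finset.sum_neg_distrib]
  refine sum_congr rfl fun k _ => ?_
  have : y + (1 - s) • (z - y) = z + s • (y - z) := by
    refine pt_ext ?_ ?_ <;> simp <;> ring
  rw [this]
  simp only [sub_apply]
  ring

lemma jacTilde_edge (hs : sarea K ≠ 0) (y : Tri) (k : Fin 2) (i j : Fin 3) :
    jacTilde K y k 0 * (K j - K i) 0 + jacTilde K y k 1 * (K j - K i) 1 = (y j - y i) k := by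
  have h := fun a => gradBary_edge hs a j i
  have : jacTilde K y k 0 * (K j - K i) 0 + jacTilde K y k 1 * (K j - K i) 1 =
      ∑ a, y a k * (gradBary K a 0 * (K j 0 - K i 0) + gradBary K a 1 * (K j 1 - K i 1)) := by
    simp only [jacTilde, Matrix.of_apply, sum_univ_three, sub_apply]
    ring
  rw [this]
  rw [sum_congr rfl fun a _ => by rw [h a]]
  simp only [mul_sub, sum_sub_distrib, mul_ite, mul_one, mul_zero, Finset.sum_ite_eq',
    Finset.mem_univ, if_true, sub_apply]

lemma combo_baryVec_vertex (hs : sarea K ≠ 0) (i : Fin 3) (y : Tri) :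
    combo (baryVec K (K i)) y = y i := by
  rw [combo_apply]
  simp [baryVec, bary_vertex hs]

lemma combo_baryVec_segment (hs : sarea K ≠ 0) (i j : Fin 3) (s : ℝ) (y : Tri) :
    combo (baryVec K (K i + s • (K j - K i))) y = y i + s • (y j - y i) := by
  rw [combo_apply]
  simp only [baryVec, bary_segment hs, add_smul, mul_smul, sub_smul, sum_add_distrib,
    ← smul_sum, sum_sub_distrib, ite_smul, one_smul, zero_smul,
    Finset.sum_ite_eq', Finset.mem_univ, if_true]

/-- The tangential integral of a smoothed `1`-form along an edge is an average of its integrals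
along the perturbed edges. -/
lemma edge_average (hs : sarea K ≠ 0) (hK : ∀ i, GoodDisk ρ (K i)) (l : ℕ) {g : Fin 2 → Pt → ℝ}
    (hg : ∀ k, Measurable (g k)) (hM : ∀ k x, |g k x| ≤ M) {S : Fin 2 → Pt → ℝ} (i : Fin 3) (hS :
    ∀ s ∈ Icc (0 : ℝ) 1, ∀ m, S m (K (i + 1) + s • (K (i + 2) - K (i + 1))) = ∑ k, ∫ y in diskProd ρ
    K, (kappaProd l ρ K y * jacTilde K y k m) * g k (combo (baryVec K (K (i + 1) + s • (K (i + 2) -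
    K (i + 1)))) y)) : ∫ s in (0 : ℝ)..1, (S 0 (K (i + 1) + s • (K (i + 2) - K (i + 1))) * (K (i +
    2) - K (i + 1)) 0 + S 1 (K (i + 1) + s • (K (i + 2) - K (i + 1))) * (K (i + 2) - K (i + 1)) 1) =
    dofEdge l ρ (K (i + 1)) (K (i + 2)) (lineInt g) := by
  have key : ∀ s ∈ Icc (0 : ℝ) 1,
      S 0 (K (i + 1) + s • (K (i + 2) - K (i + 1))) * (K (i + 2) - K (i + 1)) 0 +
      S 1 (K (i + 1) + s • (K (i + 2) - K (i + 1))) * (K (i + 2) - K (i + 1)) 1 =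
      dofEdge l ρ (K (i + 1)) (K (i + 2)) (fun y z => ∑ k, (z - y) k * g k (y + s • (z - y))) := by
    intro s hsI
    have hint : ∀ k m, IntegrableOn (fun y => (kappaProd l ρ K y * jacTilde K y k m) *
        g k (combo (baryVec K (K (i + 1) + s • (K (i + 2) - K (i + 1)))) y)) (diskProd ρ K) :=
      fun k m => integrableOn_average ((continuous_kappaProd l ρ K).mul (continuous_jacTilde K k m))
        (hg k) (hM k) _
    rw [hS s hsI 0, hS s hsI 1, ← average_edge hK i]
    simp only [sum_univ_two]
    have hadd : ∀ f : Fin 2 → Fin 2 → Tri → ℝ, (∀ k m, IntegrableOn (f k m) (diskProd ρ K)) →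
        ∀ d e : ℝ, ((∫ y in diskProd ρ K, f 0 0 y) + ∫ y in diskProd ρ K, f 1 0 y) * d +
          ((∫ y in diskProd ρ K, f 0 1 y) + ∫ y in diskProd ρ K, f 1 1 y) * e =
          ∫ y in diskProd ρ K, ((f 0 0 y + f 1 0 y) * d + (f 0 1 y + f 1 1 y) * e) := by
      intro f hf d e
      have h0 : ∀ m, IntegrableOn (fun y => f 0 m y + f 1 m y) (diskProd ρ K) := fun m =>
        (hf 0 m).add (hf 1 m)
      rw [integral_add ((h0 0).mul_const d) ((h0 1).mul_const e),
        integral_mul_const, integral_mul_const, integral_add (hf 0 0) (hf 1 0),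
        integral_add (hf 0 1) (hf 1 1)]
    rw [hadd (fun k m y => (kappaProd l ρ K y * jacTilde K y k m) *
        g k (combo (baryVec K (K (i + 1) + s • (K (i + 2) - K (i + 1)))) y)) hint]
    refine integral_congr_ae (.of_forall fun y => ?_)
    simp only [combo_baryVec_segment hs, ← jacTilde_edge hs y _ (i + 1) (i + 2)]
    ring
  rw [intervalIntegral.integral_congr fun s hs' => key s (by simp_all)]
  simp only [dofEdge, lineInt]
  rw [integral_of_le zero_le_one]
  rw [integral_integral_swap]
  · refine integral_congr_ae (.of_forall fun p => ?_)
    simp only [integral_of_le zero_le_one, ← integral_const_mul]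
  · set D := disk ρ (K (i + 1)) ×ˢ disk ρ (K (i + 2)) with hD
    have hDc : IsCompact D := (isCompact_disk _ _).prod (isCompact_disk _ _)
    have e : (volume.restrict (Ioc 0 1)).prod (volume.restrict D) =
        (volume : Measure (ℝ × (Pt × Pt))).restrict (Ioc 0 1 ×ˢ D) := by
      rw [Measure.prod_restrict]; rfl
    have hb : ∀ k, IntegrableOn (fun q : ℝ × (Pt × Pt) =>
        (kappa l ρ (K (i + 1)) q.2.1 * kappa l ρ (K (i + 2)) q.2.2 * (q.2.2 - q.2.1) k) *
          g k (q.2.1 + q.1 • (q.2.2 - q.2.1))) (Ioc 0 1 ×ˢ D) := by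
      intro k
      refine Integrable.mul_bdd ?_ ?_ (.of_forall fun q => hM k _)
      · have hc : Continuous (fun q : ℝ × (Pt × Pt) =>
            (kappa l ρ (K (i + 1)) q.2.1 * kappa l ρ (K (i + 2)) q.2.2 * (q.2.2 - q.2.1) k)) := by
          have h1 := continuous_kappa l ρ (K (i + 1))
          have h2 := continuous_kappa l ρ (K (i + 2))
          fun_prop
        exact (hc.continuousOn.integrableOn_compact (isCompact_Icc.prod hDc)).mono_set
          (prod_mono Ioc_subset_Icc_self subset_rfl)
      · exact ((hg k).comp (by fun_prop)).aestronglyMeasurable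
    rw [e]
    refine ((hb 0).add (hb 1)).congr (.of_forall fun q => ?_)
    simp only [Function.uncurry, sum_univ_two, Pi.add_apply]
    ring

/-! ### The extension operators pull back discrete forms by the folding map -/

/-- The pull-back by the folding map of the `2`-form with density `s`, expressed through the folded
hat functions (which makes its measurability evident). -/
def Triangulation.foldedForm2 (T : Triangulation) (F : Pt → Pt → ℝ) (s : Tri → ℝ) (x : Pt) : ℝ :=
  open Classical in
  ∑ K ∈ T.cells, s K * sarea K * (if ∀ i, 0 < F (K i) x then
    pd 0 (F (K 1)) x * pd 1 (F (K 2)) x - pd 1 (F (K 1)) x * pd 0 (F (K 2)) x else 0)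

namespace FoldedMesh
variable (h : FoldedMesh Ω ψ T L A ε F)
include h

lemma measurable_foldedForm2 (s : Tri → ℝ) : Measurable (T.foldedForm2 F s) := by
  classical
  refine Finset.measurable_sum _ fun K _ => Measurable.const_mul (Measurable.ite ?_ ?_ ?_) _
  · have : {x | ∀ i, 0 < F (K i) x} = ⋂ i, {x | 0 < F (K i) x} := by ext; simp
    rw [this]
    exact MeasurableSet.iInter fun i => measurableSet_lt measurable_const (h.continuous _).measurable
  · exact ((measurable_pd _ _).mul (measurable_pd _ _)).sub
      ((measurable_pd _ _).mul (measurable_pd _ _))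
  · simp

lemma exists_foldedForm2_le (s : Tri → ℝ) : ∃ C, ∀ x, |T.foldedForm2 F s x| ≤ C := by
  obtain ⟨C, hC⟩ := h.exists_lip
  refine ⟨∑ K ∈ T.cells, |s K * sarea K| * (C * C + C * C), fun x => ?_⟩
  refine (abs_sum_le_sum_abs _ _).trans (sum_le_sum fun K _ => ?_)
  rw [abs_mul]
  refine mul_le_mul_of_nonneg_left ?_ (abs_nonneg _)
  have hp := fun a i => abs_pd_le_of_lip (hC a) i x
  have hC0 := C.2
  split_ifs
  · refine (abs_sub _ _).trans ?_
    rw [abs_mul, abs_mul]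
    have := fun a b i j => mul_le_mul (hp a i) (hp b j) (abs_nonneg _) hC0
    exact add_le_add (this _ _ _ _) (this _ _ _ _)
  · simp; positivity

omit h in
lemma foldedForm2_eq (hK : K ∈ T.cells) {p : Pt} (hp : p ∈ interior (tri K))
    {J : Matrix (Fin 2) (Fin 2) ℝ} (hJ : ChainAt F K p J x) (s : Tri → ℝ) :
    T.foldedForm2 F s x = J.det * s K := by
  have hs := T.sarea_ne hK
  have hinj := T.inj hK
  rw [interior_tri hs] at hp
  rw [foldedForm2, Finset.sum_eq_single_of_mem K hK]
  · rw [if_pos fun i => by rw [(hJ _).1, hatOn_self hinj]; exact hp i]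
    have e := cross_gradBary hs 0
    simp only [(hJ _).2, gradHatOn_self hinj, sum_univ_two, Matrix.det_fin_two]
    grind
  · intro K' hK' hne
    rw [if_neg, mul_zero]
    intro hpos
    have hsub : ∀ i, K' i ∈ range K := fun i => by
      by_contra hn
      have := hpos i
      rw [(hJ _).1, hatOn_of_notMem hn] at this
      linarith
    refine hne (T.listed_once K' hK' K hK ?_)
    have h1 : Finset.univ.image K' ⊆ Finset.univ.image K := fun a ha => by
      aesop
    have h2 := Finset.eq_of_subset_of_card_le h1
      (by rw [Finset.card_image_of_injective _ hinj, Finset.card_image_of_injective _ (T.inj hK')])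
    have h3 := congrArg (fun S : Finset Pt => (S : Set Pt)) h2
    simpa using h3

/-- Almost everywhere in the collar, the folded forms are pull-backs by the folding map. -/
lemma ae_pullback : ∀ᵐ z, z ∈ collar ε (closure Ω) → fold Ω ψ z ∈ Ω ∧
    (∀ q, T.form0 F q z = T.form0 F q (fold Ω ψ z)) ∧
    (∀ c m, T.form1 F c m z = ∑ k, T.form1 F c k (fold Ω ψ z) * foldJac Ω ψ z k m) ∧ ∀ s,
    T.foldedForm2 F s z = (foldJac Ω ψ z).det * T.form2 s (fold Ω ψ z) := by
  filter_upwards [h.ae_chain] with z hz hzc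
  obtain ⟨-, K, hK, hf, hc⟩ := hz hzc
  have hJ : ChainAt F K (fold Ω ψ z) (foldJac Ω ψ z) z := fun a => ⟨(hc a).1, (hc a).2.2⟩
  refine ⟨h.meshes.interior_tri_subset hK hf, fun q => ?_, fun c m => ?_, fun s => ?_⟩
  · rw [hJ.form0_eq hK, h.form0_eq hK hf]
  · rw [hJ.form1_eq hK]
    exact sum_congr rfl fun k _ => by rw [h.form1_eq hK hf]
  · rw [foldedForm2_eq hK hf hJ]
    congr 1
    exact (piecewise_eq (fun K _ => s K) hK hf).symm

lemma ae_rep {V : Type*} {u v : Pt → V} (huv : u =ᵐ[rMeasure Ω] v) :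
    ∀ᵐ z, z ∈ collar ε (closure Ω) → fold Ω ψ z ∈ Ω → u (fold Ω ψ z) = v (fold Ω ψ z) :=
  h.toFolds.ae_fold ((ae_rMeasure_iff h.isOpen h.pos).1 huv)

lemma quotG_extG (hn : 0 < n) (hu : u =ᵐ[rMeasure Ω] T.fieldG F n q) :
    ∀ᵐ z, z ∈ collar ε (closure Ω) → quotG n (extG n Ω ψ u) z = T.form0 F q z := by
  have hn' : (n : ℝ) ≠ 0 := by positivity
  filter_upwards [h.ae_pullback, h.ae_rep hu] with z hz hr hzc
  obtain ⟨hΩ, h0, -, -⟩ := hz hzc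
  have hr := hr hzc hΩ
  have hz0 : z 0 ≠ 0 := hzc.2.ne'
  have hf0 : (fold Ω ψ z) 0 ≠ 0 := (h.pos hΩ).ne'
  rw [h0]
  by_cases hzΩ : z ∈ Ω
  · simp only [fold, if_pos hzΩ, quotG, extG, fieldG] at hr hf0 ⊢
    rw [hr]
    field_simp
  · simp only [fold, if_neg hzΩ, quotG, extG, fieldG] at hr hf0 ⊢
    rw [hr]
    field_simp

lemma quotC_extC (hn : 0 < n) {v : Pt → Vec} (hv : v =ᵐ[rMeasure Ω] T.fieldC F n θ c) : ∀ᵐ z, z ∈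
    collar ε (closure Ω) → (∀ m, quotC n (extC n Ω ψ v) z m = T.form1 F c m z) ∧ extC n Ω ψ v z 1 =
    T.form0 F θ z := by
  have hn' : (n : ℝ) ≠ 0 := by positivity
  filter_upwards [h.ae_pullback, h.ae_rep hv] with z hz hr hzc
  obtain ⟨hΩ, h0, h1, -⟩ := hz hzc
  have hr := hr hzc hΩ
  have hz0 : z 0 ≠ 0 := hzc.2.ne'
  have hf0 : (fold Ω ψ z) 0 ≠ 0 := (h.pos hΩ).ne'
  have hq : ∀ m, quotC n v (fold Ω ψ z) m = T.form1 F c m (fold Ω ψ z) := fun m => by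
    simp only [quotC, hr, fieldC]
    fin_cases m <;> simp <;> field_simp
    ring
  have hq1 : v (fold Ω ψ z) 1 = T.form0 F θ (fold Ω ψ z) := by
    rw [hr, fieldC]; simp
  simp only [h1, h0, ← hq, ← hq1]
  by_cases hzΩ : z ∈ Ω
  · simp only [fold, foldJac, if_pos hzΩ, extC, quotC]
    simp
  · have e : extC n Ω ψ v z = _ := if_neg hzΩ
    simp only [fold, foldJac, if_neg hzΩ]
    refine ⟨fun m => ?_, by rw [e]; simp⟩
    rw [quotC, e]
    fin_cases m
    · simp [Matrix.mulVec, dotProduct, sum_univ_two]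
      field_simp
      ring
    · simp [Matrix.mulVec, dotProduct, sum_univ_two]
      field_simp

lemma quotD_extD (hn : 0 < n) {w : Pt → Vec} (hw : w =ᵐ[rMeasure Ω] T.fieldD F n c s) : ∀ᵐ z, z ∈
    collar ε (closure Ω) → (rzPart (extD n Ω ψ w) z 1 = T.form1 F c 0 z ∧ rzPart (extD n Ω ψ w) z 0
    = -T.form1 F c 1 z) ∧ quotD n (extD n Ω ψ w) z = T.foldedForm2 F s z := by
  have hn' : (n : ℝ) ≠ 0 := by positivity
  filter_upwards [h.ae_pullback, h.ae_rep hw] with z hz hr hzc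
  obtain ⟨hΩ, -, h1, h2⟩ := hz hzc
  have hr := hr hzc hΩ
  have hz0 : z 0 ≠ 0 := hzc.2.ne'
  have hf0 : (fold Ω ψ z) 0 ≠ 0 := (h.pos hΩ).ne'
  have hq0 : w (fold Ω ψ z) 2 = T.form1 F c 0 (fold Ω ψ z) := by
    rw [hr, fieldD]; simp
  have hq1 : T.form1 F c 1 (fold Ω ψ z) = -w (fold Ω ψ z) 0 := by
    rw [hr, fieldD]; simp
  have hq2 : quotD n w (fold Ω ψ z) = T.form2 s (fold Ω ψ z) := by
    rw [quotD, hr, fieldD]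
    simp
    field_simp
    ring
  simp only [h1, h2, sum_univ_two, ← hq0, hq1, ← hq2]
  by_cases hzΩ : z ∈ Ω
  · simp [fold, foldJac, if_pos hzΩ, extD, rzPart, quotD]
  · simp only [fold, foldJac, if_neg hzΩ, extD, rzPart]
    refine ⟨⟨?_, ?_⟩, ?_⟩
    · simp [Matrix.mulVec, dotProduct, sum_univ_two, Matrix.adjugate_fin_two]; ring
    · simp [Matrix.mulVec, dotProduct, sum_univ_two, Matrix.adjugate_fin_two]; ring
    · rw [quotD, extD, if_neg hzΩ]
      simp
      field_simp
      ring

lemma extO_eq (hf : f =ᵐ[rMeasure Ω] T.form2 s) :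
    ∀ᵐ z, z ∈ collar ε (closure Ω) → extO Ω ψ f z = T.foldedForm2 F s z := by
  filter_upwards [h.ae_pullback, h.ae_rep hf] with z hz hr hzc
  obtain ⟨hΩ, -, -, h2⟩ := hz hzc
  rw [h2, ← hr hzc hΩ]
  by_cases hzΩ : z ∈ Ω
  · simp [fold, foldJac, if_pos hzΩ, extO]
  · simp [fold, foldJac, if_neg hzΩ, extO]

end FoldedMesh

/-! ### The operators `R_h` act on the degrees of freedom -/

/-- The action of `R_h` on vertex values. -/
def Triangulation.map0 (T : Triangulation) (F : Pt → Pt → ℝ) (l : ℕ) (ρ : ℝ) (q : Pt → ℝ) (a : Pt) :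
    ℝ := dofVertex l ρ a (T.form0 F q)

/-- The action of `R_h` on edge values. -/
def Triangulation.map1 (T : Triangulation) (F : Pt → Pt → ℝ) (l : ℕ) (ρ : ℝ) (c : Pt → Pt → ℝ)
    (a b : Pt) : ℝ := dofEdge l ρ a b (lineInt (T.form1 F c))

/-- The action of `R_h` on densities. -/
def Triangulation.map2 (T : Triangulation) (F : Pt → Pt → ℝ) (l : ℕ) (ρ : ℝ) (s : Tri → ℝ)
    (K : Tri) : ℝ :=
  ⨍ x in tri K, ∫ y in diskProd ρ K, (kappaProd l ρ K y * (jacTilde K y).det) *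
    T.foldedForm2 F s (combo (baryVec K x) y)

lemma alternating_map1 (T : Triangulation) (F : Pt → Pt → ℝ) (l : ℕ) (ρ : ℝ) (c : Pt → Pt → ℝ) :
    Alternating (T.map1 F l ρ c) := by
  intro a b
  rw [map1, map1, ← dofEdge_swap l ρ a b, dofEdge, dofEdge,
    ← integral_neg]
  refine integral_congr_ae (.of_forall fun p => ?_)
  simp only
  rw [lineInt_swap _ p.2 p.1]
  ring

lemma whitneyOn_eq_sum_nu (K : Tri) (hc : Alternating c) (m : Fin 2) (x : Pt) :
    whitneyOn K c m x = ∑ i : Fin 3, c (K (i + 1)) (K (i + 2)) * nu K i x m := by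
  rw [whitneyOn, sum_alternating (fun i j => c (K i) (K j)) (fun i j => hc _ _), sum_univ_three]
  aesop

namespace SmoothedMesh
variable (h : SmoothedMesh Ω ψ T L A ε F ρ)
include h

omit h in
lemma segment_mem_tri (i j : Fin 3) {s : ℝ} (h : s ∈ Icc (0 : ℝ) 1) :
    K i + s • (K j - K i) ∈ tri K := by
  exact (convex_tri K).add_smul_sub_mem (vertex_mem_tri K i) (vertex_mem_tri K j) h

lemma onTri_smoothG (hn : 0 < n) (hu : u =ᵐ[rMeasure Ω] T.fieldG F n q) (hK : K ∈ T.cells)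
    (i : Fin 3) :
    onTri K (quotG n (smoothG n l ρ K (extG n Ω ψ u))) (K i) = T.map0 F l ρ q (K i) := by
  have hn' : (n : ℝ) ≠ 0 := by positivity
  have hs := T.sarea_ne hK
  obtain ⟨M, hM⟩ := h.exists_form0_le q
  have hm := h.measurable_form0 q
  rw [onTri_eq hs (continuous_average hs ρ (continuous_kappaProd l ρ K) hm hM) (fun x hx => ?_)
    (vertex_mem_tri K i)]
  · simp only [combo_baryVec_vertex hs]
    exact average_vertex (h.goodDisk K hK) i _
  · have hx0 := (pos_of_mem_interior hK hx).ne'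
    have e := h.smooth_eq_average hK (interior_subset hx) l (ι := Unit) (W := fun _ _ => 1)
      (fun _ => continuous_const) (fun _ => hm) (fun _ => hM)
      (by filter_upwards [h.quotG_extG hn hu] with z hz hzc using fun _ => hz hzc)
      (f := fun y => quotG n (extG n Ω ψ u) (xTilde K y x)) (fun y => by simp)
    rw [quotG, smoothG, e]
    simp only [Finset.univ_unique, Finset.sum_singleton, mul_one]
    field_simp

lemma smooth_covariant (hK : K ∈ T.cells) (hx : x ∈ tri K) {G : Pt → Fin 2 → ℝ}
    (hG : ∀ᵐ z, z ∈ collar ε (closure Ω) → ∀ m, G z m = T.form1 F c m z) (m : Fin 2) : smooth l ρ K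
    (fun y => ((jacTilde K y)ᵀ *ᵥ G (xTilde K y x)) m) = ∑ k, ∫ y in diskProd ρ K,
    (kappaProd l ρ K y * jacTilde K y k m) * T.form1 F c k (combo (baryVec K x) y) := by
  obtain ⟨M, hM⟩ := h.exists_form1_le c
  exact h.smooth_eq_average hK hx l
    (fun k => continuous_jacTilde K k m) (fun k => h.measurable_form1 c k)
    (fun k => hM k) hG (fun y => by simp [Matrix.mulVec, dotProduct])

lemma edgeTangent_smoothC (hn : 0 < n) {v : Pt → Vec} (hv : v =ᵐ[rMeasure Ω] T.fieldC F n θ c)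
    (hK : K ∈ T.cells) (i : Fin 3) : edgeTangent K i
    (fun p m => onTri K (fun q => quotC n (smoothC n l ρ K (extC n Ω ψ v)) q m) p) = T.map1 F l ρ c
    (K (i + 1)) (K (i + 2)) := by
  have hn' : (n : ℝ) ≠ 0 := by positivity
  have hs := T.sarea_ne hK
  obtain ⟨M, hM⟩ := h.exists_form1_le c
  have hG : ∀ᵐ z, z ∈ collar ε (closure Ω) → ∀ m, quotC n (extC n Ω ψ v) z m = T.form1 F c m z := by
    filter_upwards [h.quotC_extC hn hv] with z hz hzc using (hz hzc).1
  refine edge_average hs (h.goodDisk K hK) l (h.measurable_form1 c) hM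
    (S := fun m p => onTri K (fun q => quotC n (smoothC n l ρ K (extC n Ω ψ v)) q m) p) i
    fun s hsI m => ?_
  refine onTri_eq hs (g := fun x => ∑ k, ∫ y in diskProd ρ K,
    (kappaProd l ρ K y * jacTilde K y k m) * T.form1 F c k (combo (baryVec K x) y)) ?_ ?_
    (segment_mem_tri _ _ hsI)
  · exact continuous_finsetSum _ fun k _ => continuous_average hs ρ
      ((continuous_kappaProd l ρ K).mul (continuous_jacTilde K k m)) (h.measurable_form1 c k) (hM k)
  · intro x hx
    have hx0 := (pos_of_mem_interior hK hx).ne'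
    have e := h.smooth_covariant hK (interior_subset hx) (l := l) hG m
    rw [← e]
    fin_cases m
    · simp [quotC, smoothC]
      field_simp
      ring
    · simp [quotC, smoothC]
      field_simp

lemma smoothC_vertex (hn : 0 < n) {v : Pt → Vec} (hv : v =ᵐ[rMeasure Ω] T.fieldC F n θ c)
    (hK : K ∈ T.cells) (i : Fin 3) :
    smoothC n l ρ K (extC n Ω ψ v) (K i) 1 = T.map0 F l ρ θ (K i) := by
  have hs := T.sarea_ne hK
  obtain ⟨M, hM⟩ := h.exists_form0_le θ
  have e := h.smooth_eq_average hK (vertex_mem_tri K i) l (ι := Unit) (W := fun _ _ => 1)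
    (fun _ => continuous_const) (fun _ => h.measurable_form0 θ) (fun _ => hM)
   
    (by filter_upwards [h.quotC_extC hn hv] with z hz hzc using fun _ => (hz hzc).2)
    (f := fun y => extC n Ω ψ v (xTilde K y (K i)) 1) (fun y => by simp)
  simp only [smoothC, map0]
  simp only [Finset.univ_unique, Finset.sum_singleton, mul_one, combo_baryVec_vertex hs] at e
  rw [average_vertex (h.goodDisk K hK) i] at e
  simpa using e

lemma smooth_density (hK : K ∈ T.cells) (hx : x ∈ tri K)
    (hG : ∀ᵐ z, z ∈ collar ε (closure Ω) → G z = T.foldedForm2 F s z) : smooth l ρ K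
    (fun y => (jacTilde K y).det * G (xTilde K y x)) = ∫ y in diskProd ρ K,
    (kappaProd l ρ K y * (jacTilde K y).det) * T.foldedForm2 F s (combo (baryVec K x) y) := by
  obtain ⟨M, hM⟩ := h.exists_foldedForm2_le s
  have e := h.smooth_eq_average hK hx l (ι := Unit) (W := fun _ y => (jacTilde K y).det)
    (fun _ => continuous_det_jacTilde K) (fun _ => h.measurable_foldedForm2 s) (fun _ => hM)
    (G := fun _ => G) (by simp_all)
    (f := fun y => (jacTilde K y).det * G (xTilde K y x)) (fun y => by simp)
  simpa using e

lemma average_quotD (hn : 0 < n) {w : Pt → Vec} (hw : w =ᵐ[rMeasure Ω] T.fieldD F n c s)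
    (hK : K ∈ T.cells) :
    (⨍ p in tri K, quotD n (smoothD n l ρ K (extD n Ω ψ w)) p) = T.map2 F l ρ s K := by
  have hn' : (n : ℝ) ≠ 0 := by positivity
  refine average_congr ?_
  rw [EventuallyEq, ae_restrict_iff' (isCompact_tri K).isClosed.measurableSet]
  filter_upwards [ae_mem_interior_of_mem_tri K] with x hi hx
  have hx0 := (pos_of_mem_interior hK (hi hx)).ne'
  rw [← h.smooth_density hK hx (G := quotD n (extD n Ω ψ w))
    (by filter_upwards [h.quotD_extD hn hw] with z hz hzc using (hz hzc).2)]
  simp [quotD, smoothD]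
  field_simp
  ring

lemma edgeNormal_smoothD (hn : 0 < n) {w : Pt → Vec} (hw : w =ᵐ[rMeasure Ω] T.fieldD F n c s)
    (hK : K ∈ T.cells) (i : Fin 3) : edgeNormal K i (rzPart (smoothD n l ρ K (extD n Ω ψ w))) =
    T.map1 F l ρ c (K (i + 1)) (K (i + 2)) := by
  have hs := T.sarea_ne hK
  obtain ⟨M, hM⟩ := h.exists_form1_le c
  have hG : ∀ᵐ z, z ∈ collar ε (closure Ω) → ∀ m,
      (![rzPart (extD n Ω ψ w) z 1, -rzPart (extD n Ω ψ w) z 0] : Fin 2 → ℝ) m =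
        T.form1 F c m z := by
    filter_upwards [h.quotD_extD hn hw] with z hz hzc m
    obtain ⟨⟨e1, e2⟩, -⟩ := hz hzc
    fin_cases m
    · simpa using e1
    · simp [e2]
  have hneg : ∀ f : Tri → ℝ, smooth l ρ K (fun y => -f y) = -smooth l ρ K f := fun f => by
    simp only [smooth, mul_neg, integral_neg]
  rw [map1, ← edge_average hs (h.goodDisk K hK) l (h.measurable_form1 c) hM
    (S := fun m p => (![rzPart (smoothD n l ρ K (extD n Ω ψ w)) p 1,
      -rzPart (smoothD n l ρ K (extD n Ω ψ w)) p 0] : Fin 2 → ℝ) m) i ?_]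
  · aesop
  · intro t ht m
    have e := h.smooth_covariant hK (segment_mem_tri (i + 1) (i + 2) ht) (l := l)
      (G := fun z => ![rzPart (extD n Ω ψ w) z 1, -rzPart (extD n Ω ψ w) z 0]) hG m
    rw [← e]
    fin_cases m
    · simp [rzPart, smoothD, Matrix.mulVec, dotProduct, sum_univ_two, Matrix.adjugate_fin_two]
      grind
    · simp [rzPart, smoothD, Matrix.mulVec, dotProduct, sum_univ_two, Matrix.adjugate_fin_two]
      rw [← hneg]
      simp

lemma ae_eq_piecewise {V : Type*} [AddCommGroup V] {P : Tri → Pt → V} {f : Pt → V}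
    (hP : ∀ K ∈ T.cells, ∀ x ∈ interior (tri K), P K x = f x) : piecewise T P =ᵐ[rMeasure Ω] f :=
  h.ae_of_ae_cells (fun _ _ => .of_forall fun _ _ => trivial)
    fun K hK x hx _ => by rw [piecewise_eq P hK hx, hP K hK x hx]

omit h in
theorem RhG_eq (h : SmoothedMesh Ω ψ T L A ε F (δ * T.meshSize)) (hn : 0 < n)
    (hu : u =ᵐ[rMeasure Ω] T.fieldG F n q) :
    RhG n l Ω ψ T δ u =ᵐ[rMeasure Ω] T.fieldG F n (T.map0 F l (δ * T.meshSize) q) := by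
  refine h.ae_eq_piecewise fun K hK x hx => ?_
  rw [fieldG, h.form0_eq hK hx, affineOn, interpG, mul_sum]
  refine sum_congr rfl fun i _ => ?_
  rw [h.onTri_smoothG hn hu hK]
  ring

omit h in
theorem RhC_eq (h : SmoothedMesh Ω ψ T L A ε F (δ * T.meshSize)) (hn : 0 < n) {v : Pt → Vec}
    (hv : v =ᵐ[rMeasure Ω] T.fieldC F n θ c) : RhC n l Ω ψ T δ v =ᵐ[rMeasure Ω] T.fieldC F n
    (T.map0 F l (δ * T.meshSize) θ) (T.map1 F l (δ * T.meshSize) c) := by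
  refine h.ae_eq_piecewise fun K hK x hx => ?_
  rw [fieldC, h.form0_eq hK hx, h.form1_eq hK hx, h.form1_eq hK hx, affineOn,
    whitneyOn_eq_sum_nu K (alternating_map1 T F l _ c),
    whitneyOn_eq_sum_nu K (alternating_map1 T F l _ c), interpC]
  simp only [h.smoothC_vertex hn hv hK, h.edgeTangent_smoothC hn hv hK]
  ext m
  fin_cases m
  · simp [sum_univ_three]; ring
  · simp [sum_univ_three]
  · simp [sum_univ_three]; ring

omit h in
theorem RhD_eq (h : SmoothedMesh Ω ψ T L A ε F (δ * T.meshSize)) (hn : 0 < n) {w : Pt → Vec}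
    (hw : w =ᵐ[rMeasure Ω] T.fieldD F n c s) : RhD n l Ω ψ T δ w =ᵐ[rMeasure Ω] T.fieldD F n
    (T.map1 F l (δ * T.meshSize) c) (T.map2 F l (δ * T.meshSize) s) := by
  refine h.ae_eq_piecewise fun K hK x hx => ?_
  have e : T.form2 (T.map2 F l (δ * T.meshSize) s) x = T.map2 F l (δ * T.meshSize) s K :=
    piecewise_eq (fun K _ => T.map2 F l (δ * T.meshSize) s K) hK hx
  rw [fieldD, h.form1_eq hK hx, h.form1_eq hK hx, e,
    whitneyOn_eq_sum_nu K (alternating_map1 T F l _ c),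
    whitneyOn_eq_sum_nu K (alternating_map1 T F l _ c), interpD, h.average_quotD hn hw hK]
  simp only [h.edgeNormal_smoothD hn hw hK]
  ext m
  fin_cases m
  · simp [sum_univ_three, xi]; ring
  · simp [sum_univ_three, xi]; ring
  · aesop

omit h in
theorem RhO_eq (h : SmoothedMesh Ω ψ T L A ε F (δ * T.meshSize)) (hf : f =ᵐ[rMeasure Ω] T.form2 s) :
    RhO l Ω ψ T δ f =ᵐ[rMeasure Ω] T.form2 (T.map2 F l (δ * T.meshSize) s) := by
  refine h.ae_eq_piecewise fun K hK x hx => ?_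
  have e : T.form2 (T.map2 F l (δ * T.meshSize) s) x = T.map2 F l (δ * T.meshSize) s K :=
    piecewise_eq (fun K _ => T.map2 F l (δ * T.meshSize) s K) hK hx
  rw [e, interpO, map2]
  refine average_congr ?_
  rw [EventuallyEq, ae_restrict_iff' (isCompact_tri K).isClosed.measurableSet]
  exact .of_forall fun x hx => h.smooth_density hK hx (h.extO_eq hf)

end SmoothedMesh

/-! ### The action on degrees of freedom commutes with the exterior derivative -/

/-- `F` is differentiable at `z` and is there the pull-back of the hat functions of a triangle. -/
def Triangulation.SmoothAt (T : Triangulation) (F : Pt → Pt → ℝ) (z : Pt) : Prop :=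
  (∃ K ∈ T.cells, ∃ p ∈ interior (tri K), ∃ J, ChainAt F K p J z) ∧ ∀ a, DifferentiableAt ℝ (F a) z

namespace Triangulation.SmoothAt

variable {z : Pt}

lemma form1_diff0 (h : T.SmoothAt F z) (q : Pt → ℝ) (m : Fin 2) :
    T.form1 F (diff0 q) m z = T.gradForm0 F q m z := by
  obtain ⟨⟨K, hK, p, -, J, hJ⟩, -⟩ := h
  rw [hJ.form1_eq hK, hJ.gradForm0_eq hK]
  refine sum_congr rfl fun k _ => ?_
  have h1 := bary_sum (T.sarea_ne hK) p
  have h2 := sum_gradBary (T.sarea_ne hK) k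
  congr 1
  simp only [whitneyOn, diff0, sum_univ_three] at h1 h2 ⊢
  grind

lemma foldedForm2_curlOn (h : T.SmoothAt F z) (hc : Alternating c) :
    T.foldedForm2 F (curlOn c) z = T.curlForm1 F c z := by
  obtain ⟨⟨K, hK, p, hp, J, hJ⟩, -⟩ := h
  rw [FoldedMesh.foldedForm2_eq hK hp hJ, hJ.curlForm1_eq hK (T.sarea_ne hK) hc]

end Triangulation.SmoothAt

lemma FoldedMesh.ae_smoothAt (h : FoldedMesh Ω ψ T L A ε F) :
    ∀ᵐ z, z ∈ collar ε (closure Ω) → T.SmoothAt F z := by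
  filter_upwards [h.ae_chain] with z hz hzc
  obtain ⟨-, K, hK, hf, hc⟩ := hz hzc
  exact ⟨⟨K, hK, _, hf, _, fun a => ⟨(hc a).1, (hc a).2.2⟩⟩, fun a => (hc a).2.1⟩

lemma hasDerivAt_comp_edgeCurve (y : Tri) (i : Fin 3) {s : ℝ}
    (hG : DifferentiableAt ℝ G (edgeCurve y i s)) : HasDerivAt (fun s => G (edgeCurve y i s))
    (∑ k, (y (i + 2) - y (i + 1)) k * pd k G (edgeCurve y i s)) s := by
  have := hG.hasFDerivAt.comp_hasDerivAt s (hasDerivAt_edgeCurve y i s)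
  rw [fderiv_apply_eq_pd] at this
  aesop

/-- `∫ F dG` along the edge `i` of `y`. -/
def edgeForm (F G : Pt → ℝ) (y : Tri) (i : Fin 3) : ℝ :=
  ∫ s in (0 : ℝ)..1, F (edgeCurve y i s) * deriv (fun s => G (edgeCurve y i s)) s

lemma exists_lipschitz_comp_edgeCurve (hG : LipschitzWith C G) (y : Tri) (i : Fin 3) :
    LipschitzWith (C * nndist (y (i + 1)) (y (i + 2))) (fun s => G (edgeCurve y i s)) :=
  hG.comp (lipschitz_edgeCurve y i)

lemma intervalIntegrable_edgeForm {F : Pt → ℝ} (hF : Continuous F) (hG : LipschitzWith C G)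
    (y : Tri) (i : Fin 3) : IntervalIntegrable
    (fun s => F (edgeCurve y i s) * deriv (fun s => G (edgeCurve y i s)) s) volume 0 1 :=
  (acOfLip (exists_lipschitz_comp_edgeCurve hG y i) 0 1).intervalIntegrable_deriv.continuousOn_mul
    (hF.comp (lipschitz_edgeCurve y i).continuous).continuousOn

lemma measurable_lineInt {g : Fin 2 → Pt → ℝ} (hg : ∀ k, Measurable (g k)) (j k : Fin 3) :
    Measurable fun y : Tri => lineInt g (y j) (y k) := by
  simp only [lineInt, integral_of_le zero_le_one]
  refine StronglyMeasurable.measurable ?_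
  refine StronglyMeasurable.integral_prod_right (f := fun (y : Tri) (s : ℝ) =>
    ∑ m, (y k - y j) m * g m (y j + s • (y k - y j))) ?_
  fun_prop

lemma abs_lineInt_le {g : Fin 2 → Pt → ℝ} (hM : ∀ k x, |g k x| ≤ M) (y z : Pt) :
    |lineInt g y z| ≤ 2 * dist y z * M := by
  have h := intervalIntegral.norm_integral_le_of_norm_le_const (a := 0) (b := 1)
    (f := fun s => ∑ k, (z - y) k * g k (y + s • (z - y))) (C := 2 * dist y z * M) ?_
  · simpa [lineInt] using h
  · intro s _
    have hd : ∀ k, |(z - y) k| ≤ dist y z := fun k => by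
      rw [dist_comm]; exact abs_coord_sub_le_dist z y k
    rw [sum_univ_two, norm_eq_abs]
    refine (abs_add_le _ _).trans ?_
    rw [abs_mul, abs_mul]
    have := fun k => mul_le_mul (hd k) (hM k (y + s • (z - y))) (abs_nonneg _) dist_nonneg
    linarith [this 0, this 1]

lemma integrableOn_lineInt {W : Tri → ℝ} (hW : Continuous W) {g : Fin 2 → Pt → ℝ}
    (hg : ∀ k, Measurable (g k)) (hM : ∀ k x, |g k x| ≤ M) (j k : Fin 3) :
    IntegrableOn (fun y => W y * lineInt g (y j) (y k)) (diskProd ρ K) := by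
  have hi : IntegrableOn (fun y => W y * (2 * dist (y j) (y k) * M)) (diskProd ρ K) :=
    (by fun_prop : Continuous fun y => W y * (2 * dist (y j) (y k) * M)).continuousOn
      |>.integrableOn_compact (isCompact_diskProd ρ K)
  refine Integrable.mono hi (hW.measurable.mul (measurable_lineInt hg j k)).aestronglyMeasurable
    (.of_forall fun y => ?_)
  rw [norm_mul, norm_mul]
  refine mul_le_mul_of_nonneg_left ?_ (norm_nonneg _)
  exact (abs_lineInt_le hM _ _).trans (le_abs_self _)

namespace SmoothedMesh
variable (h : SmoothedMesh Ω ψ T L A ε F ρ)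
include h

/-- Almost every perturbation of a triangle moves almost every point of a family to a point with a
given property that holds almost everywhere. -/
lemma ae_ae_combo (hK : K ∈ T.cells) (hp : ∀ᵐ z, z ∈ collar ε (closure Ω) → p z) {X : Type*}
    [MeasurableSpace X] (μ : Measure X) [SFinite μ] {S : Set X} (hS : MeasurableSet S) {P : X → Pt}
    (hP : Measurable P) (hPS : ∀ x ∈ S, P x ∈ tri K) :
    ∀ᵐ y : Tri, y ∈ diskProd ρ K → ∀ᵐ x ∂μ, x ∈ S → p (combo (baryVec K (P x)) y) := by
  set N := toMeasurable volume {z | ¬(z ∈ collar ε (closure Ω) → p z)} with hN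
  have hN0 : volume N = 0 := by rw [hN, measure_toMeasurable]; exact hp
  have hgood : ∀ᵐ z, z ∈ collar ε (closure Ω) → z ∉ N ∧ z ∈ collar ε (closure Ω) := by
    have := measure_eq_zero_iff_ae_notMem.1 hN0
    filter_upwards [this] with z hz hzc using ⟨hz, hzc⟩
  have hm : Measurable fun q : X × Tri => combo (baryVec K (P q.1)) q.2 := by
    simp only [combo_apply, baryVec]
    refine Finset.measurable_sum _ fun i _ => Measurable.smul
      ((continuous_bary i).measurable.comp (hP.comp measurable_fst))
      ((measurable_pi_apply i).comp measurable_snd)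
  have h1 : ∀ᵐ x ∂μ, ∀ᵐ y : Tri, x ∈ S → y ∈ diskProd ρ K →
      combo (baryVec K (P x)) y ∉ N ∧ combo (baryVec K (P x)) y ∈ collar ε (closure Ω) := by
    refine .of_forall fun x => ?_
    by_cases hx : x ∈ S
    · filter_upwards [h.ae_combo_mem_collar hK (hPS x hx) hgood] with y hy _ using hy
    · simp_all
  rw [Measure.ae_ae_comm] at h1
  · filter_upwards [h1] with y hy hyD
    filter_upwards [hy] with x hx hxS
    obtain ⟨h2, h3⟩ := hx hxS hyD
    by_contra hn
    exact h2 (subset_toMeasurable _ _ fun hh => hn (hh h3))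
  · have e : {x : X × Tri | x.1 ∈ S → x.2 ∈ diskProd ρ K →
        combo (baryVec K (P x.1)) x.2 ∉ N ∧ combo (baryVec K (P x.1)) x.2 ∈ collar ε (closure Ω)} =
        (S ×ˢ diskProd ρ K)ᶜ ∪ (fun q : X × Tri => combo (baryVec K (P q.1)) q.2) ⁻¹'
          (Nᶜ ∩ collar ε (closure Ω)) := by
      grind
    rw [e]
    exact (hS.prod (isCompact_diskProd ρ K).isClosed.measurableSet).compl.union
      (hm ((measurableSet_toMeasurable _ _).compl.inter (isOpen_collar _ _).measurableSet))

omit h in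
lemma combo_edgeCurve (hs : sarea K ≠ 0) (i : Fin 3) (s : ℝ) (y : Tri) :
    combo (baryVec K (edgeCurve K i s)) y = edgeCurve y i s :=
  combo_baryVec_segment hs _ _ _ _

lemma ae_edge (hK : K ∈ T.cells) (i : Fin 3) (hp : ∀ᵐ z, z ∈ collar ε (closure Ω) → p z) :
    ∀ᵐ y : Tri, y ∈ diskProd ρ K → ∀ᵐ s : ℝ, s ∈ Icc (0 : ℝ) 1 → p (edgeCurve y i s) := by
  have := h.ae_ae_combo hK hp volume measurableSet_Icc
    (lipschitz_edgeCurve K i).continuous.measurable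
    (fun s hs => segment_mem_tri (i + 1) (i + 2) hs)
  simpa only [combo_edgeCurve (T.sarea_ne hK)] using this

lemma edgeCurve_mem (hK : K ∈ T.cells) (i : Fin 3) {y : Tri} (hy : y ∈ diskProd ρ K) {s : ℝ}
    (hs : s ∈ Icc (0 : ℝ) 1) : edgeCurve y i s ∈ closedCollar ε (tri K) := by
  rw [← combo_edgeCurve (T.sarea_ne hK)]
  exact h.combo_mem_closedCollar hK (segment_mem_tri (i + 1) (i + 2) hs) hy

lemma lineInt_eq (hK : K ∈ T.cells) (i : Fin 3) : ∀ᵐ y : Tri, y ∈ diskProd ρ K → ∀ c, lineInt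
    (T.form1 F c) (y (i + 1)) (y (i + 2)) = ∑ a ∈ T.verts, ∑ b ∈ T.verts, c a b * edgeForm (F a)
    (F b) y i := by
  obtain ⟨C, hC⟩ := h.exists_lip
  filter_upwards [h.ae_edge hK i h.ae_smoothAt] with y hy hyD c
  have hI := fun a b => intervalIntegrable_edgeForm (h.continuous a) (hC b) y i
  simp only [edgeForm, ← intervalIntegral.integral_const_mul]
  rw [lineInt, intervalIntegral.integral_congr_ae (g := fun s => ∑ a ∈ T.verts, ∑ b ∈ T.verts,
    c a b * (F a (edgeCurve y i s) * deriv (fun s => F b (edgeCurve y i s)) s))]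
  · rw [intervalIntegral.integral_finsetSum]
    · refine sum_congr rfl fun a _ => ?_
      rw [intervalIntegral.integral_finsetSum]
      simp_all
    · intro a _
      have : (fun s => ∑ b ∈ T.verts, c a b * (F a (edgeCurve y i s) *
          deriv (fun s => F b (edgeCurve y i s)) s)) = ∑ b ∈ T.verts, fun s => c a b *
          (F a (edgeCurve y i s) * deriv (fun s => F b (edgeCurve y i s)) s) := by
        ext s; simp
      rw [this]
      exact IntervalIntegrable.sum _ fun b _ => (hI a b).const_mul _
  · filter_upwards [hy hyD] with s hs hsI
    rw [uIoc_of_le zero_le_one] at hsI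
    have hsm := (hs ⟨hsI.1.le, hsI.2⟩).2
    simp only [form1, mul_sum]
    rw [sum_comm]
    refine sum_congr rfl fun a _ => ?_
    rw [sum_comm]
    refine sum_congr rfl fun b _ => ?_
    rw [(hasDerivAt_comp_edgeCurve y i (hsm b)).deriv, mul_sum, mul_sum]
    refine sum_congr rfl fun k _ => ?_
    rw [edgeCurve]
    ring

lemma map1_eq (hK : K ∈ T.cells) (i : Fin 3) (c : Pt → Pt → ℝ) : T.map1 F l ρ c (K (i + 1))
    (K (i + 2)) = ∫ y in diskProd ρ K, kappaProd l ρ K y * lineInt (T.form1 F c) (y (i + 1))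
    (y (i + 2)) :=
  (average_edge (h.goodDisk K hK) i _).symm

lemma exists_lipschitz_form0 (q : Pt → ℝ) : ∃ C : ℝ≥0, LipschitzWith C (T.form0 F q) := by
  obtain ⟨C, hC⟩ := h.exists_lip
  refine ⟨∑ a ∈ T.verts, ‖q a‖₊ * C, LipschitzWith.of_dist_le_mul fun x y => ?_⟩
  rw [Real.dist_eq, form0, form0, ← sum_sub_distrib]
  push_cast
  rw [sum_mul]
  refine (abs_sum_le_sum_abs _ _).trans (sum_le_sum fun a _ => ?_)
  rw [← mul_sub, abs_mul, mul_assoc]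
  exact mul_le_mul_of_nonneg_left ((hC a).dist_le_mul x y) (abs_nonneg _)

lemma lineInt_diff0 (hK : K ∈ T.cells) (i : Fin 3) (q : Pt → ℝ) : ∀ᵐ y : Tri, y ∈ diskProd ρ K →
    lineInt (T.form1 F (diff0 q)) (y (i + 1)) (y (i + 2)) = T.form0 F q (y (i + 2)) - T.form0 F q
    (y (i + 1)) := by
  obtain ⟨C, hC⟩ := h.exists_lipschitz_form0 q
  filter_upwards [h.ae_edge hK i h.ae_smoothAt] with y hy hyD
  have e := (acOfLip (exists_lipschitz_comp_edgeCurve hC y i) 0 1).integral_deriv_eq_sub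
  simp only [edgeCurve, zero_smul, add_zero, one_smul, add_sub_cancel] at e
  rw [← e, lineInt]
  refine intervalIntegral.integral_congr_ae ?_
  filter_upwards [hy hyD] with s hs hsI
  rw [uIoc_of_le zero_le_one] at hsI
  have hsm := hs ⟨hsI.1.le, hsI.2⟩
  have hd : HasDerivAt (fun s => T.form0 F q (edgeCurve y i s)) (∑ a ∈ T.verts, q a *
      ∑ k, (y (i + 2) - y (i + 1)) k * pd k (F a) (edgeCurve y i s)) s := by
    have := HasDerivAt.fun_sum (u := T.verts) fun a _ =>
      (hasDerivAt_comp_edgeCurve y i (hsm.2 a)).const_mul (q a)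
    exact this
  have hd' := hd.deriv
  simp only [edgeCurve] at hd'
  rw [hd']
  have hf := fun m => hsm.form1_diff0 q m
  simp only [edgeCurve] at hf
  simp only [hf, gradForm0, mul_sum]
  rw [sum_comm]
  exact sum_congr rfl fun a _ => sum_congr rfl fun k _ => by ring

/-- The fundamental theorem of calculus along the displaced edges, averaged. -/
theorem map1_diff0 (hK : K ∈ T.cells) (i : Fin 3) (q : Pt → ℝ) : T.map1 F l ρ (diff0 q) (K (i + 1))
    (K (i + 2)) = diff0 (T.map0 F l ρ q) (K (i + 1)) (K (i + 2)) := by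
  rw [h.map1_eq hK, diff0, map0, map0,
    ← average_vertex (h.goodDisk K hK) (i + 2), ← average_vertex (h.goodDisk K hK) (i + 1)]
  obtain ⟨C, hC⟩ := h.exists_lipschitz_form0 q
  have hI : ∀ j, IntegrableOn (fun y => kappaProd l ρ K y * T.form0 F q (y j))
      (diskProd ρ K) := fun j => by
    have h1 := continuous_kappaProd l ρ K
    have h2 := hC.continuous
    exact (by fun_prop : Continuous fun y => kappaProd l ρ K y * T.form0 F q (y j)).continuousOn
      |>.integrableOn_compact (isCompact_diskProd ρ K)
  rw [← integral_sub (hI _) (hI _)]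
  refine integral_congr_ae ?_
  rw [EventuallyEq, ae_restrict_iff' (isCompact_diskProd ρ K).isClosed.measurableSet]
  filter_upwards [h.lineInt_diff0 hK i q] with y hy hyD
  rw [hy hyD]
  ring

end SmoothedMesh

/-! ### Stokes' theorem for the smoothed forms -/

lemma combo_baryVec_eq_colMap (K y : Tri) (x : Pt) :
    combo (baryVec K x) y = combo (baryVec K 0) y +
      colMap (∑ i, gradBary K i 0 • y i) (∑ i, gradBary K i 1 • y i) x := by
  rw [colMap_apply, combo_apply, combo_apply, smul_sum, smul_sum,
    ← sum_add_distrib, ← sum_add_distrib]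
  refine sum_congr rfl fun i _ => ?_
  rw [baryVec, baryVec, bary_eq_affine K i x, add_smul, add_smul, mul_comm, smul_smul, smul_smul,
    mul_comm (gradBary K i 1), add_assoc]

lemma lipschitz_combo_baryVec (K y : Tri) : ∃ C : ℝ≥0, LipschitzWith C fun x => combo (baryVec K x) y := by
  refine ⟨‖colMap (∑ i, gradBary K i 0 • y i) (∑ i, gradBary K i 1 • y i)‖₊, fun x z => ?_⟩
  simp only [combo_baryVec_eq_colMap K y x, combo_baryVec_eq_colMap K y z, edist_add_left]
  exact ContinuousLinearMap.lipschitz _ x z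

/-- The chain rule for the composition with the map of a triangle onto a perturbed one. -/
lemma pd_comp_combo (K y : Tri) (hG : DifferentiableAt ℝ G (combo (baryVec K x) y)) (m : Fin 2) : pd
    m (fun x => G (combo (baryVec K x) y)) x = ∑ k, jacTilde K y k m * pd k G
    (combo (baryVec K x) y) := by
  have h1 : HasFDerivAt (fun x => combo (baryVec K x) y)
      (colMap (∑ i, gradBary K i 0 • y i) (∑ i, gradBary K i 1 • y i)) x := by
    have : (fun x => combo (baryVec K x) y) = fun x => combo (baryVec K 0) y +
      colMap (∑ i, gradBary K i 0 • y i) (∑ i, gradBary K i 1 • y i) x := by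
      ext1 x; exact combo_baryVec_eq_colMap K y x
    rw [this]
    fun_prop
  have h2 : HasFDerivAt (fun x => G (combo (baryVec K x) y)) _ x := hG.hasFDerivAt.comp x h1
  rw [pd, h2.fderiv, ContinuousLinearMap.comp_apply, fderiv_apply_eq_pd, colMap_apply,
    sum_univ_two]
  fin_cases m <;> simp [jacTilde, sum_univ_three, mul_comm]

lemma integrableOn_wedge {F : Pt → ℝ} (hF : LipschitzWith C F) (hG : LipschitzWith C G) (K : Tri) :
    IntegrableOn (fun x => pd 0 F x * pd 1 G x - pd 1 F x * pd 0 G x) (tri K) := by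
  have hfin : IsFiniteMeasure (volume.restrict (tri K)) :=
    ⟨by rw [Measure.restrict_apply_univ]; exact (isCompact_tri K).measure_lt_top⟩
  refine Integrable.of_bound (C := C * C + C * C)
    (((measurable_pd _ _).mul (measurable_pd _ _)).sub
      ((measurable_pd _ _).mul (measurable_pd _ _))).aestronglyMeasurable
    (.of_forall fun x => ?_)
  have hp := fun i => abs_pd_le_of_lip hF i x
  have hq := fun i => abs_pd_le_of_lip hG i x
  have hC0 := C.2
  rw [norm_eq_abs]
  refine (abs_sub _ _).trans ?_
  rw [abs_mul, abs_mul]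
  have := fun i j => mul_le_mul (hp i) (hq j) (abs_nonneg _) hC0
  exact add_le_add (this _ _) (this _ _)

namespace SmoothedMesh
variable (h : SmoothedMesh Ω ψ T L A ε F ρ)
include h

lemma ae_tri_combo (hK : K ∈ T.cells) (hp : ∀ᵐ z, z ∈ collar ε (closure Ω) → p z) :
    ∀ᵐ y : Tri, y ∈ diskProd ρ K → ∀ᵐ x : Pt, x ∈ tri K → p (combo (baryVec K x) y) :=
  h.ae_ae_combo hK hp volume (isCompact_tri K).isClosed.measurableSet measurable_id
    (fun _ hx => hx)

lemma stokes_perturbed (hK : K ∈ T.cells) (hc : Alternating c) : ∀ᵐ y : Tri, y ∈ diskProd ρ K → ∫ x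
    in tri K, (jacTilde K y).det * T.foldedForm2 F (curlOn c) (combo (baryVec K x) y) =
    SignType.sign (sarea K) * ∑ i : Fin 3, lineInt (T.form1 F c) (y (i + 1)) (y (i + 2)) := by
  have hs := T.sarea_ne hK
  obtain ⟨C, hC⟩ := h.exists_lip
  filter_upwards [h.ae_tri_combo hK h.ae_smoothAt, h.lineInt_eq hK 0, h.lineInt_eq hK 1,
    h.lineInt_eq hK 2] with y hy h0 h1 h2 hyD
  obtain ⟨C', hC'⟩ := lipschitz_combo_baryVec K y
  have hl := fun a => (hC a).comp hC'
  have hst := fun a b => stokes_tri hs (hl a) (hl b)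
  have hI := fun a b => integrableOn_wedge (hl a) (hl b) K
  simp only [Function.comp_def] at hst hI
  have hedge : ∀ a b (i : Fin 3), (∫ s in 0..1,
      F a (combo (baryVec K (edgeCurve K i s)) y) *
        deriv (fun s => F b (combo (baryVec K (edgeCurve K i s)) y)) s) =
      edgeForm (F a) (F b) y i := fun a b i => by
    simp only [combo_edgeCurve hs]; rfl
  simp only [hedge] at hst
  have e : ∫ x in tri K, (jacTilde K y).det * T.foldedForm2 F (curlOn c) (combo (baryVec K x) y) =
      ∫ x in tri K, ∑ a ∈ T.verts, ∑ b ∈ T.verts, c a b *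
        (pd 0 (fun x => F a (combo (baryVec K x) y)) x *
          pd 1 (fun x => F b (combo (baryVec K x) y)) x -
        pd 1 (fun x => F a (combo (baryVec K x) y)) x *
          pd 0 (fun x => F b (combo (baryVec K x) y)) x) := by
    refine integral_congr_ae ?_
    rw [EventuallyEq, ae_restrict_iff' (isCompact_tri K).isClosed.measurableSet]
    filter_upwards [hy hyD] with x hx hxK
    have hsm := hx hxK
    rw [hsm.foldedForm2_curlOn hc, curlForm1, mul_sum]
    refine sum_congr rfl fun a _ => ?_
    rw [mul_sum]
    refine sum_congr rfl fun b _ => ?_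
    rw [pd_comp_combo K y (hsm.2 a), pd_comp_combo K y (hsm.2 a), pd_comp_combo K y (hsm.2 b),
      pd_comp_combo K y (hsm.2 b)]
    simp only [sum_univ_two, Matrix.det_fin_two]
    ring
  rw [e, integral_finsetSum _ fun a _ => integrable_finsetSum _ fun b _ => (hI a b).const_mul _]
  simp only [integral_finsetSum _ fun b _ => (hI _ b).const_mul _, integral_const_mul, hst,
    sum_univ_three]
  have h0' := h0 hyD c
  have h1' := h1 hyD c
  have h2' := h2 hyD c
  rw [h0', h1', h2', ← sum_add_distrib, ← sum_add_distrib, mul_sum]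
  refine sum_congr rfl fun a _ => ?_
  rw [← sum_add_distrib, ← sum_add_distrib, mul_sum]
  grind

/-- Stokes' theorem on the displaced triangles, averaged. The Jacobian of the displacement turns the
integral over the displaced triangle into one over `K`. -/
theorem map2_curlOn (hK : K ∈ T.cells) (hc : Alternating c) :
    T.map2 F l ρ (curlOn c) K = curlOn (T.map1 F l ρ c) K := by
  have hs := T.sarea_ne hK
  obtain ⟨M, hM⟩ := h.exists_foldedForm2_le (curlOn c)
  obtain ⟨M', hM'⟩ := h.exists_form1_le c
  have hfin : IsFiniteMeasure (volume.restrict (tri K)) :=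
    ⟨by rw [Measure.restrict_apply_univ]; exact (isCompact_tri K).measure_lt_top⟩
  have hcont := (continuous_kappaProd l ρ K).mul (continuous_det_jacTilde K)
  have hswap : Integrable (Function.uncurry fun (x : Pt) (y : Tri) =>
      (kappaProd l ρ K y * (jacTilde K y).det) *
        T.foldedForm2 F (curlOn c) (combo (baryVec K x) y))
      ((volume.restrict (tri K)).prod (volume.restrict (diskProd ρ K))) := by
    refine Integrable.mul_bdd ?_ ?_ (.of_forall fun q => hM _)
    · exact Integrable.comp_snd (hcont.continuousOn.integrableOn_compact (isCompact_diskProd ρ K)) _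
    · refine ((h.measurable_foldedForm2 _).comp ?_).aestronglyMeasurable
      simp only [combo_apply, baryVec]
      exact Finset.measurable_sum _ fun i _ => Measurable.smul
        ((continuous_bary i).measurable.comp measurable_fst)
        ((measurable_pi_apply i).comp measurable_snd)
  rw [map2, setAverage_eq, smul_eq_mul, integral_integral_swap hswap,
    volume_real_tri hs, curlOn]
  have hL : ∀ i, IntegrableOn (fun y => kappaProd l ρ K y *
      lineInt (T.form1 F c) (y (i + 1)) (y (i + 2))) (diskProd ρ K) := fun i =>
    integrableOn_lineInt (continuous_kappaProd l ρ K) (h.measurable_form1 c) hM' _ _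
  have e : ∫ y in diskProd ρ K, ∫ x in tri K, (kappaProd l ρ K y * (jacTilde K y).det) *
        T.foldedForm2 F (curlOn c) (combo (baryVec K x) y) =
      ∫ y in diskProd ρ K, SignType.sign (sarea K) * ∑ i : Fin 3, kappaProd l ρ K y *
        lineInt (T.form1 F c) (y (i + 1)) (y (i + 2)) := by
    refine integral_congr_ae ?_
    rw [EventuallyEq, ae_restrict_iff' (isCompact_diskProd ρ K).isClosed.measurableSet]
    filter_upwards [h.stokes_perturbed hK hc] with y hy hyD
    simp only [mul_assoc, integral_const_mul]
    rw [← mul_sum, ← integral_const_mul, hy hyD]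
    ring
  rw [e, integral_const_mul, integral_finsetSum _ fun i _ => hL i]
  simp only [← h.map1_eq hK]
  rw [← mul_assoc]
  congr 1
  rcases lt_or_gt_of_ne hs with h0 | h0
  · rw [abs_of_neg h0, sign_neg h0]
    simp
    field_simp
  · rw [abs_of_pos h0, sign_pos h0]
    simp

end SmoothedMesh

/-! ### Perturbation of the degrees of freedom: vertices and edges -/

/-- The mesh, the folded hat functions and the disks of radius `ρ ≤ δ h`, where `δ` is small and
`M` bounds the `L¹`-norms of the weights. -/
structure SmallDisks (Ω : Set Pt) (ψ : Pt → Pt) (T : Triangulation) (L A ε : ℝ)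
    (F : Pt → Pt → ℝ) (ρ : ℝ) (l : ℕ) (δ M : ℝ) : Prop extends SmoothedMesh Ω ψ T L A ε F ρ where
  radius_le : ρ ≤ δ * T.meshSize
  delta_nonneg : 0 ≤ δ
  delta_le : A * L * δ ≤ 1 / 12
  one_le_bound : 1 ≤ M
  kappa_le : ∀ K ∈ T.cells, ∀ i, ∫ y in disk ρ (K i), |kappa l ρ (K i) y| ≤ M

/-- A bound for a sum with small factors, only finitely many of which, covered by `g`, matter. -/
lemma abs_sum_mul_le {ι τ : Type*} {S : Finset ι} {S' : Finset τ} {f d : ι → ℝ} {B : ℝ}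
    (hB : 0 ≤ B) (hd : ∀ i, |d i| ≤ B) (g : τ → ι)
    (h : ∀ i ∈ S, f i * d i ≠ 0 → ∃ t ∈ S', g t = i) :
    |∑ i ∈ S, f i * d i| ≤ B * ∑ t ∈ S', |f (g t)| := by
  classical
  have h1 : S.filter (fun i => f i * d i ≠ 0) ⊆ S'.image g := fun i hi => by
    grind
  rw [← Finset.sum_filter_ne_zero]
  calc _ ≤ ∑ i ∈ S.filter (fun i => f i * d i ≠ 0), B * |f i| :=
        (abs_sum_le_sum_abs _ _).trans (sum_le_sum fun i _ => by
          rw [abs_mul, mul_comm]; simp_all)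
    _ ≤ B * ∑ t ∈ S', |f (g t)| := by
      rw [← mul_sum]
      exact mul_le_mul_of_nonneg_left ((Finset.sum_le_sum_of_subset_of_nonneg h1 fun i _ _ =>
        abs_nonneg (f i)).trans (Finset.sum_image_le_of_nonneg fun i _ => abs_nonneg (f i))) hB

namespace SmallDisks
variable (h : SmallDisks Ω ψ T L A ε F ρ l δ M)
include h

lemma bounds : L * δ ≤ 1 / 12 ∧ A * δ ≤ 1 / 12 ∧ δ ≤ 1 / 12 ∧ 1 ≤ A * L := by
  have h1 := h.one_le
  have h2 := h.reg.one_le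
  have h3 := h.delta_le
  have h4 := h.delta_nonneg
  have h5 := mul_nonneg (sub_nonneg.2 h1) h4
  have h6 := mul_nonneg (sub_nonneg.2 h2) h4
  have h7 := mul_nonneg (mul_nonneg (sub_nonneg.2 h1) h4) (zero_le_one.trans h2)
  have h8 := mul_nonneg (mul_nonneg (sub_nonneg.2 h2) h4) (zero_le_one.trans h1)
  have h9 := mul_nonneg (sub_nonneg.2 h1) (sub_nonneg.2 h2)
  grind

/-- Only the vertices of the neighbouring triangles are felt near `K`. -/
lemma mem_near_of_ne_zero (hK : K ∈ T.cells) {z : Pt} (hx : x ∈ tri K)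
    (hz : z ∈ closedCollar ε (tri K)) (hd : dist z x ≤ ρ) {b : Pt} (hb : F b z ≠ 0)
    (hK' : K' ∈ T.cells) (hbK : b ∈ range K') : K' ∈ T.near K := by
  obtain ⟨j, rfl⟩ := hbK
  have h1 := h.dist_le_of_ne_zero hK hz hb hx
  have h2 := h.reg.dist_le K' hK' _ (vertex_mem_tri K' 0) _ (vertex_mem_tri K' j)
  have h3 := h.reg.dist_le K hK _ hx _ (vertex_mem_tri K 0)
  have h4 : L * dist z x ≤ T.meshSize := by
    have hp := h.reg.pos
    have := mul_le_mul_of_nonneg_left (hd.trans h.radius_le) (zero_le_one.trans h.one_le)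
    have h5 := mul_le_mul_of_nonneg_right h.bounds.1 hp.le
    linarith
  refine mem_near.2 ⟨hK', ?_⟩
  linarith [dist_triangle4 (K' 0) (K' j) x (K 0)]

lemma abs_F_sub_le (hK : K ∈ T.cells) {z : Pt} (hx : x ∈ closedCollar ε (tri K))
    (hz : z ∈ closedCollar ε (tri K)) (hd : dist z x ≤ ρ) (b : Pt) :
    |F b z - F b x| ≤ A * L * δ := by
  have hp := h.reg.pos
  refine (h.lip_closedCollar hK b hz hx).trans ?_
  have hAL := zero_le_one.trans h.bounds.2.2.2
  calc A * L / T.meshSize * dist z x ≤ A * L / T.meshSize * (δ * T.meshSize) :=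
        mul_le_mul_of_nonneg_left (hd.trans h.radius_le) (by positivity)
    _ = A * L * δ := by field_simp

lemma mem_closedCollar (hK : K ∈ T.cells) (hx : x ∈ tri K) : x ∈ closedCollar ε (tri K) :=
  ⟨self_subset_thickening h.eps_pos _ hx, nonneg_of_mem hK hx⟩

lemma rho_nonneg (hK : K ∈ T.cells) : 0 ≤ ρ :=
  (h.goodDisk K hK 0).pos.le

lemma F_vertex (hK : K ∈ T.cells) (q : Pt → ℝ) (i : Fin 3) : T.form0 F q (K i) = q (K i) := by
  have : ∀ a, F a (K i) = hatOn K a (K i) := fun a => h.eq_hatOn hK a (vertex_mem_tri K i)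
  simp only [form0, this]
  rw [sum_hatOn hK]
  simp [bary_vertex (T.sarea_ne hK)]

lemma integral_abs_kappaProd_le (hK : K ∈ T.cells) :
    ∫ y in diskProd ρ K, |kappaProd l ρ K y| ≤ M ^ 3 := by
  have e : ∀ y, |kappaProd l ρ K y| = ∏ i, |kappa l ρ (K i) (y i)| := fun y => by
    rw [kappaProd_eq_prod, Finset.abs_prod]
  simp only [e]
  rw [← integral_indicator (isCompact_diskProd ρ K).isClosed.measurableSet]
  simp_rw [indicator_diskProd ρ K (fun i x => |kappa l ρ (K i) x|)]
  rw [volume_pi, integral_fintype_prod_eq_prod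
    (fun i => (disk ρ (K i)).indicator (fun x => |kappa l ρ (K i) x|))]
  simp only [integral_indicator (isClosed_disk _ _).measurableSet]
  calc _ ≤ ∏ _i : Fin 3, M := Finset.prod_le_prod
        (fun i _ => integral_nonneg fun _ => abs_nonneg _) (fun i _ => h.kappa_le K hK i)
    _ = M ^ 3 := by simp

lemma integral_kappaProd (hK : K ∈ T.cells) : ∫ y in diskProd ρ K, kappaProd l ρ K y = 1 := by
  have := average_vertex (l := l) (h.goodDisk K hK) 0 (fun _ => 1)
  simp only [mul_one, dofVertex] at this
  rw [this, (h.goodDisk K hK 0).integral_kappa]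

/-- An average is as close to a constant as the averaged function. -/
lemma abs_average_sub_le (hK : K ∈ T.cells) {G : Tri → ℝ}
    (hG : IntegrableOn (fun y => kappaProd l ρ K y * G y) (diskProd ρ K)) {c B : ℝ} (hB : 0 ≤ B)
    (hGB : ∀ᵐ y, y ∈ diskProd ρ K → |G y - c| ≤ B) :
    |(∫ y in diskProd ρ K, kappaProd l ρ K y * G y) - c| ≤ M ^ 3 * B := by
  have hk : IntegrableOn (kappaProd l ρ K) (diskProd ρ K) :=
    (continuous_kappaProd l ρ K).continuousOn.integrableOn_compact (isCompact_diskProd ρ K)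
  have e : (∫ y in diskProd ρ K, kappaProd l ρ K y * G y) - c =
      ∫ y in diskProd ρ K, kappaProd l ρ K y * (G y - c) := by
    simp only [mul_sub]
    rw [integral_sub hG (hk.mul_const c), integral_mul_const, h.integral_kappaProd hK, one_mul]
  rw [e]
  have hkB := hk.abs.mul_const B
  have h1 := norm_integral_le_of_norm_le (μ := volume.restrict (diskProd ρ K)) hkB
    (f := fun y => kappaProd l ρ K y * (G y - c)) ?_
  · rw [integral_mul_const] at h1
    exact h1.trans (mul_le_mul_of_nonneg_right (h.integral_abs_kappaProd_le hK) hB)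
  · rw [ae_restrict_iff' (isCompact_diskProd ρ K).isClosed.measurableSet]
    filter_upwards [hGB] with y hy hyD
    rw [norm_mul]
    exact mul_le_mul_of_nonneg_left (hy hyD) (abs_nonneg _)

/-- Only hat functions of nearby vertices contribute, and each varies by at most `A * L * δ` on a
smoothing disk. -/
theorem abs_map0_sub_le (hK : K ∈ T.cells) (q : Pt → ℝ) (i : Fin 3) :
    |T.map0 F l ρ q (K i) - q (K i)| ≤ M ^ 3 * (A * L * δ) * ∑ K' ∈ T.near K, ∑ j, |q (K' j)| := by
  have hAL := mul_nonneg (zero_le_one.trans h.bounds.2.2.2) h.delta_nonneg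
  obtain ⟨C, hC⟩ := h.exists_lipschitz_form0 q
  rw [map0, ← average_vertex (h.goodDisk K hK), mul_assoc]
  refine h.abs_average_sub_le hK (G := fun y => T.form0 F q (y i)) ?_ (mul_nonneg hAL
    (sum_nonneg fun _ _ => sum_nonneg fun _ _ => abs_nonneg _))
    (.of_forall fun y hy => ?_)
  · have h1 := continuous_kappaProd l ρ K
    have h2 := hC.continuous
    exact (by fun_prop : Continuous fun y => kappaProd l ρ K y * T.form0 F q (y i)).continuousOn
      |>.integrableOn_compact (isCompact_diskProd ρ K)
  · have hz := h.combo_mem_closedCollar hK (vertex_mem_tri K i) hy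
    rw [combo_baryVec_vertex (T.sarea_ne hK)] at hz
    have hd := dist_of_mem_diskProd hy i
    have hx := h.mem_closedCollar hK (vertex_mem_tri K i)
    rw [← h.F_vertex hK q i, form0, form0, ← sum_sub_distrib, ← Finset.sum_product' (T.near K)]
    simp only [← mul_sub]
    refine abs_sum_mul_le hAL (h.abs_F_sub_le hK hx hz hd) (fun t : Tri × Fin 3 => t.1 t.2)
      fun b hb hne => ?_
    obtain ⟨K', hK', j, rfl⟩ := T.mem_verts.1 hb
    refine ⟨(K', j), Finset.mem_product.2 ⟨?_, Finset.mem_univ _⟩, rfl⟩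
    by_cases hb : F (K' j) (y i) = 0
    · exact h.mem_near_of_ne_zero hK (vertex_mem_tri K i) hx
        (by rw [dist_self]; exact h.rho_nonneg hK) (fun h0 => hne (by simp [hb, h0])) hK' ⟨j, rfl⟩
    · exact h.mem_near_of_ne_zero hK (vertex_mem_tri K i) hz hd hb hK' ⟨j, rfl⟩

end SmallDisks

namespace SmallDisks

lemma edgeCurve_mem_tri (i : Fin 3) {s : ℝ} (h : s ∈ Icc (0 : ℝ) 1) :
    edgeCurve K i s ∈ tri K := SmoothedMesh.segment_mem_tri (i + 1) (i + 2) h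

/-- The edge values of a discrete `1`-form are its integrals along the edges. -/
lemma sum_edgeForm_self (h : SmallDisks Ω ψ T L A ε F ρ l δ M) (hK : K ∈ T.cells) (i : Fin 3)
    (hc : Alternating c) :
    ∑ a ∈ T.verts, ∑ b ∈ T.verts, c a b * edgeForm (F a) (F b) K i = c (K (i + 1)) (K (i + 2)) := by
  have hs := T.sarea_ne hK
  set p := K (i + 1) with hp
  set p' := K (i + 2) with hp'
  set e : Pt → Pt → ℝ := fun p a => if p = a then 1 else 0 with he
  have hF : ∀ a, ∀ s ∈ Icc 0 1, F a (edgeCurve K i s) = e p a + s * (e p' a - e p a) := by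
    intro a s hsI
    rw [h.eq_hatOn hK a (edgeCurve_mem_tri i hsI), hatOn, edgeCurve]
    simp only [bary_segment hs, he, hp, hp']
    clear_value p p'
    fin_cases i <;> simp [sum_univ_three] <;> split_ifs <;> ring
  have hE : ∀ a b, edgeForm (F a) (F b) K i = (e p a + e p' a) / 2 * (e p' b - e p b) := by
    intro a b
    rw [edgeForm, intervalIntegral.integral_congr_Ioo_of_le
      (g := fun s => (e p a + s * (e p' a - e p a)) * (e p' b - e p b)) zero_le_one fun s hsI => ?_]
    · rw [intervalIntegral.integral_mul_const, intervalIntegral.integral_add (by simp) (by simp)]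
      congr 1
      simp
      ring
    · have h1 := ((hasDerivAt_id s).mul_const (e p' b - e p b)).const_add (e p b)
      have h2 := (h1.congr_of_eventuallyEq (by
          filter_upwards [Icc_mem_nhds hsI.1 hsI.2] with t ht using hF b t ht)).deriv
      grind
  have h1 : p ∈ T.verts := T.vertex_mem_verts hK _
  have h2 : p' ∈ T.verts := T.vertex_mem_verts hK _
  have h3 : c p' p = -c p p' := hc _ _
  simp only [hE, he, mul_sub, mul_ite, mul_one, mul_zero, sum_sub_distrib, Finset.sum_ite_eq, h1,
    h2, if_true, add_div, mul_add, sum_add_distrib, ite_div, zero_div]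
  rw [hc.self, hc.self, h3]
  ring

/-- The integral of `F_a dF_b` along an edge is stable under uniformly small perturbations of the
Lipschitz functions `F_a`, `F_b`, by partial integration. -/
theorem abs_map1_sub_le (h : SmallDisks Ω ψ T L A ε F ρ l δ M) (hK : K ∈ T.cells)
    (hc : Alternating c) (hcs : T.EdgeSupported c) (i : Fin 3) :
    |T.map1 F l ρ c (K (i + 1)) (K (i + 2)) - c (K (i + 1)) (K (i + 2))| ≤
      M ^ 3 * (6 * (A * L) ^ 2 * δ) * ∑ K' ∈ T.near K, ∑ j, ∑ k, |c (K' j) (K' k)| := by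
  have hAL := h.bounds.2.2.2
  have hAL0 := zero_le_one.trans hAL
  have hδ0 := h.delta_nonneg
  have hs := T.sarea_ne hK
  have hp := h.reg.pos
  obtain ⟨C, hC⟩ := h.exists_lip
  obtain ⟨M', hM'⟩ := h.exists_form1_le c
  rw [h.map1_eq hK, mul_assoc]
  refine h.abs_average_sub_le hK (G := fun y => lineInt (T.form1 F c) (y (i + 1)) (y (i + 2)))
    (integrableOn_lineInt (continuous_kappaProd l ρ K) (h.measurable_form1 c) hM' _ _)
    (mul_nonneg (by positivity) (sum_nonneg fun _ _ => sum_nonneg fun _ _ =>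
      sum_nonneg fun _ _ => abs_nonneg _)) ?_
  filter_upwards [h.lineInt_eq hK i] with y hy hyD
  rw [hy hyD, ← h.sum_edgeForm_self hK i hc]
  simp only [← sum_sub_distrib, ← mul_sub]
  -- the perturbed edge stays close to the edge
  have hz : ∀ s ∈ Icc 0 1, edgeCurve y i s ∈ closedCollar ε (tri K) := fun s hsI =>
    h.edgeCurve_mem hK i hyD hsI
  have hx : ∀ s ∈ Icc 0 1, edgeCurve K i s ∈ tri K := fun s hsI => edgeCurve_mem_tri i hsI
  have hd : ∀ s ∈ Icc 0 1, dist (edgeCurve y i s) (edgeCurve K i s) ≤ ρ := fun s hsI => by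
    rw [← SmoothedMesh.combo_edgeCurve hs]
    exact dist_combo_baryVec hs (hx s hsI) hyD
  have hFd : ∀ a, ∀ s ∈ Icc 0 1,
      |F a (edgeCurve y i s) - F a (edgeCurve K i s)| ≤ A * L * δ := fun a s hsI =>
    h.abs_F_sub_le hK (h.mem_closedCollar hK (hx s hsI)) (hz s hsI) (hd s hsI) a
  have hlen : ∀ z, dist (z (i + 1)) (z (i + 2)) ≤ 2 * T.meshSize →
      (∀ s ∈ Icc 0 1, edgeCurve z i s ∈ closedCollar ε (tri K)) → ∀ a,
      ∀ s ∈ Icc 0 1, ∀ t ∈ Icc 0 1,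
      |F a (edgeCurve z i s) - F a (edgeCurve z i t)| ≤ 2 * (A * L) * |s - t| := by
    intro z hzl hzc a s hsI t ht
    refine (h.lip_closedCollar hK a (hzc s hsI) (hzc t ht)).trans ?_
    have h1 := (lipschitz_edgeCurve z i).dist_le_mul s t
    rw [coe_nndist, Real.dist_eq] at h1
    have h2 := h1.trans (mul_le_mul_of_nonneg_right hzl (abs_nonneg _))
    calc A * L / T.meshSize * dist (edgeCurve z i s) (edgeCurve z i t)
        ≤ A * L / T.meshSize * (2 * T.meshSize * |s - t|) :=
          mul_le_mul_of_nonneg_left h2 (by positivity)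
      _ = _ := by field_simp
  have hlK : dist (K (i + 1)) (K (i + 2)) ≤ T.meshSize :=
    h.reg.dist_le K hK _ (vertex_mem_tri K _) _ (vertex_mem_tri K _)
  have hly : dist (y (i + 1)) (y (i + 2)) ≤ 2 * T.meshSize := by
    have h1 := dist_of_mem_diskProd hyD (i + 1)
    have h2 := dist_of_mem_diskProd hyD (i + 2)
    have h3 := dist_triangle4_right (y (i + 1)) (y (i + 2)) (K (i + 1)) (K (i + 2))
    have h4 := h.radius_le
    have h5 := mul_le_mul_of_nonneg_right h.bounds.2.2.1 hp.le
    linarith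
  have hterm : ∀ a b, |edgeForm (F a) (F b) y i - edgeForm (F a) (F b) K i| ≤
      6 * (A * L) ^ 2 * δ := fun a b => by
    have hl : ∀ b, LipschitzWith (C * (nndist (y (i + 1)) (y (i + 2)) +
        nndist (K (i + 1)) (K (i + 2)))) (fun s => F b (edgeCurve y i s)) ∧
        LipschitzWith (C * (nndist (y (i + 1)) (y (i + 2)) +
        nndist (K (i + 1)) (K (i + 2)))) (fun s => F b (edgeCurve K i s)) := fun b =>
      ⟨(exists_lipschitz_comp_edgeCurve (hC b) y i).weaken (by gcongr; exact le_self_add),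
        (exists_lipschitz_comp_edgeCurve (hC b) K i).weaken (by gcongr; exact le_add_self)⟩
    refine (abs_integral_mul_deriv_sub_le (hl a).1 (hl b).1 (hl a).2 (hl b).2
      (η := A * L * δ) (B := 2 * (A * L)) (by positivity) (by positivity) (hFd a) (hFd b)
      (fun s _ => h.abs_le_one a _) (hlen y hly hz b)
      (hlen K (by linarith) (fun s hsI => h.mem_closedCollar hK (hx s hsI)) a)).trans ?_
    nlinarith [mul_nonneg (mul_nonneg hAL0 hδ0) (sub_nonneg.2 hAL)]
  have h0 : ∀ (z : Tri) a b, (∀ s ∈ Icc 0 1, F a (edgeCurve z i s) = 0) →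
      edgeForm (F a) (F b) z i = 0 := fun z a b hz0 => by
    rw [edgeForm, intervalIntegral.integral_congr (g := fun _ => 0)]
    · simp
    · intro s hsI
      rw [uIcc_of_le zero_le_one] at hsI
      grind
  simp only [← Finset.sum_product']
  refine abs_sum_mul_le (f := fun t : Pt × Pt => c t.1 t.2) (by positivity)
    (fun t => hterm t.1 t.2) (fun t : Tri × Fin 3 × Fin 3 => (t.1 t.2.1, t.1 t.2.2))
    fun ⟨a, b⟩ _ hne => ?_
  obtain ⟨K', hK', ⟨j, rfl⟩, k, rfl⟩ := hcs a b (left_ne_zero_of_mul hne)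
  refine ⟨(K', j, k), Finset.mem_product.2 ⟨?_, Finset.mem_univ _⟩, rfl⟩
  by_contra hn
  refine hne ?_
  simp only
  rw [h0 y, h0 K, sub_zero, mul_zero] <;> intro s hsI <;> by_contra hFs <;> refine hn ?_
  · exact h.mem_near_of_ne_zero hK (hx s hsI) (h.mem_closedCollar hK (hx s hsI))
      (by rw [dist_self]; exact h.rho_nonneg hK) hFs hK' ⟨j, rfl⟩
  · exact h.mem_near_of_ne_zero hK (hx s hsI) (hz s hsI) (hd s hsI) hFs hK' ⟨j, rfl⟩

end SmallDisks

/-! ### Perturbation of the degrees of freedom: densities -/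

/-- The points of `K` with a small barycentric coordinate form a small part of `K`, since `K`
contains a homothetic copy of itself outside of them. -/
lemma volume_boundary_layer_le (hs : sarea K ≠ 0) {η : ℝ} (hη : 0 ≤ η) (hη' : η ≤ 1 / 3) :
    volume.real {x ∈ tri K | ∃ i, bary K i x < η} ≤ 6 * η * volume.real (tri K) := by
  set r : ℝ := 1 - 3 * η with hr
  have hr0 : 0 ≤ r := by linarith
  set c : Pt := ∑ j, (fun _ => (1 / 3 : ℝ)) j • K j with hc
  have hbc : ∀ i, bary K i c = 1 / 3 := fun i =>
    bary_of_combo hs (by simp) i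
  set H := AffineMap.homothety c r '' tri K with hH
  have hbH : ∀ x ∈ H, ∀ i, η ≤ bary K i x := by
    rintro _ ⟨z, hz, rfl⟩ i
    have h1 := bary_sub K i (AffineMap.homothety c r z) c
    have h2 := bary_sub K i z c
    have h3 : ∀ m, (AffineMap.homothety c r z) m - c m = r * (z m - c m) := fun m => by
      simp [AffineMap.homothety_apply]
    rw [h3, h3] at h1
    have h4 := mul_nonneg hr0 ((mem_tri_iff hs z).1 hz i)
    rw [hbc] at h1 h2
    nlinarith
  have hHK : H ⊆ tri K := fun x hx =>
    (mem_tri_iff hs x).2 fun i => hη.trans (hbH x hx i)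
  have hvol : volume.real H = r ^ 2 * volume.real (tri K) := by
    rw [measureReal_def, hH, Measure.addHaar_image_homothety, ENNReal.toReal_mul,
      ENNReal.toReal_ofReal (abs_nonneg _), ← measureReal_def]
    simp
  have hfin : volume (tri K) ≠ ⊤ := (isCompact_tri K).measure_lt_top.ne
  have hmH : MeasurableSet H := by
    refine IsClosed.measurableSet (IsCompact.isClosed ((isCompact_tri K).image ?_))
    fun_prop
  have hsub : {x ∈ tri K | ∃ i, bary K i x < η} ⊆ tri K \ H := by
    rintro x ⟨hx, i, hi⟩
    exact ⟨hx, fun hxH => (hbH x hxH i).not_gt hi⟩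
  have hfin' : volume (tri K \ H) ≠ ⊤ := measure_ne_top_of_subset Set.sdiff_subset hfin
  have h1 := measureReal_mono hsub hfin'
  rw [measureReal_sdiff hHK hmH hfin, hvol] at h1
  have hv : 0 ≤ volume.real (tri K) := measureReal_nonneg
  nlinarith [mul_nonneg (sq_nonneg η) hv]

lemma sum_vertex_gradBary (hs : sarea K ≠ 0) (k m : Fin 2) :
    ∑ j, K j k * gradBary K j m = if k = m then 1 else 0 := by
  have key : ∀ y : Pt, ∀ p, ∑ j, K j p * (gradBary K j 0 * (y 0) + gradBary K j 1 * (y 1)) =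
      y p := fun y p => by
    have e1 := bary_combo_apply hs y p
    have e2 := bary_combo_apply hs 0 p
    have e3 : ∀ j, gradBary K j 0 * (y 0) + gradBary K j 1 * (y 1) =
        bary K j y - bary K j 0 := fun j => by rw [bary_sub]; simp
    simp only [e3, mul_sub, sum_sub_distrib]
    simp only [mul_comm (K _ p), e1, e2]
    simp
  have := key (single m 1) k
  fin_cases m <;> fin_cases k <;> simpa using this

namespace SmallDisks
variable (h : SmallDisks Ω ψ T L A ε F ρ l δ M)
include h

lemma abs_jacTilde_sub_le (hK : K ∈ T.cells) {y : Tri} (hy : y ∈ diskProd ρ K) (k m : Fin 2) :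
    |jacTilde K y k m - if k = m then 1 else 0| ≤ 3 * (A * δ) := by
  have hp := h.reg.pos
  rw [← sum_vertex_gradBary (T.sarea_ne hK)]
  simp only [jacTilde, Matrix.of_apply, ← sum_sub_distrib, ← sub_mul]
  calc _ ≤ ∑ i : Fin 3, δ * T.meshSize * (A / T.meshSize) := by
        refine (abs_sum_le_sum_abs _ _).trans (sum_le_sum fun i _ => ?_)
        rw [abs_mul]
        exact mul_le_mul (((abs_coord_sub_le_dist _ _ _).trans (dist_of_mem_diskProd hy i)).trans
          h.radius_le) (h.reg.grad_le hK i m) (abs_nonneg _) (mul_nonneg h.delta_nonneg hp.le)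
    _ = _ := by
        simp only [sum_const, card_univ, Fintype.card_fin, nsmul_eq_mul]
        grind

lemma abs_det_jacTilde_sub_le (hK : K ∈ T.cells) {y : Tri} (hy : y ∈ diskProd ρ K) :
    |(jacTilde K y).det - 1| ≤ 9 * (A * δ) ∧ |(jacTilde K y).det| ≤ 2 := by
  have ht := h.bounds.2.1
  have e00 := h.abs_jacTilde_sub_le hK hy 0 0
  have e01 := h.abs_jacTilde_sub_le hK hy 0 1
  have e10 := h.abs_jacTilde_sub_le hK hy 1 0
  have e11 := h.abs_jacTilde_sub_le hK hy 1 1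
  simp only [if_true, zero_ne_one, one_ne_zero, if_false, sub_zero] at e00 e01 e10 e11
  have p1 := mul_le_mul e00 e11 (abs_nonneg _) ((abs_nonneg _).trans e00)
  have p2 := mul_le_mul e01 e10 (abs_nonneg _) ((abs_nonneg _).trans e01)
  rw [← abs_mul] at p1 p2
  have h0 : 0 ≤ A * δ := by grind
  have key : |(jacTilde K y).det - 1| ≤ 9 * (A * δ) := by
    rw [Matrix.det_fin_two]
    rw [abs_le] at *
    constructor <;> nlinarith
  grind

lemma self_mem_near (hK : K ∈ T.cells) : K ∈ T.near K :=
  mem_near.2 ⟨hK, by have := h.reg.pos; rw [dist_self]; positivity⟩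

/-- At points of `K` away from the boundary the average is the value on `K` up to the factor
`det M = 1 + O(δ)`. The boundary layer has relative area `O(δ)`, and there the average is bounded. -/
theorem abs_map2_sub_le (hK : K ∈ T.cells) (s : Tri → ℝ) :
    |T.map2 F l ρ s K - s K| ≤ M ^ 3 * (69 * A * L ^ 2 * δ) * ∑ K' ∈ T.near K, |s K'| := by
  have hs := T.sarea_ne hK
  have hp := h.reg.pos
  have hδ0 := h.delta_nonneg
  have hA := h.reg.one_le
  have hL := h.one_le
  have hM := h.one_le_bound
  obtain ⟨C, hC⟩ := h.exists_foldedForm2_le s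
  have hδ : 0 < δ := by
    have h1 := (h.goodDisk K hK 0).pos.trans_le h.radius_le
    simp_all
  set N := ∑ K' ∈ T.near K, |s K'| with hN
  have hsN : ∀ K' ∈ T.near K, |s K'| ≤ N := fun K' hK' =>
    Finset.single_le_sum (f := fun K' => |s K'|) (fun _ _ => abs_nonneg _) hK'
  have hN0 := (abs_nonneg _).trans (hsN K (h.self_mem_near hK))
  set S : Pt → ℝ := fun x => ∫ y in diskProd ρ K, (kappaProd l ρ K y * (jacTilde K y).det) *
    T.foldedForm2 F s (combo (baryVec K x) y) with hS
  have hcont : Continuous fun y => kappaProd l ρ K y * (jacTilde K y).det :=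
    (continuous_kappaProd l ρ K).mul (continuous_det_jacTilde K)
  have hSc := continuous_average hs ρ hcont (h.measurable_foldedForm2 s) hC
  have hSe : ∀ x, S x = ∫ y in diskProd ρ K, kappaProd l ρ K y * ((jacTilde K y).det *
      T.foldedForm2 F s (combo (baryVec K x) y)) := fun x => by simp only [hS, mul_assoc]
  have hSi : ∀ x, IntegrableOn (fun y => kappaProd l ρ K y * ((jacTilde K y).det *
      T.foldedForm2 F s (combo (baryVec K x) y))) (diskProd ρ K) := fun x => by
    have := integrableOn_average (ρ := ρ) (K := K) hcont (h.measurable_foldedForm2 s) hC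
      (baryVec K x)
    simpa only [mul_assoc] using this
  -- away from the boundary of `K`, only the value on `K` is averaged
  have hgood : ∀ x ∈ tri K, (∀ i, 2 * (A * δ) ≤ bary K i x) → |S x - s K| ≤ M ^ 3 * (9 * (A * δ) * N) := by
    intro x hx hbx
    rw [hSe]
    refine h.abs_average_sub_le hK (hSi x) (by positivity) (.of_forall fun y hy => ?_)
    have hX : combo (baryVec K x) y ∈ interior (tri K) := by
      rw [interior_tri hs]
      intro i
      have h1 := h.reg.bary_lip K hK i (combo (baryVec K x) y) x
      have h2 := (dist_combo_baryVec hs hx hy).trans h.radius_le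
      have h3 : A / T.meshSize * dist (combo (baryVec K x) y) x ≤ A * δ :=
        (mul_le_mul_of_nonneg_left h2 (by positivity)).trans (by field_simp; exact le_refl _)
      have h4 := (abs_le.1 (h1.trans h3)).1
      have h5 : 0 < A * δ := by positivity
      linarith [hbx i]
    have e : T.foldedForm2 F s (combo (baryVec K x) y) = s K := by
      have := FoldedMesh.foldedForm2_eq hK hX (h.chainAt_of_mem_interior hK hX) s
      simpa using this
    rw [e, ← sub_one_mul, abs_mul]
    exact mul_le_mul (h.abs_det_jacTilde_sub_le hK hy).1 (hsN K (h.self_mem_near hK))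
      (abs_nonneg _) (by positivity)
  have hbad : ∀ x ∈ tri K, |S x - s K| ≤ M ^ 3 * (5 * L ^ 2 * N) := by
    intro x hx
    rw [hSe]
    refine h.abs_average_sub_le hK (hSi x) (by positivity) ?_
    filter_upwards [h.ae_combo_mem_collar hK hx h.ae_chain] with y hy hyD
    obtain ⟨hJ, K', hK', hf, hc⟩ := hy hyD
    set z := combo (baryVec K x) y with hz
    have hnear : K' ∈ T.near K := by
      refine h.mem_near_of_ne_zero hK hx (h.combo_mem_closedCollar hK hx hyD)
        (dist_combo_baryVec hs hx hyD) ?_ hK' ⟨0, rfl⟩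
      rw [(hc _).1, hatOn_self (T.inj hK')]
      rw [interior_tri (T.sarea_ne hK')] at hf
      exact (hf 0).ne'
    rw [FoldedMesh.foldedForm2_eq hK' hf (fun a => ⟨(hc a).1, (hc a).2.2⟩) s]
    have hdet : |(foldJac Ω ψ z).det| ≤ 2 * L ^ 2 := by
      rw [Matrix.det_fin_two]
      refine (abs_sub _ _).trans ?_
      rw [abs_mul, abs_mul]
      have := fun a b c d => mul_le_mul (hJ a b) (hJ c d) (abs_nonneg _) (zero_le_one.trans hL)
      linarith [this 0 0 1 1, this 0 1 1 0, sq L]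
    have h1 : |(jacTilde K y).det * ((foldJac Ω ψ z).det * s K')| ≤ 2 * (2 * L ^ 2 * N) := by
      rw [abs_mul, abs_mul]
      exact mul_le_mul (h.abs_det_jacTilde_sub_le hK hyD).2
        (mul_le_mul hdet (hsN K' hnear) (abs_nonneg _) (by positivity)) (by positivity)
        (by positivity)
    refine (abs_sub _ _).trans ?_
    have h2 := hsN K (h.self_mem_near hK)
    nlinarith [mul_nonneg hN0 (by nlinarith : 0 ≤ L ^ 2 - 1)]
  set Bd := {x ∈ tri K | ∃ i, bary K i x < 2 * (A * δ)} with hBd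
  have hBdm : MeasurableSet Bd := by
    have : Bd = tri K ∩ ⋃ i, {x | bary K i x < 2 * (A * δ)} := by ext x; simp [hBd]
    rw [this]
    exact (isCompact_tri K).isClosed.measurableSet.inter (MeasurableSet.iUnion fun i =>
      measurableSet_lt (continuous_bary i).measurable measurable_const)
  have hvol := volume_boundary_layer_le hs (η := 2 * (A * δ)) (by positivity)
    (by linarith [h.bounds.2.1])
  rw [← hBd] at hvol
  have hfin : IsFiniteMeasure (volume.restrict (tri K)) :=
    ⟨by rw [Measure.restrict_apply_univ]; exact (isCompact_tri K).measure_lt_top⟩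
  have hV : 0 < volume.real (tri K) := by
    rw [volume_real_tri hs]; positivity
  have hSint : IntegrableOn S (tri K) := hSc.continuousOn.integrableOn_compact (isCompact_tri K)
  have e : T.map2 F l ρ s K - s K = (volume.real (tri K))⁻¹ * ∫ x in tri K, (S x - s K) := by
    rw [map2, setAverage_eq, smul_eq_mul, integral_sub hSint (integrable_const _)]
    simp only [integral_const, smul_eq_mul, measureReal_restrict_apply_univ]
    field_simp
    ring
  have hb : |∫ x in tri K, (S x - s K)| ≤
      ∫ x in tri K, (M ^ 3 * (9 * (A * δ) * N) + Bd.indicator (fun _ => M ^ 3 * (5 * L ^ 2 * N)) x) := by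
    refine norm_integral_le_of_norm_le (μ := volume.restrict (tri K)) (f := fun x => S x - s K)
      ((integrable_const _).add ((integrable_const _).indicator hBdm)) ?_
    rw [ae_restrict_iff' (isCompact_tri K).isClosed.measurableSet]
    refine .of_forall fun x hx => ?_
    by_cases hxB : x ∈ Bd
    · rw [indicator_of_mem hxB]
      refine (hbad x hx).trans (le_add_of_nonneg_left (by positivity))
    · simp_all
  rw [integral_add (integrable_const _) ((integrable_const _).indicator hBdm),
    integral_indicator hBdm, Measure.restrict_restrict hBdm,
    inter_eq_left.2 (fun x hx => hx.1 : Bd ⊆ tri K)] at hb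
  simp only [integral_const, smul_eq_mul, measureReal_restrict_apply_univ] at hb
  rw [e, abs_mul, abs_of_pos (inv_pos.2 hV)]
  have h3 : |∫ x in tri K, (S x - s K)| ≤
      (M ^ 3 * (69 * A * L ^ 2 * δ) * N) * volume.real (tri K) := by
    refine hb.trans ?_
    have h4 := mul_le_mul_of_nonneg_right hvol (by positivity : 0 ≤ M ^ 3 * (5 * L ^ 2 * N))
    have h5 : 0 ≤ M ^ 3 * (9 * (A * δ) * N) * volume.real (tri K) * (L ^ 2 - 1) :=
      mul_nonneg (by positivity) (by nlinarith)
    nlinarith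
  calc _ ≤ (volume.real (tri K))⁻¹ *
        ((M ^ 3 * (69 * A * L ^ 2 * δ) * N) * volume.real (tri K)) :=
        mul_le_mul_of_nonneg_left h3 (inv_pos.2 hV).le
    _ = _ := by field_simp

end SmallDisks

/-! ### Weighted mass bounds on a triangle -/

lemma integrableOn_tri (hg : Continuous g) (K : Tri) : IntegrableOn g (tri K) :=
  hg.continuousOn.integrableOn_compact (isCompact_tri K)

/-- An affine function is an average of its values at the vertices. -/
lemma affine_eq_sum_bary (hs : sarea K ≠ 0) {p : Pt → ℝ} {t₀ t₁ t₂ : ℝ}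
    (hp : ∀ x, p x = t₀ + t₁ * x 0 + t₂ * x 1) (x : Pt) : p x = ∑ i, bary K i x * p (K i) := by
  have e0 := bary_combo_apply hs x 0
  have e1 := bary_combo_apply hs x 1
  have e2 := bary_sum hs x
  simp only [sum_univ_three, hp] at e0 e1 e2 ⊢
  grind

lemma le_of_forall_vertex_le (hs : sarea K ≠ 0) {p : Pt → ℝ} {t₀ t₁ t₂ b : ℝ}
    (hp : ∀ x, p x = t₀ + t₁ * x 0 + t₂ * x 1) (hb : ∀ i, b ≤ p (K i)) (hx : x ∈ tri K) :
    b ≤ p x := by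
  rw [affine_eq_sum_bary hs hp x, ← one_mul b, ← bary_sum hs x, sum_mul]
  exact sum_le_sum fun i _ => mul_le_mul_of_nonneg_left (hb i) ((mem_tri_iff hs x).1 hx i)

/-- The image of a triangle under the homothety of ratio `t` about its vertex `j`. -/
def shrink (t : ℝ) (j : Fin 3) (K : Tri) : Tri := fun i => (1 - t) • K j + t • K i

lemma shrink_apply (t : ℝ) (j i : Fin 3) (K : Tri) (k : Fin 2) :
    shrink t j K i k = (1 - t) * K j k + t * K i k := by simp [shrink]

lemma sarea_shrink (t : ℝ) (j : Fin 3) (K : Tri) : sarea (shrink t j K) = t ^ 2 * sarea K := by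
  simp only [sarea, cross, sub_apply, shrink_apply]; ring

lemma tri_shrink_subset {t : ℝ} (h0 : 0 ≤ t) (h1 : t ≤ 1) (j : Fin 3) (K : Tri) :
    tri (shrink t j K) ⊆ tri K := by
  refine convexHull_min ?_ (convex_tri K)
  rintro _ ⟨i, rfl⟩
  exact convex_tri K (vertex_mem_tri K j) (vertex_mem_tri K i) (by linarith) h0 (by ring)

/-- Near the vertex at which an affine function is largest, it is at least half as large. -/
lemma sum_sq_le_integral (hs : sarea K ≠ 0) {p : Pt → ℝ} {t₀ t₁ t₂ : ℝ}
    (hp : ∀ x, p x = t₀ + t₁ * x 0 + t₂ * x 1) :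
    |sarea K| * ∑ i, p (K i) ^ 2 ≤ 384 * ∫ x in tri K, p x ^ 2 := by
  obtain ⟨j, hj⟩ := Finite.exists_max fun i => p (K i) ^ 2
  have hs' : sarea (shrink (1 / 4) j K) ≠ 0 := by simpa [sarea_shrink] using hs
  have hcont : Continuous p := by rw [funext hp]; fun_prop
  have hlow : ∀ x ∈ tri (shrink (1 / 4) j K), p (K j) ^ 2 / 4 ≤ p x ^ 2 := fun x hx => by
    have := le_of_forall_vertex_le hs' (p := fun x => p (K j) * p x) (b := p (K j) ^ 2 / 2)
      (t₀ := p (K j) * t₀) (t₁ := p (K j) * t₁) (t₂ := p (K j) * t₂)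
      (fun x => by rw [hp x]; ring) (fun i => by
        have e : p (shrink (1 / 4) j K i) = 3 / 4 * p (K j) + 1 / 4 * p (K i) := by
          simp only [hp, shrink_apply]; ring
        rw [e]
        nlinarith [hj i, sq_nonneg (p (K j) + p (K i))]) hx
    nlinarith
  have h := (setIntegral_mono_on (integrableOn_const (isCompact_tri _).measure_lt_top.ne)
    (integrableOn_tri (by fun_prop) _) (isCompact_tri _).measurableSet hlow).trans
    (setIntegral_mono_set (integrableOn_tri (hcont.pow 2) K)
      (.of_forall fun x => sq_nonneg _) (tri_shrink_subset (by norm_num) (by norm_num) j K).eventuallyLE)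
  rw [setIntegral_const, volume_real_tri hs', sarea_shrink, abs_mul, smul_eq_mul] at h
  norm_num at h
  have := mul_le_mul_of_nonneg_left (sum_le_sum fun i (_ : i ∈ Finset.univ) => hj i) (abs_nonneg (sarea K))
  simp only [sum_const, card_univ, Fintype.card_fin, nsmul_eq_mul, Nat.cast_ofNat] at this
  linarith

/-- The weight of the triangle `K` in `∫ r ^ m`, up to constants. -/
def cellWeight (m : ℕ) (K : Tri) : ℝ := (∑ i, K i 0) ^ m * |sarea K|

lemma radius_le_sum (hs : sarea K ≠ 0) (h0 : ∀ i, 0 ≤ K i 0) (hx : x ∈ tri K) :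
    0 ≤ x 0 ∧ x 0 ≤ ∑ i, K i 0 := by
  rw [← bary_combo_apply hs x 0]
  have hb := (mem_tri_iff hs x).1 hx
  exact ⟨sum_nonneg fun i _ => mul_nonneg (hb i) (h0 i),
    sum_le_sum fun i _ => mul_le_of_le_one_left (h0 i) (bary_le_one hs hx i)⟩

lemma integral_radius_pow_mul_sq_le (hs : sarea K ≠ 0) (h0 : ∀ i, 0 ≤ K i 0) (m : ℕ) {p : Pt → ℝ}
    {t₀ t₁ t₂ : ℝ} (hp : ∀ x, p x = t₀ + t₁ * x 0 + t₂ * x 1) :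
    ∫ x in tri K, x 0 ^ m * p x ^ 2 ≤ cellWeight m K * ∑ i, p (K i) ^ 2 := by
  have hS : 0 ≤ ∑ i, p (K i) ^ 2 := sum_nonneg fun i _ => sq_nonneg _
  have hR : 0 ≤ ∑ i, K i 0 := sum_nonneg fun i _ => h0 i
  have hb : ∀ x ∈ tri K, x 0 ^ m * p x ^ 2 ≤ (∑ i, K i 0) ^ m * ∑ i, p (K i) ^ 2 := by
    intro x hx
    obtain ⟨r0, r1⟩ := radius_le_sum hs h0 hx
    refine mul_le_mul (pow_le_pow_left₀ r0 r1 m) ?_ (sq_nonneg _) (pow_nonneg hR m)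
    have hb := (mem_tri_iff hs x).1 hx
    rw [affine_eq_sum_bary hs hp x]
    refine (Finset.sum_mul_sq_le_sq_mul_sq _ _ _).trans (mul_le_of_le_one_left hS ?_)
    rw [← bary_sum hs x]
    refine sum_le_sum fun i _ => ?_
    rw [pow_two]
    exact mul_le_of_le_one_left (hb i) (bary_le_one hs hx i)
  have hcont : Continuous p := by rw [funext hp]; fun_prop
  calc ∫ x in tri K, x 0 ^ m * p x ^ 2
      ≤ ∫ _ in tri K, (∑ i, K i 0) ^ m * ∑ i, p (K i) ^ 2 :=
        setIntegral_mono_on (integrableOn_tri (by fun_prop) K)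
          (integrableOn_const (isCompact_tri K).measure_lt_top.ne)
          (isCompact_tri K).isClosed.measurableSet hb
    _ ≤ _ := by
        rw [setIntegral_const, volume_real_tri hs, smul_eq_mul, cellWeight]
        nlinarith [mul_nonneg (mul_nonneg (pow_nonneg hR m) (abs_nonneg (sarea K))) hS]

/-- Near the vertex of largest radius, the radius is comparable to that of the triangle. -/
lemma cellWeight_mul_sum_sq_le (hs : sarea K ≠ 0) (h0 : ∀ i, 0 ≤ K i 0) (hm : m ≤ 3) {p : Pt → ℝ}
    {t₀ t₁ t₂ : ℝ} (hp : ∀ x, p x = t₀ + t₁ * x 0 + t₂ * x 1) :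
    cellWeight m K * ∑ i, p (K i) ^ 2 ≤ 2654208 * ∫ x in tri K, x 0 ^ m * p x ^ 2 := by
  obtain ⟨j, hj⟩ : ∃ j, ∑ i, K i 0 ≤ 3 * K j 0 := by
    by_contra! H
    have := H 0
    have := H 1
    have := H 2
    simp only [sum_univ_three] at *
    linarith
  set R := ∑ i, K i 0 with hRdef
  have hR : 0 ≤ R := sum_nonneg fun i _ => h0 i
  set K' : Tri := shrink (1 / 2) j K
  have hsK : sarea K' = sarea K / 4 := by rw [sarea_shrink]; ring
  have hs' : sarea K' ≠ 0 := by grind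
  have hsub : tri K' ⊆ tri K := tri_shrink_subset (by norm_num) (by norm_num) j K
  have hr : ∀ x ∈ tri K', R / 6 ≤ x 0 := fun x hx =>
    le_of_forall_vertex_le hs' (p := fun x => x 0) (t₀ := 0) (t₁ := 1) (t₂ := 0) (by simp)
      (fun i => by rw [shrink_apply]; linarith [h0 i]) hx
  have hcont : Continuous p := by rw [funext hp]; fun_prop
  have hI := sum_sq_le_integral hs' hp
  have h1 : (R / 6) ^ m * ∫ x in tri K', p x ^ 2 ≤ ∫ x in tri K, x 0 ^ m * p x ^ 2 := by
    rw [← integral_const_mul]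
    refine le_trans (setIntegral_mono_on
      (integrableOn_tri (by fun_prop) K')
      (integrableOn_tri (by fun_prop) K')
      (isCompact_tri K').isClosed.measurableSet fun x hx => ?_)
      (setIntegral_mono_set
      (integrableOn_tri (by fun_prop) K) ?_ hsub.eventuallyLE)
    · exact mul_le_mul_of_nonneg_right (pow_le_pow_left₀ (by positivity) (hr x hx) m) (sq_nonneg _)
    · filter_upwards [ae_restrict_mem (isCompact_tri K).isClosed.measurableSet] with x hx
      exact mul_nonneg (pow_nonneg (radius_le_sum hs h0 hx).1 m) (sq_nonneg _)
  have h2 : ∑ i, p (K i) ^ 2 ≤ 8 * ∑ i, p (K' i) ^ 2 := by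
    have e : ∀ i, p (K' i) = (p (K j) + p (K i)) / 2 := fun i => by
      simp only [hp, K', shrink_apply]; ring
    have g : ∀ (a : Fin 3 → ℝ) (j : Fin 3), ∑ i, a i ^ 2 ≤ 8 * ∑ i, ((a j + a i) / 2) ^ 2 := by
      intro a j
      have e : ∀ x y : ℝ, x ^ 2 ≤ 8 * ((y + x) / 2) ^ 2 + 2 * y ^ 2 := fun x y => by
        nlinarith [sq_nonneg (x + 2 * y)]
      simp only [sum_univ_three]
      fin_cases j <;> grind
    simp_all
  have h6 : R ^ m ≤ 216 * (R / 6) ^ m := by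
    rw [div_pow, mul_div_assoc', le_div_iff₀ (by positivity), mul_comm]
    refine mul_le_mul_of_nonneg_right ?_ (pow_nonneg hR m)
    calc (6 : ℝ) ^ m ≤ 6 ^ 3 := pow_le_pow_right₀ (by norm_num) hm
      _ = 216 := by norm_num
  have hq : 0 ≤ (R / 6) ^ m := by positivity
  rw [hsK, abs_div, abs_of_pos (by norm_num : (0 : ℝ) < 4)] at hI
  rw [cellWeight]
  calc R ^ m * |sarea K| * ∑ i, p (K i) ^ 2
      ≤ 216 * (R / 6) ^ m * |sarea K| * (8 * ∑ i, p (K' i) ^ 2) := by gcongr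
    _ = 6912 * ((R / 6) ^ m * (|sarea K| / 4 * ∑ i, p (K' i) ^ 2)) := by ring
    _ ≤ 6912 * ((R / 6) ^ m * (384 * ∫ x in tri K', p x ^ 2)) := by gcongr
    _ ≤ _ := by linarith

/-! ### Local perturbations in the weighted norms -/

/-- The constant of `integral_perturbation_le`, which depends on the regularity constant only. -/
def perturbationConst (A : ℝ) : ℝ :=
  2654208 * (14400 * A ^ 2 * ((19 * A) ^ 3 * (4 * A ^ 2)) * (400 * A ^ 2))

lemma Triangulation.Regular.cellWeight_le (hT : T.Regular A) (hK : K ∈ T.cells)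
    (hK' : K' ∈ T.near K) (hm : m ≤ 3) :
    cellWeight m K ≤ (19 * A) ^ 3 * (4 * A ^ 2) * cellWeight m K' := by
  obtain ⟨hK'c, hd⟩ := mem_near.1 hK'
  have hA := hT.one_le
  have hh := hT.pos
  have hR0 : 0 ≤ ∑ i, K i 0 := sum_nonneg fun i _ => T.nonneg K hK i
  have hR : ∑ i, K i 0 ≤ 19 * A * ∑ i, K' i 0 := by
    obtain ⟨i, hi⟩ := hT.radius K' hK'c
    have h1 := hi.trans (mul_le_mul_of_nonneg_left
      (Finset.single_le_sum (fun i _ => T.nonneg K' hK'c i) (Finset.mem_univ i)) (by linarith))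
    have h2 : ∀ i, K i 0 ≤ K' i 0 + 6 * T.meshSize := fun i => by
      have e1 := hT.dist_le K hK _ (vertex_mem_tri K i) _ (vertex_mem_tri K 0)
      have e2 := hT.dist_le K' hK'c _ (vertex_mem_tri K' 0) _ (vertex_mem_tri K' i)
      have e3 : |K i 0 - K' i 0| ≤ dist (K i) (K' i) := by
        rw [dist_eq_norm]
        exact PiLp.norm_apply_le (K i - K' i) 0
      have e4 := dist_triangle4 (K i) (K 0) (K' 0) (K' i)
      rw [dist_comm (K 0)] at e4
      linarith [le_abs_self (K i 0 - K' i 0)]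
    have h3 : 0 ≤ ∑ i, K' i 0 := sum_nonneg fun i _ => T.nonneg K' hK'c i
    have h4 : ∑ i, K i 0 ≤ ∑ i, (K' i 0 + 6 * T.meshSize) := sum_le_sum fun i _ => h2 i
    rw [sum_add_distrib] at h4
    simp only [sum_const, card_univ, Fintype.card_fin, nsmul_eq_mul, Nat.cast_ofNat] at h4
    nlinarith
  have hS : |sarea K| ≤ 4 * A ^ 2 * |sarea K'| := by
    linarith [hT.sarea_le hK, hT.sarea_ge hK'c]
  have hR'0 : 0 ≤ ∑ i, K' i 0 := sum_nonneg fun i _ => T.nonneg K' hK'c i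
  calc cellWeight m K ≤ (19 * A * ∑ i, K' i 0) ^ m * (4 * A ^ 2 * |sarea K'|) :=
        mul_le_mul (pow_le_pow_left₀ hR0 hR m) hS (abs_nonneg _) (by positivity)
    _ = (19 * A) ^ m * ((∑ i, K' i 0) ^ m * (4 * A ^ 2 * |sarea K'|)) := by rw [mul_pow]; ring
    _ ≤ (19 * A) ^ 3 * ((∑ i, K' i 0) ^ m * (4 * A ^ 2 * |sarea K'|)) :=
        mul_le_mul_of_nonneg_right (pow_le_pow_right₀ (by linarith) hm) (by positivity)
    _ = _ := by rw [cellWeight]; ring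

lemma Triangulation.sum_near_comm (T : Triangulation) (f : Tri → Tri → ℝ) :
    ∑ K ∈ T.cells, ∑ K' ∈ T.near K, f K K' = ∑ K' ∈ T.cells, ∑ K ∈ T.near K', f K K' :=
  Finset.sum_comm' fun K K' => by
    simp only [mem_near, dist_comm (K 0)]; tauto

/-- Weighted sums over the cells absorb sums over neighbouring cells. -/
lemma Triangulation.Regular.sum_cellWeight_le (hT : T.Regular A) (hm : m ≤ 3) {ι : Type*}
    [Fintype ι] (hι : Fintype.card ι ≤ 6) {D N : Tri → ι → ℝ} {b : ℝ}
    (hD : ∀ K ∈ T.cells, ∀ i, |D K i| ≤ b * ∑ K' ∈ T.near K, ∑ j, |N K' j|) : ∑ K ∈ T.cells,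
    cellWeight m K * ∑ i, D K i ^ 2 ≤ 14400 * A ^ 2 * ((19 * A) ^ 3 * (4 * A ^ 2)) * (400 * A ^ 2) *
    b ^ 2 * ∑ K ∈ T.cells, cellWeight m K * ∑ i, N K i ^ 2 := by
  have hA := hT.one_le
  have hι' : (Fintype.card ι : ℝ) ≤ 6 := by exact_mod_cast hι
  have hw : ∀ K ∈ T.cells, 0 ≤ cellWeight m K := fun K hK =>
    mul_nonneg (pow_nonneg (sum_nonneg fun i _ => T.nonneg K hK i) m) (abs_nonneg _)
  have hN : ∀ K, 0 ≤ ∑ i, N K i ^ 2 := fun K => sum_nonneg fun i _ => sq_nonneg _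
  have h1 : ∀ K ∈ T.cells, ∑ i, D K i ^ 2 ≤
      14400 * A ^ 2 * b ^ 2 * ∑ K' ∈ T.near K, ∑ i, N K' i ^ 2 := by
    intro K hK
    have hNn : 0 ≤ ∑ K' ∈ T.near K, ∑ i, N K' i ^ 2 := sum_nonneg fun K' _ => hN K'
    have e1 : (∑ K' ∈ T.near K, ∑ j, |N K' j|) ^ 2 ≤
        400 * A ^ 2 * (6 * ∑ K' ∈ T.near K, ∑ i, N K' i ^ 2) := by
      refine sq_sum_le_card_mul_sum_sq.trans ?_
      refine mul_le_mul (hT.card_near_le K) ?_ (sum_nonneg fun _ _ => sq_nonneg _)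
        (by positivity)
      rw [mul_sum]
      refine sum_le_sum fun K' _ => sq_sum_le_card_mul_sum_sq.trans ?_
      simp only [sq_abs, card_univ]
      exact mul_le_mul_of_nonneg_right hι' (hN K')
    have e2 : ∀ i, D K i ^ 2 ≤ b ^ 2 * (400 * A ^ 2 * (6 * ∑ K' ∈ T.near K, ∑ i, N K' i ^ 2)) :=
      fun i => by
        rw [← sq_abs]
        refine (pow_le_pow_left₀ (abs_nonneg _) (hD K hK i) 2).trans ?_
        nlinarith
    refine (sum_le_sum fun i _ => e2 i).trans ?_
    rw [sum_const, nsmul_eq_mul, card_univ]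
    refine (mul_le_mul_of_nonneg_right hι' (by positivity)).trans (le_of_eq ?_)
    ring
  calc ∑ K ∈ T.cells, cellWeight m K * ∑ i, D K i ^ 2
      ≤ ∑ K ∈ T.cells, 14400 * A ^ 2 * b ^ 2 *
          ∑ K' ∈ T.near K, cellWeight m K * ∑ i, N K' i ^ 2 := by
        refine sum_le_sum fun K hK => ?_
        rw [← mul_sum]
        linarith [mul_le_mul_of_nonneg_left (h1 K hK) (hw K hK)]
    _ = 14400 * A ^ 2 * b ^ 2 * ∑ K' ∈ T.cells, ∑ K ∈ T.near K', cellWeight m K * ∑ i, N K' i ^ 2 := by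
        rw [← mul_sum, T.sum_near_comm]
    _ ≤ 14400 * A ^ 2 * b ^ 2 * ∑ K' ∈ T.cells, 400 * A ^ 2 * ((19 * A) ^ 3 * (4 * A ^ 2) *
          cellWeight m K' * ∑ i, N K' i ^ 2) := by
        refine mul_le_mul_of_nonneg_left (sum_le_sum fun K' hK' => ?_) (by positivity)
        have e : ∀ K ∈ T.near K', cellWeight m K * ∑ i, N K' i ^ 2 ≤
            (19 * A) ^ 3 * (4 * A ^ 2) * cellWeight m K' * ∑ i, N K' i ^ 2 := fun K hK => by
          refine mul_le_mul_of_nonneg_right (hT.cellWeight_le (mem_near.1 hK).1 ?_ hm) (hN K')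
          exact mem_near.2 ⟨hK', by rw [dist_comm]; exact (mem_near.1 hK).2⟩
        refine (sum_le_sum e).trans ?_
        rw [sum_const, nsmul_eq_mul]
        exact mul_le_mul_of_nonneg_right (hT.card_near_le K')
          (mul_nonneg (mul_nonneg (by positivity) (hw K' hK')) (hN K'))
    _ = _ := by
        simp only [mul_sum]
        grind

/-- Affine functions of `(r, z)`. -/
def IsAffine (p : Pt → ℝ) : Prop := ∃ t₀ t₁ t₂ : ℝ, ∀ x, p x = t₀ + t₁ * x 0 + t₂ * x 1

lemma IsAffine.continuous {p : Pt → ℝ} (h : IsAffine p) : Continuous p := by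
  obtain ⟨t₀, t₁, t₂, h⟩ := h
  rw [funext h]
  fun_prop

/-- On each cell `K`, the function `f i` is the affine function `P i K`. -/
def Triangulation.PiecewiseAffine {ι : Type*} (T : Triangulation) (f : ι → Pt → ℝ)
    (P : ι → Tri → Pt → ℝ) : Prop :=
  ∀ i, ∀ K ∈ T.cells, IsAffine (P i K) ∧ ∀ x ∈ interior (tri K), f i x = P i K x

/-- The squared `L²` norm of a family of functions for the weight `r ^ m`. -/
def energy {ι : Type*} [Fintype ι] (m : ℕ) (Ω : Set Pt) (f : ι → Pt → ℝ) : ℝ :=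
  ∫ x in Ω, x 0 ^ m * ∑ i, f i x ^ 2

namespace FoldedMesh
variable (h : FoldedMesh Ω ψ T L A ε F)
include h

lemma setIntegral_eq_sum {P : Tri → Pt → ℝ} (hP : ∀ K ∈ T.cells, Continuous (P K))
    (hf : ∀ K ∈ T.cells, ∀ x ∈ interior (tri K), f x = P K x) :
    IntegrableOn f Ω ∧ ∫ x in Ω, f x = ∑ K ∈ T.cells, ∫ x in tri K, P K x := by
  have hΩ : (⋃ K ∈ T.cells, interior (tri K) : Set Pt) =ᵐ[volume] Ω := by
    have h1 := (ae_restrict_iff' h.meshes.isOpen.measurableSet).1 (h.ae_of_cells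
      (p := fun x => x ∈ ⋃ K ∈ T.cells, interior (tri K)) fun K hK x hx => mem_biUnion hK hx)
    have hsub : (⋃ K ∈ T.cells, interior (tri K) : Set Pt) ⊆ Ω :=
      iUnion₂_subset fun K hK => h.meshes.interior_tri_subset hK
    refine eventuallyEq_set.2 ?_
    filter_upwards [h1] with x hx
    aesop
  have hi : ∀ K ∈ T.cells, IntegrableOn f (interior (tri K)) := fun K hK =>
    ((integrableOn_tri (hP K hK) K).mono_set interior_subset).congr_fun
      (fun x hx => (hf K hK x hx).symm) isOpen_interior.measurableSet
  refine ⟨IntegrableOn.congr_set_ae (integrableOn_finset_iUnion.2 hi) hΩ.symm, ?_⟩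
  rw [← setIntegral_congr_set hΩ, integral_biUnion_finset _
    (fun K _ => isOpen_interior.measurableSet) ?_ hi]
  · refine sum_congr rfl fun K hK => ?_
    rw [setIntegral_congr_fun isOpen_interior.measurableSet (fun x hx => hf K hK x hx)]
    refine setIntegral_congr_set (eventuallyEq_set.2 ?_)
    filter_upwards [ae_mem_interior_of_mem_tri K] with x hx
    exact ⟨fun hx' => interior_subset hx', hx⟩
  · intro K hK K' hK' hne
    exact Set.disjoint_left.2 fun x hx hx' =>
      hne (T.eq_of_mem_interior hK hK' hx (interior_subset hx'))

lemma setIntegral_energy {ι : Type*} [Fintype ι] (m : ℕ) {f : ι → Pt → ℝ} {P : ι → Tri → Pt → ℝ}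
    (hf : T.PiecewiseAffine f P) : IntegrableOn (fun x => x 0 ^ m * ∑ i, f i x ^ 2) Ω ∧
    energy m Ω f = ∑ K ∈ T.cells, ∑ i, ∫ x in tri K, x 0 ^ m * P i K x ^ 2 := by
  have hc : ∀ i, ∀ K ∈ T.cells, Continuous fun x => x 0 ^ m * P i K x ^ 2 := fun i K hK => by
    have := (hf i K hK).1.continuous
    fun_prop
  have key := h.setIntegral_eq_sum (f := fun x => x 0 ^ m * ∑ i, f i x ^ 2)
   
    (fun K hK => continuous_finsetSum _ fun i _ => hc i K hK) (fun K hK x hx => by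
      rw [mul_sum]
      exact sum_congr rfl fun i _ => by rw [(hf i K hK).2 x hx])
  refine ⟨key.1, key.2.trans (sum_congr rfl fun K hK => ?_)⟩
  exact integral_finsetSum _ fun i _ => integrableOn_tri (hc i K hK) K

/-- A perturbation whose vertex values are controlled by those on the neighbouring cells is small
in every weighted norm. -/
theorem energy_perturbation_le {ι : Type*} [Fintype ι] (hι : Fintype.card ι ≤ 2) (hm : m ≤ 3)
    {f g : ι → Pt → ℝ} {P Q : ι → Tri → Pt → ℝ} (hg : T.PiecewiseAffine g P)
    (hf : T.PiecewiseAffine f Q) {b : ℝ} (hb : ∀ K ∈ T.cells, ∀ i j,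
      |P i K (K j)| ≤ b * ∑ K' ∈ T.near K, ∑ k : ι × Fin 3, |Q k.1 K' (K' k.2)|) :
    energy m Ω g ≤ perturbationConst A * b ^ 2 * energy m Ω f := by
  rw [(h.setIntegral_energy m hg).2, (h.setIntegral_energy m hf).2]
  have h1 : ∑ K ∈ T.cells, ∑ i, ∫ x in tri K, x 0 ^ m * P i K x ^ 2 ≤
      ∑ K ∈ T.cells, cellWeight m K * ∑ k : ι × Fin 3, P k.1 K (K k.2) ^ 2 := by
    refine sum_le_sum fun K hK => ?_
    rw [Fintype.sum_prod_type, mul_sum]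
    refine sum_le_sum fun i _ => ?_
    obtain ⟨t₀, t₁, t₂, ht⟩ := (hg i K hK).1
    exact integral_radius_pow_mul_sq_le (T.sarea_ne hK) (T.nonneg K hK) m ht
  have h2 : ∑ K ∈ T.cells, cellWeight m K * ∑ k : ι × Fin 3, Q k.1 K (K k.2) ^ 2 ≤
      2654208 * ∑ K ∈ T.cells, ∑ i, ∫ x in tri K, x 0 ^ m * Q i K x ^ 2 := by
    rw [mul_sum]
    refine sum_le_sum fun K hK => ?_
    rw [Fintype.sum_prod_type, mul_sum, mul_sum]
    refine sum_le_sum fun i _ => ?_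
    obtain ⟨t₀, t₁, t₂, ht⟩ := (hf i K hK).1
    exact cellWeight_mul_sum_sq_le (T.sarea_ne hK) (T.nonneg K hK) hm ht
  have hι' : Fintype.card (ι × Fin 3) ≤ 6 := by simp; omega
  have h3 := h.reg.sum_cellWeight_le hm hι' (D := fun K k => P k.1 K (K k.2))
    (N := fun K k => Q k.1 K (K k.2)) (fun K hK k => hb K hK k.1 k.2)
  have hA := h.reg.one_le
  refine (h1.trans h3).trans ((mul_le_mul_of_nonneg_left h2 (by positivity)).trans (le_of_eq ?_))
  rw [perturbationConst]
  ring

end FoldedMesh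

lemma Alternating.sub (h : Alternating c) (h' : Alternating c') : Alternating (c - c') :=
  fun a b => by simp only [Pi.sub_apply, h a b, h' a b]; ring

lemma isAffine_whitneyOn (K : Tri) (hc : Alternating c) (m : Fin 2) :
    IsAffine (whitneyOn K c m) := by
  obtain ⟨α, β, γ, h⟩ := whitneyOn_eq K hc
  fin_cases m
  · exact ⟨α, 0, -γ, fun x => by simp [(h x).1]; ring⟩
  · exact ⟨β, γ, 0, fun x => by simp [(h x).2]⟩

lemma whitneyOn_vertex (hs : sarea K ≠ 0) (c : Pt → Pt → ℝ) (m : Fin 2) (i : Fin 3) :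
    whitneyOn K c m (K i) = ∑ j, c (K i) (K j) * gradBary K j m := by
  simp [whitneyOn, bary_vertex hs]

lemma eq_whitneyOn_vertex (hs : sarea K ≠ 0) (hc : Alternating c) (i j : Fin 3) : c (K i) (K j) =
    whitneyOn K c 0 (K i) * (K j 0 - K i 0) + whitneyOn K c 1 (K i) * (K j 1 - K i 1) := by
  rw [whitneyOn_vertex hs, whitneyOn_vertex hs, sum_mul, sum_mul,
    ← sum_add_distrib]
  simp only [mul_assoc, ← mul_add, gradBary_edge hs]
  simp [mul_sub, sum_sub_distrib, hc.self]

lemma FoldedMesh.piecewise_form0 (h : FoldedMesh Ω ψ T L A ε F) (q : Pt → ℝ) :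
    T.PiecewiseAffine (fun _ : Fin 1 => T.form0 F q) fun _ K => affineOn K q :=
  fun _ K hK => ⟨affineOn_eq K q, fun _ hx => h.form0_eq hK hx _⟩

lemma FoldedMesh.piecewise_form1 (h : FoldedMesh Ω ψ T L A ε F) (hc : Alternating c) :
    T.PiecewiseAffine (T.form1 F c) fun i K => whitneyOn K c i :=
  fun i K hK => ⟨isAffine_whitneyOn K hc i, fun _ hx => h.form1_eq hK hx _ i⟩

lemma piecewise_form2 (s : Tri → ℝ) :
    T.PiecewiseAffine (fun _ : Fin 1 => T.form2 s) fun _ K _ => s K :=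
  fun _ K hK => ⟨⟨s K, 0, 0, fun _ => by simp⟩, fun _ hx => T.piecewise_eq _ hK hx⟩

/-- The factor by which the errors of the averaged degrees of freedom are smaller than the degrees
of freedom, in the squared weighted norms. -/
def driftConst (L A M δ : ℝ) : ℝ := perturbationConst A * (M ^ 3 * (69 * A * (A * L) ^ 2 * δ)) ^ 2

namespace SmallDisks
variable (h : SmallDisks Ω ψ T L A ε F ρ l δ M)
include h

lemma const_le :
    A * L * δ ≤ 69 * A * (A * L) ^ 2 * δ ∧ 69 * A * L ^ 2 * δ ≤ 69 * A * (A * L) ^ 2 * δ := by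
  obtain ⟨-, -, -, hAL⟩ := h.bounds
  have hA := h.reg.one_le
  have hδ := h.delta_nonneg
  have e : A * L ≤ (A * L) ^ 2 := by nlinarith
  have e' : (A * L) ^ 2 ≤ 69 * A * (A * L) ^ 2 := by nlinarith
  refine ⟨mul_le_mul_of_nonneg_right (e.trans e') hδ, mul_le_mul_of_nonneg_right ?_ hδ⟩
  nlinarith

lemma energy_map0_sub_le (hm : m ≤ 3) (q : Pt → ℝ) :
    energy m Ω (fun _ : Fin 1 => T.form0 F (T.map0 F l ρ q - q)) ≤
      driftConst L A M δ * energy m Ω fun _ : Fin 1 => T.form0 F q := by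
  have e : ∀ (q : Pt → ℝ), ∀ K ∈ T.cells, ∀ i, affineOn K q (K i) = q (K i) := fun q K hK i => by
    simp [affineOn, bary_vertex (T.sarea_ne hK)]
  refine h.energy_perturbation_le (by simp) hm (h.piecewise_form0 _) (h.piecewise_form0 _)
    fun K hK _ j => ?_
  rw [e _ K hK]
  refine (h.abs_map0_sub_le hK q j).trans (mul_le_mul (mul_le_mul_of_nonneg_left h.const_le.1
    (pow_nonneg (zero_le_one.trans h.one_le_bound) 3)) ?_ (by positivity) ?_)
  · refine sum_le_sum fun K' hK' => le_of_eq ?_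
    rw [Fintype.sum_prod_type]
    simp only [e _ K' (mem_near.1 hK').1]
    simp
  · have := h.const_le
    have := h.reg.one_le
    have := h.delta_nonneg
    have := h.one_le_bound
    positivity

lemma energy_map2_sub_le (hm : m ≤ 3) (s : Tri → ℝ) :
    energy m Ω (fun _ : Fin 1 => T.form2 (T.map2 F l ρ s - s)) ≤
      driftConst L A M δ * energy m Ω fun _ : Fin 1 => T.form2 s := by
  refine h.energy_perturbation_le (by simp) hm (piecewise_form2 _) (piecewise_form2 _)
    fun K hK _ j => ?_
  have hA := h.reg.one_le
  have hδ := h.delta_nonneg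
  have hM := h.one_le_bound
  refine (h.abs_map2_sub_le hK s).trans (mul_le_mul (mul_le_mul_of_nonneg_left h.const_le.2
    (by positivity)) ?_ (by positivity) (by positivity))
  refine sum_le_sum fun K' _ => ?_
  simp only [sum_const, card_univ, Fintype.card_prod, Fintype.card_fin, nsmul_eq_mul]
  grind

lemma energy_map1_sub_le (hm : m ≤ 3) (hc : Alternating c) (hcs : T.EdgeSupported c) :
    energy m Ω (T.form1 F (T.map1 F l ρ c - c)) ≤ driftConst L A M δ * energy m Ω (T.form1 F c) := by
  have hA := h.reg.one_le
  have hδ := h.delta_nonneg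
  have hM := h.one_le_bound
  have hh := h.reg.pos
  have hc' := (alternating_map1 T F l ρ c).sub hc
  refine h.energy_perturbation_le (by simp) hm (h.piecewise_form1 hc') (h.piecewise_form1 hc)
    fun K hK i j => ?_
  set B := M ^ 3 * (6 * (A * L) ^ 2 * δ)
  set S := ∑ K' ∈ T.near K, ∑ j, ∑ k, |c (K' j) (K' k)|
  set N := ∑ K' ∈ T.near K, ∑ k : Fin 2 × Fin 3, |whitneyOn K' c k.1 (K' k.2)|
  have hB : 0 ≤ B := by positivity
  have hS : 0 ≤ S := by positivity
  have hN : 0 ≤ N := by positivity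
  have hD : ∀ a b : Fin 3, |(T.map1 F l ρ c - c) (K a) (K b)| ≤ B * S := by
    have h0 := h.abs_map1_sub_le hK hc hcs
    have hBS := mul_nonneg hB hS
    have key : ∀ a b : Fin 3, a = b ∨ (∃ i : Fin 3, a = i + 1 ∧ b = i + 2) ∨
        ∃ i : Fin 3, a = i + 2 ∧ b = i + 1 := by decide
    intro a b
    rcases key a b with rfl | ⟨i, rfl, rfl⟩ | ⟨i, rfl, rfl⟩
    · rw [hc'.self, abs_zero]; exact hBS
    · exact h0 i
    · rw [hc', abs_neg]; exact h0 i
  have hcN : S ≤ 3 * T.meshSize * N := by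
    rw [mul_sum]
    refine sum_le_sum fun K' hK' => ?_
    have hK'c := (mem_near.1 hK').1
    have e : ∀ j k, |c (K' j) (K' k)| ≤
        T.meshSize * (|whitneyOn K' c 0 (K' j)| + |whitneyOn K' c 1 (K' j)|) := fun j k => by
      have hd := h.reg.dist_le K' hK'c _ (vertex_mem_tri K' k) _ (vertex_mem_tri K' j)
      have hp : ∀ m, |K' k m - K' j m| ≤ T.meshSize := fun m => by
        rw [dist_eq_norm] at hd
        exact (PiLp.norm_apply_le (K' k - K' j) m).trans hd
      rw [eq_whitneyOn_vertex (T.sarea_ne hK'c) hc j k]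
      refine (abs_add_le _ _).trans ?_
      rw [abs_mul, abs_mul, mul_add, mul_comm T.meshSize, mul_comm T.meshSize]
      exact add_le_add (mul_le_mul_of_nonneg_left (hp 0) (abs_nonneg _))
        (mul_le_mul_of_nonneg_left (hp 1) (abs_nonneg _))
    refine (sum_le_sum fun j _ => sum_le_sum fun k _ => e j k).trans (le_of_eq ?_)
    simp only [Fintype.sum_prod_type, sum_univ_two, sum_univ_three]
    ring
  rw [whitneyOn_vertex (T.sarea_ne hK)]
  calc |∑ k, (T.map1 F l ρ c - c) (K j) (K k) * gradBary K k i|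
      ≤ ∑ _k : Fin 3, B * S * (A / T.meshSize) := by
        refine (abs_sum_le_sum_abs _ _).trans (sum_le_sum fun k _ => ?_)
        rw [abs_mul]
        exact mul_le_mul (hD j k) (h.reg.grad_le hK k i) (abs_nonneg _) (mul_nonneg hB hS)
    _ = 3 * (B * S * (A / T.meshSize)) := by simp
    _ ≤ 3 * (B * (3 * T.meshSize * N) * (A / T.meshSize)) := by gcongr
    _ = M ^ 3 * (54 * A * (A * L) ^ 2 * δ) * N := by
        grind
    _ ≤ _ := by gcongr; norm_num

end SmallDisks

/-! ### The `L²_r` norms of the discrete fields -/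

/-- Norms in `L²_r(Ω)` as weighted integrals. -/
lemma norm_sq_eq (hΩ : IsOpen Ω) (hpos : Ω ⊆ halfPlane) {E : Type*} [NormedAddCommGroup E]
    [InnerProductSpace ℝ E] (v : Lp E 2 (rMeasure Ω)) {f : Pt → E} (hf : ⇑v =ᵐ[rMeasure Ω] f) :
    IntegrableOn (fun x => x 0 * ‖f x‖ ^ 2) Ω ∧ ‖v‖ ^ 2 = ∫ x in Ω, x 0 * ‖f x‖ ^ 2 := by
  have e : (fun x => inner ℝ (v x) (v x)) =ᵐ[rMeasure Ω] fun x => ‖f x‖ ^ 2 := by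
    filter_upwards [hf] with x hx
    simp_all
  have hae : ∀ᵐ x ∂(volume.restrict Ω), (ENNReal.ofReal (x 0)).toReal = x 0 :=
    (ae_restrict_iff' hΩ.measurableSet).2 (.of_forall fun x hx =>
      ENNReal.toReal_ofReal (le_of_lt (hpos hx)))
  have hi := (L2.integrable_inner (𝕜 := ℝ) v v).congr e
  have hn : ‖v‖ ^ 2 = ∫ x, ‖f x‖ ^ 2 ∂(rMeasure Ω) := by
    rw [← integral_congr_ae e, ← L2.inner_def, real_inner_self_eq_norm_sq]
  rw [rMeasure] at hi
  rw [integrable_withDensity_iff_integrable_smul' (by fun_prop) (by simp)] at hi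
  have hd : ∫ x, ‖f x‖ ^ 2 ∂(rMeasure Ω) = ∫ x in Ω, (ENNReal.ofReal (x 0)).toReal • ‖f x‖ ^ 2 := by
    rw [rMeasure, integral_withDensity_eq_integral_toReal_smul (by fun_prop) (by simp)]
  refine ⟨hi.congr ?_, (hn.trans hd).trans (integral_congr_ae ?_)⟩ <;>
  · filter_upwards [hae] with x hx
    rw [hx, smul_eq_mul]

lemma form0_add_smul (t : ℝ) (q q' : Pt → ℝ) (x : Pt) :
    T.form0 F (q + t • q') x = T.form0 F q x + t * T.form0 F q' x := by
  simp [form0, add_mul, mul_assoc, sum_add_distrib, mul_sum]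

lemma form1_add_smul (t : ℝ) (c c' : Pt → Pt → ℝ) (m : Fin 2) (x : Pt) :
    T.form1 F (c + t • c') m x = T.form1 F c m x + t * T.form1 F c' m x := by
  simp [form1, add_mul, mul_assoc, sum_add_distrib, mul_sum]

lemma form2_add_smul (t : ℝ) (s s' : Tri → ℝ) (x : Pt) :
    T.form2 (s + t • s') x = T.form2 s x + t * T.form2 s' x := by
  simp only [form2, piecewise, mul_sum, ← sum_add_distrib]
  refine sum_congr rfl fun K _ => ?_
  by_cases hx : x ∈ interior (tri K) <;> simp [hx]

lemma fieldG_add_smul (t : ℝ) (q q' : Pt → ℝ) (x : Pt) :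
    T.fieldG F n (q + t • q') x = T.fieldG F n q x + t • T.fieldG F n q' x := by
  simp only [fieldG, form0_add_smul, smul_eq_mul]; ring

lemma fieldC_add_smul (t : ℝ) (θ θ' : Pt → ℝ) (c c' : Pt → Pt → ℝ) (x : Pt) :
    T.fieldC F n (θ + t • θ') (c + t • c') x = T.fieldC F n θ c x + t • T.fieldC F n θ' c' x := by
  ext i
  fin_cases i <;> simp [fieldC, form0_add_smul, form1_add_smul] <;> ring

lemma fieldD_add_smul (t : ℝ) (c c' : Pt → Pt → ℝ) (s s' : Tri → ℝ) (x : Pt) :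
    T.fieldD F n (c + t • c') (s + t • s') x = T.fieldD F n c s x + t • T.fieldD F n c' s' x := by
  ext i
  fin_cases i <;> simp [fieldD, form1_add_smul, form2_add_smul] <;> ring

lemma sub_eq_add_neg_one_smul {V : Type*} [AddCommGroup V] [Module ℝ V] (a b : V) :
    a - b = a + (-1 : ℝ) • b := by
  rw [neg_one_smul, sub_eq_add_neg]

lemma form2_sub (s s' : Tri → ℝ) (x : Pt) : T.form2 (s - s') x = T.form2 s x - T.form2 s' x := by
  rw [sub_eq_add_neg_one_smul s, form2_add_smul]; ring

lemma fieldG_sub (q q' : Pt → ℝ) (x : Pt) :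
    T.fieldG F n (q - q') x = T.fieldG F n q x - T.fieldG F n q' x := by
  rw [sub_eq_add_neg_one_smul q, fieldG_add_smul, ← sub_eq_add_neg_one_smul]

lemma fieldC_sub (θ θ' : Pt → ℝ) (c c' : Pt → Pt → ℝ) (x : Pt) :
    T.fieldC F n (θ - θ') (c - c') x = T.fieldC F n θ c x - T.fieldC F n θ' c' x := by
  rw [sub_eq_add_neg_one_smul θ, sub_eq_add_neg_one_smul c, fieldC_add_smul,
    ← sub_eq_add_neg_one_smul]

lemma fieldD_sub (c c' : Pt → Pt → ℝ) (s s' : Tri → ℝ) (x : Pt) :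
    T.fieldD F n (c - c') (s - s') x = T.fieldD F n c s x - T.fieldD F n c' s' x := by
  rw [sub_eq_add_neg_one_smul c, sub_eq_add_neg_one_smul s, fieldD_add_smul,
    ← sub_eq_add_neg_one_smul]

namespace FoldedMesh
variable (h : FoldedMesh Ω ψ T L A ε F)
include h

lemma norm_sq_fieldG {u : L2r Ω} (hu : ⇑u =ᵐ[rMeasure Ω] T.fieldG F n q) :
    ‖u‖ ^ 2 = 1 / (n : ℝ) ^ 2 * energy 3 Ω fun _ : Fin 1 => T.form0 F q := by
  rw [(norm_sq_eq h.meshes.isOpen (fun x hx => h.meshes.pos_of_mem hx) u hu).2, energy,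
    ← integral_const_mul]
  refine integral_congr_ae (.of_forall fun x => ?_)
  simp only [norm_eq_abs, sq_abs, fieldG, Fin.sum_univ_one]
  ring

lemma norm_sq_form2 {f : L2r Ω} (hf : ⇑f =ᵐ[rMeasure Ω] T.form2 s) :
    ‖f‖ ^ 2 = energy 1 Ω fun _ : Fin 1 => T.form2 s := by
  rw [(norm_sq_eq h.meshes.isOpen (fun x hx => h.meshes.pos_of_mem hx) f hf).2]
  simp [energy]

/-- The norm of a vector field is equivalent to a weighted sum of the norms of two forms if this
holds pointwise. -/
lemma norm_sq_mem_Icc {ι κ : Type*} [Fintype ι] [Fintype κ] {f : ι → Pt → ℝ} {g : κ → Pt → ℝ}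
    {P : ι → Tri → Pt → ℝ} {Q : κ → Tri → Pt → ℝ} (hf : T.PiecewiseAffine f P)
    (hg : T.PiecewiseAffine g Q) {v : L2rVec Ω} {V : Pt → Vec} (hv : ⇑v =ᵐ[rMeasure Ω] V)
    (H : ∀ x, 3 * ∑ i, f i x ^ 2 + 2 * ∑ i, (1 / n * (x 0 * g i x)) ^ 2 ∈
      Icc (‖V x‖ ^ 2) (7 * ‖V x‖ ^ 2)) :
    3 * energy 1 Ω f + 2 / (n : ℝ) ^ 2 * energy 3 Ω g ∈ Icc (‖v‖ ^ 2) (7 * ‖v‖ ^ 2) := by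
  obtain ⟨hi, he⟩ := norm_sq_eq h.meshes.isOpen (fun x hx => h.meshes.pos_of_mem hx) v hv
  have h0 := (h.setIntegral_energy 1 hf).1.const_mul 3
  have h1 := (h.setIntegral_energy 3 hg).1.const_mul (2 / (n : ℝ) ^ 2)
  have e : ∀ x, 3 * (x 0 ^ 1 * ∑ i, f i x ^ 2) + 2 / (n : ℝ) ^ 2 * (x 0 ^ 3 * ∑ i, g i x ^ 2) =
      x 0 * (3 * ∑ i, f i x ^ 2 + 2 * ∑ i, (1 / n * (x 0 * g i x)) ^ 2) := fun x => by
    simp only [mul_pow, ← mul_sum]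
    ring
  rw [he, energy, energy, ← integral_const_mul, ← integral_const_mul, ← integral_const_mul,
    ← integral_add h0 h1]
  refine ⟨setIntegral_mono_on hi (h0.add h1) h.meshes.isOpen.measurableSet fun x hx => ?_,
    setIntegral_mono_on (h0.add h1) (hi.const_mul 7) h.meshes.isOpen.measurableSet fun x hx => ?_⟩
  all_goals
    have hr := (h.meshes.pos_of_mem hx).le
    simp only [e]
  · exact mul_le_mul_of_nonneg_left (H x).1 hr
  · rw [mul_left_comm]
    exact mul_le_mul_of_nonneg_left (H x).2 hr

omit h in
lemma sq_add_sq_mem_Icc (hn : 0 < n) (p y : ℝ) : 3 * p ^ 2 + 2 * y ^ 2 ∈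
    Icc ((y - 1 / n * p) ^ 2 + p ^ 2) (7 * ((y - 1 / n * p) ^ 2 + p ^ 2)) := by
  have hk : (1 / n * p) ^ 2 ≤ p ^ 2 := by
    rw [mul_pow, div_pow, one_pow]
    exact mul_le_of_le_one_left (sq_nonneg p) (div_le_one_of_le₀
      (one_le_pow₀ (by exact_mod_cast hn)) (by positivity))
  constructor
  · nlinarith [sq_nonneg (y + 1 / n * p)]
  · nlinarith

lemma norm_sq_fieldC (hn : 0 < n) (hc : Alternating c) {v : L2rVec Ω}
    (hv : ⇑v =ᵐ[rMeasure Ω] T.fieldC F n θ c) :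
    3 * energy 1 Ω (fun _ : Fin 1 => T.form0 F θ) + 2 / (n : ℝ) ^ 2 * energy 3 Ω (T.form1 F c) ∈
      Icc (‖v‖ ^ 2) (7 * ‖v‖ ^ 2) := by
  refine h.norm_sq_mem_Icc (h.piecewise_form0 θ) (h.piecewise_form1 hc) hv fun x => ?_
  obtain ⟨h1, h2⟩ := sq_add_sq_mem_Icc hn (T.form0 F θ x) (1 / n * (x 0 * T.form1 F c 0 x))
  have := sq_nonneg (1 / n * (x 0 * T.form1 F c 1 x))
  have e : ‖T.fieldC F n θ c x‖ ^ 2 = (1 / n * (x 0 * T.form1 F c 0 x) - 1 / n * T.form0 F θ x) ^ 2 +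
      T.form0 F θ x ^ 2 + (1 / n * (x 0 * T.form1 F c 1 x)) ^ 2 := by
    simp [EuclideanSpace.real_norm_sq_eq, sum_univ_three, fieldC]
    ring
  rw [e, Fin.sum_univ_one, sum_univ_two]
  constructor <;> linarith

lemma norm_sq_fieldD (hn : 0 < n) (hc : Alternating c) {v : L2rVec Ω}
    (hv : ⇑v =ᵐ[rMeasure Ω] T.fieldD F n c s) :
    3 * energy 1 Ω (T.form1 F c) + 2 / (n : ℝ) ^ 2 * energy 3 Ω (fun _ : Fin 1 => T.form2 s) ∈
      Icc (‖v‖ ^ 2) (7 * ‖v‖ ^ 2) := by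
  refine h.norm_sq_mem_Icc (h.piecewise_form1 hc) (piecewise_form2 s) hv fun x => ?_
  obtain ⟨h1, h2⟩ := sq_add_sq_mem_Icc hn (T.form1 F c 1 x) (1 / n * (x 0 * T.form2 s x))
  have := sq_nonneg (T.form1 F c 0 x)
  have e : ‖T.fieldD F n c s x‖ ^ 2 = (1 / n * (x 0 * T.form2 s x) - 1 / n * T.form1 F c 1 x) ^ 2 +
      T.form1 F c 1 x ^ 2 + T.form1 F c 0 x ^ 2 := by
    simp [EuclideanSpace.real_norm_sq_eq, sum_univ_three, fieldD]
    ring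
  rw [e, Fin.sum_univ_one, sum_univ_two]
  constructor <;> linarith

end FoldedMesh

/-- Smoothing disks so small that `R_h` is a perturbation of the identity. -/
structure Contracts (Ω : Set Pt) (ψ : Pt → Pt) (T : Triangulation) (L A ε : ℝ) (F : Pt → Pt → ℝ)
    (ρ : ℝ) (l : ℕ) (δ M : ℝ) : Prop extends SmallDisks Ω ψ T L A ε F ρ l δ M where
  contraction : 7 * driftConst L A M δ ≤ 1 / 4

namespace Contracts
variable (h : Contracts Ω ψ T L A ε F ρ l δ M)
include h

lemma norm_le_half {E : Type*} [SeminormedAddCommGroup E] {v w : E}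
    (hvw : ‖w‖ ^ 2 ≤ 7 * driftConst L A M δ * ‖v‖ ^ 2) : ‖w‖ ≤ 1 / 2 * ‖v‖ := by
  refine le_of_sq_le_sq ?_ (by positivity)
  have := mul_le_mul_of_nonneg_right h.contraction (sq_nonneg ‖v‖)
  linarith

lemma const_nonneg : 0 ≤ driftConst L A M δ :=
  mul_nonneg (by have := h.reg.one_le; unfold perturbationConst; positivity) (sq_nonneg _)

omit h in
lemma coeFn_sub_ae {E : Type*} [NormedAddCommGroup E] {v v' : Lp E 2 (rMeasure Ω)} {f f' g : Pt → E}
    (hv : ⇑v =ᵐ[rMeasure Ω] f) (hv' : ⇑v' =ᵐ[rMeasure Ω] f') (hg : ∀ x, g x = f' x - f x) :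
    ⇑(v' - v) =ᵐ[rMeasure Ω] g := by
  filter_upwards [Lp.coeFn_sub v' v, hv, hv'] with x h1 h2 h3
  simp_all

lemma norm_sub_fieldG_le {u u' : L2r Ω} (hu : ⇑u =ᵐ[rMeasure Ω] T.fieldG F n q)
    (hu' : ⇑u' =ᵐ[rMeasure Ω] T.fieldG F n (T.map0 F l ρ q)) : ‖u' - u‖ ≤ 1 / 2 * ‖u‖ := by
  refine h.norm_le_half ?_
  have e := coeFn_sub_ae hu hu' fun x => fieldG_sub _ _ x
  have h1 := h.energy_map0_sub_le le_rfl q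
  have h2 := h.const_nonneg
  rw [h.norm_sq_fieldG e]
  have h3 := mul_le_mul_of_nonneg_left h1 (by positivity : 0 ≤ 1 / (n : ℝ) ^ 2)
  have h4 := h.norm_sq_fieldG hu
  nlinarith

lemma norm_sub_form2_le {f f' : L2r Ω} (hf : ⇑f =ᵐ[rMeasure Ω] T.form2 s)
    (hf' : ⇑f' =ᵐ[rMeasure Ω] T.form2 (T.map2 F l ρ s)) : ‖f' - f‖ ≤ 1 / 2 * ‖f‖ := by
  refine h.norm_le_half ?_
  have e := coeFn_sub_ae hf hf' fun x => form2_sub _ _ x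
  have h1 := h.energy_map2_sub_le (m := 1) (by norm_num) s
  rw [← h.norm_sq_form2 e, ← h.norm_sq_form2 hf] at h1
  nlinarith

lemma norm_sub_fieldC_le (hn : 0 < n) (hc : Alternating c) (hcs : T.EdgeSupported c)
    {v v' : L2rVec Ω} (hv : ⇑v =ᵐ[rMeasure Ω] T.fieldC F n θ c)
    (hv' : ⇑v' =ᵐ[rMeasure Ω] T.fieldC F n (T.map0 F l ρ θ) (T.map1 F l ρ c)) :
    ‖v' - v‖ ≤ 1 / 2 * ‖v‖ := by
  refine h.norm_le_half ?_
  have e := coeFn_sub_ae hv hv' fun x => fieldC_sub _ _ _ _ x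
  have h1 := (h.norm_sq_fieldC hn ((alternating_map1 T F l ρ c).sub hc) e).1
  have h2 := (h.norm_sq_fieldC hn hc hv).2
  have h3 := h.energy_map0_sub_le (m := 1) (by norm_num) θ
  have h4 := mul_le_mul_of_nonneg_left (h.energy_map1_sub_le le_rfl hc hcs)
    (by positivity : 0 ≤ 2 / (n : ℝ) ^ 2)
  have h5 := mul_le_mul_of_nonneg_left h2 h.const_nonneg
  linarith

lemma norm_sub_fieldD_le (hn : 0 < n) (hc : Alternating c) (hcs : T.EdgeSupported c)
    {w w' : L2rVec Ω} (hw : ⇑w =ᵐ[rMeasure Ω] T.fieldD F n c s)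
    (hw' : ⇑w' =ᵐ[rMeasure Ω] T.fieldD F n (T.map1 F l ρ c) (T.map2 F l ρ s)) :
    ‖w' - w‖ ≤ 1 / 2 * ‖w‖ := by
  refine h.norm_le_half ?_
  have e := coeFn_sub_ae hw hw' fun x => fieldD_sub _ _ _ _ x
  have h1 := (h.norm_sq_fieldD hn ((alternating_map1 T F l ρ c).sub hc) e).1
  have h2 := (h.norm_sq_fieldD hn hc hw).2
  have h3 := h.energy_map1_sub_le (m := 1) (by norm_num) hc hcs
  have h4 := mul_le_mul_of_nonneg_left (h.energy_map2_sub_le le_rfl s)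
    (by positivity : 0 ≤ 2 / (n : ℝ) ^ 2)
  have h5 := mul_le_mul_of_nonneg_left h2 h.const_nonneg
  linarith

end Contracts

/-! ### Linearity of the maps of degrees of freedom -/

namespace SmoothedMesh
variable (h : SmoothedMesh Ω ψ T L A ε F ρ)
include h

lemma map0_add_smul (hK : K ∈ T.cells) (i : Fin 3) (t : ℝ) (q q' : Pt → ℝ) :
    T.map0 F l ρ (q + t • q') (K i) = (T.map0 F l ρ q + t • T.map0 F l ρ q') (K i) := by
  have hI : ∀ q, IntegrableOn (fun y => kappaProd l ρ K y * T.form0 F q (y i))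
      (diskProd ρ K) := fun q => by
    obtain ⟨C, hC⟩ := h.exists_lipschitz_form0 q
    have h1 := continuous_kappaProd l ρ K
    have h2 := hC.continuous
    exact (by fun_prop : Continuous fun y => kappaProd l ρ K y * T.form0 F q (y i)).continuousOn
      |>.integrableOn_compact (isCompact_diskProd ρ K)
  simp only [Pi.add_apply, Pi.smul_apply, smul_eq_mul, map0,
    ← average_vertex (h.goodDisk K hK) i]
  rw [← integral_const_mul, ← integral_add (hI q) ((hI q').const_mul t)]
  refine integral_congr_ae (.of_forall fun y => ?_)
  simp only [form0_add_smul]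
  ring

lemma map1_add_smul (hK : K ∈ T.cells) (i : Fin 3) (t : ℝ) (c c' : Pt → Pt → ℝ) : T.map1 F l ρ
    (c + t • c') (K (i + 1)) (K (i + 2)) = (T.map1 F l ρ c + t • T.map1 F l ρ c') (K (i + 1))
    (K (i + 2)) := by
  have hI : ∀ c, IntegrableOn (fun y => kappaProd l ρ K y *
      lineInt (T.form1 F c) (y (i + 1)) (y (i + 2))) (diskProd ρ K) := fun c => by
    obtain ⟨M, hM⟩ := h.exists_form1_le c
    exact integrableOn_lineInt (continuous_kappaProd l ρ K) (h.measurable_form1 c) hM _ _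
  simp only [Pi.add_apply, Pi.smul_apply, smul_eq_mul, h.map1_eq hK]
  rw [← integral_const_mul, ← integral_add (hI c) ((hI c').const_mul t)]
  refine integral_congr_ae ?_
  rw [EventuallyEq, ae_restrict_iff' (isCompact_diskProd ρ K).isClosed.measurableSet]
  filter_upwards [h.lineInt_eq hK i] with y hy hyD
  simp only [hy hyD, Pi.add_apply, Pi.smul_apply, smul_eq_mul, add_mul, sum_add_distrib,
    mul_sum, mul_add]
  exact congrArg _ (sum_congr rfl fun a _ => sum_congr rfl fun b _ => by ring)

lemma map2_add_smul (hK : K ∈ T.cells) (t : ℝ) (s s' : Tri → ℝ) :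
    T.map2 F l ρ (s + t • s') K = (T.map2 F l ρ s + t • T.map2 F l ρ s') K := by
  have hcont := (continuous_kappaProd l ρ K).mul (continuous_det_jacTilde K)
  have hI : ∀ s x, IntegrableOn (fun y => (kappaProd l ρ K y * (jacTilde K y).det) *
      T.foldedForm2 F s (combo (baryVec K x) y)) (diskProd ρ K) := fun s x => by
    obtain ⟨C, hC⟩ := h.exists_foldedForm2_le s
    exact integrableOn_average hcont (h.measurable_foldedForm2 s) hC _
  have hJ : ∀ s, IntegrableOn (fun x => ∫ y in diskProd ρ K, (kappaProd l ρ K y *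
      (jacTilde K y).det) * T.foldedForm2 F s (combo (baryVec K x) y)) (tri K) := fun s => by
    obtain ⟨C, hC⟩ := h.exists_foldedForm2_le s
    exact integrableOn_tri
      (continuous_average (T.sarea_ne hK) ρ hcont (h.measurable_foldedForm2 s) hC) K
  have e : ∀ z, T.foldedForm2 F (s + t • s') z = T.foldedForm2 F s z + t * T.foldedForm2 F s' z := by
    intro z
    simp only [foldedForm2, mul_sum, ← sum_add_distrib, Pi.add_apply,
      Pi.smul_apply, smul_eq_mul]
    grind
  have key : ∀ x, ∫ y in diskProd ρ K, (kappaProd l ρ K y * (jacTilde K y).det) *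
      T.foldedForm2 F (s + t • s') (combo (baryVec K x) y) =
      (∫ y in diskProd ρ K, (kappaProd l ρ K y * (jacTilde K y).det) *
        T.foldedForm2 F s (combo (baryVec K x) y)) + t * ∫ y in diskProd ρ K,
        (kappaProd l ρ K y * (jacTilde K y).det) * T.foldedForm2 F s' (combo (baryVec K x) y) := by
    intro x
    rw [← integral_const_mul, ← integral_add (hI s x) ((hI s' x).const_mul t)]
    refine integral_congr_ae (.of_forall fun y => ?_)
    simp only [e]
    ring
  simp only [Pi.add_apply, Pi.smul_apply, smul_eq_mul, map2, setAverage_eq, key]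
  rw [integral_add (hJ s) ((hJ s').const_mul t), integral_const_mul]
  ring

end SmoothedMesh

/-! ### Perturbations of the identity on finite-dimensional spaces -/

lemma finiteDimensional_of_rep {X E D : Type*} [MeasurableSpace X] {μ : Measure X}
    [NormedAddCommGroup E] [NormedSpace ℝ E] [AddCommGroup D] [Module ℝ D] [FiniteDimensional ℝ D]
    {S : Submodule ℝ (Lp E 2 μ)} {f : D → X → E} (hf : ∀ d, MemLp (f d) 2 μ)
    (hlin : ∀ (t : ℝ) d d' x, f (d + t • d') x = f d x + t • f d' x)
    (hS : ∀ v ∈ S, ∃ d, ⇑v =ᵐ[μ] f d) : FiniteDimensional ℝ S := by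
  have h0 : ∀ x, f 0 x = 0 := fun x => by simpa using hlin 1 0 0 x
  let Φ : D →ₗ[ℝ] Lp E 2 μ :=
    { toFun := fun d => (hf d).toLp
      map_add' := fun d d' => by
        rw [← MemLp.toLp_add]
        exact MemLp.toLp_congr _ _ (.of_forall fun x => by simpa using hlin 1 d d' x)
      map_smul' := fun t d => by
        rw [RingHom.id_apply, ← MemLp.toLp_const_smul]
        exact MemLp.toLp_congr _ _ (.of_forall fun x => by simpa [h0] using hlin t 0 d x) }
  refine Submodule.finiteDimensional_of_le (S₂ := LinearMap.range Φ) fun v hv => ?_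
  obtain ⟨d, hd⟩ := hS v hv
  exact ⟨d, Lp.ext ((hf d).coeFn_toLp.trans hd.symm)⟩

/-- A linear relation close to the identity on a finite-dimensional space is an isomorphism whose
inverse has norm at most `2`. -/
theorem exists_linearEquiv_of_near_id {V : Type*} [NormedAddCommGroup V] [NormedSpace ℝ V]
    (S : Submodule ℝ V) [FiniteDimensional ℝ S] {P : V → V → Prop}
    (hex : ∀ v ∈ S, ∃ v' ∈ S, P v v')
    (hlin : ∀ v ∈ S, ∀ w ∈ S, ∀ v' w' (t : ℝ), P v v' → P w w' → P (v + t • w) (v' + t • w'))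
    (huniq : ∀ v v' v'', P v v' → P v v'' → v' = v'')
    (hnear : ∀ v ∈ S, ∀ v', P v v' → ‖v' - v‖ ≤ 1 / 2 * ‖v‖) :
    ∃ R : S ≃ₗ[ℝ] S, (∀ v : S, P v (R v)) ∧ ∀ v, ‖R.symm v‖ ≤ 2 * ‖v‖ := by
  choose r hrS hr using fun v : S => hex v v.2
  have key : ∀ (v w : S) (t : ℝ), r (v + t • w) = r v + t • r w := fun v w t =>
    huniq _ _ _ (hr (v + t • w)) (hlin v v.2 w w.2 _ _ t (hr v) (hr w))
  have h0 : r 0 = 0 := by simpa using key 0 0 1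
  let R : S →ₗ[ℝ] S :=
    { toFun := fun v => ⟨r v, hrS v⟩
      map_add' := fun v w => Subtype.ext (by simpa using key v w 1)
      map_smul' := fun t v => Subtype.ext (by simpa [h0] using key 0 v t) }
  have hR : ∀ v : S, ‖v‖ ≤ 2 * ‖R v‖ := fun v => by
    have h1 : ‖R v - v‖ ≤ 1 / 2 * ‖v‖ := hnear v v.2 _ (hr v)
    have h2 := norm_sub_norm_le v (v - R v)
    rw [sub_sub_cancel, norm_sub_rev] at h2
    linarith
  have hinj := (injective_iff_map_eq_zero R).2 fun v hv => by
    have := hR v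
    simp_all
  refine ⟨LinearEquiv.ofInjectiveEndo R hinj, fun v => hr v, fun v => ?_⟩
  have := hR ((LinearEquiv.ofInjectiveEndo R hinj).symm v)
  rwa [show R _ = v from (LinearEquiv.ofInjectiveEndo R hinj).apply_symm_apply v] at this

/-- If isomorphisms commute with an operator, so do their inverses. The operator is given by its
graph. -/
lemma commute_symm {V W : Type*} [NormedAddCommGroup V] [NormedSpace ℝ V] [NormedAddCommGroup W]
    [NormedSpace ℝ W] {S : Submodule ℝ V} {S' : Submodule ℝ W} {R : S ≃ₗ[ℝ] S} {R' : S' ≃ₗ[ℝ] S'}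
    {G : V → W → Prop} (hex : ∀ u ∈ S, ∃ v, G u v) (huniq : ∀ u v v', G u v → G u v' → v = v')
    (hcomm : ∀ (u : S) v, G u v → ∃ hv : v ∈ S', G (R u) (R' ⟨v, hv⟩)) (u : S) (v : W)
    (h : G u v) : ∃ hv : v ∈ S', G (R.symm u) (R'.symm ⟨v, hv⟩) := by
  obtain ⟨v₁, h₁⟩ := hex _ (R.symm u).2
  obtain ⟨hv₁, h₂⟩ := hcomm _ _ h₁
  rw [LinearEquiv.apply_symm_apply] at h₂
  obtain rfl := huniq _ _ _ h h₂
  simp_all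

/-! ### The operators on the discrete spaces -/

/-- Extension by zero of a function on a finite set. -/
def extendZero {α : Type*} (s : Finset α) (d : s → ℝ) (a : α) : ℝ :=
  open Classical in if h : a ∈ s then d ⟨a, h⟩ else 0

lemma extendZero_add_smul {α : Type*} (s : Finset α) (t : ℝ) (d d' : s → ℝ) :
    extendZero s (d + t • d') = extendZero s d + t • extendZero s d' := by
  ext a
  by_cases h : a ∈ s <;> simp [extendZero, h]

lemma extendZero_restrict {α : Type*} {s : Finset α} (f : α → ℝ) {a : α} (ha : a ∈ s) :
    extendZero s (fun b => f b) a = f a := by simp [extendZero, ha]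

/-- A map of the degrees of freedom that is a small perturbation of the identity yields an
isomorphism of the discrete space. -/
theorem exists_linearEquiv_of_rep {X E D : Type*} [MeasurableSpace X] {μ : Measure X}
    [NormedAddCommGroup E] [NormedSpace ℝ E] [AddCommGroup D] [Module ℝ D]
    (S : Submodule ℝ (Lp E 2 μ)) [FiniteDimensional ℝ S] (field : D → X → E) (m : D → D)
    (good : D → Prop) (R : (X → E) → X → E)
    (hrep : ∀ v ∈ S, ∃ d, good d ∧ ⇑v =ᵐ[μ] field d)
    (hLp : ∀ d, MemLp (field (m d)) 2 μ)
    (hmem : ∀ d (v : Lp E 2 μ), ⇑v =ᵐ[μ] field (m d) → v ∈ S)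
    (hR : ∀ d (v : Lp E 2 μ), ⇑v =ᵐ[μ] field d → R v =ᵐ[μ] field (m d))
    (hlin : ∀ (t : ℝ) d d' x, field (d + t • d') x = field d x + t • field d' x)
    (hm : ∀ (t : ℝ) d d', field (m (d + t • d')) =ᵐ[μ] field (m d + t • m d'))
    (hnear : ∀ d (v v' : Lp E 2 μ), good d → ⇑v =ᵐ[μ] field d → ⇑v' =ᵐ[μ] field (m d) →
      ‖v' - v‖ ≤ 1 / 2 * ‖v‖) :
    ∃ e : S ≃ₗ[ℝ] S, (∀ v : S, ⇑(e v : Lp E 2 μ) =ᵐ[μ] R ⇑(v : Lp E 2 μ)) ∧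
      ∀ v, ‖e.symm v‖ ≤ 2 * ‖v‖ := by
  refine exists_linearEquiv_of_near_id S (P := fun v v' => ⇑v' =ᵐ[μ] R ⇑v) ?_ ?_ ?_ ?_
  · intro v hv
    obtain ⟨d, -, hd⟩ := hrep v hv
    exact ⟨(hLp d).toLp, hmem d _ (hLp d).coeFn_toLp, (hLp d).coeFn_toLp.trans (hR d v hd).symm⟩
  · intro v hv w hw v' w' t hv' hw'
    obtain ⟨d, -, hd⟩ := hrep v hv
    obtain ⟨d', -, hd'⟩ := hrep w hw
    have e : ⇑(v + t • w) =ᵐ[μ] field (d + t • d') := by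
      filter_upwards [Lp.coeFn_add v (t • w), Lp.coeFn_smul t w, hd, hd'] with x h1 h2 h3 h4
      rw [h1, Pi.add_apply, h2, Pi.smul_apply, h3, h4, hlin]
    refine EventuallyEq.trans ?_ ((hR _ _ e).trans (hm t d d')).symm
    filter_upwards [Lp.coeFn_add v' (t • w'), Lp.coeFn_smul t w', hv'.trans (hR d v hd),
      hw'.trans (hR d' w hd')] with x h1 h2 h3 h4
    rw [h1, Pi.add_apply, h2, Pi.smul_apply, h3, h4, hlin]
  · exact fun v v' v'' h1 h2 => Lp.ext (h1.trans h2.symm)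
  · intro v hv v' hv'
    obtain ⟨d, hg, hd⟩ := hrep v hv
    exact hnear d v v' hg hd (hv'.trans (hR d v hd))

section

lemma form0_congr {q' : Pt → ℝ} (hq : ∀ K ∈ T.cells, ∀ i, q (K i) = q' (K i)) :
    T.form0 F q = T.form0 F q' := funext fun x => sum_congr rfl fun a ha => by
  obtain ⟨K, hK, i, rfl⟩ := T.mem_verts.1 ha
  rw [hq K hK i]

lemma form2_congr (hs : ∀ K ∈ T.cells, s K = s' K) : T.form2 s = T.form2 s' :=
  funext fun x => sum_congr rfl fun K hK => by simp only [hs K hK]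

namespace FoldedMesh
variable (h : FoldedMesh Ω ψ T L A ε F)
include h

lemma form1_congr (hc : Alternating c) (hc' : Alternating c')
    (hcc : ∀ K ∈ T.cells, ∀ i : Fin 3, c (K (i + 1)) (K (i + 2)) = c' (K (i + 1)) (K (i + 2))) :
    ∀ᵐ x ∂(rMeasure Ω), ∀ m, T.form1 F c m x = T.form1 F c' m x :=
  h.ae_of_ae_cells (fun _ _ => .of_forall fun _ _ => trivial)
    fun K hK x hx _ m => by
      rw [h.form1_eq hK hx, h.form1_eq hK hx, whitneyOn_eq_sum_nu K hc, whitneyOn_eq_sum_nu K hc']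
      grind

lemma fieldC_congr {θ' : Pt → ℝ} (hθ : ∀ K ∈ T.cells, ∀ i, θ (K i) = θ' (K i)) (hc : Alternating c)
    (hc' : Alternating c')
    (hcc : ∀ K ∈ T.cells, ∀ i : Fin 3, c (K (i + 1)) (K (i + 2)) = c' (K (i + 1)) (K (i + 2))) :
    T.fieldC F n θ c =ᵐ[rMeasure Ω] T.fieldC F n θ' c' := by
  filter_upwards [h.form1_congr hc hc' hcc] with x hx
  rw [fieldC, fieldC, form0_congr hθ, hx 0, hx 1]

lemma fieldD_congr (hc : Alternating c) (hc' : Alternating c')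
    (hcc : ∀ K ∈ T.cells, ∀ i : Fin 3, c (K (i + 1)) (K (i + 2)) = c' (K (i + 1)) (K (i + 2)))
    (hs : ∀ K ∈ T.cells, s K = s' K) : T.fieldD F n c s =ᵐ[rMeasure Ω] T.fieldD F n c' s' := by
  filter_upwards [h.form1_congr hc hc' hcc] with x hx
  rw [fieldD, fieldD, form2_congr hs, hx 0, hx 1]

lemma memLp_fieldC (n : ℕ) (θ : Pt → ℝ) (c : Pt → Pt → ℝ) :
    MemLp (T.fieldC F n θ c) 2 (rMeasure Ω) := memLp_of_comp (h.memLp_fieldC_comp n θ c)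

lemma memLp_fieldD (n : ℕ) (c : Pt → Pt → ℝ) (s : Tri → ℝ) :
    MemLp (T.fieldD F n c s) 2 (rMeasure Ω) := memLp_of_comp (h.memLp_fieldD_comp n c s)

omit h in
lemma form0_extendZero (q : Pt → ℝ) :
    T.form0 F (extendZero T.verts fun a => q a) = T.form0 F q :=
  form0_congr fun _ hK i => extendZero_restrict q (T.vertex_mem_verts hK i)

omit h in
lemma form1_extendZero (c : Pt → Pt → ℝ) :
    T.form1 F (fun a b => extendZero (T.verts ×ˢ T.verts) (fun p => c p.1.1 p.1.2) (a, b)) =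
      T.form1 F c := by
  funext m x
  refine sum_congr rfl fun a ha => sum_congr rfl fun b hb => ?_
  beta_reduce
  rw [extendZero_restrict (fun p : Pt × Pt => c p.1 p.2) (Finset.mk_mem_product ha hb)]

omit h in
lemma form2_extendZero (s : Tri → ℝ) : T.form2 (extendZero T.cells fun K => s K) = T.form2 s :=
  form2_congr fun _ hK => extendZero_restrict s hK

lemma finiteDimensional_Ah (hn : 0 < n) : FiniteDimensional ℝ (Ah n Ω T) := by
  refine finiteDimensional_of_rep (f := fun d : T.verts → ℝ => T.fieldG F n (extendZero _ d))
    (fun d => h.memLp_fieldG n _) (fun t d d' x => ?_) fun u hu => ?_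
  · rw [extendZero_add_smul, fieldG_add_smul]
  · obtain ⟨q, hq⟩ := h.exists_fieldG hn hu
    refine ⟨fun a => q a, hq.trans (EventuallyEq.of_eq (funext fun x => ?_))⟩
    simp only [fieldG, form0_extendZero]

lemma finiteDimensional_Bh (hn : 0 < n) : FiniteDimensional ℝ (Bh n Ω T) := by
  refine finiteDimensional_of_rep (f := fun d : (T.verts → ℝ) × (↥(T.verts ×ˢ T.verts) → ℝ) =>
    T.fieldC F n (extendZero _ d.1) fun a b => extendZero _ d.2 (a, b))
    (fun d => h.memLp_fieldC n _ _) (fun t d d' x => ?_) fun u hu => ?_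
  · rw [← fieldC_add_smul, Prod.fst_add, Prod.snd_add, Prod.smul_fst, Prod.smul_snd,
      extendZero_add_smul, extendZero_add_smul]
    rfl
  · obtain ⟨θ, c, -, -, hq⟩ := h.exists_fieldC hn hu
    refine ⟨(fun a => θ a, fun p => c p.1.1 p.1.2),
      hq.trans (EventuallyEq.of_eq (funext fun x => ?_))⟩
    simp only [fieldC, form0_extendZero, form1_extendZero]

lemma finiteDimensional_Ch (hn : 0 < n) : FiniteDimensional ℝ (Ch n Ω T) := by
  refine finiteDimensional_of_rep (f := fun d : (↥(T.verts ×ˢ T.verts) → ℝ) × (T.cells → ℝ) =>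
    T.fieldD F n (fun a b => extendZero _ d.1 (a, b)) (extendZero _ d.2))
    (fun d => h.memLp_fieldD n _ _) (fun t d d' x => ?_) fun u hu => ?_
  · rw [← fieldD_add_smul, Prod.fst_add, Prod.snd_add, Prod.smul_fst, Prod.smul_snd,
      extendZero_add_smul, extendZero_add_smul]
    rfl
  · obtain ⟨c, s, -, -, hq⟩ := h.exists_fieldD hn hu
    refine ⟨(fun p => c p.1.1 p.1.2, fun K => s K),
      hq.trans (EventuallyEq.of_eq (funext fun x => ?_))⟩
    simp only [fieldD, form1_extendZero, form2_extendZero]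

lemma finiteDimensional_Dh : FiniteDimensional ℝ (Dh Ω T) := by
  refine finiteDimensional_of_rep (f := fun d : T.cells → ℝ => T.form2 (extendZero _ d))
    (fun d => h.memLp_form2 _) (fun t d d' x => ?_) fun u hu => ?_
  · rw [extendZero_add_smul, form2_add_smul, smul_eq_mul]
  · obtain ⟨s, hs⟩ := h.exists_form2 hu
    exact ⟨fun K => s K, by rw [form2_extendZero]; exact hs⟩

end FoldedMesh

namespace Contracts

lemma exists_equivG (h : Contracts Ω ψ T L A ε F (δ * T.meshSize) l δ M) (hn : 0 < n) :
    ∃ e : Ah n Ω T ≃ₗ[ℝ] Ah n Ω T,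
      (∀ u : Ah n Ω T, ⇑(e u : L2r Ω) =ᵐ[rMeasure Ω] RhG n l Ω ψ T δ ⇑(u : L2r Ω)) ∧
      ∀ u, ‖e.symm u‖ ≤ 2 * ‖u‖ := by
  have := h.finiteDimensional_Ah hn
  refine exists_linearEquiv_of_rep (Ah n Ω T) (T.fieldG F n) (T.map0 F l (δ * T.meshSize))
    (fun _ => True) _ (fun v hv => ?_) (fun d => h.memLp_fieldG n _) (fun d v => h.mem_Ah hn)
    (fun d v hv => h.RhG_eq hn hv) (fun t d d' x => fieldG_add_smul t d d' x)
    (fun t d d' => ?_) fun d v v' _ hv hv' => h.norm_sub_fieldG_le hv hv'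
  · obtain ⟨q, hq⟩ := h.exists_fieldG hn hv
    aesop
  · refine EventuallyEq.of_eq (funext fun x => ?_)
    rw [fieldG, form0_congr fun K hK i => h.map0_add_smul hK i t d d',
      fieldG]

lemma exists_equivC (h : Contracts Ω ψ T L A ε F (δ * T.meshSize) l δ M) (hn : 0 < n) :
    ∃ e : Bh n Ω T ≃ₗ[ℝ] Bh n Ω T,
      (∀ v : Bh n Ω T, ⇑(e v : L2rVec Ω) =ᵐ[rMeasure Ω] RhC n l Ω ψ T δ ⇑(v : L2rVec Ω)) ∧
      ∀ v, ‖e.symm v‖ ≤ 2 * ‖v‖ := by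
  have := h.finiteDimensional_Bh hn
  have ha := alternating_map1 T F l (δ * T.meshSize)
  refine exists_linearEquiv_of_rep (Bh n Ω T)
    (fun d : (Pt → ℝ) × (Pt → Pt → ℝ) => T.fieldC F n d.1 d.2)
    (fun d => (T.map0 F l (δ * T.meshSize) d.1, T.map1 F l (δ * T.meshSize) d.2))
    (fun d => Alternating d.2 ∧ T.EdgeSupported d.2) _ (fun v hv => ?_)
    (fun d => h.memLp_fieldC n _ _) (fun d v => h.mem_Bh hn (ha _)) (fun d v hv => h.RhC_eq hn hv)
    (fun t d d' x => fieldC_add_smul t d.1 d'.1 d.2 d'.2 x) (fun t d d' => ?_)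
    fun d v v' hd hv hv' => h.norm_sub_fieldC_le hn hd.1 hd.2 hv hv'
  · obtain ⟨θ, c, hc, hcs, hv⟩ := h.exists_fieldC hn hv
    aesop
  · exact h.fieldC_congr (fun K hK i => h.map0_add_smul hK i t _ _) (ha _)
      ((ha _).add fun a b => by simp [ha d'.2 a b])
      fun K hK i => h.map1_add_smul hK i t _ _

lemma exists_equivD (h : Contracts Ω ψ T L A ε F (δ * T.meshSize) l δ M) (hn : 0 < n) :
    ∃ e : Ch n Ω T ≃ₗ[ℝ] Ch n Ω T,
      (∀ w : Ch n Ω T, ⇑(e w : L2rVec Ω) =ᵐ[rMeasure Ω] RhD n l Ω ψ T δ ⇑(w : L2rVec Ω)) ∧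
      ∀ w, ‖e.symm w‖ ≤ 2 * ‖w‖ := by
  have := h.finiteDimensional_Ch hn
  have ha := alternating_map1 T F l (δ * T.meshSize)
  refine exists_linearEquiv_of_rep (Ch n Ω T)
    (fun d : (Pt → Pt → ℝ) × (Tri → ℝ) => T.fieldD F n d.1 d.2)
    (fun d => (T.map1 F l (δ * T.meshSize) d.1, T.map2 F l (δ * T.meshSize) d.2))
    (fun d => Alternating d.1 ∧ T.EdgeSupported d.1) _ (fun v hv => ?_)
    (fun d => h.memLp_fieldD n _ _) (fun d v => h.mem_Ch hn (ha _)) (fun d v hv => h.RhD_eq hn hv)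
    (fun t d d' x => fieldD_add_smul t d.1 d'.1 d.2 d'.2 x) (fun t d d' => ?_)
    fun d v v' hd hv hv' => h.norm_sub_fieldD_le hn hd.1 hd.2 hv hv'
  · obtain ⟨c, s, hc, hcs, hv⟩ := h.exists_fieldD hn hv
    aesop
  · exact h.fieldD_congr (ha _) ((ha _).add fun a b => by simp [ha d'.1 a b])
      (fun K hK i => h.map1_add_smul hK i t _ _) fun K hK => h.map2_add_smul hK t _ _

lemma exists_equivO (h : Contracts Ω ψ T L A ε F (δ * T.meshSize) l δ M) :
    ∃ e : Dh Ω T ≃ₗ[ℝ] Dh Ω T,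
      (∀ f : Dh Ω T, ⇑(e f : L2r Ω) =ᵐ[rMeasure Ω] RhO l Ω ψ T δ ⇑(f : L2r Ω)) ∧
      ∀ f, ‖e.symm f‖ ≤ 2 * ‖f‖ := by
  have := h.finiteDimensional_Dh
  refine exists_linearEquiv_of_rep (Dh Ω T) T.form2 (T.map2 F l (δ * T.meshSize))
    (fun _ => True) _ (fun v hv => ?_) (fun d => h.memLp_form2 _) (fun d v => h.mem_Dh)
    (fun d v hv => h.RhO_eq hv) (fun t d d' x => form2_add_smul t d d' x)
    (fun t d d' => ?_) fun d v v' _ hv hv' => h.norm_sub_form2_le hv hv'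
  · obtain ⟨s, hs⟩ := h.exists_form2 hv
    aesop
  · rw [form2_congr fun K hK => h.map2_add_smul hK t d d']

end Contracts

/-! ### Commutation with the differential operators -/

namespace SmoothedMesh

lemma map0_neg (h : SmoothedMesh Ω ψ T L A ε F ρ) (hK : K ∈ T.cells) (i : Fin 3) (q : Pt → ℝ) :
    T.map0 F l ρ (-q) (K i) = (-T.map0 F l ρ q) (K i) := by
  have := h.map0_add_smul (l := l) hK i (-2) q q
  rw [show q + (-2 : ℝ) • q = -q by module] at this
  rw [this, show T.map0 F l ρ q + (-2 : ℝ) • T.map0 F l ρ q = -T.map0 F l ρ q by module]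

lemma map2_neg (h : SmoothedMesh Ω ψ T L A ε F ρ) (hK : K ∈ T.cells) (s : Tri → ℝ) :
    T.map2 F l ρ (-s) K = -T.map2 F l ρ s K := by
  have := h.map2_add_smul (l := l) hK (-2) s s
  rw [show s + (-2 : ℝ) • s = -s by module] at this
  rw [this, show T.map2 F l ρ s + (-2 : ℝ) • T.map2 F l ρ s = -T.map2 F l ρ s by module,
    Pi.neg_apply]

lemma isGrad_Rh (h : SmoothedMesh Ω ψ T L A ε F (δ * T.meshSize)) (hn : 0 < n) {u : L2r Ω}
    (hu : u ∈ Ah n Ω T) {v : L2rVec Ω} (hv : IsGrad n Ω u v) : v ∈ Bh n Ω T ∧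
      ∀ u' v', u' =ᵐ[rMeasure Ω] RhG n l Ω ψ T δ u → v' =ᵐ[rMeasure Ω] RhC n l Ω ψ T δ v →
        IsGrad n Ω u' v' := by
  obtain ⟨q, hq⟩ := h.exists_fieldG hn hu
  have hve : ⇑v =ᵐ[rMeasure Ω] T.fieldC F n (-q) (diff0 q) := by
    have hL := h.memLp_fieldC n (-q) (diff0 q)
    rw [IsGrad.unique h.meshes.isOpen (fun x hx => h.meshes.pos_of_mem hx) hv
      ((h.isGrad_fieldG hn q).congr hq.symm hL.coeFn_toLp.symm)]
    exact hL.coeFn_toLp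
  refine ⟨h.mem_Bh hn (alternating_diff0 q) hve, fun u' v' hu' hv' => ?_⟩
  refine (h.isGrad_fieldG hn (T.map0 F l (δ * T.meshSize) q)).congr
    (hu'.trans (h.RhG_eq hn hq)).symm ((hv'.trans (h.RhC_eq hn hve)).trans ?_).symm
  exact h.fieldC_congr (fun K hK i => h.map0_neg hK i q) (alternating_map1 T F l _ _)
    (alternating_diff0 _) fun K hK i => h.map1_diff0 hK i q

lemma isCurl_Rh (h : SmoothedMesh Ω ψ T L A ε F (δ * T.meshSize)) (hn : 0 < n) {v : L2rVec Ω}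
    (hv : v ∈ Bh n Ω T) {w : L2rVec Ω} (hw : IsCurl n Ω v w) : w ∈ Ch n Ω T ∧
      ∀ v' w', v' =ᵐ[rMeasure Ω] RhC n l Ω ψ T δ v → w' =ᵐ[rMeasure Ω] RhD n l Ω ψ T δ w →
        IsCurl n Ω v' w' := by
  obtain ⟨θ, c, hc, -, hq⟩ := h.exists_fieldC hn hv
  have hcd := hc.add (alternating_diff0 θ)
  have hwe : ⇑w =ᵐ[rMeasure Ω] T.fieldD F n (c + diff0 θ) (-curlOn c) := by
    have hL := h.memLp_fieldD n (c + diff0 θ) (-curlOn c)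
    rw [IsCurl.unique h.meshes.isOpen (fun x hx => h.meshes.pos_of_mem hx) hw
      ((h.isCurl_fieldC hn θ hc).congr hq.symm hL.coeFn_toLp.symm)]
    exact hL.coeFn_toLp
  refine ⟨h.mem_Ch hn hcd hwe, fun v' w' hv' hw' => ?_⟩
  have ha := alternating_map1 T F l (δ * T.meshSize)
  refine (h.isCurl_fieldC hn (T.map0 F l (δ * T.meshSize) θ) (ha c)).congr
    (hv'.trans (h.RhC_eq hn hq)).symm ((hw'.trans (h.RhD_eq hn hwe)).trans ?_).symm
  refine h.fieldD_congr (ha _) ((ha c).add (alternating_diff0 _)) (fun K hK i => ?_) fun K hK => ?_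
  · rw [← one_smul ℝ (diff0 θ), h.map1_add_smul hK, one_smul]
    simp only [Pi.add_apply, h.map1_diff0 hK]
  · rw [h.map2_neg hK, h.map2_curlOn hK hc, Pi.neg_apply]

lemma isDiv_Rh (h : SmoothedMesh Ω ψ T L A ε F (δ * T.meshSize)) (hn : 0 < n) {w : L2rVec Ω}
    (hw : w ∈ Ch n Ω T) {f : L2r Ω} (hf : IsDiv n Ω w f) : f ∈ Dh Ω T ∧
      ∀ w' f', w' =ᵐ[rMeasure Ω] RhD n l Ω ψ T δ w → f' =ᵐ[rMeasure Ω] RhO l Ω ψ T δ f →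
        IsDiv n Ω w' f' := by
  obtain ⟨c, s, hc, -, hq⟩ := h.exists_fieldD hn hw
  have hfe : ⇑f =ᵐ[rMeasure Ω] T.form2 (-curlOn c - s) := by
    have hL := h.memLp_form2 (-curlOn c - s)
    rw [IsDiv.unique h.meshes.isOpen (fun x hx => h.meshes.pos_of_mem hx) hf
      ((h.isDiv_fieldD hn hc s).congr hq.symm hL.coeFn_toLp.symm)]
    exact hL.coeFn_toLp
  refine ⟨h.mem_Dh hfe, fun w' f' hw' hf' => ?_⟩
  refine (h.isDiv_fieldD hn (alternating_map1 T F l (δ * T.meshSize) c)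
    (T.map2 F l (δ * T.meshSize) s)).congr
    (hw'.trans (h.RhD_eq hn hq)).symm ((hf'.trans (h.RhO_eq hfe)).trans ?_).symm
  refine EventuallyEq.of_eq (form2_congr fun K hK => ?_)
  rw [sub_eq_add_neg_one_smul (-curlOn c), h.map2_add_smul hK]
  simp only [Pi.add_apply, Pi.smul_apply, Pi.sub_apply, Pi.neg_apply, smul_eq_mul, h.map2_neg hK,
    h.map2_curlOn hK hc]
  ring

end SmoothedMesh

end

/-! ### The choice of the radius -/

/-- For small `δ`, uniformly in the mesh, the disks of radius `δ h` make `R_h` a contraction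
perturbation of the identity. -/
theorem exists_contracts {U : Set Pt} (hψ : IsReflection Ω U ψ) (hc : IsCompact (closure Ω)) (l : ℕ)
    (σ τ : ℝ) : ∃ δ₁ : ℝ, 0 < δ₁ ∧ ∀ T : Triangulation, T.Meshes Ω → T.ShapeRegular σ →
    T.QuasiUniform τ → T.cells.Nonempty → ∀ δ : ℝ, 0 < δ → δ < δ₁ → Admissible Ω T δ → ∃ L A ε F M,
    Contracts Ω ψ T L A ε F (δ * T.meshSize) l δ M := by
  obtain ⟨L, ε, hF⟩ := hψ.exists_folds hc
  obtain ⟨M, hM1, hM⟩ := exists_integral_abs_kappa_le l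
  by_cases hex : ∃ T : Triangulation, T.Meshes Ω
  swap
  · exact ⟨1, one_pos, fun T hT => (hex ⟨T, hT⟩).elim⟩
  have hε : 0 < ε := (hF _ hex.choose_spec).eps_pos
  set A := max 1 (2 * σ * τ)
  have hev : ∀ᶠ δ in 𝓝 (0 : ℝ), δ * diam (closure Ω) < ε / 2 ∧ A * L * δ < 1 / 12 ∧
      7 * driftConst L A M δ < 1 / 4 := by
    unfold driftConst
    refine ((Continuous.tendsto (by fun_prop) 0).eventually_lt_const (by simpa using hε)).and
      (((Continuous.tendsto (by fun_prop) 0).eventually_lt_const (by simp)).and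
      ((Continuous.tendsto (by fun_prop) 0).eventually_lt_const (by simp)))
  obtain ⟨δ₁, hδ₁, hball⟩ := Metric.eventually_nhds_iff.1 hev
  refine ⟨δ₁, hδ₁, fun T hT hσ hτ hne δ h0 hlt had => ?_⟩
  obtain ⟨e1, e2, e3⟩ := hball (y := δ) (by rwa [Real.dist_eq, sub_zero, abs_of_pos h0])
  have hreg : T.Regular A := regular_of_shapeRegular hσ hτ hne
  obtain ⟨F, hFm⟩ := (hF T hT).exists_foldedMesh hT hreg
  have hh : T.meshSize ≤ diam (closure Ω) := by
    refine csSup_le (hne.to_set.image _) ?_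
    rintro _ ⟨K, hK, rfl⟩
    refine diam_mono ?_ hc.isBounded
    rw [hT.closure_eq]
    exact T.tri_subset_support hK
  have hgood : ∀ K ∈ T.cells, ∀ i, GoodDisk (δ * T.meshSize) (K i) := fun K hK i =>
    { pos := mul_pos h0 hreg.pos
      nonneg := T.nonneg K hK i
      radius := had.radius _ (T.mem_vertices hK i) }
  exact ⟨L, A, ε / 2, F, M,
    { hFm with
      radius_lt := (mul_le_mul_of_nonneg_left hh h0.le).trans_lt e1
      goodDisk := hgood
      radius_le := le_rfl
      delta_nonneg := h0.le
      delta_le := e2.le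
      one_le_bound := hM1
      kappa_le := fun K hK i => hM _ _ (hgood K hK i)
      contraction := e3.le }⟩

end AxiFEM

end

open AxiFEM in
theorem lemma5p5 (Ω U : Set Pt) (ψ : Pt → Pt) (hψ : IsReflection Ω U ψ) (l : ℕ) (σ τ : ℝ) :
    ∃ δ₁ : ℝ, 0 < δ₁ ∧ ∀ n : ℕ, 0 < n → ∀ T : Triangulation, T.Meshes Ω →
      T.ShapeRegular σ → T.QuasiUniform τ →
      ∀ δ : ℝ, 0 < δ → δ < δ₁ → Admissible Ω T δ →
      ∃ (Rg : Ah n Ω T ≃ₗ[ℝ] Ah n Ω T) (Rc : Bh n Ω T ≃ₗ[ℝ] Bh n Ω T)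
        (Rd : Ch n Ω T ≃ₗ[ℝ] Ch n Ω T) (Ro : Dh Ω T ≃ₗ[ℝ] Dh Ω T),
        -- these invertible maps are the restrictions of the operators `R_h`
        (∀ u : Ah n Ω T, ⇑(Rg u : L2r Ω) =ᵐ[rMeasure Ω] RhG n l Ω ψ T δ ⇑(u : L2r Ω)) ∧
        (∀ v : Bh n Ω T, ⇑(Rc v : L2rVec Ω) =ᵐ[rMeasure Ω] RhC n l Ω ψ T δ ⇑(v : L2rVec Ω)) ∧
        (∀ w : Ch n Ω T, ⇑(Rd w : L2rVec Ω) =ᵐ[rMeasure Ω] RhD n l Ω ψ T δ ⇑(w : L2rVec Ω)) ∧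
        (∀ f : Dh Ω T, ⇑(Ro f : L2r Ω) =ᵐ[rMeasure Ω] RhO l Ω ψ T δ ⇑(f : L2r Ω)) ∧
        -- their inverses have operator norm at most `2`
        (∀ u : Ah n Ω T, ‖Rg.symm u‖ ≤ 2 * ‖u‖) ∧
        (∀ v : Bh n Ω T, ‖Rc.symm v‖ ≤ 2 * ‖v‖) ∧
        (∀ w : Ch n Ω T, ‖Rd.symm w‖ ≤ 2 * ‖w‖) ∧
        (∀ f : Dh Ω T, ‖Ro.symm f‖ ≤ 2 * ‖f‖) ∧
        -- and commute with `grad`, `curl`, `div`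
        (∀ (u : Ah n Ω T) (v : L2rVec Ω), IsGrad n Ω ⇑(u : L2r Ω) ⇑v →
          ∃ hv : v ∈ Bh n Ω T,
            IsGrad n Ω ⇑(Rg.symm u : L2r Ω) ⇑(Rc.symm ⟨v, hv⟩ : L2rVec Ω)) ∧
        (∀ (v : Bh n Ω T) (w : L2rVec Ω), IsCurl n Ω ⇑(v : L2rVec Ω) ⇑w →
          ∃ hw : w ∈ Ch n Ω T,
            IsCurl n Ω ⇑(Rc.symm v : L2rVec Ω) ⇑(Rd.symm ⟨w, hw⟩ : L2rVec Ω)) ∧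
        (∀ (w : Ch n Ω T) (f : L2r Ω), IsDiv n Ω ⇑(w : L2rVec Ω) ⇑f →
          ∃ hf : f ∈ Dh Ω T,
            IsDiv n Ω ⇑(Rd.symm w : L2rVec Ω) ⇑(Ro.symm ⟨f, hf⟩ : L2r Ω)) := by
  by_cases hc : IsCompact (closure Ω)
  swap
  · refine ⟨1, one_pos, fun n _ T hT => (hc ?_).elim⟩
    rw [hT.closure_eq]
    exact T.isCompact_support
  obtain ⟨δ₁, hδ₁, H⟩ := exists_contracts hψ hc l σ τ
  refine ⟨δ₁, hδ₁, fun n hn T hT hσ hτ δ h0 hlt had => ?_⟩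
  rcases T.cells.eq_empty_or_nonempty with he | hne
  · have hμ : rMeasure Ω = 0 := by
      rw [hT.eq_interior, Triangulation.support, he]
      simp [rMeasure]
    have hae : ∀ {E : Type} (f g : Pt → E), f =ᵐ[rMeasure Ω] g := fun f g => by
      rw [hμ]; simp [Filter.EventuallyEq]
    have h1 : ∀ {S : Submodule ℝ (L2r Ω)} u, u ∈ S := fun {S} u => by
      rw [Lp.ext (hae u (0 : L2r Ω))]; exact S.zero_mem
    have h3 : ∀ {S : Submodule ℝ (L2rVec Ω)} u, u ∈ S := fun {S} u => by
      rw [Lp.ext (hae u (0 : L2rVec Ω))]; exact S.zero_mem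
    have hn : ∀ {V : Type} [NormedAddCommGroup V] (v : V), ‖v‖ ≤ 2 * ‖v‖ := fun v => by
      linarith [norm_nonneg v]
    exact ⟨.refl ℝ _, .refl ℝ _, .refl ℝ _, .refl ℝ _, fun _ => hae _ _, fun _ => hae _ _,
      fun _ => hae _ _, fun _ => hae _ _, fun _ => hn _, fun _ => hn _, fun _ => hn _,
      fun _ => hn _, fun _ v h => ⟨h3 v, h⟩, fun _ v h => ⟨h3 v, h⟩, fun _ v h => ⟨h1 v, h⟩⟩
  obtain ⟨L, A, ε, F, M, h⟩ := H T hT hσ hτ hne δ h0 hlt had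
  obtain ⟨Rg, hg, hg'⟩ := h.exists_equivG hn
  obtain ⟨Rc, hRc, hc'⟩ := h.exists_equivC hn
  obtain ⟨Rd, hd, hd'⟩ := h.exists_equivD hn
  obtain ⟨Ro, ho, ho'⟩ := h.exists_equivO
  have hpos : Ω ⊆ halfPlane := fun x hx => hT.pos_of_mem hx
  refine ⟨Rg, Rc, Rd, Ro, hg, hRc, hd, ho, hg', hc', hd', ho', ?_, ?_, ?_⟩
  · exact commute_symm (G := fun (u : L2r Ω) (v : L2rVec Ω) => IsGrad n Ω u v) (fun u hu => hu.1)
      (fun u v v' => IsGrad.unique hT.isOpen hpos) fun u v huv =>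
        ⟨(h.isGrad_Rh (l := l) hn u.2 huv).1, (h.isGrad_Rh hn u.2 huv).2 _ _ (hg u) (hRc _)⟩
  · exact commute_symm (G := fun (u v : L2rVec Ω) => IsCurl n Ω u v) (fun u hu => hu.1)
      (fun u v v' => IsCurl.unique hT.isOpen hpos) fun u v huv =>
        ⟨(h.isCurl_Rh (l := l) hn u.2 huv).1, (h.isCurl_Rh hn u.2 huv).2 _ _ (hRc u) (hd _)⟩
  · exact commute_symm (G := fun (u : L2rVec Ω) (v : L2r Ω) => IsDiv n Ω u v) (fun u hu => hu.1)
      (fun u v v' => IsDiv.unique hT.isOpen hpos) fun u v huv =>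
        ⟨(h.isDiv_Rh (l := l) hn u.2 huv).1, (h.isDiv_Rh hn u.2 huv).2 _ _ (hd u) (ho _)⟩
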